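/- Let $M$ be a connected $d$-dimensional Riemannian manifold with distance $d(\cdot,\cdot)$ and volume measure $\mathrm{vol}$. Consider a control-affine system $$\dot x(t)=f_0(x(t))+\sum_{i=1}^m u_i(t)f_i(x(t)),\qquad u\in\mathcal U,$$ with $C^2$ vector fields $f_0,\dots,f_m$ on $M$, where $\mathcal U$ is the set of (a.e. classes of) measurable $u:\mathbb R\to\mathbb R^m$ with $u(t)\in U$ for a.e. $t$, and $U\subset\mathbb R^m$ is an infinite compact convex set; $\mathcal U$ carries the weak$^*$ topology of $L^\infty(\mathbb R,\mathbb R^m)=L^1(\mathbb R,\mathbb R^m)^*$. Let $\varphi(t,x,u)=\varphi_{t,u}(x)$ be the trajectory with $\varphi(0,x,u)=x$; all trajectories are assumed to be defined on $\mathbb R$. Put $(\theta_tu)(s)=u(s+t)$ and $\Phi_t(u,x)=(\theta_tu,\varphi(t,x,u))$. Let $Q\subset M$ be compact, $Q(u)=\{x\in M:\varphi(\mathbb R,x,u)\subset Q\}$ and $L(Q)=\{(u,x)\in\mathcal U\times M:\varphi(\mathbb R,x,u)\subset Q\}$. Assume that $Q$ is partially hyperbolic: for every $(u,x)\in L(Q)$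 there is a splitting $T_xM=E^+(u,x)\oplus E^{0-}(u,x)$ into subspaces of constant dimensions with $\mathrm D\varphi_{t,u}(x)E^i(u,x)=E^i(\Phi_t(u,x))$ for all $t\in\mathbb R$, $i\in\{+,0-\}$, and there is $\lambda>0$ such that for every $\varepsilon>0$ there is $T>0$ with $$|\mathrm D\varphi_{t,u}(x)v|\ge e^{\lambda t}|v|\ \ (v\in E^+(u,x)),\qquad |\mathrm D\varphi_{t,u}(x)v|\le e^{\varepsilon t}|v|\ \ (v\in E^{0-}(u,x))$$ for all $(u,x)\in L(Q)$ and $t\ge T$. For $(u,x)\in L(Q)$ let $J^+\varphi_{t,u}(x)=|\det \mathrm D\varphi_{t,u}(x)|_{E^+(u,x)}:E^+(u,x)\to E^+(\Phi_t(u,x))|$. For $n\ge1$, $\varepsilon,\delta>0$ put $$Q_{\mathrm d}(n,u,\varepsilon)=\{x\in M: \mathrm{dist}(\varphi(j,x,u),Q(\theta_ju))\le\varepsilon,\ 0\le j<n\},$$ $$B^{n,u}_\delta(x)=\{y\in M: d(\varphi(j,x,u),\varphi(j,y,u))\le\delta,\ 0\le j<n\},$$ where $\mathrm{dist}(x,\emptyset)=\infty$.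 Then there are a neighborhood $\mathcal K$ of $L(Q)$ and, for each integer $n\ge0$, a positive continuous function $(u,x)\mapsto J^+\varphi_{n,u}(x)$ on the neighborhood $\mathcal K_n=\{p:\Phi_i(p)\in\mathcal K,\ 0\le i<n\}$ of $L(Q)$ which extends the function above from $L(Q)$ and satisfies $$J^+\varphi_{n+k,u}(x)=J^+\varphi_{n,u}(x)\cdot J^+\varphi_{k,\theta_nu}(\varphi(n,x,u))\qquad\text{for all }n,k\ge 0,\ (u,x)\in\mathcal K_{n+k},$$ such that the following holds. For every $\zeta>0$ there are $\varepsilon_0,\delta_0>0$ and constants $C_\delta>0$, depending on $\delta$ but not on $\varepsilon,u,n,x$, such that for all $\varepsilon\in(0,\varepsilon_0]$, $u\in\mathcal U$, $n\ge1$, $x\in Q_{\mathrm d}(n,u,\varepsilon)$ one has $(u,x)\in\mathcal K_n$ and, for all $\delta\in(0,\delta_0]$, $$C_\delta^{-1}e^{-n\zeta}J^+\varphi_{n,u}(x)^{-1}\le \mathrm{vol}(B^{n,u}_\delta(x))\le C_\delta e^{n\zeta}J^+\varphi_{n,u}(x)^{-1}.$$ -/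

import Mathlib

open Set Filter Topology MeasureTheory Manifold Bundle
open scoped ContDiff ENNReal NNReal

noncomputable section

namespace ControlAffine

/-- The tangent spaces of a `d`-dimensional manifold are finite-dimensional. -/
instance tangentSpace_finiteDimensional {d : ℕ} {M : Type*} [TopologicalSpace M]
    [ChartedSpace (EuclideanSpace ℝ (Fin d)) M] (x : M) :
    FiniteDimensional ℝ (TangentSpace (𝓡 d) x) :=
  inferInstanceAs (FiniteDimensional ℝ (EuclideanSpace ℝ (Fin d)))

/-- The space of admissible control functions: (classes modulo a.e. equality of) measurable
functions `u : ℝ → ℝᵐ` with `u t ∈ U` for almost every `t`. -/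
def Control {m : ℕ} (U : Set (EuclideanSpace ℝ (Fin m))) : Type :=
  {u : ℝ →ₘ[(volume : Measure ℝ)] EuclideanSpace ℝ (Fin m) // ∀ᵐ t : ℝ, u t ∈ U}

/-- The weak* topology of `L^∞(ℝ, ℝᵐ) = L¹(ℝ, ℝᵐ)*` on the control functions: the coarsest topology
for which `u ↦ ∫ ⟨u t, g t⟩ dt` is continuous for each `g ∈ L¹(ℝ, ℝᵐ)`. -/
instance {m : ℕ} (U : Set (EuclideanSpace ℝ (Fin m))) : TopologicalSpace (Control U) :=
  TopologicalSpace.induced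
    (fun (u : Control U) (g : Lp (EuclideanSpace ℝ (Fin m)) 1 (volume : Measure ℝ)) =>
      ∫ t, inner ℝ (u.1 t) (g t))
    Pi.topologicalSpace

/-- The shift `(θ_s u)(t) = u (t + s)`. -/
def shift {m : ℕ} {U : Set (EuclideanSpace ℝ (Fin m))} (s : ℝ) (u : Control U) : Control U :=
  ⟨u.1.compMeasurePreserving (fun t => t + s) (measurePreserving_add_right volume s), by
    have h := measurePreserving_add_right (volume : Measure ℝ) s
    filter_upwards [AEEqFun.coeFn_compMeasurePreserving u.1 h,
      h.quasiMeasurePreserving.ae u.2] with t ht hu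
    rw [ht]
    exact hu⟩

/-- A control-affine system `x' = f₀(x) + ∑ i, uᵢ fᵢ(x)` on `M`, with `C²` vector fields and an
infinite compact convex control range `U ⊆ ℝᵐ`. -/
structure System (d m : ℕ) (M : Type*) [TopologicalSpace M]
    [ChartedSpace (EuclideanSpace ℝ (Fin d)) M] [IsManifold (𝓡 d) ∞ M] where
  f₀ : ∀ x : M, TangentSpace (𝓡 d) x
  f : Fin m → ∀ x : M, TangentSpace (𝓡 d) x
  U : Set (EuclideanSpace ℝ (Fin m))
  contMDiff_f₀ : ContMDiff (𝓡 d) (𝓡 d).tangent 2 (fun x => (⟨x, f₀ x⟩ : TangentBundle (𝓡 d) M))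
  contMDiff_f : ∀ i,
    ContMDiff (𝓡 d) (𝓡 d).tangent 2 (fun x => (⟨x, f i x⟩ : TangentBundle (𝓡 d) M))
  isCompact_U : IsCompact U
  convex_U : Convex ℝ U
  infinite_U : U.Infinite

namespace System

variable {d m : ℕ} {M : Type*} [MetricSpace M] [ChartedSpace (EuclideanSpace ℝ (Fin d)) M]
  [IsManifold (𝓡 d) ∞ M] (S : System d m M)

/-- The right-hand side `f₀(x) + ∑ i, wᵢ fᵢ(x)` of the system at `x` for the control value `w`. -/
def vectorField (w : EuclideanSpace ℝ (Fin m)) (x : M) : TangentSpace (𝓡 d) x :=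
  S.f₀ x + ∑ i, w i • S.f i x

/-- `γ : ℝ → M` is a (Carathéodory) trajectory for the control `u`: it is locally absolutely
continuous and solves the differential equation almost everywhere. -/
def IsTrajectory (u : Control S.U) (γ : ℝ → M) : Prop :=
  (∀ a b : ℝ, AbsolutelyContinuousOnInterval γ a b) ∧
    ∀ᵐ t : ℝ, HasMFDerivAt 𝓘(ℝ, ℝ) (𝓡 d) γ t
      ((1 : ℝ →L[ℝ] ℝ).smulRight (S.vectorField (u.1 t) (γ t)))

/-- All trajectories are defined on the whole real line. -/
def IsComplete : Prop :=
  ∀ (u : Control S.U) (x : M), ∃ γ : ℝ → M, S.IsTrajectory u γ ∧ γ 0 = x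

open Classical in
/-- `φ(t, x, u)`: the point at time `t` of the trajectory through `x` for the control `u`. (The
constant curve is a dummy value, for systems that are not complete.) -/
def φ (t : ℝ) (x : M) (u : Control S.U) : M :=
  if h : ∃ γ : ℝ → M, S.IsTrajectory u γ ∧ γ 0 = x then h.choose t else x

/-- The control flow `Φ_t(u, x) = (θ_t u, φ(t, x, u))`. -/
def Φ (t : ℝ) (p : Control S.U × M) : Control S.U × M :=
  (shift t p.1, S.φ t p.2 p.1)

/-- The derivative `Dφ_{t,u}(x) : T_x M → T_{φ(t,x,u)} M`. -/
def Dφ (t : ℝ) (p : Control S.U × M) :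
    TangentSpace (𝓡 d) p.2 →L[ℝ] TangentSpace (𝓡 d) (S.Φ t p).2 :=
  mfderiv (𝓡 d) (𝓡 d) (fun y => S.φ t y p.1) p.2

/-- The `u`-fiber `Q(u) = {x | φ(ℝ, x, u) ⊆ Q}`. -/
def fiber (Q : Set M) (u : Control S.U) : Set M :=
  {x | ∀ t : ℝ, S.φ t x u ∈ Q}

/-- The lift `L(Q) = {(u, x) | φ(ℝ, x, u) ⊆ Q}`. -/
def lift (Q : Set M) : Set (Control S.U × M) :=
  {p | ∀ t : ℝ, S.φ t p.2 p.1 ∈ Q}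

/-- The set `Q_d(n, u, ε)` of all `x` with `dist(φ(j, x, u), Q(θ_j u)) ≤ ε` for `0 ≤ j < n`. The
extended distance is used so that no point is close to an empty fiber. -/
def nearFiber (Q : Set M) (n : ℕ) (u : Control S.U) (ε : ℝ) : Set M :=
  {x | ∀ j < n, Metric.infEDist (S.φ j x u) (S.fiber Q (shift j u)) ≤ ENNReal.ofReal ε}

/-- The Bowen ball `B^{n,u}_δ(x)` of order `n` and radius `δ` centered at `x`. -/
def bowenBall (n : ℕ) (u : Control S.U) (δ : ℝ) (x : M) : Set M :=
  {y | ∀ j < n, dist (S.φ j x u) (S.φ j y u) ≤ δ}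

variable [RiemannianBundle (fun x : M => TangentSpace (𝓡 d) x)]

/-- `T_x M = E⁺(u, x) ⊕ E⁰⁻(u, x)` for `(u, x) ∈ L(Q)` is an invariant splitting into subspaces of
constant dimensions which makes `Q` partially hyperbolic: uniform exponential expansion on `E⁺`, and
growth of arbitrarily small exponential rate on `E⁰⁻`. (Values outside `L(Q)` are irrelevant.) -/
structure IsPartiallyHyperbolic (Q : Set M)
    (Eu Ecs : ∀ p : Control S.U × M, Submodule ℝ (TangentSpace (𝓡 d) p.2)) : Prop where
  isCompl : ∀ p ∈ S.lift Q, IsCompl (Eu p) (Ecs p)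
  finrank_const : ∃ k l : ℕ, ∀ p ∈ S.lift Q,
    Module.finrank ℝ (Eu p) = k ∧ Module.finrank ℝ (Ecs p) = l
  map_Eu : ∀ p ∈ S.lift Q, ∀ t : ℝ, (Eu p).map (S.Dφ t p).toLinearMap = Eu (S.Φ t p)
  map_Ecs : ∀ p ∈ S.lift Q, ∀ t : ℝ, (Ecs p).map (S.Dφ t p).toLinearMap = Ecs (S.Φ t p)
  growth : ∃ l : ℝ, 0 < l ∧ ∀ ε : ℝ, 0 < ε → ∃ T : ℝ, 0 < T ∧
    ∀ p ∈ S.lift Q, ∀ t : ℝ, T ≤ t →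
      (∀ v ∈ Eu p, Real.exp (l * t) * ‖v‖ ≤ ‖S.Dφ t p v‖) ∧
      (∀ v ∈ Ecs p, ‖S.Dφ t p v‖ ≤ Real.exp (ε * t) * ‖v‖)

/-- The unstable determinant `J⁺φ_{t,u}(x)`: the absolute value of the determinant, with respect to
orthonormal bases, of `Dφ_{t,u}(x)` as a map from `E⁺(u, x)` onto its image. -/
def unstableDet (Eu : ∀ p : Control S.U × M, Submodule ℝ (TangentSpace (𝓡 d) p.2))
    (t : ℝ) (p : Control S.U × M) : ℝ :=
  ((S.Dφ t p).toLinearMap.domRestrict (Eu p)).normDet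

/-- `J` is a continuous multiplicative extension of the unstable determinant at integer times from
`L(Q)` to the neighborhood `K` of `L(Q)`. The function `J n` is defined on the (again a
neighborhood of `L(Q)`) set of all `p` whose orbit segment `p, Φ_1 p, …, Φ_{n-1} p` lies in `K`. -/
structure IsExtension (Q : Set M)
    (Eu : ∀ p : Control S.U × M, Submodule ℝ (TangentSpace (𝓡 d) p.2))
    (K : Set (Control S.U × M)) (J : ℕ → Control S.U × M → ℝ) : Prop where
  nhds : ∀ n : ℕ, {p | ∀ i < n, S.Φ i p ∈ K} ∈ 𝓝ˢ (S.lift Q)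
  continuousOn : ∀ n : ℕ, ContinuousOn (J n) {p | ∀ i < n, S.Φ i p ∈ K}
  pos : ∀ (n : ℕ) (p), (∀ i < n, S.Φ i p ∈ K) → 0 < J n p
  eq : ∀ n : ℕ, ∀ p ∈ S.lift Q, J n p = S.unstableDet Eu n p
  mul : ∀ (n k : ℕ) (p), (∀ i < n + k, S.Φ i p ∈ K) →
    J (n + k) p = J n p * J k (S.Φ n p)

end System

end ControlAffine

/-- The Riemannian volume measure of a `d`-dimensional Riemannian manifold: the `d`-dimensional
Hausdorff measure of the Riemannian distance, normalized to be Lebesgue measure on `ℝᵈ`. -/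
def riemannianVolume (d : ℕ) (M : Type*) [MetricSpace M] [MeasurableSpace M] [BorelSpace M] :
    Measure M :=
  Measure.euclideanHausdorffMeasure d

end

open ControlAffine

/-! The mechanism is the Bowen–Ruelle volume lemma, with the contracting direction replaced by one
of subexponential growth. A Bowen ball of order `n` is thin, of size about `1 / J⁺`, in the
expanding directions. In the remaining directions it keeps a size that shrinks at worst at an
arbitrarily small exponential rate. All exponentially small errors are absorbed by `e^{±nζ}`.

Uniformity in the control rests on two facts. The control space is weak* compact
(`compactSpace_control`). Since the system is affine in the control, solutions and their derivatives
in the initial value depend weak*-continuously on the control (`IsIntegralSolution.tendsto`,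
`exists_hasFDerivAt_solution`, `continuous_TΦ`). Hence `L(Q)` is compact, and local estimates around
it are uniform in `u`.

Each invariant bundle is cut out by closed growth conditions (`exists_mem_iff`, `isClosed_bundles`),
and the angle between the bundles is bounded below (`exists_norm_le`). So the unstable projection
and the unstable determinant are continuous on `L(Q)`. Tietze's theorem extends the logarithm of the
time-one determinant over a compact neighborhood of `Q`, and products along orbits give the
extension of `J⁺`.

For the volume, a block length `N` is chosen after `ζ`, so large that over time `N` the domination
of `E⁰⁻` by `E⁺` beats all chart constants, and that `e^{Nζ}` exceeds the error made per block
(`exists_time`). At the times `jN` the orbit of `x` is close to fiber points `y_j`, and coordinates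
adapted to the splitting at `y_j` are used. The image of `y_j` need not be `y_{j+1}`, but both lie
near the orbit of `x` and in the same fiber, so their splittings are close. In these coordinates the
time-`N` maps are nonlinear perturbations of block diagonal maps `P_j ⊕ D_j`
(`exists_isDominatedStep`), and `|det P_j|` agrees with the unstable determinant up to a constant
factor (`det_blockFst_bounds`).

For such a sequence of maps, Fubini slices the set of points with `δ`-bounded orbits by the
`E⁰⁻`-coordinate. A horizontal slice is mapped to graphs of 1-Lipschitz functions, and its
projection to `E⁺` changes volume by `|det P_j|` up to a factor 2 per step. The last projection lies
in a ball, which bounds every slice from above (`prod_det_mul_measure_le`). From below, graphs over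
the whole ball starting at height `σ` stay in the ball as long as `(b+η)^q σ ≤ δ`, and their images
keep covering it (`le_prod_det_mul_measure`); the factor `σ^l` costs only a small exponential rate.
Bi-Lipschitz coordinates carry these bounds to the Riemannian volume. -/

noncomputable section

set_option linter.unusedSectionVars false

/-! ### Charts as bi-Lipschitz coordinates -/

namespace ControlAffine
variable {d : ℕ} {M : Type*} [MetricSpace M]
    [ChartedSpace (EuclideanSpace ℝ (Fin d)) M] [IsManifold (𝓡 d) ∞ M]

/-- The tangent space at `z` read in the chart at `c`. -/
def chartMap (c z : M) : TangentSpace (𝓡 d) z →L[ℝ] EuclideanSpace ℝ (Fin d) :=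
  (trivializationAt (EuclideanSpace ℝ (Fin d)) (TangentSpace (𝓡 d) : M → Type _) c).continuousLinearMapAt ℝ z

/-- The inverse of `chartMap`. -/
def chartInv (c z : M) : EuclideanSpace ℝ (Fin d) →L[ℝ] TangentSpace (𝓡 d) z :=
  (trivializationAt (EuclideanSpace ℝ (Fin d)) (TangentSpace (𝓡 d) : M → Type _) c).symmL ℝ z

theorem chartInv_chartMap {c z : M} (hz : z ∈ (extChartAt (𝓡 d) c).source) (v : TangentSpace (𝓡 d) z) :
    chartInv c z (chartMap c z v) = v := 
  Trivialization.symmL_continuousLinearMapAt _ (by simpa [extChartAt_source] using hz) v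

theorem chartMap_chartInv {c z : M} (hz : z ∈ (extChartAt (𝓡 d) c).source) (v : EuclideanSpace ℝ (Fin d)) :
    chartMap c z (chartInv c z v) = v := 
  Trivialization.continuousLinearMapAt_symmL _ (by simpa [extChartAt_source] using hz) v

theorem hasMFDerivAt_extChartAt {c z : M} (hz : z ∈ (extChartAt (𝓡 d) c).source) :
    HasMFDerivAt (𝓡 d) 𝓘(ℝ, EuclideanSpace ℝ (Fin d)) (extChartAt (𝓡 d) c) z (chartMap c z) := by
  rw [extChartAt_source] at hz
  have h := (mdifferentiableAt_extChartAt (I := 𝓡 d) hz).hasMFDerivAt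
  rwa [← TangentBundle.continuousLinearMapAt_trivializationAt hz] at h

theorem hasMFDerivAt_extChartAt_symm {c : M} {w : EuclideanSpace ℝ (Fin d)} (hw : w ∈ (extChartAt (𝓡 d) c).target) :
    HasMFDerivAt 𝓘(ℝ, EuclideanSpace ℝ (Fin d)) (𝓡 d) (extChartAt (𝓡 d) c).symm w
      (chartInv c ((extChartAt (𝓡 d) c).symm w)) := by
  have hz := (extChartAt (𝓡 d) c).map_target hw
  rw [extChartAt_source] at hz
  have h := (mdifferentiableWithinAt_extChartAt_symm (I := 𝓡 d) hw)
  simp only [ModelWithCorners.range_eq_univ] at h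
  rw [mdifferentiableWithinAt_univ] at h
  have h := h.hasMFDerivAt
  have h2 := TangentBundle.symmL_trivializationAt (𝕜 := ℝ) (I := 𝓡 d) hz
  rw [(extChartAt (𝓡 d) c).right_inv hw] at h2
  simp only [ModelWithCorners.range_eq_univ, mfderivWithin_univ] at h2
  rw [← h2] at h
  exact h

variable [RiemannianBundle (fun x : M => TangentSpace (𝓡 d) x)]
    [IsContMDiffRiemannianBundle (𝓡 d) ∞ (EuclideanSpace ℝ (Fin d))
      (fun x : M => TangentSpace (𝓡 d) x)]

instance isContinuousRiemannianBundle : IsContinuousRiemannianBundle (EuclideanSpace ℝ (Fin d))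
      (fun x : M => TangentSpace (𝓡 d) x) := by
  obtain ⟨g, hg, hg'⟩ := IsContMDiffRiemannianBundle.exists_contMDiff (IB := 𝓡 d) (n := ∞) (F := EuclideanSpace ℝ (Fin d)) (E := (fun x : M => TangentSpace (𝓡 d) x))
  exact ⟨g, hg.continuous, hg'⟩

theorem eventually_norm_chartMap_le (c : M) : ∃ C > 0, ∀ᶠ z in 𝓝 c, ∀ v : TangentSpace (𝓡 d) z, ‖chartMap c z v‖ ≤ C * ‖v‖ := by
  obtain ⟨C, hC, h⟩ := eventually_norm_trivializationAt_lt (EuclideanSpace ℝ (Fin d)) (fun x : M => TangentSpace (𝓡 d) x) c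
  refine ⟨C, hC, h.mono fun z hz v => (ContinuousLinearMap.le_opNorm _ v).trans ?_⟩
  gcongr
  exact hz.le

theorem eventually_norm_chartInv_le (c : M) : ∃ C > 0, ∀ᶠ z in 𝓝 c, ∀ v : EuclideanSpace ℝ (Fin d), ‖(chartInv c z v : TangentSpace (𝓡 d) z)‖ ≤ C * ‖v‖ := by
  obtain ⟨C, hC, h⟩ := eventually_norm_symmL_trivializationAt_lt (EuclideanSpace ℝ (Fin d)) (fun x : M => TangentSpace (𝓡 d) x) c
  refine ⟨C, hC, h.mono fun z hz v => (ContinuousLinearMap.le_opNorm _ v).trans ?_⟩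
  gcongr
  exact hz.le

variable [IsRiemannianManifold (𝓡 d) M]

/-- The inverse of a chart is Lipschitz near the base point. -/
theorem exists_edist_le_edist_extChartAt (c : M) : ∃ C : ℝ≥0, ∃ r > 0,
    Metric.ball (extChartAt (𝓡 d) c c) r ⊆ (extChartAt (𝓡 d) c).target ∧
    ∀ w ∈ Metric.ball (extChartAt (𝓡 d) c c) r, ∀ w' ∈ Metric.ball (extChartAt (𝓡 d) c c) r,
      edist ((extChartAt (𝓡 d) c).symm w) ((extChartAt (𝓡 d) c).symm w') ≤ C * edist w w' := by
  rcases eventually_norm_chartInv_le (d := d) c with ⟨C, C_pos, hC⟩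
  lift C to ℝ≥0 using C_pos.le
  have h1 : ∀ᶠ w in 𝓝 (extChartAt (𝓡 d) c c), w ∈ (extChartAt (𝓡 d) c).target ∧
      ∀ v : EuclideanSpace ℝ (Fin d), ‖(chartInv c ((extChartAt (𝓡 d) c).symm w) v :
        TangentSpace (𝓡 d) ((extChartAt (𝓡 d) c).symm w))‖ ≤ C * ‖v‖ := by
    refine Filter.Eventually.and (extChartAt_target_mem_nhds (I := 𝓡 d) c) ?_
    have h := continuousAt_extChartAt_symm (I := 𝓡 d) c
    rw [ContinuousAt, extChartAt_to_inv] at h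
    exact h.eventually hC
  obtain ⟨r, r_pos, hr⟩ := Metric.eventually_nhds_iff_ball.1 h1
  refine ⟨C, r, r_pos, fun w hw => (hr w hw).1, fun w hw w' hw' => ?_⟩
  -- The chart preimage of the straight segment competes in the infimum defining the Riemannian
  -- distance, and its speed is at most `C` times the Euclidean one.
  let η := ContinuousAffineMap.lineMap (R := ℝ) w w'
  have hη : ∀ t ∈ Icc (0:ℝ) 1, η t ∈ Metric.ball (extChartAt (𝓡 d) c c) r := by
    intro t ht
    refine (convex_ball _ _).segment_subset hw hw' ?_
    rw [segment_eq_image_lineMap]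
    exact ⟨t, ht, rfl⟩
  set γ := (extChartAt (𝓡 d) c).symm ∘ η
  have η_smooth : ContMDiff 𝓘(ℝ, ℝ) 𝓘(ℝ, EuclideanSpace ℝ (Fin d)) 1 η := by
    rw [contMDiff_iff_contDiff]
    exact ContinuousAffineMap.contDiff _
  rw [IsRiemannianManifold.out (I := 𝓡 d)]
  have : riemannianEDist (𝓡 d) ((extChartAt (𝓡 d) c).symm w) ((extChartAt (𝓡 d) c).symm w')
      ≤ pathELength (𝓡 d) γ 0 1 := by
    apply riemannianEDist_le_pathELength _ _ _ zero_le_one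
    · exact (contMDiffOn_extChartAt_symm c).comp η_smooth.contMDiffOn
        fun t ht => (hr _ (hη t ht)).1
    · simp [γ, η, ContinuousAffineMap.coe_lineMap_eq]
    · simp [γ, η, ContinuousAffineMap.coe_lineMap_eq]
  apply this.trans
  have hηd : ∀ t, HasMFDerivAt 𝓘(ℝ, ℝ) 𝓘(ℝ, EuclideanSpace ℝ (Fin d)) η t
      ((1 : ℝ →L[ℝ] ℝ).smulRight (w' - w)) := fun t => by
    have h : HasDerivAt η (w' - w) t := AffineMap.hasDerivAt_lineMap
    exact h.hasFDerivAt.hasMFDerivAt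
  rw [pathELength_eq_lintegral_mfderiv_Icc]
  have hb : ∀ t ∈ Icc (0:ℝ) 1, ‖mfderiv 𝓘(ℝ, ℝ) (𝓡 d) γ t 1‖ₑ ≤ C * edist w w' := by
    intro t ht
    have h := (hasMFDerivAt_extChartAt_symm (hr _ (hη t ht)).1).comp t (hηd t)
    rw [h.mfderiv]
    have h3 := (hr _ (hη t ht)).2 (w' - w)
    have h4 : ‖(chartInv c ((extChartAt (𝓡 d) c).symm (η t)) (w' - w) :
        TangentSpace (𝓡 d) ((extChartAt (𝓡 d) c).symm (η t)))‖ₑ ≤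
        C * edist w w' := by
      rw [edist_comm, edist_eq_enorm_sub, ← ofReal_norm, ← ofReal_norm, ← ENNReal.ofReal_coe_nnreal,
        ← ENNReal.ofReal_mul C.coe_nonneg]
      exact ENNReal.ofReal_le_ofReal h3
    have h5 : ((chartInv c ((extChartAt (𝓡 d) c).symm (η t))).comp
        ((1 : ℝ →L[ℝ] ℝ).smulRight (w' - w))) (1 : ℝ) =
        chartInv c ((extChartAt (𝓡 d) c).symm (η t)) (w' - w) :=
      congrArg (chartInv c ((extChartAt (𝓡 d) c).symm (η t))) (one_smul ℝ (w' - w))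
    exact (congrArg (fun v => ‖v‖ₑ) h5).trans_le h4
  calc _ ≤ ∫⁻ t in Icc (0:ℝ) 1, C * edist w w' := setLIntegral_mono' measurableSet_Icc hb
    _ = _ := by simp

/-- Charts are Lipschitz near the base point. -/
theorem exists_edist_extChartAt_le (c : M) : ∃ C : ℝ≥0, ∃ r > 0,
    Metric.ball c r ⊆ (extChartAt (𝓡 d) c).source ∧
    ∀ y ∈ Metric.ball c r, ∀ z ∈ Metric.ball c r,
      edist (extChartAt (𝓡 d) c y) (extChartAt (𝓡 d) c z) ≤ C * edist y z := by
  rcases eventually_norm_chartMap_le (d := d) c with ⟨C, C_pos, hC⟩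
  lift C to ℝ≥0 using C_pos.le
  obtain ⟨r, r_pos, hr⟩ := Metric.mem_nhds_iff.1
    (inter_mem hC (extChartAt_source_mem_nhds (I := 𝓡 d) c))
  have hr2 : Metric.ball c r ⊆ (chartAt (EuclideanSpace ℝ (Fin d)) c).source := fun z hz => by
    simpa [extChartAt_source] using (hr hz).2
  -- Two points of the `r / 3`-ball are less than `2 * r / 3` apart, so a nearly shortest path
  -- between them stays in the `r`-ball, where the chart is controlled. The path is only nearly
  -- shortest, hence the slack `ε`.
  refine ⟨C, r / 3, by positivity,
    (Metric.ball_subset_ball (by linarith)).trans fun z hz => (hr hz).2, fun y hy z hz => ?_⟩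
  refine ENNReal.le_of_forall_pos_le_add fun ε hε _ => ?_
  have hlt : riemannianEDist (𝓡 d) y z < min (edist y z + ε / C) (ENNReal.ofReal (2 * r / 3)) := by
    rw [← IsRiemannianManifold.out (I := 𝓡 d)]
    refine lt_min ?_ ?_
    · exact ENNReal.lt_add_right (edist_ne_top _ _)
        (ENNReal.div_pos (by simpa using hε.ne') ENNReal.coe_ne_top).ne'
    · rw [edist_dist]
      refine (ENNReal.ofReal_lt_ofReal_iff (by positivity)).2 ?_
      have := dist_triangle_right y z c
      rw [Metric.mem_ball] at hy hz
      linarith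
  rcases exists_lt_locally_constant_of_riemannianEDist_lt hlt zero_lt_one
    with ⟨γ, hγx, hγy, γ_smooth, hγ, -⟩
  have hmem : ∀ t ∈ Icc (0:ℝ) 1, γ t ∈ Metric.ball c r := fun t ht => by
    have h1 : edist y (γ t) ≤ pathELength (𝓡 d) γ 0 1 := by
      rw [IsRiemannianManifold.out (I := 𝓡 d)]
      exact (riemannianEDist_le_pathELength γ_smooth.contMDiffOn hγx rfl ht.1).trans
        (pathELength_mono le_rfl ht.2)
    have h2 : edist y (γ t) < ENNReal.ofReal (2 * r / 3) :=
      h1.trans_lt (hγ.trans_le (min_le_right _ _))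
    rw [edist_dist, ENNReal.ofReal_lt_ofReal_iff (by positivity)] at h2
    rw [Metric.mem_ball] at hy ⊢
    have := dist_triangle_left (γ t) c y
    linarith
  let γ' := extChartAt (𝓡 d) c ∘ γ
  have hC' : ContMDiffOn 𝓘(ℝ, ℝ) 𝓘(ℝ, EuclideanSpace ℝ (Fin d)) 1 γ' (Icc 0 1) :=
    contMDiffOn_extChartAt.comp (I' := (𝓡 d))
      (t := (chartAt (EuclideanSpace ℝ (Fin d)) c).source)
      γ_smooth.contMDiffOn (fun t' ht' ↦ hr2 (hmem t' ht'))
  have : ‖γ' 1 - γ' 0‖ₑ ≤ C * pathELength (𝓡 d) γ 0 1 := by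
    refine (enorm_sub_le_lintegral_deriv_of_contDiffOn_Icc
      (contMDiffOn_iff_contDiffOn.1 hC') zero_le_one).trans ?_
    rw [pathELength_eq_lintegral_mfderiv_Icc, ← lintegral_const_mul' _ _ ENNReal.coe_ne_top]
    refine setLIntegral_mono' measurableSet_Icc fun t ht => ?_
    have h := (hasMFDerivAt_extChartAt (hr (hmem t ht)).2).comp t
      (γ_smooth.mdifferentiable one_ne_zero t).hasMFDerivAt
    have h5 : deriv γ' t = chartMap c (γ t) (mfderiv 𝓘(ℝ, ℝ) (𝓡 d) γ t 1) := by
      have h6 : HasFDerivAt γ' ((chartMap c (γ t)).comp (mfderiv 𝓘(ℝ, ℝ) (𝓡 d) γ t) :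
        ℝ →L[ℝ] EuclideanSpace ℝ (Fin d)) t := h.hasFDerivAt
      exact h6.hasDerivAt.deriv
    rw [h5]
    have h3 := (hr (hmem t ht)).1 (mfderiv 𝓘(ℝ, ℝ) (𝓡 d) γ t 1)
    rw [← ofReal_norm, ← ofReal_norm, ← ENNReal.ofReal_coe_nnreal, ← ENNReal.ofReal_mul C.coe_nonneg]
    exact ENNReal.ofReal_le_ofReal h3
  calc edist (extChartAt (𝓡 d) c y) (extChartAt (𝓡 d) c z)
      = ‖γ' 1 - γ' 0‖ₑ := by rw [edist_comm, edist_eq_enorm_sub]; simp [γ', hγx, hγy]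
    _ ≤ C * pathELength (𝓡 d) γ 0 1 := this
    _ ≤ C * (edist y z + ε / C) := by
      gcongr
      exact (hγ.trans_le (min_le_left _ _)).le
    _ = C * edist y z + ε := by
      rw [mul_add, ENNReal.mul_div_cancel (by simpa using C_pos.ne') ENNReal.coe_ne_top]

/-- Charts are bi-Lipschitz near the base point. -/
theorem exists_extChartAt_bilipschitz (c : M) : ∃ C : ℝ≥0, ∃ W ∈ 𝓝 c,
    W ⊆ (extChartAt (𝓡 d) c).source ∧
    ∀ y ∈ W, ∀ z ∈ W, dist (extChartAt (𝓡 d) c y) (extChartAt (𝓡 d) c z) ≤ C * dist y z ∧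
      dist y z ≤ C * dist (extChartAt (𝓡 d) c y) (extChartAt (𝓡 d) c z) := by
  obtain ⟨C₁, r₁, hr₁, hs₁, h₁⟩ := exists_edist_le_edist_extChartAt (d := d) c
  obtain ⟨C₂, r₂, hr₂, hs₂, h₂⟩ := exists_edist_extChartAt_le (d := d) c
  refine ⟨max C₁ C₂, Metric.ball c r₂ ∩ extChartAt (𝓡 d) c ⁻¹' Metric.ball _ r₁,
    inter_mem (Metric.ball_mem_nhds _ hr₂)
      ((continuousAt_extChartAt c).preimage_mem_nhds (Metric.ball_mem_nhds _ hr₁)),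
    inter_subset_left.trans hs₂, fun y hy z hz => ⟨?_, ?_⟩⟩
  · have h := h₂ y hy.1 z hz.1
    rw [edist_nndist, edist_nndist] at h
    have h' : dist (extChartAt (𝓡 d) c y) (extChartAt (𝓡 d) c z) ≤ C₂ * dist y z := by
      exact_mod_cast h
    exact h'.trans (by gcongr; exact le_max_right _ _)
  · have h := h₁ _ hy.2 _ hz.2
    rw [(extChartAt (𝓡 d) c).left_inv (hs₂ hy.1), (extChartAt (𝓡 d) c).left_inv (hs₂ hz.1),
      edist_nndist, edist_nndist] at h
    have h' : dist y z ≤ C₁ * dist (extChartAt (𝓡 d) c y) (extChartAt (𝓡 d) c z) := by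
      exact_mod_cast h
    exact h'.trans (by gcongr; exact le_max_left _ _)

end ControlAffine



/-! ### The space of controls: weak* topology, shifts, compactness -/

namespace ControlAffine

section ControlSpace

variable {m : ℕ} {U : Set (EuclideanSpace ℝ (Fin m))}

theorem exists_bound_control (hU : IsCompact U) :
    ∃ R : ℝ, 0 ≤ R ∧ ∀ u : Control U, ∀ᵐ t, ‖u.1 t‖ ≤ R := by
  obtain ⟨R, hR⟩ := hU.isBounded.exists_norm_le
  exact ⟨max R 0, le_max_right _ _, fun u => u.2.mono fun t ht => (hR _ ht).trans (le_max_left _ _)⟩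

theorem tendsto_control_iff {α : Type*} {l : Filter α} {f : α → Control U} {u : Control U} :
    Tendsto f l (𝓝 u) ↔ ∀ g : Lp (EuclideanSpace ℝ (Fin m)) 1 (volume : Measure ℝ),
      Tendsto (fun a => ∫ t, inner ℝ ((f a).1 t) (g t)) l (𝓝 (∫ t, inner ℝ (u.1 t) (g t))) := by
  have h : IsInducing (fun (u : Control U) (g : Lp (EuclideanSpace ℝ (Fin m)) 1
      (volume : Measure ℝ)) => ∫ t, inner ℝ (u.1 t) (g t)) := ⟨rfl⟩
  rw [h.tendsto_nhds_iff, tendsto_pi_nhds]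
  rfl

theorem integrable_inner_control (hU : IsCompact U) (u : Control U)
    {g : ℝ → EuclideanSpace ℝ (Fin m)} (hg : Integrable g) :
    Integrable (fun t => inner ℝ (u.1 t) (g t)) := by
  obtain ⟨R, hR, h⟩ := exists_bound_control hU
  refine (hg.norm.const_mul R).mono (u.1.aestronglyMeasurable.inner hg.aestronglyMeasurable) ?_
  filter_upwards [h u] with t ht
  rw [norm_mul, norm_norm, Real.norm_of_nonneg hR]
  exact (norm_inner_le_norm _ _).trans (by gcongr)

theorem continuous_integral_inner_control {g : ℝ → EuclideanSpace ℝ (Fin m)} (hg : Integrable g) :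
    Continuous fun u : Control U => ∫ t, inner ℝ (u.1 t) (g t) := by
  refine continuous_iff_continuousAt.2 fun u => ?_
  have h := tendsto_control_iff.1 (tendsto_id (x := 𝓝 u)) (hg.toL1 g)
  have h2 : ∀ u : Control U, ∫ t, inner ℝ (u.1 t) (g t) = ∫ t, inner ℝ (u.1 t) (hg.toL1 g t) :=
    fun u => integral_congr_ae (hg.coeFn_toL1.mono fun t ht => by simp only [ht])
  simp only [ContinuousAt, h2]
  exact h

theorem shift_ae (s : ℝ) (u : Control U) : ∀ᵐ t, (shift s u).1 t = u.1 (t + s) :=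
  AEEqFun.coeFn_compMeasurePreserving u.1 (measurePreserving_add_right (volume : Measure ℝ) s)

theorem shift_zero (u : Control U) : shift 0 u = u := by
  refine Subtype.ext (AEEqFun.ext ?_)
  filter_upwards [shift_ae 0 u] with t ht
  rw [ht, add_zero]

theorem shift_shift (s t : ℝ) (u : Control U) : shift s (shift t u) = shift (s + t) u := by
  refine Subtype.ext (AEEqFun.ext ?_)
  filter_upwards [shift_ae s (shift t u), shift_ae (s + t) u,
    (measurePreserving_add_right (volume : Measure ℝ) s).quasiMeasurePreserving.ae
      (shift_ae t u)] with r h1 h2 h3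
  rw [h1, h2, h3, add_assoc]

/-- Translation invariance of Lebesgue measure moves the shift from the control to the test
function, which remains integrable. -/
theorem continuous_shift (s : ℝ) : Continuous (shift s : Control U → Control U) := by
  refine continuous_iff_continuousAt.2 fun u => tendsto_control_iff.2 fun g => ?_
  have hg : Integrable fun t => g (t - s) :=
    (L1.integrable_coeFn g).comp_sub_right s
  have h := (continuous_integral_inner_control (U := U) hg).tendsto u
  have h2 : ∀ u : Control U, ∫ t, inner ℝ (u.1 t) (g (t - s)) =
      ∫ t, inner ℝ ((shift s u).1 t) (g t) := fun u => by
    rw [← integral_add_right_eq_self (fun t => inner ℝ (u.1 t) (g (t - s))) s]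
    refine integral_congr_ae ((shift_ae s u).mono fun t ht => ?_)
    simp only [ht, add_sub_cancel_right]
  simpa only [h2] using h

/-- A weight function in `L²`. -/
def weight (t : ℝ) : ℝ := (1 + t ^ 2)⁻¹

theorem weight_pos (t : ℝ) : 0 < weight t := by unfold weight; positivity

theorem weight_le_one (t : ℝ) : weight t ≤ 1 := by
  unfold weight; exact inv_le_one_of_one_le₀ (by nlinarith [sq_nonneg t])

theorem continuous_weight : Continuous weight := by
  unfold weight
  exact Continuous.inv₀ (by fun_prop) fun t => by positivity

theorem memLp_weight : MemLp weight 2 (volume : Measure ℝ) := by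
  rw [memLp_two_iff_integrable_sq continuous_weight.aestronglyMeasurable]
  refine integrable_inv_one_add_sq.mono (continuous_weight.pow 2).aestronglyMeasurable
    (ae_of_all _ fun t => ?_)
  have h1 := weight_pos t
  have h2 := weight_le_one t
  rw [Real.norm_of_nonneg (by positivity), Real.norm_of_nonneg (by positivity)]
  change weight t ^ 2 ≤ weight t
  nlinarith

theorem memLp_weight_smul (hU : IsCompact U) (u : Control U) :
    MemLp (fun t => weight t • u.1 t) 2 (volume : Measure ℝ) := by
  obtain ⟨R, hR, h⟩ := exists_bound_control hU
  refine (memLp_weight.const_mul R).mono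
    (continuous_weight.aestronglyMeasurable.smul u.1.aestronglyMeasurable) ?_
  filter_upwards [h u] with t ht
  rw [norm_smul, norm_mul, Real.norm_of_nonneg hR, mul_comm]
  gcongr

/-- The control functions form a compact space. -/
theorem compactSpace_control (hU : IsCompact U) (hconv : Convex ℝ U) : CompactSpace (Control U) := by
  obtain ⟨R, hR, hbd⟩ := exists_bound_control hU
  -- Controls are bounded but not square integrable. After multiplication by the weight they form a
  -- bounded subset of a Hilbert space, where the Riesz isomorphism and Banach–Alaoglu provide a
  -- weak limit along any ultrafilter. Dividing by the weight recovers the candidate limit.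
  let H := Lp (EuclideanSpace ℝ (Fin m)) 2 (volume : Measure ℝ)
  let ι : Control U → H := fun u => (memLp_weight_smul hU u).toLp _
  have hι : ∀ u, ι u =ᵐ[volume] fun t => weight t • u.1 t := fun u => MemLp.coeFn_toLp _
  let B := ‖((memLp_weight.const_mul R).toLp _ : Lp ℝ 2 (volume : Measure ℝ))‖
  have hιn : ∀ u, ‖ι u‖ ≤ B := fun u => by
    refine Lp.norm_le_norm_of_ae_le ?_
    filter_upwards [hι u, (memLp_weight.const_mul R).coeFn_toLp, hbd u] with t h1 h2 h3
    rw [h1, h2, norm_smul, norm_mul, Real.norm_of_nonneg hR, mul_comm]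
    gcongr
  refine ⟨isCompact_iff_ultrafilter_le_nhds.2 fun f _ => ?_⟩
  -- weak limit in the Hilbert space
  let Ψ : Control U → WeakDual ℝ H := fun u =>
    WeakDual.toStrongDual.symm (InnerProductSpace.toDual ℝ H (ι u))
  have hK := WeakDual.isCompact_closedBall (𝕜 := ℝ) (E := H) (0 : StrongDual ℝ H) B
  obtain ⟨L, -, hL⟩ := isCompact_iff_ultrafilter_le_nhds.1 hK (f.map Ψ) (by
    rw [le_principal_iff]
    refine Ultrafilter.mem_map.2 (Filter.univ_mem' fun u => ?_)
    simp only [mem_preimage, Ψ]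
    simpa using hιn u)
  obtain ⟨k, hk⟩ : ∃ k : H, InnerProductSpace.toDual ℝ H k = WeakDual.toStrongDual L :=
    (InnerProductSpace.toDual ℝ H).surjective _
  have hlim : ∀ h : H, Tendsto (fun u => inner ℝ (ι u) h) f (𝓝 (inner ℝ k h)) := fun h => by
    have h1 : Tendsto Ψ f (𝓝 L) := hL
    have h2 := ((WeakDual.eval_continuous h).tendsto L).comp h1
    have h3 : L h = inner ℝ k h := by
      rw [← InnerProductSpace.toDual_apply_apply (𝕜 := ℝ), hk]; rfl
    rw [h3] at h2
    refine h2.congr fun u => ?_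
    exact InnerProductSpace.toDual_apply_apply
  -- the limit function
  let κ : ℝ → EuclideanSpace ℝ (Fin m) := fun t => (weight t)⁻¹ • k t
  have hκm : AEStronglyMeasurable κ volume :=
    ((continuous_weight.inv₀ fun t => (weight_pos t).ne').aestronglyMeasurable).smul
      (Lp.aestronglyMeasurable k)
  -- convergence on weighted test functions
  have hlim2 : ∀ h : ℝ → EuclideanSpace ℝ (Fin m), MemLp h 2 volume →
      Tendsto (fun u : Control U => ∫ t, inner ℝ (u.1 t) (weight t • h t)) f
        (𝓝 (∫ t, inner ℝ (κ t) (weight t • h t))) := fun h hh => by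
    have h1 := hlim (hh.toLp h)
    have h2 : inner ℝ k (hh.toLp h) = ∫ t, inner ℝ (κ t) (weight t • h t) := by
      rw [L2.inner_def]
      refine integral_congr_ae (hh.coeFn_toLp.mono fun t ht => ?_)
      simp only [ht, κ, inner_smul_left, inner_smul_right, RCLike.conj_to_real]
      rw [← mul_assoc, mul_inv_cancel₀ (weight_pos t).ne', one_mul]
    rw [h2] at h1
    refine h1.congr fun u => ?_
    rw [L2.inner_def]
    refine integral_congr_ae ?_
    filter_upwards [hh.coeFn_toLp, hι u] with t ht ht2
    simp only [ht, ht2, inner_smul_left, inner_smul_right, RCLike.conj_to_real]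
  -- local integrability and convergence of local averages
  have hκi : ∀ n : ℕ, IntegrableOn κ (Icc (-n : ℝ) n) := fun n => by
    have h1 : IntegrableOn k (Icc (-n : ℝ) n) :=
      (Lp.memLp k).restrict _ |>.integrable (by norm_num)
    refine (h1.norm.const_mul (1 + (n:ℝ) ^ 2)).mono hκm.restrict ?_
    filter_upwards [ae_restrict_mem measurableSet_Icc] with t ht
    rw [norm_smul, norm_mul, norm_norm, Real.norm_of_nonneg (by positivity : 0 ≤ 1 + (n:ℝ)^2),
      norm_inv, Real.norm_of_nonneg (weight_pos t).le, weight, inv_inv]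
    refine mul_le_mul_of_nonneg_right ?_ (norm_nonneg _)
    nlinarith [ht.1, ht.2]
  have huint : ∀ (u : Control U) (n : ℕ), IntegrableOn u.1 (Icc (-n : ℝ) n) := fun u n =>
    Measure.integrableOn_of_bounded (by simp) u.1.aestronglyMeasurable
      (ae_restrict_of_ae (hbd u))
  have havg : ∀ (n : ℕ) (A : Set ℝ), MeasurableSet A → A ⊆ Icc (-n : ℝ) n →
      Tendsto (fun u : Control U => ∫ t in A, u.1 t) f (𝓝 (∫ t in A, κ t)) := by
    intro n A hA hAn
    have hco : ∀ a : EuclideanSpace ℝ (Fin m),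
        Tendsto (fun u : Control U => inner ℝ a (∫ t in A, u.1 t)) f
          (𝓝 (inner ℝ a (∫ t in A, κ t))) := fun a => by
      have hmem : MemLp (A.indicator fun t => (weight t)⁻¹ • a) 2 volume := by
        have h1 : ContinuousOn (fun t => (weight t)⁻¹ • a) (Icc (-n : ℝ) n) :=
          ((continuous_weight.inv₀ fun t => (weight_pos t).ne').smul continuous_const).continuousOn
        rw [memLp_indicator_iff_restrict hA]
        obtain ⟨C, hC⟩ := isCompact_Icc.exists_bound_of_continuousOn h1
        have : IsFiniteMeasure (volume.restrict A) :=
          ⟨by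
            rw [Measure.restrict_apply_univ]
            exact (measure_mono hAn).trans_lt (by simp)⟩
        refine MemLp.of_bound (((continuous_weight.inv₀ fun t => (weight_pos t).ne').smul
          continuous_const).aestronglyMeasurable) C ?_
        filter_upwards [ae_restrict_mem hA] with t ht using hC t (hAn ht)
      have h2 := hlim2 _ hmem
      have h3 : ∀ w : ℝ → EuclideanSpace ℝ (Fin m), IntegrableOn w (Icc (-n : ℝ) n) →
          ∫ t, inner ℝ (w t) (weight t • A.indicator (fun t => (weight t)⁻¹ • a) t) =
            inner ℝ a (∫ t in A, w t) := fun w hw => by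
        rw [← integral_inner (hw.mono_set hAn), ← integral_indicator hA]
        refine integral_congr_ae (ae_of_all _ fun t => ?_)
        by_cases ht : t ∈ A
        · simp only [indicator_of_mem ht, smul_smul, mul_inv_cancel₀ (weight_pos t).ne', one_smul]
          exact real_inner_comm _ _
        · simp [indicator_of_notMem ht]
      rw [h3 κ (hκi n)] at h2
      exact h2.congr fun u => h3 _ (huint u n)
    have := (EuclideanSpace.basisFun (Fin m) ℝ)
    rw [show (fun u : Control U => ∫ t in A, u.1 t) = fun u : Control U =>
      ∑ i, inner ℝ (EuclideanSpace.basisFun (Fin m) ℝ i) (∫ t in A, u.1 t) •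
        EuclideanSpace.basisFun (Fin m) ℝ i from funext fun u => (OrthonormalBasis.sum_repr' _ _).symm,
      ← OrthonormalBasis.sum_repr' (EuclideanSpace.basisFun (Fin m) ℝ) (∫ t in A, κ t)]
    exact tendsto_finsetSum _ fun i _ => (hco _).smul_const _
  -- the limit takes values in `U`
  have hκU : ∀ᵐ t, κ t ∈ U := by
    -- The averages of `κ` over bounded sets of positive measure are limits of averages of controls,
    -- so they lie in the closed convex set `U`. If `κ` took values in a closed ball disjoint from
    -- `U` on such a set, the average would lie in that ball as well. Countably many of these balls
    -- cover the complement of `U`.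
    have hopen : IsOpen Uᶜ := hU.isClosed.isOpen_compl
    have hball : ∀ x ∈ Uᶜ, ∃ r > 0, Metric.closedBall x r ⊆ Uᶜ := fun x hx =>
      Metric.nhds_basis_closedBall.mem_iff.1 (hopen.mem_nhds hx)
    choose! r hr hrU using hball
    obtain ⟨T, hTU, hTc, hT⟩ := TopologicalSpace.countable_cover_nhdsWithin
      (f := fun x => Metric.closedBall x (r x)) (s := Uᶜ)
      fun x hx => mem_nhdsWithin_of_mem_nhds (Metric.closedBall_mem_nhds x (hr x hx))
    have hnull : ∀ x ∈ T, ∀ n : ℕ, ∀ᵐ t, t ∈ Icc (-n : ℝ) n → κ t ∉ Metric.closedBall x (r x) := by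
      intro x hx n
      obtain ⟨κ', hκ'm, hκ'⟩ := hκm
      let A := κ' ⁻¹' Metric.closedBall x (r x) ∩ Icc (-n : ℝ) n
      have hA : MeasurableSet A :=
        (hκ'm.measurable Metric.isClosed_closedBall.measurableSet).inter measurableSet_Icc
      suffices h0 : volume A = 0 by
        filter_upwards [measure_eq_zero_iff_ae_notMem.1 h0, hκ'] with t h1 h2 h3 h4
        exact h1 ⟨by rw [mem_preimage, ← h2]; exact h4, h3⟩
      by_contra h0
      have hfin : volume A ≠ ⊤ := ((measure_mono inter_subset_right).trans_lt (by simp)).ne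
      have h1 : ⨍ t in A, κ t ∈ Metric.closedBall x (r x) := by
        refine (convex_closedBall x (r x)).set_average_mem Metric.isClosed_closedBall h0 hfin ?_
          ((hκi n).mono_set inter_subset_right)
        filter_upwards [ae_restrict_mem hA, ae_restrict_of_ae hκ'] with t ht h2
        rw [h2]; exact ht.1
      have h2 : ⨍ t in A, κ t ∈ U := by
        have h3 := (havg n A hA inter_subset_right).const_smul (volume.real A)⁻¹
        rw [← setAverage_eq] at h3
        refine hU.isClosed.mem_of_tendsto h3 (Eventually.of_forall fun u => ?_)
        simp only [← setAverage_eq]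
        exact hconv.set_average_mem hU.isClosed h0 hfin (ae_restrict_of_ae u.2)
          ((huint u n).mono_set inter_subset_right)
      exact hrU x (hTU hx) h1 h2
    have hnull' : ∀ᵐ t, ∀ x ∈ T, ∀ n : ℕ, t ∈ Icc (-n : ℝ) n → κ t ∉ Metric.closedBall x (r x) :=
      (ae_ball_iff hTc).2 fun x hx => ae_all_iff.2 fun n => hnull x hx n
    filter_upwards [hnull'] with t ht
    by_contra hn
    obtain ⟨x, hx, hxt⟩ := mem_iUnion₂.1 (hT hn)
    obtain ⟨n, hn⟩ := exists_nat_ge |t|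
    exact ht x hx n (abs_le.1 hn) hxt
  -- the limit control
  let v : Control U := ⟨AEEqFun.mk κ hκm, by
    filter_upwards [AEEqFun.coeFn_mk κ hκm, hκU] with t h1 h2
    rwa [h1]⟩
  have hv : ∀ᵐ t, v.1 t = κ t := AEEqFun.coeFn_mk κ hκm
  refine ⟨v, mem_univ _, ?_⟩
  change Tendsto id (f : Filter (Control U)) (𝓝 v)
  refine tendsto_control_iff.2 fun g => ?_
  have hgi := L1.integrable_coeFn g
  -- truncation of the test function
  let D : ℕ → Set ℝ := fun n => {t | ‖g t‖ ≤ n * weight t ^ 2}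
  have hD : ∀ n, MeasurableSet (D n) := fun n =>
    measurableSet_le (Lp.stronglyMeasurable g).norm.measurable
      (measurable_const.mul (continuous_weight.measurable.pow_const 2))
  -- On `D n` the test function divided by the weight is at most `n` times the weight, hence square
  -- integrable. The part of `g` outside `D n` tends to zero in `L¹`, and controls are bounded by
  -- `R`, so a three-epsilon argument passes from truncated test functions to `g`.
  have hgn : Tendsto (fun n => ∫ t, ‖(D n)ᶜ.indicator g t‖) atTop (𝓝 0) := by
    rw [← integral_zero ℝ ℝ]
    refine tendsto_integral_of_dominated_convergence (fun t => ‖g t‖)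
      (fun n => ((Lp.aestronglyMeasurable g).indicator (hD n).compl).norm) hgi.norm
      (fun n => ae_of_all _ fun t => ?_) (ae_of_all _ fun t => ?_)
    · rw [norm_norm]
      exact norm_indicator_le_norm_self _ _
    · refine tendsto_const_nhds.congr' ?_
      obtain ⟨n₀, hn₀⟩ := exists_nat_ge (‖g t‖ / weight t ^ 2)
      filter_upwards [eventually_ge_atTop n₀] with n hn
      have h1 : t ∈ D n := by
        change ‖g t‖ ≤ n * weight t ^ 2
        rw [← div_le_iff₀ (pow_pos (weight_pos t) 2)]
        exact hn₀.trans (by exact_mod_cast hn)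
      simp [h1]
  have hclose : ∀ (u : Control U) (n : ℕ), dist (∫ t, inner ℝ (u.1 t) (g t))
      (∫ t, inner ℝ (u.1 t) ((D n).indicator g t)) ≤ R * ∫ t, ‖(D n)ᶜ.indicator g t‖ := by
    intro u n
    rw [Real.dist_eq, ← Real.norm_eq_abs, ← integral_sub (integrable_inner_control hU u hgi)
      (integrable_inner_control hU u (hgi.indicator (hD n))), ← integral_const_mul]
    refine norm_integral_le_of_norm_le (((hgi.indicator (hD n).compl).norm).const_mul R) ?_
    filter_upwards [hbd u] with t ht
    rw [← inner_sub_right, show g t - (D n).indicator g t = (D n)ᶜ.indicator g t by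
      rw [indicator_compl]; rfl]
    exact (norm_inner_le_norm _ _).trans (by gcongr)
  have hlim3 : ∀ n : ℕ, Tendsto (fun u : Control U => ∫ t, inner ℝ (u.1 t) ((D n).indicator g t)) f
      (𝓝 (∫ t, inner ℝ (v.1 t) ((D n).indicator g t))) := fun n => by
    have hm : MemLp (fun t => (weight t)⁻¹ • (D n).indicator g t) 2 volume := by
      refine (memLp_weight.const_mul (n : ℝ)).mono
        ((continuous_weight.inv₀ fun t => (weight_pos t).ne').aestronglyMeasurable.smul
          ((Lp.aestronglyMeasurable g).indicator (hD n))) (ae_of_all _ fun t => ?_)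
      have hw := weight_pos t
      rw [norm_smul, norm_inv, Real.norm_of_nonneg hw.le, inv_mul_le_iff₀ hw,
        Real.norm_of_nonneg (by positivity)]
      by_cases ht : t ∈ D n
      · rw [indicator_of_mem ht]
        exact (show ‖g t‖ ≤ n * weight t ^ 2 from ht).trans_eq (by ring)
      · rw [indicator_of_notMem ht, norm_zero]
        positivity
    have h1 := hlim2 _ hm
    simp only [smul_smul, mul_inv_cancel₀ (weight_pos _).ne', one_smul] at h1
    refine h1.congr' (Eventually.of_forall fun u => rfl) |>.trans_eq ?_
    congr 1
    exact integral_congr_ae (hv.mono fun t ht => by simp only [ht])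
  rw [Metric.tendsto_nhds]
  intro ε hε
  obtain ⟨n, hn⟩ : ∃ n, R * ∫ t, ‖(D n)ᶜ.indicator g t‖ < ε / 3 := by
    have h1 := hgn.const_mul R
    rw [mul_zero] at h1
    exact (h1.eventually_lt_const (by positivity : 0 < ε / 3)).exists
  filter_upwards [Metric.tendsto_nhds.1 (hlim3 n) (ε / 3) (by positivity)] with u hu
  have h1 := hclose u n
  have h2 := hclose v n
  rw [dist_comm] at h2
  have h3 := dist_triangle4 (∫ t, inner ℝ (u.1 t) (g t)) (∫ t, inner ℝ (u.1 t) ((D n).indicator g t))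
    (∫ t, inner ℝ (v.1 t) ((D n).indicator g t)) (∫ t, inner ℝ (v.1 t) (g t))
  simp only [id]
  linarith

end ControlSpace

end ControlAffine



/-! ### Integral equations for control-affine fields in a vector space -/

namespace ControlAffine

section LocalODE

variable {m : ℕ} {E : Type*} [NormedAddCommGroup E] [NormedSpace ℝ E] 

/-- The right-hand side of a control-affine equation in a vector space. -/
def affineField (g₀ : E → E) (g : Fin m → E → E) (w : EuclideanSpace ℝ (Fin m)) (x : E) : E :=
  g₀ x + ∑ i, w i • g i x

/-- On `K`, the control-affine right-hand side with controls of norm at most `R` is bounded by `B`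
and Lipschitz with constant `L`. -/
structure IsBoundedLipschitz (g₀ : E → E) (g : Fin m → E → E) (K : Set E) (R B L : ℝ) : Prop where
  nonneg : 0 ≤ B ∧ 0 ≤ L
  continuousOn₀ : ContinuousOn g₀ K
  continuousOn : ∀ i, ContinuousOn (g i) K
  bound : ∀ w : EuclideanSpace ℝ (Fin m), ‖w‖ ≤ R → ∀ x ∈ K, ‖affineField g₀ g w x‖ ≤ B
  lip : ∀ w : EuclideanSpace ℝ (Fin m), ‖w‖ ≤ R → ∀ x ∈ K, ∀ y ∈ K,
    ‖affineField g₀ g w x - affineField g₀ g w y‖ ≤ L * ‖x - y‖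

/-- `h` solves the integral equation with control `u` on `[-τ, τ]`, with values in `K`. -/
structure IsIntegralSolution (g₀ : E → E) (g : Fin m → E → E) (K : Set E) (τ : ℝ)
    (u : ℝ → EuclideanSpace ℝ (Fin m)) (h : ℝ → E) : Prop where
  continuousOn : ContinuousOn h (Icc (-τ) τ)
  mapsTo : MapsTo h (Icc (-τ) τ) K
  eq : ∀ t ∈ Icc (-τ) τ, h t = h 0 + ∫ s in (0:ℝ)..t, affineField g₀ g (u s) (h s)

theorem uIoc_zero_subset {τ t : ℝ} (hτ : 0 ≤ τ) (ht : t ∈ Icc (-τ) τ) : uIoc 0 t ⊆ Icc (-τ) τ := by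
  refine uIoc_subset_uIcc.trans (uIcc_subset_Icc ⟨by linarith, hτ⟩ ht)

/-- A short-time substitute for Gronwall's inequality: with `b` the maximum of `f`, the hypothesis
reads `max f ≤ a + max f / 2`. -/
theorem le_two_mul_of_forall_bound {τ a : ℝ} (hτ : 0 ≤ τ) {f : ℝ → ℝ}
    (hf : ContinuousOn f (Icc (-τ) τ))
    (h : ∀ b, (∀ t ∈ Icc (-τ) τ, f t ≤ b) → ∀ t ∈ Icc (-τ) τ, f t ≤ a + b / 2) :
    ∀ t ∈ Icc (-τ) τ, f t ≤ 2 * a := by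
  obtain ⟨t₀, ht₀, hmax⟩ := isCompact_Icc.exists_isMaxOn ⟨0, by constructor <;> linarith⟩ hf
  intro t ht
  have h1 := h (f t₀) (fun t ht => hmax ht) t₀ ht₀
  have h2 : f t ≤ f t₀ := hmax ht
  linarith

variable {g₀ : E → E} {g : Fin m → E → E} {K : Set E} {R B L τ : ℝ}
  {u v : ℝ → EuclideanSpace ℝ (Fin m)} {h h' : ℝ → E}

/-- Produces the term `b / 2` that `le_two_mul_of_forall_bound` absorbs; the factor one half is the
short-time condition `c * τ ≤ 1 / 2`. -/
theorem norm_intervalIntegral_le_half {F : ℝ → E} {b c t : ℝ} (hτ : 0 ≤ τ) (hc : 0 ≤ c)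
    (hcτ : c * τ ≤ 1 / 2) (hb : 0 ≤ b)
    (ht : t ∈ Icc (-τ) τ) (hF : ∀ᵐ s, s ∈ Icc (-τ) τ → ‖F s‖ ≤ c * b) :
    ‖∫ s in (0:ℝ)..t, F s‖ ≤ b / 2 := by
  have h1 : ‖∫ s in (0:ℝ)..t, F s‖ ≤ c * b * |t - 0| := by
    refine intervalIntegral.norm_integral_le_of_norm_le_const_ae ?_
    filter_upwards [hF] with s hs hst
    exact hs (uIoc_zero_subset hτ ht hst)
  have h2 : |t - 0| ≤ τ := by rw [sub_zero]; exact abs_le.2 ht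
  calc _ ≤ c * b * |t - 0| := h1
    _ ≤ c * b * τ := by gcongr
    _ = (c * τ) * b := by ring
    _ ≤ 1 / 2 * b := by gcongr
    _ = b / 2 := by ring

theorem IsBoundedLipschitz.aestronglyMeasurable (hg : IsBoundedLipschitz g₀ g K R B L)
    (hu : AEStronglyMeasurable u) {a b : ℝ} (hc : ContinuousOn h (Icc a b))
    (hK : MapsTo h (Icc a b) K) :
    AEStronglyMeasurable (fun s => affineField g₀ g (u s) (h s))
      (volume.restrict (Icc a b)) := by
  unfold affineField
  refine ((hg.continuousOn₀.comp hc hK).aestronglyMeasurable measurableSet_Icc).add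
    (Finset.aestronglyMeasurable_fun_sum _ fun i _ => ?_)
  refine AEStronglyMeasurable.smul ?_
    (((hg.continuousOn i).comp hc hK).aestronglyMeasurable measurableSet_Icc)
  exact ((EuclideanSpace.proj i : EuclideanSpace ℝ (Fin m) →L[ℝ] ℝ).continuous
    |>.comp_aestronglyMeasurable hu).restrict

theorem intervalIntegrable_of_bound {F : ℝ → E} {t C : ℝ} (hτ : 0 ≤ τ) (ht : t ∈ Icc (-τ) τ)
    (hF : AEStronglyMeasurable F (volume.restrict (Icc (-τ) τ)))
    (hC : ∀ᵐ s, s ∈ Icc (-τ) τ → ‖F s‖ ≤ C) : IntervalIntegrable F volume 0 t := by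
  rw [intervalIntegrable_iff]
  have h1 : IntegrableOn F (Icc (-τ) τ) :=
    Integrable.of_bound hF C ((ae_restrict_iff' measurableSet_Icc).2 hC)
  exact h1.mono_set (uIoc_zero_subset hτ ht)

theorem IsBoundedLipschitz.intervalIntegrable (hg : IsBoundedLipschitz g₀ g K R B L)
    (hu : AEStronglyMeasurable u) (huR : ∀ᵐ t, ‖u t‖ ≤ R) (hc : ContinuousOn h (Icc (-τ) τ))
    (hK : MapsTo h (Icc (-τ) τ) K) (hτ : 0 ≤ τ) {t : ℝ} (ht : t ∈ Icc (-τ) τ) :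
    IntervalIntegrable (fun s => affineField g₀ g (u s) (h s)) volume 0 t :=
  intervalIntegrable_of_bound hτ ht (hg.aestronglyMeasurable hu hc hK)
    (huR.mono fun _ hs hst => hg.bound _ hs _ (hK hst))

/-- Lipschitz dependence of solutions on the initial value. -/
theorem IsIntegralSolution.norm_sub_le (hg : IsBoundedLipschitz g₀ g K R B L)
    (hu : AEStronglyMeasurable u) (huR : ∀ᵐ t, ‖u t‖ ≤ R) (hτ : 0 ≤ τ) (hLτ : L * τ ≤ 1 / 2)
    (hh : IsIntegralSolution g₀ g K τ u h) (hh' : IsIntegralSolution g₀ g K τ u h') :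
    ∀ t ∈ Icc (-τ) τ, ‖h t - h' t‖ ≤ 2 * ‖h 0 - h' 0‖ := by
  refine le_two_mul_of_forall_bound hτ (hh.continuousOn.sub hh'.continuousOn).norm ?_
  intro b hb t ht
  have hb0 : 0 ≤ b := (norm_nonneg _).trans (hb t ht)
  have h1 := hg.intervalIntegrable hu huR hh.continuousOn hh.mapsTo hτ ht
  have h2 := hg.intervalIntegrable hu huR hh'.continuousOn hh'.mapsTo hτ ht
  have h3 : h t - h' t = (h 0 - h' 0) + ∫ s in (0:ℝ)..t,
      (affineField g₀ g (u s) (h s) - affineField g₀ g (u s) (h' s)) := by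
    rw [intervalIntegral.integral_sub h1 h2, hh.eq t ht, hh'.eq t ht]
    abel
  rw [h3]
  refine (norm_add_le _ _).trans (add_le_add le_rfl ?_)
  refine norm_intervalIntegral_le_half hτ hg.nonneg.2 hLτ hb0 ht ?_
  filter_upwards [huR] with s hs hst
  exact (hg.lip _ hs _ (hh.mapsTo hst) _ (hh'.mapsTo hst)).trans
    (mul_le_mul_of_nonneg_left (hb s hst) hg.nonneg.2)

variable [FiniteDimensional ℝ E]

/-- The weak* topology tests scalar integrals only, so the vector integral is read in a basis of
`E`: each coordinate is the pairing of `u` with an integrable function supported in the `i`-th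
direction. -/
theorem continuous_integral_control_smul {U : Set (EuclideanSpace ℝ (Fin m))} (hU : IsCompact U)
    (i : Fin m) {q : ℝ → E} (hq : Integrable q) :
    Continuous fun u : Control U => ∫ s, u.1 s i • q s := by
  have : CompleteSpace E := FiniteDimensional.complete ℝ E
  let e := (Module.finBasis ℝ E).equivFunL
  rw [← e.toHomeomorph.comp_continuous_iff]
  refine continuous_pi fun j => ?_
  let l : E →L[ℝ] ℝ := (ContinuousLinearMap.proj (R := ℝ) (φ := fun _ => ℝ) j).comp
    e.toContinuousLinearMap
  have hlq : Integrable fun s => EuclideanSpace.single i (l (q s)) := by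
    have h1 : Integrable fun s => l (q s) • EuclideanSpace.single i (1 : ℝ) :=
      (l.integrable_comp hq).smul_const _
    refine h1.congr (ae_of_all _ fun s => ?_)
    ext k
    by_cases hk : k = i <;> simp [hk]
  have hint : ∀ u : Control U, Integrable fun s => u.1 s i • q s := fun u => by
    obtain ⟨R, hR, hb⟩ := exists_bound_control hU
    refine (hq.norm.const_mul R).mono (((EuclideanSpace.proj i : EuclideanSpace ℝ (Fin m) →L[ℝ] ℝ
      ).continuous.comp_aestronglyMeasurable u.1.aestronglyMeasurable).smul
      hq.aestronglyMeasurable) ?_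
    filter_upwards [hb u] with s hs
    rw [norm_smul, norm_mul, norm_norm, Real.norm_of_nonneg hR]
    gcongr
    exact (PiLp.norm_apply_le _ _).trans hs
  refine (continuous_integral_inner_control (U := U) hlq).congr fun u => ?_
  change _ = l (∫ s, u.1 s i • q s)
  rw [← l.integral_comp_comm (hint u)]
  refine integral_congr_ae (ae_of_all _ fun s => ?_)
  simp [EuclideanSpace.inner_single_right, mul_comm]

/-- Solutions depend continuously on the initial value and on the control, with respect to the
weak* topology. -/
theorem IsIntegralSolution.tendsto {U : Set (EuclideanSpace ℝ (Fin m))} (hU : IsCompact U)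
    (hUR : ∀ w ∈ U, ‖w‖ ≤ R)
    (hg : IsBoundedLipschitz g₀ g K R B L) (hτ : 0 ≤ τ) (hLτ : L * τ ≤ 1 / 2)
    {α : Type*} {l : Filter α} {u : α → Control U} {u₀ : Control U} {h : α → ℝ → E} {h₀ : ℝ → E}
    (hu : Tendsto u l (𝓝 u₀)) (hx : Tendsto (fun a => h a 0) l (𝓝 (h₀ 0)))
    (hh : ∀ᶠ a in l, IsIntegralSolution g₀ g K τ (u a).1 (h a))
    (hh₀ : IsIntegralSolution g₀ g K τ u₀.1 h₀) {ε : ℝ} (hε : 0 < ε) :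
    ∀ᶠ a in l, ∀ t ∈ Icc (-τ) τ, ‖h a t - h₀ t‖ ≤ ε := by
  have : CompleteSpace E := FiniteDimensional.complete ℝ E
  have hR : ∀ u : Control U, ∀ᵐ t, ‖u.1 t‖ ≤ R := fun u => u.2.mono fun t ht => hUR _ ht
  have hm : ∀ u : Control U, AEStronglyMeasurable u.1 := fun u => u.1.aestronglyMeasurable
  have hB := hg.nonneg.1
  -- the perturbation term
  let e : Control U → ℝ → E := fun u t => ∫ s in (0:ℝ)..t, affineField g₀ g (u.1 s) (h₀ s)
  have hint : ∀ (u : Control U) {t : ℝ}, t ∈ Icc (-τ) τ →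
      IntervalIntegrable (fun s => affineField g₀ g (u.1 s) (h₀ s)) volume 0 t :=
    fun u t ht => hg.intervalIntegrable (hm u) (hR u) hh₀.continuousOn hh₀.mapsTo hτ ht
  -- Affinity in the control enters here: along the fixed curve `h₀` the right-hand side is affine
  -- in `u`, so its integral is weak* continuous.
  have hpt : ∀ t ∈ Icc (-τ) τ, Continuous fun u : Control U => e u t := by
    intro t ht
    have hq : ∀ q : E → E, ContinuousOn q K →
        IntegrableOn (fun s => q (h₀ s)) (uIoc 0 t) := fun q hq =>
      (((hq.comp hh₀.continuousOn hh₀.mapsTo).integrableOn_compact isCompact_Icc)).mono_set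
        (uIoc_zero_subset hτ ht)
    have hq' : ∀ i, ∀ u : Control U,
        IntervalIntegrable (fun s => u.1 s i • g i (h₀ s)) volume 0 t := fun i u => by
      rw [intervalIntegrable_iff]
      refine ((hq _ (hg.continuousOn i)).norm.const_mul R).mono
        (((EuclideanSpace.proj i : EuclideanSpace ℝ (Fin m) →L[ℝ] ℝ
        ).continuous.comp_aestronglyMeasurable (hm u)).restrict.smul
        (hq _ (hg.continuousOn i)).aestronglyMeasurable) (ae_restrict_of_ae ?_)
      filter_upwards [hR u] with s hs
      have hR0 : 0 ≤ R := (norm_nonneg _).trans hs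
      rw [norm_smul, norm_mul, norm_norm, Real.norm_of_nonneg hR0]
      gcongr
      exact (PiLp.norm_apply_le _ _).trans hs
    have h1 : ∀ u : Control U, e u t = (∫ s in (0:ℝ)..t, g₀ (h₀ s)) +
        ∑ i, ∫ s in (0:ℝ)..t, u.1 s i • g i (h₀ s) := fun u => by
      rw [← intervalIntegral.integral_finsetSum fun i _ => hq' i u,
        ← intervalIntegral.integral_add]
      · rfl
      · exact intervalIntegrable_iff.2 (hq _ hg.continuousOn₀)
      · have := IntervalIntegrable.sum Finset.univ fun i _ => hq' i u
        rwa [show (∑ i, fun s => u.1 s i • g i (h₀ s)) = fun s => ∑ i, u.1 s i • g i (h₀ s) from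
          funext fun s => Finset.sum_apply _ _ _] at this
    simp only [h1]
    refine continuous_const.add (continuous_finsetSum _ fun i _ => ?_)
    have h2 : ∀ u : Control U, ∫ s in (0:ℝ)..t, u.1 s i • g i (h₀ s) =
        (if 0 ≤ t then 1 else -1 : ℝ) •
          ∫ s, u.1 s i • (uIoc 0 t).indicator (fun s => g i (h₀ s)) s := fun u => by
      rw [intervalIntegral.intervalIntegral_eq_integral_uIoc, ← integral_indicator measurableSet_uIoc]
      congr 1
      refine integral_congr_ae (ae_of_all _ fun s => ?_)
      by_cases hs : s ∈ uIoc 0 t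
      · simp only [indicator_of_mem hs]
      · simp only [indicator_of_notMem hs, smul_zero]
    simp only [h2]
    exact (continuous_integral_control_smul hU i
      ((integrable_indicator_iff measurableSet_uIoc).2 (hq _ (hg.continuousOn i)))).const_smul _
  have hlipe : ∀ (u : Control U), ∀ t ∈ Icc (-τ) τ, ∀ s ∈ Icc (-τ) τ,
      ‖e u t - e u s‖ ≤ B * |t - s| := by
    intro u t ht s hs
    rw [intervalIntegral.integral_interval_sub_left (hint u ht) (hint u hs)]
    refine intervalIntegral.norm_integral_le_of_norm_le_const_ae ?_
    filter_upwards [hR u] with r hr hrt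
    exact hg.bound _ hr _ (hh₀.mapsTo (uIcc_subset_Icc hs ht (uIoc_subset_uIcc hrt)))
  -- Pointwise convergence in `t` is uniform because the functions `e u` share the Lipschitz
  -- constant `B`, so a finite net of times suffices.
  have hunif : ∀ᶠ a in l, ∀ t ∈ Icc (-τ) τ, ‖e (u a) t - e u₀ t‖ ≤ ε / 4 := by
    obtain ⟨T, hT, hTf, hTc⟩ := (isCompact_Icc (a := -τ) (b := τ)).finite_cover_balls
      (show (0:ℝ) < ε / (16 * (B + 1)) by positivity)
    have h1 : ∀ᶠ a in l, ∀ s ∈ T, ‖e (u a) s - e u₀ s‖ < ε / 8 := by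
      rw [eventually_all_finite hTf]
      intro s hs
      have h2 := ((hpt s (hT hs)).tendsto u₀).comp hu
      have h3 := Metric.tendsto_nhds.1 h2 (ε / 8) (by positivity)
      exact h3.mono fun a ha => by rw [dist_eq_norm] at ha; exact ha
    filter_upwards [h1] with a ha t ht
    obtain ⟨s, hs, hst⟩ := mem_iUnion₂.1 (hTc ht)
    rw [Metric.mem_ball, Real.dist_eq] at hst
    have h2 := hlipe (u a) t ht s (hT hs)
    have h3 := hlipe u₀ s (hT hs) t ht
    rw [abs_sub_comm] at h3
    have h4 : B * |t - s| ≤ ε / 16 := by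
      calc B * |t - s| ≤ (B + 1) * (ε / (16 * (B + 1))) := by gcongr; linarith
        _ = ε / 16 := by field_simp
    have h5 := ha s hs
    calc ‖e (u a) t - e u₀ t‖ = ‖(e (u a) t - e (u a) s) + (e (u a) s - e u₀ s) +
          (e u₀ s - e u₀ t)‖ := by congr 1; abel
      _ ≤ _ := norm_add₃_le
      _ ≤ ε / 4 := by linarith
  have hx' : ∀ᶠ a in l, ‖h a 0 - h₀ 0‖ ≤ ε / 4 := by
    have := Metric.tendsto_nhds.1 hx (ε / 4) (by positivity)
    simp only [dist_eq_norm] at this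
    exact this.mono fun a ha => ha.le
  filter_upwards [hunif, hx', hh] with a h1 h2 h3
  have h4 : ∀ t ∈ Icc (-τ) τ, ‖h a t - h₀ t‖ ≤ 2 * (ε / 2) := by
    refine le_two_mul_of_forall_bound hτ (h3.continuousOn.sub hh₀.continuousOn).norm ?_
    intro b hb t ht
    have hb0 : 0 ≤ b := (norm_nonneg _).trans (hb t ht)
    have h5 := hg.intervalIntegrable (hm (u a)) (hR _) h3.continuousOn h3.mapsTo hτ ht
    have h6 : h a t - h₀ t = (h a 0 - h₀ 0) + (e (u a) t - e u₀ t) + ∫ s in (0:ℝ)..t,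
        (affineField g₀ g ((u a).1 s) (h a s) - affineField g₀ g ((u a).1 s) (h₀ s)) := by
      rw [intervalIntegral.integral_sub h5 (hint _ ht), h3.eq t ht, hh₀.eq t ht]
      simp only [e]
      abel
    rw [h6]
    refine norm_add₃_le.trans ?_
    have h7 : ‖∫ s in (0:ℝ)..t, (affineField g₀ g ((u a).1 s) (h a s) -
        affineField g₀ g ((u a).1 s) (h₀ s))‖ ≤ b / 2 := by
      refine norm_intervalIntegral_le_half hτ hg.nonneg.2 hLτ hb0 ht ?_
      filter_upwards [hR (u a)] with s hs hst
      exact (hg.lip _ hs _ (h3.mapsTo hst) _ (hh₀.mapsTo hst)).trans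
        (mul_le_mul_of_nonneg_left (hb s hst) hg.nonneg.2)
    linarith [h1 t ht]
  intro t ht
  linarith [h4 t ht]

end LocalODE

end ControlAffine



/-! ### Differentiability of solutions in the initial value -/

namespace ControlAffine

section LocalDerivative

variable {m : ℕ} {E : Type*} [NormedAddCommGroup E] [NormedSpace ℝ E]

/-- On `K`, the control-affine right-hand side with controls of norm at most `R` is bounded by `B`
and differentiable, and its derivative is bounded by `L` and Lipschitz with constant `L`. -/
structure IsBoundedLipschitzDeriv (g₀ : E → E) (g : Fin m → E → E) (g₀' : E → E →L[ℝ] E)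
    (g' : Fin m → E → E →L[ℝ] E) (K : Set E) (R B L : ℝ) : Prop where
  nonneg : 0 ≤ B ∧ 0 ≤ L
  hasFDerivAt₀ : ∀ x ∈ K, HasFDerivAt g₀ (g₀' x) x
  hasFDerivAt : ∀ i, ∀ x ∈ K, HasFDerivAt (g i) (g' i x) x
  continuousOn₀ : ContinuousOn g₀' K
  continuousOn : ∀ i, ContinuousOn (g' i) K
  bound : ∀ w : EuclideanSpace ℝ (Fin m), ‖w‖ ≤ R → ∀ x ∈ K, ‖affineField g₀ g w x‖ ≤ B
  bound_deriv : ∀ w : EuclideanSpace ℝ (Fin m), ‖w‖ ≤ R → ∀ x ∈ K,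
    ‖g₀' x + ∑ i, w i • g' i x‖ ≤ L
  lip_deriv : ∀ w : EuclideanSpace ℝ (Fin m), ‖w‖ ≤ R → ∀ x ∈ K, ∀ y ∈ K,
    ‖(g₀' x + ∑ i, w i • g' i x) - (g₀' y + ∑ i, w i • g' i y)‖ ≤ L * ‖x - y‖

variable {g₀ : E → E} {g : Fin m → E → E} {g₀' : E → E →L[ℝ] E}
    {g' : Fin m → E → E →L[ℝ] E} {K : Set E} {R B L τ : ℝ}

theorem IsBoundedLipschitzDeriv.hasFDerivAt_affineField
    (hg : IsBoundedLipschitzDeriv g₀ g g₀' g' K R B L) (w : EuclideanSpace ℝ (Fin m)) {x : E}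
    (hx : x ∈ K) : HasFDerivAt (affineField g₀ g w) (g₀' x + ∑ i, w i • g' i x) x :=
  (hg.hasFDerivAt₀ x hx).add (HasFDerivAt.fun_sum fun i _ => (hg.hasFDerivAt i x hx).const_smul _)

theorem IsBoundedLipschitzDeriv.isBoundedLipschitz
    (hg : IsBoundedLipschitzDeriv g₀ g g₀' g' K R B L) (hK : Convex ℝ K) :
    IsBoundedLipschitz g₀ g K R B L where
  nonneg := hg.nonneg
  continuousOn₀ x hx := (hg.hasFDerivAt₀ x hx).continuousAt.continuousWithinAt
  continuousOn i x hx := (hg.hasFDerivAt i x hx).continuousAt.continuousWithinAt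
  bound := hg.bound
  lip w hw _ hx _ hy := hK.norm_image_sub_le_of_norm_hasFDerivWithin_le
    (fun _ hz => (hg.hasFDerivAt_affineField w hz).hasFDerivWithinAt)
    (fun z hz => hg.bound_deriv w hw z hz) hy hx

/-- On the segment from `x` to `y` the derivative stays within `L * ‖y - x‖` of its value at `x`;
the mean value inequality then makes the Taylor remainder quadratic. -/
theorem IsBoundedLipschitzDeriv.norm_sub_sub_le
    (hg : IsBoundedLipschitzDeriv g₀ g g₀' g' K R B L) (hK : Convex ℝ K)
    {w : EuclideanSpace ℝ (Fin m)} (hw : ‖w‖ ≤ R) {x y : E} (hx : x ∈ K) (hy : y ∈ K) :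
    ‖affineField g₀ g w y - affineField g₀ g w x - (g₀' x + ∑ i, w i • g' i x) (y - x)‖ ≤
      L * ‖y - x‖ ^ 2 := by
  have hseg : segment ℝ x y ⊆ K := hK.segment_subset hx hy
  have h := (convex_segment x y).norm_image_sub_le_of_norm_hasFDerivWithin_le'
    (f := affineField g₀ g w) (φ := g₀' x + ∑ i, w i • g' i x) (C := L * ‖y - x‖)
    (fun z hz => (hg.hasFDerivAt_affineField w (hseg hz)).hasFDerivWithinAt)
    (fun z hz => (hg.lip_deriv w hw z (hseg hz) x hx).trans
      (mul_le_mul_of_nonneg_left (norm_sub_le_of_mem_segment hz) hg.nonneg.2))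
    (left_mem_segment ℝ x y) (right_mem_segment ℝ x y)
  rwa [mul_assoc, ← sq] at h

/-- The drift of the system of first variation. -/
def variationField (f : E → E) (f' : E → E →L[ℝ] E) (p : E × (E →L[ℝ] E)) : E × (E →L[ℝ] E) :=
  (f p.1, (f' p.1).comp p.2)

theorem affineField_variationField (w : EuclideanSpace ℝ (Fin m)) (p : E × (E →L[ℝ] E)) :
    affineField (variationField g₀ g₀') (fun i => variationField (g i) (g' i)) w p =
      (affineField g₀ g w p.1, (g₀' p.1 + ∑ i, w i • g' i p.1).comp p.2) := by
  refine Prod.ext ?_ ?_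
  · simp [affineField, variationField, Prod.fst_sum]
  · ext v
    simp [affineField, variationField, Prod.snd_sum]

/-- The system of first variation is again control-affine, so the weak* continuity of solutions
applies to it and gives continuity of the derivative. The radius 2 is the a priori bound for the
derivative over short times; it produces the constant `3 * L` as `2 * L + L`. -/
theorem IsBoundedLipschitzDeriv.variation
    (hg : IsBoundedLipschitzDeriv g₀ g g₀' g' K R B L) (hK : Convex ℝ K) :
    IsBoundedLipschitz (variationField g₀ g₀') (fun i => variationField (g i) (g' i))
      (K ×ˢ Metric.closedBall (0 : E →L[ℝ] E) 2) R (B + 2 * L) (3 * L) where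
  nonneg := ⟨by linarith [hg.nonneg.1, hg.nonneg.2], by linarith [hg.nonneg.2]⟩
  continuousOn₀ := by
    have h1 := (hg.isBoundedLipschitz hK).continuousOn₀.comp
      (continuousOn_fst (s := K ×ˢ Metric.closedBall (0 : E →L[ℝ] E) 2)) fun p hp => hp.1
    have h2 := hg.continuousOn₀.comp
      (continuousOn_fst (s := K ×ˢ Metric.closedBall (0 : E →L[ℝ] E) 2)) fun p hp => hp.1
    exact h1.prodMk (h2.clm_comp continuousOn_snd)
  continuousOn i := by
    have h1 := ((hg.isBoundedLipschitz hK).continuousOn i).comp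
      (continuousOn_fst (s := K ×ˢ Metric.closedBall (0 : E →L[ℝ] E) 2)) fun p hp => hp.1
    have h2 := (hg.continuousOn i).comp
      (continuousOn_fst (s := K ×ˢ Metric.closedBall (0 : E →L[ℝ] E) 2)) fun p hp => hp.1
    exact h1.prodMk (h2.clm_comp continuousOn_snd)
  bound w hw p hp := by
    rw [affineField_variationField]
    have h1 := hg.bound w hw p.1 hp.1
    have h2 := hg.bound_deriv w hw p.1 hp.1
    have h3 : ‖p.2‖ ≤ 2 := mem_closedBall_zero_iff.1 hp.2
    have h4 := ContinuousLinearMap.opNorm_comp_le (g₀' p.1 + ∑ i, w i • g' i p.1) p.2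
    have h5 : ‖g₀' p.1 + ∑ i, w i • g' i p.1‖ * ‖p.2‖ ≤ L * 2 := by
      have := hg.nonneg.2
      gcongr
    rw [Prod.norm_def]
    refine max_le ?_ ?_ <;> simp only <;> linarith [hg.nonneg.1, hg.nonneg.2]
  lip w hw p hp q hq := by
    rw [affineField_variationField, affineField_variationField]
    have hL := hg.nonneg.2
    have h1 := (hg.isBoundedLipschitz hK).lip w hw p.1 hp.1 q.1 hq.1
    have h2 := hg.bound_deriv w hw q.1 hq.1
    have h3 : ‖p.2‖ ≤ 2 := mem_closedBall_zero_iff.1 hp.2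
    have h4 := hg.lip_deriv w hw p.1 hp.1 q.1 hq.1
    have h5 : ‖p.1 - q.1‖ ≤ ‖p - q‖ := norm_fst_le (p - q)
    have h6 : ‖p.2 - q.2‖ ≤ ‖p - q‖ := norm_snd_le (p - q)
    have hn := norm_nonneg (p - q)
    rw [Prod.norm_def]
    refine max_le ?_ ?_
    · refine h1.trans ?_
      nlinarith
    · have h7 : (g₀' p.1 + ∑ i, w i • g' i p.1).comp p.2 - (g₀' q.1 + ∑ i, w i • g' i q.1).comp q.2
          = ((g₀' p.1 + ∑ i, w i • g' i p.1) - (g₀' q.1 + ∑ i, w i • g' i q.1)).comp p.2 +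
            (g₀' q.1 + ∑ i, w i • g' i q.1).comp (p.2 - q.2) := by
        rw [ContinuousLinearMap.sub_comp, ContinuousLinearMap.comp_sub]; abel
      change ‖(g₀' p.1 + ∑ i, w i • g' i p.1).comp p.2 -
        (g₀' q.1 + ∑ i, w i • g' i q.1).comp q.2‖ ≤ _
      rw [h7]
      calc _ ≤ ‖(g₀' p.1 + ∑ i, w i • g' i p.1) - (g₀' q.1 + ∑ i, w i • g' i q.1)‖ * ‖p.2‖ +
            ‖g₀' q.1 + ∑ i, w i • g' i q.1‖ * ‖p.2 - q.2‖ :=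
          (norm_add_le _ _).trans (add_le_add (ContinuousLinearMap.opNorm_comp_le _ _)
            (ContinuousLinearMap.opNorm_comp_le _ _))
        _ ≤ (L * ‖p - q‖) * 2 + L * ‖p - q‖ := by
          gcongr
          exact h4.trans (by gcongr)
        _ = 3 * L * ‖p - q‖ := by ring

theorem IsBoundedLipschitzDeriv.aestronglyMeasurable_deriv
    (hg : IsBoundedLipschitzDeriv g₀ g g₀' g' K R B L) {u : ℝ → EuclideanSpace ℝ (Fin m)}
    {h : ℝ → E} (hu : AEStronglyMeasurable u) (hc : ContinuousOn h (Icc (-τ) τ))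
    (hK : MapsTo h (Icc (-τ) τ) K) :
    AEStronglyMeasurable (fun s => g₀' (h s) + ∑ i, u s i • g' i (h s))
      (volume.restrict (Icc (-τ) τ)) := by
  refine ((hg.continuousOn₀.comp hc hK).aestronglyMeasurable
    measurableSet_Icc).add (Finset.aestronglyMeasurable_fun_sum _ fun i _ => ?_)
  have h1 : AEStronglyMeasurable (fun s => u s i) (volume.restrict (Icc (-τ) τ)) :=
    ((EuclideanSpace.proj i : EuclideanSpace ℝ (Fin m) →L[ℝ] ℝ).continuous
      |>.comp_aestronglyMeasurable hu).restrict
  exact h1.smul (((hg.continuousOn i).comp hc hK).aestronglyMeasurable measurableSet_Icc)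

/-- Existence for linear equations on short time intervals. -/
theorem exists_linear_solution {F : Type*} [NormedRing F] [NormedAlgebra ℝ F] [CompleteSpace F]
    (hτ : 0 ≤ τ) (hL : 0 ≤ L) (hLτ : L * τ ≤ 1 / 2) {A : ℝ → F}
    (hA : AEStronglyMeasurable A (volume.restrict (Icc (-τ) τ)))
    (hAL : ∀ᵐ t, t ∈ Icc (-τ) τ → ‖A t‖ ≤ L) :
    ∃ V : ℝ → F, Continuous V ∧ ∀ t ∈ Icc (-τ) τ, V t = 1 + ∫ s in (0:ℝ)..t, A s * V s := by
  have hττ : -τ ≤ τ := by linarith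
  -- Extending `A` by zero and the unknown function by its boundary values makes the integral
  -- operator well defined on the whole line; `L * τ ≤ 1 / 2` makes it a contraction for the
  -- supremum norm.
  let A' : ℝ → F := (Icc (-τ) τ).indicator A
  have hA' : AEStronglyMeasurable A' volume :=
    (aestronglyMeasurable_indicator_iff measurableSet_Icc).2 hA
  have hA'L : ∀ᵐ t, ‖A' t‖ ≤ L := by
    filter_upwards [hAL] with t ht
    by_cases h : t ∈ Icc (-τ) τ
    · simpa [A', h] using ht h
    · simpa [A', h] using hL
  let ext : C(Icc (-τ) τ, F) → ℝ → F := fun V s => V (projIcc _ _ hττ s)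
  have hextc : ∀ V, Continuous (ext V) := fun V => V.continuous.comp continuous_projIcc
  have hint : ∀ V, ∀ a b, IntervalIntegrable (fun s => A' s * ext V s) volume a b := by
    intro V a b
    rw [intervalIntegrable_iff]
    have : IsFiniteMeasure (volume.restrict (uIoc a b)) := ⟨by simp [uIoc]⟩
    refine Integrable.of_bound (C := L * ‖V‖) (hA'.mul (hextc V).aestronglyMeasurable).restrict
      (ae_restrict_of_ae (hA'L.mono fun s hs => ?_))
    exact (norm_mul_le _ _).trans (mul_le_mul hs (V.norm_coe_le_norm _) (norm_nonneg _) hL)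
  let T : C(Icc (-τ) τ, F) → C(Icc (-τ) τ, F) := fun V =>
    ⟨fun t => 1 + ∫ s in (0:ℝ)..t, A' s * ext V s, by
      have := intervalIntegral.continuous_primitive (hint V) 0
      fun_prop⟩
  have hT : ContractingWith (1 / 2 : ℝ≥0) T := by
    refine ⟨by rw [← NNReal.coe_lt_coe]; norm_num, LipschitzWith.of_dist_le_mul fun V W => ?_⟩
    rw [ContinuousMap.dist_le (by positivity)]
    intro t
    have h1 : dist (T V t) (T W t) = ‖∫ s in (0:ℝ)..t, (A' s * (ext V s - ext W s))‖ := by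
      simp only [mul_sub]
      rw [intervalIntegral.integral_sub (hint V _ _) (hint W _ _), dist_eq_norm]
      simp [T]
    rw [h1]
    refine (norm_intervalIntegral_le_half hτ hL hLτ (dist_nonneg (x := V) (y := W)) t.2 ?_).trans ?_
    · filter_upwards [hA'L] with s hs _
      refine (norm_mul_le _ _).trans (mul_le_mul hs ?_ (norm_nonneg _) hL)
      rw [← dist_eq_norm]
      exact ContinuousMap.dist_apply_le_dist _
    · simp; linarith
  have hfix := hT.fixedPoint_isFixedPt
  set V := hT.fixedPoint
  refine ⟨ext V, hextc V, fun t ht => ?_⟩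
  have h1 : ext V t = T V ⟨t, ht⟩ := by
    rw [hfix]; simp [ext, projIcc_of_mem _ ht]
  rw [h1]
  change 1 + ∫ s in (0:ℝ)..t, A' s * ext V s = _
  congr 1
  refine intervalIntegral.integral_congr_ae (ae_of_all _ fun s hs => ?_)
  have hs' := uIoc_zero_subset hτ ht hs
  simp [A', hs']

variable [FiniteDimensional ℝ E]

/-- The equation of first variation along a solution. -/
theorem IsIntegralSolution.exists_variation
    (hg : IsBoundedLipschitzDeriv g₀ g g₀' g' K R B L) (hK : Convex ℝ K)
    {u : ℝ → EuclideanSpace ℝ (Fin m)} {h : ℝ → E}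
    (hu : AEStronglyMeasurable u) (huR : ∀ᵐ t, ‖u t‖ ≤ R) (hτ : 0 ≤ τ) (hLτ : L * τ ≤ 1 / 2)
    (hh : IsIntegralSolution g₀ g K τ u h) : ∃ V : ℝ → E →L[ℝ] E, V 0 = 1 ∧
      IsIntegralSolution (variationField g₀ g₀') (fun i => variationField (g i) (g' i))
      (K ×ˢ Metric.closedBall (0 : E →L[ℝ] E) 2) τ u (fun t => (h t, V t)) := by
  have : CompleteSpace E := FiniteDimensional.complete ℝ E
  have hL := hg.nonneg.2
  let A : ℝ → E →L[ℝ] E := fun s => g₀' (h s) + ∑ i, u s i • g' i (h s)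
  have hAm : AEStronglyMeasurable A (volume.restrict (Icc (-τ) τ)) := by
    exact hg.aestronglyMeasurable_deriv hu hh.continuousOn hh.mapsTo
  have hAL : ∀ᵐ t, t ∈ Icc (-τ) τ → ‖A t‖ ≤ L :=
    huR.mono fun t ht htτ => hg.bound_deriv _ ht _ (hh.mapsTo htτ)
  obtain ⟨V, hVc, hV⟩ := exists_linear_solution hτ hL hLτ hAm hAL
  have h0 : (0:ℝ) ∈ Icc (-τ) τ := ⟨by linarith, hτ⟩
  have hV0 : V 0 = 1 := by simpa using hV 0 h0
  -- The initial value is the identity, of norm at most one, and a short time at most doubles this.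
  -- That is the radius 2 of the ball in the variational system.
  have hV2 : ∀ t ∈ Icc (-τ) τ, ‖V t‖ ≤ 2 * 1 := by
    refine le_two_mul_of_forall_bound hτ hVc.norm.continuousOn fun b hb t ht => ?_
    rw [hV t ht]
    refine (norm_add_le _ _).trans (add_le_add ContinuousLinearMap.norm_id_le ?_)
    refine norm_intervalIntegral_le_half hτ hL hLτ ((norm_nonneg _).trans (hb t ht)) ht ?_
    filter_upwards [hAL] with s hs hst
    exact (norm_mul_le _ _).trans (mul_le_mul (hs hst) (hb s hst) (norm_nonneg _) hL)
  have hmaps : MapsTo (fun t => (h t, V t)) (Icc (-τ) τ)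
      (K ×ˢ Metric.closedBall (0 : E →L[ℝ] E) 2) := fun t ht =>
    ⟨hh.mapsTo ht, mem_closedBall_zero_iff.2 (by linarith [hV2 t ht])⟩
  refine ⟨V, hV0, hh.continuousOn.prodMk hVc.continuousOn, hmaps, fun t ht => ?_⟩
  have hi := (hg.variation hK).intervalIntegrable hu huR
    (hh.continuousOn.prodMk hVc.continuousOn) hmaps hτ ht
  simp only [affineField_variationField] at hi ⊢
  have h1 : IntervalIntegrable (fun s => affineField g₀ g (u s) (h s)) volume 0 t :=
    (hg.isBoundedLipschitz hK).intervalIntegrable hu huR hh.continuousOn hh.mapsTo hτ ht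
  have h2 : IntervalIntegrable (fun s => A s * V s) volume 0 t := by
    refine intervalIntegrable_of_bound (C := L * 2) hτ ht
      (hAm.mul hVc.aestronglyMeasurable.restrict) ?_
    filter_upwards [hAL] with s hs hst
    exact (norm_mul_le _ _).trans (mul_le_mul (hs hst) (by linarith [hV2 s hst])
      (norm_nonneg _) hL)
  have h3 : ∫ s in (0:ℝ)..t, (affineField g₀ g (u s) (h s), A s * V s) =
      (∫ s in (0:ℝ)..t, affineField g₀ g (u s) (h s), ∫ s in (0:ℝ)..t, A s * V s) := by
    simp only [intervalIntegral.intervalIntegral_eq_integral_uIoc]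
    rw [integral_pair (intervalIntegrable_iff.1 h1) (intervalIntegrable_iff.1 h2)]
    rfl
  refine Eq.trans ?_ (congrArg _ h3.symm)
  rw [hV0]
  exact Prod.ext (hh.eq t ht) (hV t ht)

/-- The solutions are differentiable with respect to the initial value, and the derivative depends
continuously on the initial value and on the control. -/
theorem exists_hasFDerivAt_solution {U : Set (EuclideanSpace ℝ (Fin m))} (hU : IsCompact U)
    (hUR : ∀ w ∈ U, ‖w‖ ≤ R)
    (hg : IsBoundedLipschitzDeriv g₀ g g₀' g' K R B L) (hK : Convex ℝ K)
    (hτ : 0 ≤ τ) (hLτ : 3 * L * τ ≤ 1 / 2)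
    {O : Set E} (hO : IsOpen O) {h : Control U → E → ℝ → E}
    (hh : ∀ u, ∀ x ∈ O, IsIntegralSolution g₀ g K τ u.1 (h u x)) (hh0 : ∀ u, ∀ x ∈ O, h u x 0 = x) :
    ∃ V : Control U → E → ℝ → E →L[ℝ] E, ∀ t ∈ Icc (-τ) τ, ∀ u, ∀ x ∈ O,
      HasFDerivAt (fun y => h u y t) (V u x t) x ∧
      ContinuousAt (fun p : Control U × E => h p.1 p.2 t) (u, x) ∧
      ContinuousAt (fun p : Control U × E => V p.1 p.2 t) (u, x) := by
  have hR : ∀ u : Control U, ∀ᵐ t, ‖u.1 t‖ ≤ R := fun u => u.2.mono fun t ht => hUR _ ht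
  have hm : ∀ u : Control U, AEStronglyMeasurable u.1 := fun u => u.1.aestronglyMeasurable
  have hL := hg.nonneg.2
  have hLτ' : L * τ ≤ 1 / 2 := by nlinarith
  have hbl := hg.isBoundedLipschitz hK
  have hex := fun u x (hx : x ∈ O) => (hh u x hx).exists_variation hg hK (hm u) (hR u) hτ hLτ'
  choose! V hV0 hV using hex
  refine ⟨V, fun t ht u x hx => ⟨?_, ?_⟩⟩
  · have hlip : ∀ y ∈ O, ∀ s ∈ Icc (-τ) τ, ‖h u y s - h u x s‖ ≤ 2 * ‖y - x‖ := fun y hy s hs => by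
      have := (hh u y hy).norm_sub_le hbl (hm u) (hR u) hτ hLτ' (hh u x hx) s hs
      rwa [hh0 u y hy, hh0 u x hx] at this
    -- The remainder `h y - h x - V (y - x)` satisfies the linearized equation with zero initial
    -- value and a forcing term quadratic in `y - x`, so over a short time it is itself quadratic.
    have hquad : ∀ y ∈ O, ‖h u y t - h u x t - V u x t (y - x)‖ ≤
        2 * ((L * τ) * (4 * ‖y - x‖ ^ 2)) := by
      intro y hy
      have hVc : ContinuousOn (V u x) (Icc (-τ) τ) :=
        continuous_snd.comp_continuousOn (hV u x hx).continuousOn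
      have hc := ((hh u y hy).continuousOn.sub (hh u x hx).continuousOn).sub
        (hVc.clm_apply continuousOn_const (g := fun _ => y - x))
      refine le_two_mul_of_forall_bound (f := fun s => ‖h u y s - h u x s - V u x s (y - x)‖)
        hτ hc.norm ?_ t ht
      intro b hb s hs
      have hb0 : 0 ≤ b := (norm_nonneg _).trans (hb s hs)
      have hi1 := hbl.intervalIntegrable (hm u) (hR u) (hh u y hy).continuousOn
        (hh u y hy).mapsTo hτ hs
      have hi2 := hbl.intervalIntegrable (hm u) (hR u) (hh u x hx).continuousOn
        (hh u x hx).mapsTo hτ hs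
      have hi3 := (hg.variation hK).intervalIntegrable (hm u) (hR u) (hV u x hx).continuousOn
        (hV u x hx).mapsTo hτ hs
      simp only [affineField_variationField] at hi3
      let A : ℝ → E →L[ℝ] E := fun s => g₀' (h u x s) + ∑ i, u.1 s i • g' i (h u x s)
      have hi4 : IntervalIntegrable (fun s => (A s).comp (V u x s)) volume 0 s := by
        rw [intervalIntegrable_iff] at hi3 ⊢
        exact (ContinuousLinearMap.snd ℝ E (E →L[ℝ] E)).integrable_comp hi3
      have hi5 : IntervalIntegrable (fun s => A s (V u x s (y - x))) volume 0 s := by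
        rw [intervalIntegrable_iff] at hi4 ⊢
        exact (ContinuousLinearMap.apply ℝ E (y - x)).integrable_comp hi4
      have hi6 : IntervalIntegrable (fun s => A s (h u y s - h u x s)) volume 0 s := by
        refine intervalIntegrable_of_bound (C := L * (2 * ‖y - x‖)) hτ hs ?_ ?_
        · exact isBoundedBilinearMap_apply.continuous.comp_aestronglyMeasurable
            ((hg.aestronglyMeasurable_deriv (hm u) (hh u x hx).continuousOn
              (hh u x hx).mapsTo).prodMk (((hh u y hy).continuousOn.sub
              (hh u x hx).continuousOn).aestronglyMeasurable measurableSet_Icc))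
        · filter_upwards [hR u] with r hr hrs
          exact (ContinuousLinearMap.le_opNorm _ _).trans (mul_le_mul
            (hg.bound_deriv _ hr _ ((hh u x hx).mapsTo hrs)) (hlip y hy r hrs) (norm_nonneg _) hL)
      have hVeq : V u x s (y - x) = (y - x) + ∫ r in (0:ℝ)..s, A r (V u x r (y - x)) := by
        have h1 := (hV u x hx).eq s hs
        simp only [affineField_variationField] at h1
        have h2 := congrArg (fun p : E × (E →L[ℝ] E) => p.2 (y - x)) h1
        have : CompleteSpace E := FiniteDimensional.complete ℝ E
        have h3 : (∫ r in (0:ℝ)..s, (affineField g₀ g (u.1 r) (h u x r),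
            (A r).comp (V u x r))).2 (y - x) = ∫ r in (0:ℝ)..s, A r (V u x r (y - x)) := by
          have h4 := ((ContinuousLinearMap.apply ℝ E (y - x)).comp
            (ContinuousLinearMap.snd ℝ E (E →L[ℝ] E))).intervalIntegral_comp_comm hi3
          exact h4.symm
        simp only [hV0 u x hx] at h2
        refine h2.trans ?_
        change (1 + (∫ r in (0:ℝ)..s, (affineField g₀ g (u.1 r) (h u x r),
            (A r).comp (V u x r))).2) (y - x) = _
        rw [add_apply, h3]
        rfl
      have hz : h u y s - h u x s - V u x s (y - x) =
          (∫ r in (0:ℝ)..s, (affineField g₀ g (u.1 r) (h u y r) -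
            affineField g₀ g (u.1 r) (h u x r) - A r (h u y r - h u x r))) +
          ∫ r in (0:ℝ)..s, A r (h u y r - h u x r - V u x r (y - x)) := by
        rw [← intervalIntegral.integral_add]
        · have : ∀ r, affineField g₀ g (u.1 r) (h u y r) -
            affineField g₀ g (u.1 r) (h u x r) - A r (h u y r - h u x r) +
            A r (h u y r - h u x r - V u x r (y - x)) = affineField g₀ g (u.1 r) (h u y r) -
            affineField g₀ g (u.1 r) (h u x r) - A r (V u x r (y - x)) := fun r => by
            rw [map_sub (A r) (h u y r - h u x r)]; abel
          simp only [this]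
          rw [intervalIntegral.integral_sub (hi1.sub hi2) hi5, intervalIntegral.integral_sub hi1 hi2,
            hVeq, (hh u y hy).eq s hs, (hh u x hx).eq s hs, hh0 u y hy, hh0 u x hx]
          abel
        · exact (hi1.sub hi2).sub hi6
        · have : ∀ r, A r (h u y r - h u x r - V u x r (y - x)) = A r (h u y r - h u x r) -
            A r (V u x r (y - x)) := fun r => map_sub _ _ _
          simp only [this]
          exact hi6.sub hi5
      rw [hz]
      refine (norm_add_le _ _).trans (add_le_add ?_ ?_)
      · have h1 : ‖∫ r in (0:ℝ)..s, (affineField g₀ g (u.1 r) (h u y r) -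
            affineField g₀ g (u.1 r) (h u x r) - A r (h u y r - h u x r))‖ ≤
            (L * (4 * ‖y - x‖ ^ 2)) * |s - 0| := by
          refine intervalIntegral.norm_integral_le_of_norm_le_const_ae ?_
          filter_upwards [hR u] with r hr hrs
          have hr' := uIoc_zero_subset hτ hs hrs
          refine (hg.norm_sub_sub_le hK hr ((hh u x hx).mapsTo hr') ((hh u y hy).mapsTo hr')).trans ?_
          have := hlip y hy r hr'
          refine mul_le_mul_of_nonneg_left ?_ hL
          calc ‖h u y r - h u x r‖ ^ 2 ≤ (2 * ‖y - x‖) ^ 2 := by gcongr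
            _ = _ := by ring
        refine h1.trans ?_
        have h2 : |s - 0| ≤ τ := by rw [sub_zero]; exact abs_le.2 hs
        calc (L * (4 * ‖y - x‖ ^ 2)) * |s - 0| ≤ (L * (4 * ‖y - x‖ ^ 2)) * τ := by gcongr
          _ = _ := by ring
      · refine norm_intervalIntegral_le_half hτ hL hLτ' hb0 hs ?_
        filter_upwards [hR u] with r hr hrs
        refine (ContinuousLinearMap.le_opNorm _ _).trans ?_
        exact mul_le_mul (hg.bound_deriv _ hr _ ((hh u x hx).mapsTo hrs)) (hb r hrs)
          (norm_nonneg _) hL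
    rw [hasFDerivAt_iff_isLittleO]
    refine Asymptotics.IsBigO.trans_isLittleO (g := fun y => ‖y - x‖ ^ 2) ?_ ?_
    · refine Asymptotics.IsBigO.of_bound (2 * ((L * τ) * 4)) ?_
      filter_upwards [hO.mem_nhds hx] with y hy
      refine (hquad y hy).trans_eq ?_
      rw [Real.norm_of_nonneg (by positivity)]
      ring
    · have := (Asymptotics.isLittleO_pow_id (one_lt_two)).comp_tendsto
        (tendsto_norm_sub_self x)
      refine (Asymptotics.isLittleO_norm_right.1 ?_)
      exact this
  · have hOn : ∀ᶠ p : Control U × E in 𝓝 (u, x), p.2 ∈ O :=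
      continuous_snd.continuousAt.eventually (hO.mem_nhds hx)
    -- The pair of solution and derivative solves the variational system, whose Lipschitz constant
    -- is `3 * L`; this is why `τ` is restricted by `3 * L * τ`.
    have key : ∀ ε > 0, ∀ᶠ p : Control U × E in 𝓝 (u, x),
        ‖((h p.1 p.2 t, V p.1 p.2 t) : E × (E →L[ℝ] E)) - (h u x t, V u x t)‖ ≤ ε := by
      intro ε hε
      have h1 := IsIntegralSolution.tendsto (l := 𝓝 (u, x)) (u := fun p : Control U × E => p.1)
        (h := fun p t => (h p.1 p.2 t, V p.1 p.2 t)) hU hUR (hg.variation hK) hτ hLτ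
        continuous_fst.continuousAt ?_ (hOn.mono fun p hp => hV p.1 p.2 hp) (hV u x hx) hε
      · exact h1.mono fun p hp => hp t ht
      · simp only [hh0 u x hx, hV0 u x hx]
        have h2 : Tendsto (fun p : Control U × E => (p.2, (1 : E →L[ℝ] E))) (𝓝 (u, x))
          (𝓝 (x, 1)) := continuous_snd.continuousAt.prodMk_nhds tendsto_const_nhds
        refine h2.congr' (hOn.mono fun p hp => ?_)
        simp only [hh0 p.1 p.2 hp, hV0 p.1 p.2 hp]
    have hcont : ContinuousAt (fun p : Control U × E =>
        ((h p.1 p.2 t, V p.1 p.2 t) : E × (E →L[ℝ] E))) (u, x) := by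
      rw [ContinuousAt, Metric.tendsto_nhds]
      intro ε hε
      filter_upwards [key (ε / 2) (by positivity)] with p hp
      rw [dist_eq_norm]
      exact hp.trans_lt (by linarith)
    exact ⟨continuous_fst.continuousAt.comp hcont, continuous_snd.continuousAt.comp hcont⟩

end LocalDerivative

end ControlAffine
-- The system read in charts: flow boxes
namespace ControlAffine

section ChartField

variable {d : ℕ} {M : Type*} [MetricSpace M]
  [ChartedSpace (EuclideanSpace ℝ (Fin d)) M] [IsManifold (𝓡 d) ∞ M]

/-- A vector field in the coordinates of the chart at `c`. -/
def chartField (c : M) (X : ∀ x : M, TangentSpace (𝓡 d) x) (w : EuclideanSpace ℝ (Fin d)) :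
    EuclideanSpace ℝ (Fin d) :=
  chartMap c ((extChartAt (𝓡 d) c).symm w) (X ((extChartAt (𝓡 d) c).symm w))

theorem contDiffOn_chartField (c : M) {X : ∀ x : M, TangentSpace (𝓡 d) x}
    (hX : ContMDiff (𝓡 d) (𝓡 d).tangent 2 (fun x => (⟨x, X x⟩ : TangentBundle (𝓡 d) M))) :
    ContDiffOn ℝ 2 (chartField c X) (extChartAt (𝓡 d) c).target := by
  have : IsManifold (𝓡 d) 2 M := IsManifold.of_le (n := ∞)
    (WithTop.coe_le_coe.2 (le_top : (2 : ℕ∞) ≤ ⊤))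
  have : IsManifold (𝓡 d) (2 + 1) M := IsManifold.of_le (n := ∞)
    (WithTop.coe_le_coe.2 (le_top : (2 + 1 : ℕ∞) ≤ ⊤))
  let e := trivializationAt (EuclideanSpace ℝ (Fin d)) (TangentSpace (𝓡 d) : M → Type _) c
  have h1 : ContMDiffOn (𝓡 d) 𝓘(ℝ, EuclideanSpace ℝ (Fin d)) 2 (fun x => (e ⟨x, X x⟩).2)
      (extChartAt (𝓡 d) c).source := by
    rw [extChartAt_source]
    exact (e.contMDiffOn_section_baseSet_iff).1 hX.contMDiffOn
  have h2 := h1.comp (contMDiffOn_extChartAt_symm (I := 𝓡 d) (n := 2) c)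
    (fun w hw => (extChartAt (𝓡 d) c).map_target hw)
  rw [← contMDiffOn_iff_contDiffOn]
  refine h2.congr fun w hw => ?_
  have hz := (extChartAt (𝓡 d) c).map_target hw
  rw [extChartAt_source] at hz
  exact e.continuousLinearMapAt_apply_of_mem ℝ hz _

end ChartField

section Bounds

variable {m : ℕ} {E : Type*} [NormedAddCommGroup E] [NormedSpace ℝ E] [FiniteDimensional ℝ E]

/-- Compactness of the closed ball bounds the `C²` fields up to second order, and the second
derivative controls the Lipschitz constant of the first. Affinity in `w` with `‖w‖ ≤ R` gives one
constant for all control values. -/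
theorem exists_isBoundedLipschitzDeriv {g₀ : E → E} {g : Fin m → E → E} {O : Set E} (hO : IsOpen O)
    (hg₀ : ContDiffOn ℝ 2 g₀ O) (hg : ∀ i, ContDiffOn ℝ 2 (g i) O) {c : E} {R : ℝ} (hR : 0 ≤ R)
    {r : ℝ} (hr : Metric.closedBall c r ⊆ O) :
    ∃ B L, IsBoundedLipschitzDeriv g₀ g (fderiv ℝ g₀) (fun i => fderiv ℝ (g i))
      (Metric.closedBall c r) R B L := by
  have key : ∀ f : E → E, ContDiffOn ℝ 2 f O → ∃ A, 0 ≤ A ∧ ∀ x ∈ Metric.closedBall c r,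
      HasFDerivAt f (fderiv ℝ f x) x ∧ ‖f x‖ ≤ A ∧ ‖fderiv ℝ f x‖ ≤ A ∧
      ContinuousWithinAt (fderiv ℝ f) (Metric.closedBall c r) x ∧
      ∀ y ∈ Metric.closedBall c r, ‖fderiv ℝ f x - fderiv ℝ f y‖ ≤ A * ‖x - y‖ := by
    intro f hf
    have hf' : ContDiffOn ℝ 1 (fderiv ℝ f) O := hf.fderiv_of_isOpen hO (by norm_num)
    have hf'' : ContinuousOn (fderiv ℝ (fderiv ℝ f)) O := hf'.continuousOn_fderiv_of_isOpen hO le_rfl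
    have hK : IsCompact (Metric.closedBall c r) := isCompact_closedBall c r
    obtain ⟨A₁, h₁⟩ := hK.exists_bound_of_continuousOn (hf.continuousOn.mono hr)
    obtain ⟨A₂, h₂⟩ := hK.exists_bound_of_continuousOn (hf'.continuousOn.mono hr)
    obtain ⟨A₃, h₃⟩ := hK.exists_bound_of_continuousOn (hf''.mono hr)
    refine ⟨max 0 (max A₁ (max A₂ A₃)), le_max_left _ _, fun x hx => ⟨?_, ?_, ?_, ?_, ?_⟩⟩
    · exact ((hf.differentiableOn (by norm_num)).differentiableAt (hO.mem_nhds (hr hx))).hasFDerivAt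
    · exact (h₁ x hx).trans (by simp)
    · exact (h₂ x hx).trans (by simp)
    · exact (hf'.continuousOn.mono hr) x hx
    · intro y hy
      refine (convex_closedBall c r).norm_image_sub_le_of_norm_hasFDerivWithin_le
        (f := fderiv ℝ f) (f' := fderiv ℝ (fderiv ℝ f)) (fun z hz => ?_) (fun z hz => ?_) hy hx
      · exact ((hf'.differentiableOn (by norm_num)).differentiableAt
          (hO.mem_nhds (hr hz))).hasFDerivAt.hasFDerivWithinAt
      · exact (h₃ z hz).trans (by simp)
  obtain ⟨A₀, hA₀, h₀⟩ := key g₀ hg₀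
  choose A hA h using fun i => key (g i) (hg i)
  have hw : ∀ w : EuclideanSpace ℝ (Fin m), ‖w‖ ≤ R → ∀ i, ‖w i‖ ≤ R := fun w hw i =>
    (PiLp.norm_apply_le w i).trans hw
  have hsum : ∀ {F : Type _} [NormedAddCommGroup F] [NormedSpace ℝ F]
      (w : EuclideanSpace ℝ (Fin m)), ‖w‖ ≤ R → ∀ (a : F) (b : Fin m → F) (D : ℝ), 0 ≤ D →
      ‖a‖ ≤ A₀ * D → (∀ i, ‖b i‖ ≤ A i * D) → ‖a + ∑ i, w i • b i‖ ≤ (A₀ + ∑ i, R * A i) * D := by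
    intro F _ _ w hwR a b D hD ha hb
    refine (norm_add_le _ _).trans ?_
    rw [add_mul, Finset.sum_mul]
    refine add_le_add ha ((norm_sum_le _ _).trans (Finset.sum_le_sum fun i _ => ?_))
    rw [norm_smul, mul_assoc]
    exact mul_le_mul (hw w hwR i) (hb i) (norm_nonneg _) hR
  have hBpos : 0 ≤ A₀ + ∑ i, R * A i := by
    have := Finset.sum_nonneg (fun i (_ : i ∈ Finset.univ) => mul_nonneg hR (hA i))
    positivity
  refine ⟨A₀ + ∑ i, R * A i, A₀ + ∑ i, R * A i, ⟨hBpos, hBpos⟩, fun x hx => (h₀ x hx).1,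
    fun i x hx => (h i x hx).1, fun x hx => (h₀ x hx).2.2.2.1, fun i x hx => (h i x hx).2.2.2.1,
    fun w hwR x hx => ?_, fun w hwR x hx => ?_, fun w hwR x hx y hy => ?_⟩
  · have := hsum w hwR (g₀ x) (fun i => g i x) 1 zero_le_one (by simpa using (h₀ x hx).2.1)
      (fun i => by simpa using (h i x hx).2.1)
    simpa [affineField] using this
  · have := hsum w hwR (fderiv ℝ g₀ x) (fun i => fderiv ℝ (g i) x) 1 zero_le_one
      (by simpa using (h₀ x hx).2.2.1) (fun i => by simpa using (h i x hx).2.2.1)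
    simpa using this
  · have := hsum w hwR (fderiv ℝ g₀ x - fderiv ℝ g₀ y) (fun i => fderiv ℝ (g i) x - fderiv ℝ (g i) y)
      ‖x - y‖ (norm_nonneg _) ((h₀ x hx).2.2.2.2 y hy) (fun i => (h i x hx).2.2.2.2 y hy)
    refine le_of_eq_of_le (congrArg _ ?_) this
    simp only [smul_sub, Finset.sum_sub_distrib]
    abel

end Bounds

section FlowBox

variable {d m : ℕ} {M : Type*} [MetricSpace M] [ChartedSpace (EuclideanSpace ℝ (Fin d)) M]
  [IsManifold (𝓡 d) ∞ M]

/-- On the closed ball of radius `r` around the image of `c`, the system read in the chart at `c`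
satisfies uniform bounds, and the chart is Lipschitz on the preimage of this ball. -/
structure IsFlowBox (S : System d m M) (c : M) (R r B L : ℝ) (C : ℝ≥0) : Prop where
  pos : 0 < r
  subset_target : Metric.closedBall (extChartAt (𝓡 d) c c) r ⊆ (extChartAt (𝓡 d) c).target
  lipschitz : LipschitzOnWith C (extChartAt (𝓡 d) c)
    ((extChartAt (𝓡 d) c).symm '' Metric.closedBall (extChartAt (𝓡 d) c c) r)
  norm_le : ∀ w ∈ S.U, ‖w‖ ≤ R
  deriv : IsBoundedLipschitzDeriv (chartField c S.f₀) (fun i => chartField c (S.f i))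
    (fderiv ℝ (chartField c S.f₀)) (fun i => fderiv ℝ (chartField c (S.f i)))
    (Metric.closedBall (extChartAt (𝓡 d) c c) r) R B L

theorem exists_isFlowBox [RiemannianBundle (fun x : M => TangentSpace (𝓡 d) x)]
    [IsContMDiffRiemannianBundle (𝓡 d) ∞ (EuclideanSpace ℝ (Fin d))
      (fun x : M => TangentSpace (𝓡 d) x)] [IsRiemannianManifold (𝓡 d) M]
    (S : System d m M) (c : M) : ∃ R r B L C, IsFlowBox S c R r B L C := by
  obtain ⟨R, hR, hUR⟩ : ∃ R : ℝ, 0 ≤ R ∧ ∀ w ∈ S.U, ‖w‖ ≤ R := by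
    obtain ⟨R, hR⟩ := S.isCompact_U.isBounded.exists_norm_le
    exact ⟨max 0 R, le_max_left _ _, fun w hw => (hR w hw).trans (le_max_right _ _)⟩
  obtain ⟨C, W, hW, hWs, hC⟩ := exists_extChartAt_bilipschitz (d := d) c
  have h1 : ∀ᶠ w in 𝓝 (extChartAt (𝓡 d) c c), w ∈ (extChartAt (𝓡 d) c).target ∧
      (extChartAt (𝓡 d) c).symm w ∈ W := by
    refine Filter.Eventually.and (extChartAt_target_mem_nhds (I := 𝓡 d) c) ?_
    have h := continuousAt_extChartAt_symm (I := 𝓡 d) c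
    rw [ContinuousAt, extChartAt_to_inv] at h
    exact h.eventually hW
  obtain ⟨r, hr, hrs⟩ := Metric.nhds_basis_closedBall.mem_iff.1 h1
  have hrt : Metric.closedBall (extChartAt (𝓡 d) c c) r ⊆ (extChartAt (𝓡 d) c).target :=
    fun w hw => (hrs hw).1
  obtain ⟨B, L, hBL⟩ := exists_isBoundedLipschitzDeriv (isOpen_extChartAt_target c)
    (contDiffOn_chartField c S.contMDiff_f₀) (fun i => contDiffOn_chartField c (S.contMDiff_f i))
    hR hrt
  refine ⟨R, r, B, L, C, hr, hrt, LipschitzOnWith.of_dist_le_mul ?_, hUR, hBL⟩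
  rintro _ ⟨w, hw, rfl⟩ _ ⟨w', hw', rfl⟩
  exact (hC _ (hrs hw).2 _ (hrs hw').2).1

theorem _root_.AbsolutelyContinuousOnInterval.lipschitzOnWith_comp {X Y : Type*}
    [PseudoMetricSpace X] [PseudoMetricSpace Y] {γ : ℝ → X} {a b : ℝ} {f : X → Y} {C : ℝ≥0}
    {s : Set X} (hf : LipschitzOnWith C f s) (hγ : AbsolutelyContinuousOnInterval γ a b)
    (h : MapsTo γ (uIcc a b) s) : AbsolutelyContinuousOnInterval (f ∘ γ) a b := by
  rw [absolutelyContinuousOnInterval_iff] at hγ ⊢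
  intro ε hε
  -- Dividing by `C + 1` rather than `C` covers the case `C = 0`.
  obtain ⟨η, hη, H⟩ := hγ (ε / (C + 1)) (by positivity)
  refine ⟨η, hη, fun E hE hEη => ?_⟩
  have h1 := H E hE hEη
  calc ∑ i ∈ Finset.range E.1, dist ((f ∘ γ) (E.2 i).1) ((f ∘ γ) (E.2 i).2)
      ≤ ∑ i ∈ Finset.range E.1, (C + 1) * dist (γ (E.2 i).1) (γ (E.2 i).2) := by
        refine Finset.sum_le_sum fun i hi => ?_
        refine (hf.dist_le_mul _ (h (hE.1 i hi).1) _ (h (hE.1 i hi).2)).trans ?_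
        gcongr
        simp
    _ = (C + 1) * ∑ i ∈ Finset.range E.1, dist (γ (E.2 i).1) (γ (E.2 i).2) := by
        rw [Finset.mul_sum]
    _ < (C + 1) * (ε / (C + 1)) := by gcongr
    _ = ε := by field_simp

/-- An absolutely continuous function is the integral of a bounded a.e. derivative. -/
theorem _root_.AbsolutelyContinuousOnInterval.sub_eq_integral {F : Type*} [NormedAddCommGroup F]
    [NormedSpace ℝ F] [CompleteSpace F] {f f' : ℝ → F} {a b B : ℝ}
    (hf : AbsolutelyContinuousOnInterval f a b) (hi : IntervalIntegrable f' volume a b)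
    (hB : ∀ᵐ t, t ∈ uIcc a b → ‖f' t‖ ≤ B) (h : ∀ᵐ t, t ∈ uIcc a b → HasDerivAt f (f' t) t) :
    f b - f a = ∫ t in a..b, f' t := by
  have hsub : ∀ x ∈ uIcc a b, ∀ y ∈ uIcc a b, IntervalIntegrable f' volume x y := fun x hx y hy =>
    hi.mono_set (uIcc_subset_uIcc hx hy)
  have h1 : LipschitzOnWith (Real.toNNReal B) (fun t => ∫ s in a..t, f' s) (uIcc a b) := by
    refine LipschitzOnWith.of_dist_le_mul fun x hx y hy => ?_
    rw [dist_eq_norm, intervalIntegral.integral_interval_sub_left (hsub _ left_mem_uIcc _ hx)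
      (hsub _ left_mem_uIcc _ hy), Real.dist_eq]
    refine intervalIntegral.norm_integral_le_of_norm_le_const_ae ?_
    filter_upwards [hB] with t ht hty
    exact (ht (uIcc_subset_uIcc hy hx (uIoc_subset_uIcc hty))).trans (Real.le_coe_toNNReal B)
  -- The difference of `f` and the primitive of `f'` is absolutely continuous with derivative zero
  -- almost everywhere, hence constant.
  obtain ⟨K, hK⟩ := (hf.fun_sub
    h1.absolutelyContinuousOnInterval).const_of_ae_hasDerivAt_zero (by
      filter_upwards [h, hi.ae_hasDerivAt_integral] with t h2 h3 ht
      simpa using (h2 ht).fun_sub (h3 ht a (by simp)))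
  have h2 := hK a (by simp)
  have h3 := hK b (by simp)
  simp only [intervalIntegral.integral_same, sub_zero] at h2
  rw [← h2] at h3
  exact sub_eq_iff_eq_add.2 (sub_eq_iff_eq_add'.1 h3)

end FlowBox
end ControlAffine
-- Trajectories inside a flow box
namespace ControlAffine

variable {d m : ℕ} {M : Type*} [MetricSpace M] [ChartedSpace (EuclideanSpace ℝ (Fin d)) M]
  [IsManifold (𝓡 d) ∞ M]

variable (d) in
/-- The preimage of a closed ball under the chart at `c`. -/
def chartBox (c : M) (r : ℝ) : Set M :=
  (extChartAt (𝓡 d) c).symm '' Metric.closedBall (extChartAt (𝓡 d) c c) r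

section Box

variable {c : M} {r : ℝ}

theorem mem_chartBox (hr : Metric.closedBall (extChartAt (𝓡 d) c c) r ⊆ (extChartAt (𝓡 d) c).target)
    {z : M} : z ∈ chartBox d c r ↔ z ∈ (extChartAt (𝓡 d) c).source ∧
      extChartAt (𝓡 d) c z ∈ Metric.closedBall (extChartAt (𝓡 d) c c) r := by
  constructor
  · rintro ⟨w, hw, rfl⟩
    refine ⟨(extChartAt (𝓡 d) c).map_target (hr hw), ?_⟩
    rwa [(extChartAt (𝓡 d) c).right_inv (hr hw)]
  · rintro ⟨hz, hz'⟩
    exact ⟨_, hz', (extChartAt (𝓡 d) c).left_inv hz⟩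

theorem isCompact_chartBox
    (hr : Metric.closedBall (extChartAt (𝓡 d) c c) r ⊆ (extChartAt (𝓡 d) c).target) :
    IsCompact (chartBox d c r) :=
  (isCompact_closedBall _ _).image_of_continuousOn ((continuousOn_extChartAt_symm c).mono hr)

theorem chartBox_mem_nhds
    (hr : Metric.closedBall (extChartAt (𝓡 d) c c) r ⊆ (extChartAt (𝓡 d) c).target) {z : M}
    (hz : z ∈ (extChartAt (𝓡 d) c).source)
    (hz' : extChartAt (𝓡 d) c z ∈ Metric.ball (extChartAt (𝓡 d) c c) r) : chartBox d c r ∈ 𝓝 z := by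
  have h1 := (continuousAt_extChartAt' (I := 𝓡 d) hz).preimage_mem_nhds
    (Metric.isOpen_ball.mem_nhds hz')
  filter_upwards [h1, extChartAt_source_mem_nhds' (I := 𝓡 d) hz] with y hy hy'
  exact (mem_chartBox hr).2 ⟨hy', Metric.ball_subset_closedBall hy⟩

/-- A continuation argument: the times at which the curve is in the box and has moved by at most `B
* t` form a closed set. By `hρ` the curve is then in the interior of the box, so it stays in the box
a little longer, where the speed bound `h` is available again. -/
theorem forall_mem_chartBox {B τ : ℝ} {α : ℝ → M} (hα : Continuous α)
    (hr : Metric.closedBall (extChartAt (𝓡 d) c c) r ⊆ (extChartAt (𝓡 d) c).target)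
    (hB : 0 ≤ B) (h : ∀ a b, a ≤ b → (∀ t ∈ Icc a b, α t ∈ chartBox d c r) →
      ‖extChartAt (𝓡 d) c (α b) - extChartAt (𝓡 d) c (α a)‖ ≤ B * (b - a))
    (h0 : α 0 ∈ (extChartAt (𝓡 d) c).source)
    (hρ : dist (extChartAt (𝓡 d) c (α 0)) (extChartAt (𝓡 d) c c) + B * τ < r) :
    ∀ t ∈ Icc 0 τ, α t ∈ chartBox d c r := by
  by_cases hτ : 0 ≤ τ
  swap
  · exact fun t ht => absurd (ht.1.trans ht.2) hτ
  have hs : IsClosed {t ∈ α ⁻¹' chartBox d c r |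
      ‖extChartAt (𝓡 d) c (α t) - extChartAt (𝓡 d) c (α 0)‖ ≤ B * t} := by
    refine IsClosed.isClosed_le ((isCompact_chartBox hr).isClosed.preimage hα) ?_ (by fun_prop)
    refine (ContinuousOn.sub ?_ continuousOn_const).norm
    exact (continuousOn_extChartAt c).comp hα.continuousOn fun t ht => ((mem_chartBox hr).1 ht).1
  have hBτ : 0 ≤ B * τ := by positivity
  have h1 := (hs.inter isClosed_Icc).Icc_subset_of_forall_exists_gt (a := 0) (b := τ) ?_ ?_
  · exact fun t ht => (h1 ht).1
  · refine ⟨(mem_chartBox hr).2 ⟨h0, ?_⟩, by simp⟩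
    rw [Metric.mem_closedBall]
    linarith
  · rintro t ⟨⟨ht, ht'⟩, ht0, htτ⟩ y hy
    have h2 : extChartAt (𝓡 d) c (α t) ∈ Metric.ball (extChartAt (𝓡 d) c c) r := by
      rw [Metric.mem_ball]
      have h3 := dist_triangle (extChartAt (𝓡 d) c (α t)) (extChartAt (𝓡 d) c (α 0))
        (extChartAt (𝓡 d) c c)
      rw [dist_eq_norm (extChartAt (𝓡 d) c (α t)) (extChartAt (𝓡 d) c (α 0))] at h3
      have h4 : B * t ≤ B * τ := by gcongr
      linarith
    have h3 := hα.continuousAt.preimage_mem_nhds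
      (chartBox_mem_nhds hr ((mem_chartBox hr).1 ht).1 h2)
    obtain ⟨ε, hε, hεs⟩ := Metric.nhds_basis_closedBall.mem_iff.1 h3
    have hy : t < y := hy
    have hmin : t < min y (t + ε) := lt_min hy (by linarith)
    have hin : ∀ s ∈ Icc t (min y (t + ε)), α s ∈ chartBox d c r := fun s hs => hεs (by
      rw [Metric.mem_closedBall, Real.dist_eq, abs_of_nonneg (by linarith [hs.1])]
      linarith [hs.2, min_le_right y (t + ε)])
    refine ⟨min y (t + ε), ⟨hin _ ⟨hmin.le, le_rfl⟩, ?_⟩, hmin, min_le_left _ _⟩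
    have h5 := h t _ hmin.le hin
    calc _ ≤ ‖extChartAt (𝓡 d) c (α (min y (t + ε))) - extChartAt (𝓡 d) c (α t)‖ +
          ‖extChartAt (𝓡 d) c (α t) - extChartAt (𝓡 d) c (α 0)‖ := norm_sub_le_norm_sub_add_norm_sub _ _ _
      _ ≤ B * (min y (t + ε) - t) + B * t := add_le_add h5 ht'
      _ = _ := by ring

end Box

variable {S : System d m M} {u : Control S.U} {γ γ' : ℝ → M}

theorem System.IsTrajectory.continuous (hγ : S.IsTrajectory u γ) : Continuous γ := by
  rw [continuous_iff_continuousAt]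
  intro t
  rw [Metric.continuousAt_iff]
  intro ε hε
  obtain ⟨η, hη, H⟩ := (absolutelyContinuousOnInterval_iff _ _ _).1 (hγ.1 (t - 1) (t + 1)) ε hε
  refine ⟨min η 1, by positivity, fun y hy => ?_⟩
  have hy1 := abs_le.1 (hy.le.trans (min_le_right _ _))
  have h1 := H (1, fun _ => (y, t)) ⟨fun i _ => ?_, ?_⟩
    (by simpa using hy.trans_le (min_le_left _ _))
  · simpa using h1
  · rw [uIcc_of_le (by linarith)]
    exact ⟨⟨by linarith, by linarith⟩, ⟨by linarith, by linarith⟩⟩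
  · simp

theorem _root_.AbsolutelyContinuousOnInterval.comp_add_right {X : Type*} [PseudoMetricSpace X]
    {f : ℝ → X} {a b s : ℝ} (hf : AbsolutelyContinuousOnInterval f (a + s) (b + s)) :
    AbsolutelyContinuousOnInterval (fun t => f (t + s)) a b := by
  rw [absolutelyContinuousOnInterval_iff] at hf ⊢
  intro ε hε
  obtain ⟨η, hη, H⟩ := hf ε hε
  refine ⟨η, hη, fun E hE hEη => ?_⟩
  refine H (E.1, fun i => ((E.2 i).1 + s, (E.2 i).2 + s)) ⟨fun i hi => ?_, ?_⟩ (by simpa using hEη)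
  · have h1 := hE.1 i hi
    simp only [mem_uIcc] at h1 ⊢
    grind
  · intro i hi j hj hij
    have h1 := Set.disjoint_left.1 (hE.2 hi hj hij)
    refine Set.disjoint_left.2 fun x hx hx' => h1 (a := x - s) ?_ ?_ <;>
    · simp only [mem_uIoc] at *
      grind

theorem System.IsTrajectory.shift (hγ : S.IsTrajectory u γ) (s : ℝ) :
    S.IsTrajectory (shift s u) (fun t => γ (t + s)) := by
  refine ⟨fun a b => (hγ.1 (a + s) (b + s)).comp_add_right, ?_⟩
  filter_upwards [shift_ae s u, (measurePreserving_add_right (volume : Measure ℝ) s).quasiMeasurePreserving.ae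
      hγ.2] with t h1 h2
  rw [h1]
  have h3 : HasMFDerivAt 𝓘(ℝ, ℝ) 𝓘(ℝ, ℝ) (fun t : ℝ => t + s) t (ContinuousLinearMap.id ℝ ℝ) :=
    ((hasFDerivAt_id (𝕜 := ℝ) t).add_const s).hasMFDerivAt
  exact h2.comp t h3

variable {c : M} {R r B L τ : ℝ} {C : ℝ≥0}

theorem IsFlowBox.ae_norm_le (hB : IsFlowBox S c R r B L C) (u : Control S.U) :
    ∀ᵐ t, ‖u.1 t‖ ≤ R := u.2.mono fun _ ht => hB.norm_le _ ht

theorem IsFlowBox.sub_eq_integral (hB : IsFlowBox S c R r B L C) (hγ : S.IsTrajectory u γ) {a b : ℝ}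
    (h : ∀ t ∈ uIcc a b, γ t ∈ chartBox d c r) :
    extChartAt (𝓡 d) c (γ b) - extChartAt (𝓡 d) c (γ a) =
      ∫ t in a..b, affineField (chartField c S.f₀) (fun i => chartField c (S.f i)) (u.1 t)
        (extChartAt (𝓡 d) c (γ t)) := by
  have hbl := hB.deriv.isBoundedLipschitz (convex_closedBall _ _)
  have hm : MapsTo (fun t => extChartAt (𝓡 d) c (γ t)) (uIcc a b)
      (Metric.closedBall (extChartAt (𝓡 d) c c) r) :=
    fun t ht => ((mem_chartBox hB.subset_target).1 (h t ht)).2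
  have hsrc : ∀ t ∈ uIcc a b, γ t ∈ (extChartAt (𝓡 d) c).source :=
    fun t ht => ((mem_chartBox hB.subset_target).1 (h t ht)).1
  have hcont : ContinuousOn (fun t => extChartAt (𝓡 d) c (γ t)) (uIcc a b) :=
    (continuousOn_extChartAt c).comp hγ.continuous.continuousOn hsrc
  have hbd : ∀ᵐ t, t ∈ uIcc a b → ‖affineField (chartField c S.f₀) (fun i => chartField c (S.f i))
      (u.1 t) (extChartAt (𝓡 d) c (γ t))‖ ≤ B := by
    filter_upwards [hB.ae_norm_le u] with t ht hab
    exact hbl.bound _ ht _ (hm hab)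
  refine AbsolutelyContinuousOnInterval.sub_eq_integral (f := fun t => extChartAt (𝓡 d) c (γ t))
    ((hγ.1 a b).lipschitzOnWith_comp hB.lipschitz h) ?_ hbd ?_
  · rw [intervalIntegrable_iff]
    have : IsFiniteMeasure (volume.restrict (uIcc a b)) :=
      ⟨by simp⟩
    have h1 : IntegrableOn (fun t => affineField (chartField c S.f₀) (fun i => chartField c (S.f i))
      (u.1 t) (extChartAt (𝓡 d) c (γ t))) (uIcc a b) :=
      Integrable.of_bound (hbl.aestronglyMeasurable u.1.aestronglyMeasurable hcont hm) B
        ((ae_restrict_iff' measurableSet_uIcc).2 hbd)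
    exact h1.mono_set uIoc_subset_uIcc
  · filter_upwards [hγ.2] with t ht hab
    have h1 := (hasMFDerivAt_extChartAt (hsrc t hab)).comp t ht
    have h2 : HasFDerivAt (fun t => extChartAt (𝓡 d) c (γ t)) ((chartMap c (γ t)).comp
        ((1 : ℝ →L[ℝ] ℝ).smulRight (S.vectorField (u.1 t) (γ t))) :
        ℝ →L[ℝ] EuclideanSpace ℝ (Fin d)) t := h1.hasFDerivAt
    have h3 : ((chartMap c (γ t)).comp ((1 : ℝ →L[ℝ] ℝ).smulRight (S.vectorField (u.1 t) (γ t))) :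
        ℝ →L[ℝ] EuclideanSpace ℝ (Fin d)) 1 =
        affineField (chartField c S.f₀) (fun i => chartField c (S.f i)) (u.1 t)
          (extChartAt (𝓡 d) c (γ t)) := by
      refine (congrArg (chartMap c (γ t)) (one_smul ℝ (S.vectorField (u.1 t) (γ t)))).trans ?_
      simp only [affineField, chartField, System.vectorField, map_add, map_sum, map_smul]
      rw [(extChartAt (𝓡 d) c).left_inv (hsrc t hab)]
    have h4 := h2.hasDerivAt
    rwa [h3] at h4

theorem IsFlowBox.norm_sub_le (hB : IsFlowBox S c R r B L C) (hγ : S.IsTrajectory u γ) {a b : ℝ}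
    (h : ∀ t ∈ uIcc a b, γ t ∈ chartBox d c r) :
    ‖extChartAt (𝓡 d) c (γ b) - extChartAt (𝓡 d) c (γ a)‖ ≤ B * |b - a| := by
  rw [hB.sub_eq_integral hγ h]
  refine intervalIntegral.norm_integral_le_of_norm_le_const_ae ?_
  filter_upwards [hB.ae_norm_le u] with t ht hab
  exact hB.deriv.bound _ ht _ ((mem_chartBox hB.subset_target).1 (h t (uIoc_subset_uIcc hab))).2

theorem IsFlowBox.mem_chartBox (hB : IsFlowBox S c R r B L C) (hγ : S.IsTrajectory u γ)
    (h0 : γ 0 ∈ (extChartAt (𝓡 d) c).source)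
    (hρ : dist (extChartAt (𝓡 d) c (γ 0)) (extChartAt (𝓡 d) c c) + B * τ < r) :
    ∀ t ∈ Icc (-τ) τ, γ t ∈ chartBox d c r := by
  intro t ht
  rcases le_total 0 t with h | h
  · refine forall_mem_chartBox hγ.continuous hB.subset_target hB.deriv.nonneg.1
      (fun a b hab hm => ?_) h0 hρ t ⟨h, ht.2⟩
    have h1 := hB.norm_sub_le hγ (a := a) (b := b) (by rwa [uIcc_of_le hab])
    rwa [abs_of_nonneg (by linarith)] at h1
  -- Negative times reduce to positive ones by reversing the curve.
  · have h2 := forall_mem_chartBox (α := fun t => γ (-t)) (τ := τ) (hγ.continuous.comp continuous_neg)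
      hB.subset_target hB.deriv.nonneg.1
      (fun a b hab hm => ?_) (by simpa using h0) (by simpa using hρ) (-t) ⟨by linarith, by linarith [ht.1]⟩
    · simpa using h2
    have h1 := hB.norm_sub_le hγ (a := -a) (b := -b) (fun t ht => ?_)
    · rw [abs_of_nonpos (by linarith)] at h1
      exact h1.trans_eq (by ring)
    · rw [uIcc_of_ge (by linarith)] at ht
      simpa using hm (-t) ⟨by linarith [ht.2], by linarith [ht.1]⟩

theorem IsFlowBox.isIntegralSolution (hB : IsFlowBox S c R r B L C) (hγ : S.IsTrajectory u γ)
    (h0 : γ 0 ∈ (extChartAt (𝓡 d) c).source) (hτ : 0 ≤ τ)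
    (hρ : dist (extChartAt (𝓡 d) c (γ 0)) (extChartAt (𝓡 d) c c) + B * τ < r) :
    IsIntegralSolution (chartField c S.f₀) (fun i => chartField c (S.f i))
      (Metric.closedBall (extChartAt (𝓡 d) c c) r) τ u.1 (fun t => extChartAt (𝓡 d) c (γ t)) where
  continuousOn := (continuousOn_extChartAt c).comp hγ.continuous.continuousOn
    fun t ht => ((ControlAffine.mem_chartBox hB.subset_target).1 (hB.mem_chartBox hγ h0 hρ t ht)).1
  mapsTo t ht := ((ControlAffine.mem_chartBox hB.subset_target).1 (hB.mem_chartBox hγ h0 hρ t ht)).2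
  eq t ht := by
    rw [← hB.sub_eq_integral hγ, add_sub_cancel]
    exact fun s hs => hB.mem_chartBox hγ h0 hρ s (uIcc_subset_Icc ⟨by linarith, hτ⟩ ht hs)

/-- The bound `r / 2` keeps trajectories that start in the ball of half the radius inside the box up
to time `τ`; the bound with `3 * L` is the short-time condition of the variational system. -/
theorem IsFlowBox.exists_time (hB : IsFlowBox S c R r B L C) : ∃ τ, 0 < τ ∧ B * τ < r / 2 ∧
    3 * L * τ ≤ 1 / 2 := by
  have h1 := hB.pos
  have h2 := hB.deriv.nonneg
  have h3 : 0 < min (r / (2 * (B + 1))) (1 / (6 * (L + 1))) := by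
    refine lt_min ?_ ?_ <;> apply div_pos <;> linarith
  refine ⟨_, h3, ?_, ?_⟩
  · calc _ < (B + 1) * min (r / (2 * (B + 1))) (1 / (6 * (L + 1))) := by gcongr; linarith
      _ ≤ (B + 1) * (r / (2 * (B + 1))) := by gcongr; linarith; exact min_le_left _ _
      _ = r / 2 := by have : B + 1 ≠ 0 := by linarith
                      field_simp
  · calc _ ≤ 3 * L * (1 / (6 * (L + 1))) := by
          have := h2.2
          gcongr
          exact min_le_right _ _
      _ ≤ _ := by
        rw [mul_one_div, div_le_div_iff₀ (by linarith) (by norm_num)]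
        linarith

end ControlAffine
-- The global flow: uniqueness, cocycle property, continuity
namespace ControlAffine

variable {d m : ℕ} {M : Type*} [MetricSpace M] [ChartedSpace (EuclideanSpace ℝ (Fin d)) M]
  [IsManifold (𝓡 d) ∞ M]

namespace System

variable {S : System d m M} {u : Control S.U} {γ γ' : ℝ → M}

theorem isTrajectory_φ (hS : S.IsComplete) (u : Control S.U) (x : M) :
    S.IsTrajectory u (fun t => S.φ t x u) := by
  have h := hS u x
  have h2 : (fun t => S.φ t x u) = h.choose := by
    funext t
    simp only [φ, dif_pos h]
  rw [h2]
  exact h.choose_spec.1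

theorem φ_zero (hS : S.IsComplete) (x : M) (u : Control S.U) : S.φ 0 x u = x := by
  have h := hS u x
  simp only [φ, dif_pos h]
  exact h.choose_spec.2

theorem continuous_φ_time (hS : S.IsComplete) (x : M) (u : Control S.U) :
    Continuous (fun t => S.φ t x u) := (isTrajectory_φ hS u x).continuous

variable [RiemannianBundle (fun x : M => TangentSpace (𝓡 d) x)]
    [IsContMDiffRiemannianBundle (𝓡 d) ∞ (EuclideanSpace ℝ (Fin d))
      (fun x : M => TangentSpace (𝓡 d) x)] [IsRiemannianManifold (𝓡 d) M]

theorem IsTrajectory.eventuallyEq (hγ : S.IsTrajectory u γ) (hγ' : S.IsTrajectory u γ')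
    (h0 : γ 0 = γ' 0) : ∀ᶠ t in 𝓝 0, γ t = γ' t := by
  obtain ⟨R, r, B, L, C, hB⟩ := exists_isFlowBox S (γ 0)
  obtain ⟨τ, hτ, hBτ, hLτ⟩ := hB.exists_time
  have hr := hB.pos
  have hL := hB.deriv.nonneg.2
  have hsrc := mem_extChartAt_source (I := 𝓡 d) (γ 0)
  have hsrc' : γ' 0 ∈ (extChartAt (𝓡 d) (γ 0)).source := h0 ▸ hsrc
  have hρ : dist (extChartAt (𝓡 d) (γ 0) (γ 0)) (extChartAt (𝓡 d) (γ 0) (γ 0)) + B * τ < r := by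
    rw [dist_self]
    linarith
  have hρ' : dist (extChartAt (𝓡 d) (γ 0) (γ' 0)) (extChartAt (𝓡 d) (γ 0) (γ 0)) + B * τ < r := by
    rw [← h0]
    exact hρ
  have h1 := (hB.isIntegralSolution hγ hsrc hτ.le hρ).norm_sub_le
    (hB.deriv.isBoundedLipschitz (convex_closedBall _ _)) u.1.aestronglyMeasurable
    (hB.ae_norm_le u) hτ.le (by nlinarith) (hB.isIntegralSolution hγ' hsrc' hτ.le hρ')
  filter_upwards [Icc_mem_nhds (neg_lt_zero.2 hτ) hτ] with t ht
  have h2 := h1 t ht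
  rw [← h0, sub_self, norm_zero, mul_zero] at h2
  have h3 := sub_eq_zero.1 (norm_eq_zero.1 (le_antisymm h2 (norm_nonneg _)))
  exact (extChartAt (𝓡 d) (γ 0)).injOn
    ((mem_chartBox hB.subset_target).1 (hB.mem_chartBox hγ hsrc hρ t ht)).1
    ((mem_chartBox hB.subset_target).1 (hB.mem_chartBox hγ' hsrc' hρ' t ht)).1 h3

/-- Trajectories are determined by their initial value. -/
theorem IsTrajectory.unique (hγ : S.IsTrajectory u γ) (hγ' : S.IsTrajectory u γ')
    (h0 : γ 0 = γ' 0) : γ = γ' := by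
  -- Local uniqueness, applied after a time shift, makes the set of coincidence open.
  have h1 : IsClopen {t | γ t = γ' t} := by
    refine ⟨isClosed_eq hγ.continuous hγ'.continuous, isOpen_iff_mem_nhds.2 fun t ht => ?_⟩
    have ht : γ t = γ' t := ht
    have h2 := (hγ.shift t).eventuallyEq (hγ'.shift t) (by simpa using ht)
    have h3 : Tendsto (fun s => s - t) (𝓝 t) (𝓝 0) := by
      have := (by fun_prop : Continuous fun s : ℝ => s - t).tendsto t
      rwa [sub_self] at this
    filter_upwards [h3.eventually h2] with s hs
    simpa using hs
  funext t
  have h2 := h1.eq_univ ⟨0, h0⟩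
  exact h2.symm.subset (mem_univ t)

theorem IsTrajectory.eq_φ (hS : S.IsComplete) (hγ : S.IsTrajectory u γ) (t : ℝ) :
    γ t = S.φ t (γ 0) u :=
  congrFun (hγ.unique (isTrajectory_φ hS u (γ 0)) (φ_zero hS _ _).symm) t

theorem φ_add (hS : S.IsComplete) (t s : ℝ) (x : M) (u : Control S.U) :
    S.φ (t + s) x u = S.φ t (S.φ s x u) (shift s u) := by
  have h := ((isTrajectory_φ hS u x).shift s).eq_φ hS t
  simpa using h

theorem Φ_zero (hS : S.IsComplete) (p : Control S.U × M) : S.Φ 0 p = p :=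
  Prod.ext (shift_zero _) (φ_zero hS _ _)

theorem Φ_add (hS : S.IsComplete) (t s : ℝ) (p : Control S.U × M) :
    S.Φ (t + s) p = S.Φ t (S.Φ s p) :=
  Prod.ext (shift_shift _ _ _).symm (φ_add hS _ _ _ _)

/-- Near each point and for short times, the flow is `C¹` in the chart, uniformly over controls. -/
theorem exists_chart_flow (hS : S.IsComplete) (c : M) :
    ∃ W, IsOpen W ∧ c ∈ W ∧ W ⊆ (extChartAt (𝓡 d) c).source ∧ ∃ τ > 0,
    ∃ V : Control S.U → EuclideanSpace ℝ (Fin d) → ℝ →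
      EuclideanSpace ℝ (Fin d) →L[ℝ] EuclideanSpace ℝ (Fin d),
    ∀ t ∈ Icc (-τ) τ, ∀ u, ∀ x ∈ W, S.φ t x u ∈ (extChartAt (𝓡 d) c).source ∧
      HasFDerivAt (fun w => extChartAt (𝓡 d) c (S.φ t ((extChartAt (𝓡 d) c).symm w) u))
        (V u (extChartAt (𝓡 d) c x) t) (extChartAt (𝓡 d) c x) ∧
      ContinuousAt (fun p : Control S.U × EuclideanSpace ℝ (Fin d) =>
        extChartAt (𝓡 d) c (S.φ t ((extChartAt (𝓡 d) c).symm p.2) p.1))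
        (u, extChartAt (𝓡 d) c x) ∧
      ContinuousAt (fun p : Control S.U × EuclideanSpace ℝ (Fin d) => V p.1 p.2 t)
        (u, extChartAt (𝓡 d) c x) := by
  obtain ⟨R, r, B, L, C, hB⟩ := exists_isFlowBox S c
  obtain ⟨τ, hτ, hBτ, hLτ⟩ := hB.exists_time
  have hr := hB.pos
  let O := Metric.ball (extChartAt (𝓡 d) c c) (r / 2)
  have hO : O ⊆ (extChartAt (𝓡 d) c).target := (Metric.ball_subset_closedBall.trans
    (Metric.closedBall_subset_closedBall (by linarith))).trans hB.subset_target
  have hsrc : ∀ x ∈ O, ∀ u, S.φ 0 ((extChartAt (𝓡 d) c).symm x) u ∈ (extChartAt (𝓡 d) c).source :=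
    fun x hx u => by
      rw [φ_zero hS]
      exact (extChartAt (𝓡 d) c).map_target (hO hx)
  have hρ : ∀ x ∈ O, ∀ u, dist (extChartAt (𝓡 d) c (S.φ 0 ((extChartAt (𝓡 d) c).symm x) u))
      (extChartAt (𝓡 d) c c) + B * τ < r := fun x hx u => by
    rw [φ_zero hS, (extChartAt (𝓡 d) c).right_inv (hO hx)]
    have := Metric.mem_ball.1 hx
    linarith
  obtain ⟨V, hV⟩ := exists_hasFDerivAt_solution S.isCompact_U hB.norm_le hB.deriv
    (convex_closedBall _ _) hτ.le hLτ (O := O) Metric.isOpen_ball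
    (h := fun u w t => extChartAt (𝓡 d) c (S.φ t ((extChartAt (𝓡 d) c).symm w) u))
    (fun u x hx => hB.isIntegralSolution (isTrajectory_φ hS u _) (hsrc x hx u) hτ.le (hρ x hx u))
    (fun u x hx => by
      rw [φ_zero hS]
      exact (extChartAt (𝓡 d) c).right_inv (hO hx))
  refine ⟨(extChartAt (𝓡 d) c).source ∩ extChartAt (𝓡 d) c ⁻¹' O,
    (continuousOn_extChartAt c).isOpen_inter_preimage (isOpen_extChartAt_source c)
      Metric.isOpen_ball, ⟨mem_extChartAt_source c, Metric.mem_ball_self (by linarith)⟩,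
    inter_subset_left, τ, hτ, V, fun t ht u x hx => ⟨?_, hV t ht u _ hx.2⟩⟩
  have h1 := (mem_chartBox hB.subset_target).1 (hB.mem_chartBox (isTrajectory_φ hS u _)
    (hsrc _ hx.2 u) (hρ _ hx.2 u) t ht)
  rw [(extChartAt (𝓡 d) c).left_inv hx.1] at h1
  exact h1.1

/-- A property of `Φ_t` at `p` that holds for short times, locally uniformly, and is stable under
composition, holds for all times. -/
theorem forall_of_local (hS : S.IsComplete) {P : ℝ → Control S.U × M → Prop}
    (hP : ∀ c : M, ∃ W ∈ 𝓝 c, ∃ τ > 0, ∀ t ∈ Icc (-τ) τ, ∀ p : Control S.U × M, p.2 ∈ W → P t p)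
    (hcomp : ∀ s t p, P t p → P s (S.Φ t p) → P (s + t) p) (t : ℝ) (p : Control S.U × M) :
    P t p := by
  -- Two nearby times on one orbit differ by a short flow step, forwards or backwards, for which `P`
  -- is known. Hence the truth value of `P` is locally constant in time, and so equal to the one at
  -- time zero.
  have h1 : IsLocallyConstant (fun t => P t p) := by
    rw [IsLocallyConstant.iff_eventually_eq]
    intro t₀
    obtain ⟨W, hW, τ, hτ, H⟩ := hP (S.φ t₀ p.2 p.1)
    filter_upwards [(continuous_φ_time hS p.2 p.1).continuousAt.preimage_mem_nhds hW,
      Metric.closedBall_mem_nhds t₀ hτ] with t ht ht'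
    have ht' := abs_le.1 (Metric.mem_closedBall.1 ht')
    refine propext ⟨fun h => ?_, fun h => ?_⟩
    · have h2 := hcomp (t₀ - t) t p h (H _ ⟨by linarith, by linarith⟩ _ ht)
      simpa using h2
    · have h2 := hcomp (t - t₀) t₀ p h (H _ ⟨by linarith, by linarith⟩ _ (mem_of_mem_nhds hW))
      simpa using h2
  have h2 : P t p = P 0 p := h1.apply_eq_of_isPreconnected isPreconnected_univ (mem_univ _) (mem_univ _)
  rw [h2]
  obtain ⟨W, hW, τ, hτ, H⟩ := hP p.2
  exact H 0 ⟨by linarith, hτ.le⟩ p (mem_of_mem_nhds hW)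

/-- Short times are handled in a chart by `exists_chart_flow`; the cocycle property makes continuity
stable under composition, as `forall_of_local` requires. -/
theorem continuous_φ (hS : S.IsComplete) (t : ℝ) :
    Continuous (fun p : Control S.U × M => S.φ t p.2 p.1) := by
  rw [continuous_iff_continuousAt]
  refine forall_of_local hS (P := fun t p => ContinuousAt (fun p : Control S.U × M => S.φ t p.2 p.1) p)
    (fun c => ?_) (fun s t p h1 h2 => ?_) t
  · obtain ⟨W, hW, hcW, hWs, τ, hτ, V, hV⟩ := exists_chart_flow hS c
    refine ⟨W, hW.mem_nhds hcW, τ, hτ, fun t ht p hp => ?_⟩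
    obtain ⟨h1, -, h3, -⟩ := hV t ht p.1 p.2 hp
    have h4 : ContinuousAt (fun q : Control S.U × M => (q.1, extChartAt (𝓡 d) c q.2)) p :=
      continuousAt_fst.prodMk ((continuousAt_extChartAt' (hWs hp)).comp continuousAt_snd)
    have h5 := h3.comp_of_eq h4 rfl
    have h6 : S.φ t ((extChartAt (𝓡 d) c).symm (extChartAt (𝓡 d) c p.2)) p.1 = S.φ t p.2 p.1 := by
      rw [(extChartAt (𝓡 d) c).left_inv (hWs hp)]
    have h7 := (continuousAt_extChartAt_symm' (I := 𝓡 d) h1).comp_of_eq h5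
      (congrArg (extChartAt (𝓡 d) c) h6)
    refine h7.congr ?_
    filter_upwards [continuousAt_snd.preimage_mem_nhds (hW.mem_nhds hp)] with q hq
    have h8 : (extChartAt (𝓡 d) c).symm (extChartAt (𝓡 d) c q.2) = q.2 :=
      (extChartAt (𝓡 d) c).left_inv (hWs hq)
    simp only [Function.comp_apply, h8]
    exact (extChartAt (𝓡 d) c).left_inv (hV t ht q.1 q.2 hq).1
  · have h3 : ContinuousAt (fun p : Control S.U × M => S.Φ t p) p :=
      ((continuous_shift t).continuousAt.comp continuousAt_fst).prodMk h1
    have h4 := ContinuousAt.comp (f := fun p : Control S.U × M => S.Φ t p) h2 h3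
    refine h4.congr (Eventually.of_forall fun q => ?_)
    exact (φ_add hS _ _ _ _).symm

theorem continuous_Φ (hS : S.IsComplete) (t : ℝ) : Continuous (S.Φ t) :=
  ((continuous_shift t).comp continuous_fst).prodMk (continuous_φ hS t)

theorem exists_hasMFDerivAt_φ (hS : S.IsComplete) (c : M) :
    ∃ W, IsOpen W ∧ c ∈ W ∧ W ⊆ (extChartAt (𝓡 d) c).source ∧ ∃ τ > 0,
    ∃ V : Control S.U → EuclideanSpace ℝ (Fin d) → ℝ →
      EuclideanSpace ℝ (Fin d) →L[ℝ] EuclideanSpace ℝ (Fin d),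
    ∀ t ∈ Icc (-τ) τ, ∀ u, ∀ x ∈ W, S.φ t x u ∈ (extChartAt (𝓡 d) c).source ∧
      HasMFDerivAt (𝓡 d) (𝓡 d) (fun y => S.φ t y u) x ((chartInv c (S.φ t x u)).comp
        ((V u (extChartAt (𝓡 d) c x) t).comp (chartMap c x))) ∧
      ContinuousAt (fun p : Control S.U × EuclideanSpace ℝ (Fin d) => V p.1 p.2 t)
        (u, extChartAt (𝓡 d) c x) := by
  obtain ⟨W, hW, hcW, hWs, τ, hτ, V, hV⟩ := exists_chart_flow hS c
  refine ⟨W, hW, hcW, hWs, τ, hτ, V, fun t ht u x hx => ?_⟩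
  obtain ⟨h1, h2, h3, h4⟩ := hV t ht u x hx
  refine ⟨h1, ?_, h4⟩
  have h5 : S.φ t ((extChartAt (𝓡 d) c).symm (extChartAt (𝓡 d) c x)) u = S.φ t x u := by
    rw [(extChartAt (𝓡 d) c).left_inv (hWs hx)]
  have h6 := h2.hasMFDerivAt.comp x (hasMFDerivAt_extChartAt (hWs hx))
  have h8 := hasMFDerivAt_extChartAt_symm ((extChartAt (𝓡 d) c).map_source h1)
  rw [(extChartAt (𝓡 d) c).left_inv h1] at h8
  have h9 : HasMFDerivAt 𝓘(ℝ, EuclideanSpace ℝ (Fin d)) (𝓡 d) (extChartAt (𝓡 d) c).symm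
      (extChartAt (𝓡 d) c (S.φ t ((extChartAt (𝓡 d) c).symm (extChartAt (𝓡 d) c x)) u))
      (chartInv c (S.φ t x u)) := by
    rw [h5]
    exact h8
  have h7 := HasMFDerivAt.comp (g := (extChartAt (𝓡 d) c).symm) x h9 h6
  refine h7.congr_of_eventuallyEq ?_
  filter_upwards [hW.mem_nhds hx] with y hy
  simp only [Function.comp_apply, (extChartAt (𝓡 d) c).left_inv (hWs hy)]
  exact ((extChartAt (𝓡 d) c).left_inv (hV t ht u y hy).1).symm

end System
end ControlAffine
-- The linearized control flow on the tangent bundle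
namespace ControlAffine

variable {d m : ℕ} {M : Type*} [MetricSpace M] [ChartedSpace (EuclideanSpace ℝ (Fin d)) M]
  [IsManifold (𝓡 d) ∞ M]

theorem mk_chartInv {c z : M} (hz : z ∈ (extChartAt (𝓡 d) c).source) (w : EuclideanSpace ℝ (Fin d)) :
    (⟨z, chartInv c z w⟩ : TangentBundle (𝓡 d) M) =
      (trivializationAt (EuclideanSpace ℝ (Fin d)) (TangentSpace (𝓡 d) : M → Type _)
        c).toOpenPartialHomeomorph.symm (z, w) := by
  have hz' : z ∈ (trivializationAt (EuclideanSpace ℝ (Fin d)) (TangentSpace (𝓡 d) : M → Type _)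
      c).baseSet := by simpa [extChartAt_source] using hz
  rw [← Trivialization.mk_symm _ hz' w, chartInv, Trivialization.symmL_apply _ hz']

theorem continuousAt_mk_chartInv {A : Type*} [TopologicalSpace A] {f : A → M}
    {g : A → EuclideanSpace ℝ (Fin d)} {a : A} {c : M} (hf : ContinuousAt f a)
    (hg : ContinuousAt g a) (ha : f a ∈ (extChartAt (𝓡 d) c).source) :
    ContinuousAt (fun b => (⟨f b, chartInv c (f b) (g b)⟩ : TangentBundle (𝓡 d) M)) a := by
  let e := trivializationAt (EuclideanSpace ℝ (Fin d)) (TangentSpace (𝓡 d) : M → Type _) c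
  have h1 : ContinuousAt e.toOpenPartialHomeomorph.symm (f a, g a) :=
    e.toOpenPartialHomeomorph.continuousAt_symm (e.mem_target.2 (by simpa [e, extChartAt_source] using ha))
  refine (h1.comp_of_eq (hf.prodMk hg) rfl).congr ?_
  filter_upwards [hf.preimage_mem_nhds (extChartAt_source_mem_nhds' (I := 𝓡 d) ha)] with b hb
  exact (mk_chartInv hb _).symm

theorem continuousAt_chartMap {c : M} {q : TangentBundle (𝓡 d) M}
    (hq : q.1 ∈ (extChartAt (𝓡 d) c).source) :
    ContinuousAt (fun q : TangentBundle (𝓡 d) M => chartMap c q.1 q.2) q := by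
  let e := trivializationAt (EuclideanSpace ℝ (Fin d)) (TangentSpace (𝓡 d) : M → Type _) c
  have hproj : ContinuousAt (fun q : TangentBundle (𝓡 d) M => q.1) q :=
    (FiberBundle.continuous_proj (EuclideanSpace ℝ (Fin d)) (TangentSpace (𝓡 d) : M → Type _)).continuousAt
  have hs : ∀ z : M, z ∈ (extChartAt (𝓡 d) c).source ↔ z ∈ e.baseSet := fun z => by
    simp [e]
  have h1 : ContinuousAt e q := e.continuousAt (e.mem_source.2 ((hs _).1 hq))
  refine (continuousAt_snd.comp h1).congr ?_
  filter_upwards [hproj.preimage_mem_nhds (extChartAt_source_mem_nhds' (I := 𝓡 d) hq)] with b hb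
  exact (e.continuousLinearMapAt_apply_of_mem ℝ ((hs _).1 hb) _).symm

theorem continuous_proj_tangentBundle : Continuous (fun q : TangentBundle (𝓡 d) M => q.1) :=
  FiberBundle.continuous_proj (EuclideanSpace ℝ (Fin d)) (TangentSpace (𝓡 d) : M → Type _)

variable [RiemannianBundle (fun x : M => TangentSpace (𝓡 d) x)]
    [IsContMDiffRiemannianBundle (𝓡 d) ∞ (EuclideanSpace ℝ (Fin d))
      (fun x : M => TangentSpace (𝓡 d) x)] 

theorem continuous_norm_tangentBundle : Continuous (fun q : TangentBundle (𝓡 d) M => ‖q.2‖) := by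
  have h1 : Continuous (fun q : TangentBundle (𝓡 d) M => inner ℝ q.2 q.2) :=
    Continuous.inner_bundle (F := EuclideanSpace ℝ (Fin d)) (b := fun q : TangentBundle (𝓡 d) M => q.1)
      (v := fun q => q.2) (w := fun q => q.2) continuous_id continuous_id
  refine (Real.continuous_sqrt.comp h1).congr fun q => ?_
  exact (norm_eq_sqrt_real_inner q.2).symm

namespace System

variable {S : System d m M}

variable [IsRiemannianManifold (𝓡 d) M]

theorem mdifferentiable_φ (hS : S.IsComplete) (t : ℝ) (u : Control S.U) :
    MDifferentiable (𝓡 d) (𝓡 d) (fun y => S.φ t y u) := by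
  intro x
  refine forall_of_local hS (P := fun t p =>
    MDifferentiableAt (𝓡 d) (𝓡 d) (fun y => S.φ t y p.1) p.2) (fun c => ?_) (fun s t p h1 h2 => ?_)
    t (u, x)
  · obtain ⟨W, hW, hcW, hWs, τ, hτ, V, hV⟩ := exists_hasMFDerivAt_φ hS c
    exact ⟨W, hW.mem_nhds hcW, τ, hτ, fun t ht p hp => (hV t ht p.1 p.2 hp).2.1.mdifferentiableAt⟩
  · have h3 := MDifferentiableAt.comp p.2 (g := fun y => S.φ s y (shift t p.1)) h2 h1
    refine h3.congr_of_eventuallyEq (Eventually.of_forall fun y => ?_)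
    exact φ_add hS _ _ _ _

theorem hasMFDerivAt_φ (hS : S.IsComplete) (t : ℝ) (p : Control S.U × M) :
    HasMFDerivAt (𝓡 d) (𝓡 d) (fun y => S.φ t y p.1) p.2 (S.Dφ t p) :=
  (mdifferentiable_φ hS t p.1 p.2).hasMFDerivAt

/-- The linearized control flow on `𝒰 × TM`. -/
def TΦ (S : System d m M) (t : ℝ) (q : Control S.U × TangentBundle (𝓡 d) M) :
    Control S.U × TangentBundle (𝓡 d) M :=
  (shift t q.1, tangentMap (𝓡 d) (𝓡 d) (fun y => S.φ t y q.1) q.2)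

theorem TΦ_add (hS : S.IsComplete) (t s : ℝ) (q : Control S.U × TangentBundle (𝓡 d) M) :
    S.TΦ (t + s) q = S.TΦ t (S.TΦ s q) := by
  refine Prod.ext (shift_shift _ _ _).symm ?_
  have h1 : (fun y => S.φ (t + s) y q.1) =
      (fun y => S.φ t y (shift s q.1)) ∘ (fun y => S.φ s y q.1) := by
    funext y
    exact φ_add hS _ _ _ _
  change tangentMap (𝓡 d) (𝓡 d) (fun y => S.φ (t + s) y q.1) q.2 =
    tangentMap (𝓡 d) (𝓡 d) (fun y => S.φ t y (shift s q.1))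
      (tangentMap (𝓡 d) (𝓡 d) (fun y => S.φ s y q.1) q.2)
  rw [h1]
  exact tangentMap_comp_at q.2 (mdifferentiable_φ hS _ _ _) (mdifferentiable_φ hS _ _ _)

theorem TΦ_zero (hS : S.IsComplete) (q : Control S.U × TangentBundle (𝓡 d) M) : S.TΦ 0 q = q := by
  refine Prod.ext (shift_zero _) ?_
  have h1 : (fun y => S.φ 0 y q.1) = id := funext fun y => φ_zero hS _ _
  change tangentMap (𝓡 d) (𝓡 d) (fun y => S.φ 0 y q.1) q.2 = q.2
  rw [h1, tangentMap_id]
  rfl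

/-- For short times the tangent map is, in trivializations, the solution `V` of the variational
equation, which is jointly continuous; longer times follow by composition. This makes growth
conditions on tangent vectors closed conditions. -/
theorem continuous_TΦ (hS : S.IsComplete) (t : ℝ) : Continuous (S.TΦ t) := by
  have key : ∀ p : Control S.U × M, ∀ q : Control S.U × TangentBundle (𝓡 d) M, (q.1, q.2.1) = p →
      ContinuousAt (S.TΦ t) q := by
    refine forall_of_local hS (P := fun t p => ∀ q : Control S.U × TangentBundle (𝓡 d) M,
      (q.1, q.2.1) = p → ContinuousAt (S.TΦ t) q) (fun c => ?_) (fun s t p h1 h2 q hq => ?_) t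
    · obtain ⟨W, hW, hcW, hWs, τ, hτ, V, hV⟩ := exists_hasMFDerivAt_φ hS c
      refine ⟨W, hW.mem_nhds hcW, τ, hτ, ?_⟩
      rintro t ht _ hq q rfl
      have hq : q.2.1 ∈ W := hq
      obtain ⟨h1, h2, h3⟩ := hV t ht q.1 q.2.1 hq
      have hproj : Continuous (fun q : Control S.U × TangentBundle (𝓡 d) M => q.2.1) :=
        continuous_proj_tangentBundle.comp continuous_snd
      have h4 : ContinuousAt (fun q : Control S.U × TangentBundle (𝓡 d) M =>
          (q.1, extChartAt (𝓡 d) c q.2.1)) q :=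
        continuousAt_fst.prodMk
          ((continuousAt_extChartAt' (hWs hq)).comp_of_eq hproj.continuousAt rfl)
      have h5 := h3.comp_of_eq h4 rfl
      have h6 : ContinuousAt (fun q : Control S.U × TangentBundle (𝓡 d) M => chartMap c q.2.1 q.2.2) q :=
        (continuousAt_chartMap (hWs hq)).comp_of_eq continuousAt_snd rfl
      have h7 : ContinuousAt (fun q : Control S.U × TangentBundle (𝓡 d) M => S.φ t q.2.1 q.1) q :=
        ((continuous_φ hS t).comp (continuous_fst.prodMk hproj)).continuousAt
      have h8 := continuousAt_mk_chartInv h7 (h5.clm_apply h6) h1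
      refine ((continuous_shift t).continuousAt.comp continuousAt_fst).prodMk (h8.congr ?_)
      filter_upwards [hproj.continuousAt.preimage_mem_nhds (hW.mem_nhds hq)] with q' hq'
      have h9 := (hV t ht q'.1 q'.2.1 hq').2.1.mfderiv
      change _ = (⟨S.φ t q'.2.1 q'.1, mfderiv (𝓡 d) (𝓡 d) (fun y => S.φ t y q'.1) q'.2.1 q'.2.2⟩ :
        TangentBundle (𝓡 d) M)
      rw [h9]
      rfl
    · have h3 : ContinuousAt (fun q => S.TΦ s (S.TΦ t q)) q :=
        ContinuousAt.comp (h2 _ (by rw [← hq]; rfl)) (h1 q hq)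
      refine h3.congr (Eventually.of_forall fun q => ?_)
      exact (TΦ_add hS _ _ _).symm
  exact continuous_iff_continuousAt.2 fun q => key _ q rfl

end System
end ControlAffine
-- Growth rates, closedness of the bundles, angle bounds
namespace ControlAffine

theorem nonpos_of_forall_le_exp {x K c T : ℝ} (hc : 0 < c)
    (h : ∀ t, T ≤ t → x ≤ Real.exp (-(c * t)) * K) : x ≤ 0 := by
  have h1 : Tendsto (fun t : ℝ => Real.exp (-(c * t)) * K) atTop (𝓝 (0 * K)) :=
    (Real.tendsto_exp_neg_atTop_nhds_zero.comp (tendsto_id.const_mul_atTop hc)).mul_const K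
  rw [zero_mul] at h1
  exact ge_of_tendsto h1 ((eventually_ge_atTop T).mono h)

/-- Boundedness confines the values to a compact ball, where a unique cluster point is a limit; in
finite dimension pointwise continuity of a family of operators is norm continuity. -/
theorem continuousOn_of_mapClusterPt {X E : Type*} [TopologicalSpace X] [NormedAddCommGroup E]
    [NormedSpace ℝ E] [FiniteDimensional ℝ E] {D : Set X} {P : X → E →L[ℝ] E} {Λ : ℝ}
    (hb : ∀ p ∈ D, ∀ w, ‖P p w‖ ≤ Λ * ‖w‖)
    (h : ∀ p₀ ∈ D, ∀ w y, MapClusterPt y (𝓝[D] p₀) (fun p => P p w) → y = P p₀ w) :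
    ContinuousOn P D := by
  rw [continuousOn_clm_apply]
  intro w p₀ hp₀
  refine (isCompact_closedBall (0 : E) (Λ * ‖w‖)).tendsto_nhds_of_unique_mapClusterPt ?_
    fun y _ hy => h p₀ hp₀ w y hy
  filter_upwards [self_mem_nhdsWithin] with p hp
  simpa using hb p hp w

variable {d m : ℕ} {M : Type*} [MetricSpace M] [ChartedSpace (EuclideanSpace ℝ (Fin d)) M]
  [IsManifold (𝓡 d) ∞ M]
    [RiemannianBundle (fun x : M => TangentSpace (𝓡 d) x)]
    [IsContMDiffRiemannianBundle (𝓡 d) ∞ (EuclideanSpace ℝ (Fin d))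
      (fun x : M => TangentSpace (𝓡 d) x)] [IsRiemannianManifold (𝓡 d) M]

namespace System

variable {S : System d m M} {Q : Set M}
  {Eu Ecs : ∀ p : Control S.U × M, Submodule ℝ (TangentSpace (𝓡 d) p.2)}

/-- The chain rule in terms of norms: the two vectors lie over base points that are equal only by
the cocycle property, so comparing norms avoids transport between tangent spaces. -/
theorem norm_Dφ_Dφ (hS : S.IsComplete) (t s : ℝ) (p : Control S.U × M) (v : TangentSpace (𝓡 d) p.2) :
    ‖S.Dφ t (S.Φ s p) (S.Dφ s p v)‖ = ‖S.Dφ (t + s) p v‖ := by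
  have h := TΦ_add hS t s (p.1, ⟨p.2, v⟩)
  exact (congrArg (fun q => ‖q.2.2‖) h).symm

theorem norm_Dφ_zero (hS : S.IsComplete) (p : Control S.U × M) (v : TangentSpace (𝓡 d) p.2) :
    ‖S.Dφ 0 p v‖ = ‖v‖ := by
  have h := TΦ_zero hS (p.1, ⟨p.2, v⟩)
  exact (congrArg (fun q => ‖q.2.2‖) h)

theorem norm_Dφ_Dφ_of_add_eq_zero (hS : S.IsComplete) {t s : ℝ} (h : t + s = 0) (p : Control S.U × M)
    (v : TangentSpace (𝓡 d) p.2) : ‖S.Dφ t (S.Φ s p) (S.Dφ s p v)‖ = ‖v‖ := by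
  rw [norm_Dφ_Dφ hS, h, norm_Dφ_zero hS]

theorem Φ_mem_lift (hS : S.IsComplete) {p : Control S.U × M} (hp : p ∈ S.lift Q) (t : ℝ) :
    S.Φ t p ∈ S.lift Q := fun s => by
  change S.φ s (S.φ t p.2 p.1) (shift t p.1) ∈ Q
  rw [← φ_add hS]
  exact hp _

theorem snd_mem_of_mem_lift (hS : S.IsComplete) {p : Control S.U × M} (hp : p ∈ S.lift Q) :
    p.2 ∈ Q := by
  simpa [φ_zero hS] using hp 0

theorem isClosed_lift (hS : S.IsComplete) (hQ : IsClosed Q) : IsClosed (S.lift Q) := by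
  have h : S.lift Q = ⋂ t : ℝ, (fun p : Control S.U × M => S.φ t p.2 p.1) ⁻¹' Q := by
    ext p
    simp only [mem_iInter, mem_preimage]
    rfl
  rw [h]
  exact isClosed_iInter fun t => hQ.preimage (continuous_φ hS t)

theorem isCompact_univ_prod (S : System d m M) {X : Set M} (hX : IsCompact X) :
    IsCompact ((univ : Set (Control S.U)) ×ˢ X) := by
  have := compactSpace_control S.isCompact_U S.convex_U
  exact isCompact_univ.prod hX

theorem isCompact_lift (hS : S.IsComplete) (hQ : IsCompact Q) : IsCompact (S.lift Q) :=
  (isCompact_univ_prod S hQ).of_isClosed_subset (isClosed_lift hS hQ.isClosed)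
    fun _ hp => ⟨mem_univ _, snd_mem_of_mem_lift hS hp⟩

/-- The norm of the linearized flow is continuous and vanishes on zero vectors, hence is below one
for small vectors over a neighborhood. Homogeneity turns this into an operator bound, and
compactness patches the neighborhoods. -/
theorem exists_norm_Dφ_le (hS : S.IsComplete) (t : ℝ) {X : Set (Control S.U × M)} (hX : IsCompact X) :
    ∃ K > 0, ∀ p ∈ X, ∀ v : TangentSpace (𝓡 d) p.2, ‖S.Dφ t p v‖ ≤ K * ‖v‖ := by
  have hloc : ∀ p₀ : Control S.U × M, ∃ K > 0, ∀ᶠ p in 𝓝 p₀, ∀ v : TangentSpace (𝓡 d) p.2,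
      ‖S.Dφ t p v‖ ≤ K * ‖v‖ := by
    intro p₀
    obtain ⟨C, hC, hC'⟩ := eventually_norm_chartMap_le (d := d) p₀.2
    have hsrc := mem_extChartAt_source (I := 𝓡 d) p₀.2
    let f : (Control S.U × M) × EuclideanSpace ℝ (Fin d) → ℝ := fun a =>
      ‖(S.TΦ t (a.1.1, ⟨a.1.2, chartInv p₀.2 a.1.2 a.2⟩)).2.2‖
    have hf : ContinuousAt f (p₀, 0) := by
      refine (continuous_norm_tangentBundle.comp (continuous_snd.comp
        (continuous_TΦ hS t))).continuousAt.comp ?_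
      exact (continuousAt_fst.comp continuousAt_fst).prodMk
        (continuousAt_mk_chartInv (continuousAt_snd.comp continuousAt_fst) continuousAt_snd hsrc)
    have hf0 : f (p₀, 0) = 0 := by
      change ‖S.Dφ t p₀ (chartInv p₀.2 p₀.2 0)‖ = 0
      simp
    have h1 : ∀ᶠ a in 𝓝 p₀ ×ˢ 𝓝 (0 : EuclideanSpace ℝ (Fin d)), f a < 1 := by
      rw [← nhds_prod_eq]
      exact hf.eventually_lt_const (by rw [hf0]; exact zero_lt_one)
    obtain ⟨P, hP, P', hP', hPP⟩ := Filter.eventually_prod_iff.1 h1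
    obtain ⟨ρ, hρ, hρP⟩ := Metric.eventually_nhds_iff_ball.1 hP'
    refine ⟨C * (2 / ρ), by positivity, ?_⟩
    filter_upwards [hP, continuousAt_snd.preimage_mem_nhds hC',
      continuousAt_snd.preimage_mem_nhds (extChartAt_source_mem_nhds (I := 𝓡 d) p₀.2)] with p hp1 hp2 hp3 v
    have hp2 : ‖chartMap p₀.2 p.2 v‖ ≤ C * ‖v‖ := hp2 v
    by_cases hv : chartMap p₀.2 p.2 v = 0
    · have hv0 : v = 0 := by rw [← chartInv_chartMap hp3 v, hv, map_zero]
      simp [hv0]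
    have hv' : 0 < ‖chartMap p₀.2 p.2 v‖ := norm_pos_iff.2 hv
    set s : ℝ := ρ / 2 / ‖chartMap p₀.2 p.2 v‖ with hs
    have hs0 : 0 < s := by positivity
    have h2 := hPP hp1 (hρP (s • chartMap p₀.2 p.2 v) (by
      rw [mem_ball_zero_iff, norm_smul, hs, Real.norm_of_nonneg (by positivity),
        div_mul_cancel₀ _ hv'.ne']
      linarith))
    change ‖S.Dφ t p (chartInv p₀.2 p.2 (s • chartMap p₀.2 p.2 v))‖ < 1 at h2
    rw [map_smul, chartInv_chartMap hp3, map_smul, norm_smul, Real.norm_of_nonneg hs0.le] at h2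
    calc ‖S.Dφ t p v‖ ≤ 1 / s := by rw [le_div_iff₀ hs0, mul_comm]; exact h2.le
      _ = (2 / ρ) * ‖chartMap p₀.2 p.2 v‖ := by rw [hs]; field_simp
      _ ≤ (2 / ρ) * (C * ‖v‖) := by gcongr
      _ = _ := by ring
  refine hX.induction_on (p := fun X => ∃ K > 0, ∀ p ∈ X, ∀ v : TangentSpace (𝓡 d) p.2,
    ‖S.Dφ t p v‖ ≤ K * ‖v‖) ⟨1, one_pos, by simp⟩ ?_ ?_ ?_
  · rintro s s' hss ⟨K, hK, h⟩
    exact ⟨K, hK, fun p hp => h p (hss hp)⟩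
  · rintro s s' ⟨K, hK, h⟩ ⟨K', hK', h'⟩
    refine ⟨max K K', by positivity, ?_⟩
    rintro p (hp | hp) v
    · exact (h p hp v).trans (by gcongr; exact le_max_left _ _)
    · exact (h' p hp v).trans (by gcongr; exact le_max_right _ _)
  · intro p₀ _
    obtain ⟨K, hK, h⟩ := hloc p₀
    exact ⟨_, mem_nhdsWithin_of_mem_nhds h, K, hK, fun p hp => hp⟩

namespace IsPartiallyHyperbolic

theorem exists_add (hE : S.IsPartiallyHyperbolic Q Eu Ecs) {p : Control S.U × M} (hp : p ∈ S.lift Q)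
    (v : TangentSpace (𝓡 d) p.2) : ∃ a ∈ Eu p, ∃ b ∈ Ecs p, a + b = v :=
  Submodule.mem_sup.1 ((hE.isCompl p hp).sup_eq_top ▸ Submodule.mem_top)

theorem Dφ_mem_Eu (hE : S.IsPartiallyHyperbolic Q Eu Ecs) {p : Control S.U × M} (hp : p ∈ S.lift Q)
    (t : ℝ) {v : TangentSpace (𝓡 d) p.2} (hv : v ∈ Eu p) : S.Dφ t p v ∈ Eu (S.Φ t p) :=
  (hE.map_Eu p hp t) ▸ Submodule.mem_map_of_mem hv

theorem Dφ_mem_Ecs (hE : S.IsPartiallyHyperbolic Q Eu Ecs) {p : Control S.U × M} (hp : p ∈ S.lift Q)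
    (t : ℝ) {v : TangentSpace (𝓡 d) p.2} (hv : v ∈ Ecs p) : S.Dφ t p v ∈ Ecs (S.Φ t p) :=
  (hE.map_Ecs p hp t) ▸ Submodule.mem_map_of_mem hv

theorem exists_mem_iff (hE : S.IsPartiallyHyperbolic Q Eu Ecs) (hS : S.IsComplete) :
    ∃ l > 0, ∃ T : ℝ, ∀ p ∈ S.lift Q, ∀ v : TangentSpace (𝓡 d) p.2,
      (v ∈ Eu p ↔ ∀ t, T ≤ t → ‖S.Dφ (-t) p v‖ ≤ Real.exp (-(l * t)) * ‖v‖) ∧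
      (v ∈ Ecs p ↔ ∀ t, T ≤ t → ‖S.Dφ t p v‖ ≤ Real.exp (l / 2 * t) * ‖v‖) := by
  obtain ⟨l, hl, H⟩ := hE.growth
  obtain ⟨T, hT, H⟩ := H (l / 2) (by positivity)
  have hEu : ∀ p ∈ S.lift Q, ∀ v ∈ Eu p, ∀ t, T ≤ t →
      ‖S.Dφ (-t) p v‖ ≤ Real.exp (-(l * t)) * ‖v‖ := by
    intro p hp v hv t ht
    have h1 := (H _ (Φ_mem_lift hS hp (-t)) t ht).1 _ (hE.Dφ_mem_Eu hp (-t) hv)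
    rw [norm_Dφ_Dφ_of_add_eq_zero hS (by simp)] at h1
    rw [Real.exp_neg, ← div_eq_inv_mul, le_div_iff₀ (Real.exp_pos _), mul_comm]
    exact h1
  refine ⟨l, hl, T, fun p hp v => ⟨⟨hEu p hp v, fun hv => ?_⟩,
    ⟨fun hv t ht => (H p hp t ht).2 v hv, fun hv => ?_⟩⟩⟩
  · obtain ⟨a, ha, b, hb, rfl⟩ := hE.exists_add hp v
    have h1 : ‖b‖ ≤ 0 := by
      refine nonpos_of_forall_le_exp (c := l / 2) (K := ‖a + b‖ + ‖a‖) (T := T) (by positivity)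
        fun t ht => ?_
      have h2 := (H _ (Φ_mem_lift hS hp (-t)) t ht).2 _ (hE.Dφ_mem_Ecs hp (-t) hb)
      rw [norm_Dφ_Dφ_of_add_eq_zero hS (by simp)] at h2
      have h3 : ‖S.Dφ (-t) p b‖ ≤ ‖S.Dφ (-t) p (a + b)‖ + ‖S.Dφ (-t) p a‖ := by
        have : S.Dφ (-t) p b = S.Dφ (-t) p (a + b) - S.Dφ (-t) p a := by rw [map_add]; abel
        rw [this]
        exact norm_sub_le _ _
      have h4 := hv t ht
      have h5 := hEu p hp a ha t ht
      calc ‖b‖ ≤ Real.exp (l / 2 * t) * (Real.exp (-(l * t)) * (‖a + b‖ + ‖a‖)) := by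
            refine h2.trans ?_
            gcongr
            linarith
        _ = _ := by rw [← mul_assoc, ← Real.exp_add]; ring_nf
    have h2 : b = 0 := norm_eq_zero.1 (le_antisymm h1 (norm_nonneg _))
    simpa [h2] using ha
  · obtain ⟨a, ha, b, hb, rfl⟩ := hE.exists_add hp v
    have h1 : ‖a‖ ≤ 0 := by
      refine nonpos_of_forall_le_exp (c := l / 2) (K := ‖a + b‖ + ‖b‖) (T := T) (by positivity)
        fun t ht => ?_
      have h2 := (H _ hp t ht).1 _ ha
      have h3 : ‖S.Dφ t p a‖ ≤ ‖S.Dφ t p (a + b)‖ + ‖S.Dφ t p b‖ := by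
        have : S.Dφ t p a = S.Dφ t p (a + b) - S.Dφ t p b := by rw [map_add]; abel
        rw [this]
        exact norm_sub_le _ _
      have h4 := hv t ht
      have h5 := (H _ hp t ht).2 _ hb
      calc ‖a‖ = Real.exp (-(l * t)) * (Real.exp (l * t) * ‖a‖) := by
            rw [← mul_assoc, ← Real.exp_add]; simp
        _ ≤ Real.exp (-(l * t)) * (Real.exp (l / 2 * t) * (‖a + b‖ + ‖b‖)) := by
            refine mul_le_mul_of_nonneg_left ?_ (Real.exp_pos _).le
            linarith
        _ = _ := by rw [← mul_assoc, ← Real.exp_add]; ring_nf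
    have h2 : a = 0 := norm_eq_zero.1 (le_antisymm h1 (norm_nonneg _))
    simpa [h2] using hb

/-- By `exists_mem_iff` each set is the part over the closed set `L(Q)` of an intersection of norm
inequalities, and both sides of these are continuous by `continuous_TΦ`. -/
theorem isClosed_bundles (hE : S.IsPartiallyHyperbolic Q Eu Ecs) (hS : S.IsComplete)
    (hQ : IsClosed Q) :
    IsClosed {q : Control S.U × TangentBundle (𝓡 d) M | (q.1, q.2.1) ∈ S.lift Q ∧
      q.2.2 ∈ Eu (q.1, q.2.1)} ∧
    IsClosed {q : Control S.U × TangentBundle (𝓡 d) M | (q.1, q.2.1) ∈ S.lift Q ∧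
      q.2.2 ∈ Ecs (q.1, q.2.1)} := by
  obtain ⟨l, -, T, H⟩ := hE.exists_mem_iff hS
  have hL : IsClosed {q : Control S.U × TangentBundle (𝓡 d) M | (q.1, q.2.1) ∈ S.lift Q} :=
    (isClosed_lift hS hQ).preimage
      (continuous_fst.prodMk (continuous_proj_tangentBundle.comp continuous_snd))
  have hN : ∀ t, Continuous (fun q : Control S.U × TangentBundle (𝓡 d) M => ‖(S.TΦ t q).2.2‖) :=
    fun t => continuous_norm_tangentBundle.comp (continuous_snd.comp (continuous_TΦ hS t))
  have hN0 : Continuous (fun q : Control S.U × TangentBundle (𝓡 d) M => ‖q.2.2‖) :=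
    continuous_norm_tangentBundle.comp continuous_snd
  constructor
  · have h1 : IsClosed ({q : Control S.U × TangentBundle (𝓡 d) M | (q.1, q.2.1) ∈ S.lift Q} ∩
        ⋂ t, ⋂ (_ : T ≤ t), {q | ‖(S.TΦ (-t) q).2.2‖ ≤ Real.exp (-(l * t)) * ‖q.2.2‖}) :=
      hL.inter (isClosed_iInter fun t => isClosed_iInter fun _ =>
        isClosed_le (hN _) (continuous_const.mul hN0))
    convert h1 using 1
    ext q
    refine and_congr_right fun hq => ?_
    rw [mem_iInter₂]
    exact (H _ hq q.2.2).1
  · have h1 : IsClosed ({q : Control S.U × TangentBundle (𝓡 d) M | (q.1, q.2.1) ∈ S.lift Q} ∩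
        ⋂ t, ⋂ (_ : T ≤ t), {q | ‖(S.TΦ t q).2.2‖ ≤ Real.exp (l / 2 * t) * ‖q.2.2‖}) :=
      hL.inter (isClosed_iInter fun t => isClosed_iInter fun _ =>
        isClosed_le (hN _) (continuous_const.mul hN0))
    convert h1 using 1
    ext q
    refine and_congr_right fun hq => ?_
    rw [mem_iInter₂]
    exact (H _ hq q.2.2).2

/-- The angle between the two bundles is bounded from below. -/
theorem exists_norm_le (hE : S.IsPartiallyHyperbolic Q Eu Ecs) (hS : S.IsComplete)
    (hQ : IsCompact Q) : ∃ Λ > 0, ∀ p ∈ S.lift Q, ∀ a ∈ Eu p, ∀ b ∈ Ecs p,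
      ‖a‖ ≤ Λ * ‖a + b‖ ∧ ‖b‖ ≤ Λ * ‖a + b‖ := by
  obtain ⟨l, hl, H⟩ := hE.growth
  obtain ⟨T, hT, H⟩ := H (l / 2) (by positivity)
  obtain ⟨K, hK, hKT⟩ := exists_norm_Dφ_le hS T (isCompact_lift hS hQ)
  -- After time `T` the growth factors of the two bundles are separated by the gap `D`. If `a` and
  -- `b` nearly cancelled, their images could not, which contradicts the bound `K` for the
  -- derivative on the small vector `a + b`.
  set D := Real.exp (l * T) - Real.exp (l / 2 * T) with hD
  have hDpos : 0 < D := by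
    rw [hD, sub_pos, Real.exp_lt_exp]
    nlinarith [mul_pos hl hT]
  refine ⟨(K + Real.exp (l / 2 * T)) / D + 1, by positivity, fun p hp a ha b hb => ?_⟩
  have key : ‖a‖ ≤ (K + Real.exp (l / 2 * T)) / D * ‖a + b‖ := by
    have h1 := (H p hp T le_rfl).1 a ha
    have h2 := (H p hp T le_rfl).2 b hb
    have h3 := hKT p hp (a + b)
    have h4 : ‖S.Dφ T p a‖ ≤ ‖S.Dφ T p (a + b)‖ + ‖S.Dφ T p b‖ := by
      have : S.Dφ T p a = S.Dφ T p (a + b) - S.Dφ T p b := by rw [map_add]; abel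
      rw [this]
      exact norm_sub_le _ _
    have h5 : ‖b‖ ≤ ‖a + b‖ + ‖a‖ := by
      have : b = (a + b) - a := by abel
      conv_lhs => rw [this]
      exact norm_sub_le _ _
    have h6 : Real.exp (l / 2 * T) * ‖b‖ ≤ Real.exp (l / 2 * T) * (‖a + b‖ + ‖a‖) := by gcongr
    rw [div_mul_eq_mul_div, le_div_iff₀ hDpos, hD]
    linarith
  constructor
  · linarith [norm_nonneg (a + b)]
  · have h5 : ‖b‖ ≤ ‖a + b‖ + ‖a‖ := by
      have : b = (a + b) - a := by abel
      conv_lhs => rw [this]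
      exact norm_sub_le _ _
    linarith

end IsPartiallyHyperbolic

end System
end ControlAffine
-- The unstable projection and the unstable determinant
namespace ControlAffine

section Linear

open Classical in
/-- The projection onto `A` along `B` (zero if these are not complementary). -/
def projAlong {V : Type*} [AddCommGroup V] [Module ℝ V] (A B : Submodule ℝ V) : V →ₗ[ℝ] V :=
  if h : IsCompl A B then A.projection B h else 0

theorem projAlong_add {V : Type*} [AddCommGroup V] [Module ℝ V] {A B : Submodule ℝ V}
    (h : IsCompl A B) {a b : V} (ha : a ∈ A) (hb : b ∈ B) : projAlong A B (a + b) = a := by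
  rw [projAlong, dif_pos h, map_add, Submodule.projection_apply_of_mem_left h ha,
    (Submodule.projection_apply_eq_zero_iff h).2 hb, add_zero]

theorem projAlong_mem {V : Type*} [AddCommGroup V] [Module ℝ V] (A B : Submodule ℝ V) (v : V) :
    projAlong A B v ∈ A := by
  by_cases h : IsCompl A B
  · rw [projAlong, dif_pos h]
    exact Submodule.projection_apply_mem h v
  · rw [projAlong, dif_neg h]
    exact A.zero_mem

theorem sub_projAlong_mem {V : Type*} [AddCommGroup V] [Module ℝ V] {A B : Submodule ℝ V}
    (h : IsCompl A B) (v : V) : v - projAlong A B v ∈ B := by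
  obtain ⟨a, ha, b, hb, rfl⟩ := Submodule.mem_sup.1 (h.sup_eq_top ▸ Submodule.mem_top : v ∈ A ⊔ B)
  rw [projAlong_add h ha hb]
  simpa using hb

/-- A Gram determinant is the squared determinant of the map sending an orthonormal basis to the
given family, and determinants are multiplicative. The identity holds for arbitrary families, so
determinants can be computed in frames that are not orthonormal. -/
theorem normDet_sq_mul_det_gram {V W : Type*} [NormedAddCommGroup V] [InnerProductSpace ℝ V]
    [FiniteDimensional ℝ V] [NormedAddCommGroup W] [InnerProductSpace ℝ W] {n : ℕ}
    (hn : Module.finrank ℝ V = n) (f : V →ₗ[ℝ] W) (a : Fin n → V) :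
    f.normDet ^ 2 * (Matrix.gram ℝ a).det = (Matrix.gram ℝ (fun i => f (a i))).det := by
  let b := EuclideanSpace.basisFun (Fin n) ℝ
  let T : EuclideanSpace ℝ (Fin n) →ₗ[ℝ] V := b.toBasis.constr ℝ a
  have hT : ∀ i, T (b i) = a i := fun i => by
    rw [← b.coe_toBasis]
    exact b.toBasis.constr_basis ℝ a i
  have h1 := T.normDet_sq_eq_det_gram b
  have h2 := (f ∘ₗ T).normDet_sq_eq_det_gram b
  rw [LinearMap.normDet_comp_of_finrank_eq _ _ (by simp [hn]), mul_pow] at h2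
  simp only [LinearMap.comp_apply, hT, RCLike.ofReal_real_eq_id, id] at h1 h2
  rw [← h1]
  exact h2

end Linear

variable {d m : ℕ} {M : Type*} [MetricSpace M] [ChartedSpace (EuclideanSpace ℝ (Fin d)) M]
  [IsManifold (𝓡 d) ∞ M]
    [RiemannianBundle (fun x : M => TangentSpace (𝓡 d) x)]
    [IsContMDiffRiemannianBundle (𝓡 d) ∞ (EuclideanSpace ℝ (Fin d))
      (fun x : M => TangentSpace (𝓡 d) x)] [IsRiemannianManifold (𝓡 d) M]

/-- `W` is a neighborhood of `c` on which the chart at `c` distorts distances and tangent vectors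
by at most `C`. -/
structure IsChartNhd (c : M) (W : Set M) (C : ℝ) : Prop where
  isOpen : IsOpen W
  mem : c ∈ W
  subset_source : W ⊆ (extChartAt (𝓡 d) c).source
  pos : 0 < C
  chartMap_le : ∀ z ∈ W, ∀ v : TangentSpace (𝓡 d) z, ‖chartMap c z v‖ ≤ C * ‖v‖
  chartInv_le : ∀ z ∈ W, ∀ v : EuclideanSpace ℝ (Fin d),
    ‖(chartInv c z v : TangentSpace (𝓡 d) z)‖ ≤ C * ‖v‖
  dist_chart_le : ∀ y ∈ W, ∀ z ∈ W,
    dist (extChartAt (𝓡 d) c y) (extChartAt (𝓡 d) c z) ≤ C * dist y z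
  dist_le : ∀ y ∈ W, ∀ z ∈ W,
    dist y z ≤ C * dist (extChartAt (𝓡 d) c y) (extChartAt (𝓡 d) c z)

theorem exists_isChartNhd (c : M) : ∃ W C, IsChartNhd (d := d) c W C := by
  obtain ⟨C₁, h₁, H₁⟩ := eventually_norm_chartMap_le (d := d) c
  obtain ⟨C₂, h₂, H₂⟩ := eventually_norm_chartInv_le (d := d) c
  obtain ⟨C₃, W, hW, hWs, H₃⟩ := exists_extChartAt_bilipschitz (d := d) c
  obtain ⟨W', hW's, hW'o, hcW'⟩ := mem_nhds_iff.1 (inter_mem (inter_mem H₁ H₂) hW)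
  have hC : ∀ x : ℝ, 0 ≤ x → C₁ * x ≤ (C₁ + C₂ + C₃) * x ∧ C₂ * x ≤ (C₁ + C₂ + C₃) * x ∧
      C₃ * x ≤ (C₁ + C₂ + C₃) * x := fun x hx => by
    have := C₃.coe_nonneg
    refine ⟨?_, ?_, ?_⟩ <;> gcongr <;> linarith
  refine ⟨W', C₁ + C₂ + C₃, hW'o, hcW', fun z hz => hWs (hW's hz).2, by positivity, fun z hz v => ?_,
    fun z hz v => ?_, fun y hy z hz => ?_, fun y hy z hz => ?_⟩
  · exact ((hW's hz).1.1 v).trans (hC _ (norm_nonneg _)).1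
  · exact ((hW's hz).1.2 v).trans (hC _ (norm_nonneg _)).2.1
  · exact (H₃ _ (hW's hy).2 _ (hW's hz).2).1.trans (hC _ dist_nonneg).2.2
  · exact (H₃ _ (hW's hy).2 _ (hW's hz).2).2.trans (hC _ dist_nonneg).2.2

namespace System

variable {S : System d m M} {Q : Set M}
  {Eu Ecs : ∀ p : Control S.U × M, Submodule ℝ (TangentSpace (𝓡 d) p.2)}

/-- The projection onto the unstable bundle, read in the chart at `c`. -/
def chartProj (Eu Ecs : ∀ p : Control S.U × M, Submodule ℝ (TangentSpace (𝓡 d) p.2)) (c : M)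
    (p : Control S.U × M) : EuclideanSpace ℝ (Fin d) →L[ℝ] EuclideanSpace ℝ (Fin d) :=
  LinearMap.toContinuousLinearMap ((chartMap c p.2).toLinearMap ∘ₗ projAlong (Eu p) (Ecs p) ∘ₗ
    (chartInv c p.2).toLinearMap)

theorem chartProj_apply (c : M) (p : Control S.U × M) (w : EuclideanSpace ℝ (Fin d)) :
    chartProj Eu Ecs c p w = chartMap c p.2 (projAlong (Eu p) (Ecs p) (chartInv c p.2 w)) := rfl

theorem continuousAt_prod_chartInv {c : M} {p : Control S.U × M} (w : EuclideanSpace ℝ (Fin d))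
    (hp : p.2 ∈ (extChartAt (𝓡 d) c).source) :
    ContinuousAt (fun a : (Control S.U × M) × EuclideanSpace ℝ (Fin d) =>
      (a.1.1, (⟨a.1.2, chartInv c a.1.2 a.2⟩ : TangentBundle (𝓡 d) M))) (p, w) :=
  (continuousAt_fst.comp continuousAt_fst).prodMk
    (continuousAt_mk_chartInv (continuousAt_snd.comp continuousAt_fst) continuousAt_snd hp)

theorem IsPartiallyHyperbolic.exists_norm_chartProj_le (hE : S.IsPartiallyHyperbolic Q Eu Ecs)
    (hS : S.IsComplete) (hQ : IsCompact Q) {c : M} {W : Set M} {C : ℝ}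
    (hW : IsChartNhd (d := d) c W C) :
    ∃ Λ > 0, ∀ p ∈ S.lift Q, p.2 ∈ W → ∀ w, ‖chartProj Eu Ecs c p w‖ ≤ Λ * ‖w‖ := by
  obtain ⟨Λ, hΛ, H⟩ := hE.exists_norm_le hS hQ
  have hC := hW.pos
  refine ⟨C * Λ * C, by positivity, fun p hp hpW w => ?_⟩
  rw [chartProj_apply]
  have h1 := (H p hp _ (projAlong_mem (Eu p) (Ecs p) (chartInv c p.2 w)) _
    (sub_projAlong_mem (hE.isCompl p hp) (chartInv c p.2 w))).1
  rw [add_sub_cancel] at h1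
  calc _ ≤ C * ‖projAlong (Eu p) (Ecs p) (chartInv c p.2 w)‖ := hW.chartMap_le _ hpW _
    _ ≤ C * (Λ * (C * ‖w‖)) := by
        gcongr
        exact h1.trans (mul_le_mul_of_nonneg_left (hW.chartInv_le _ hpW _) hΛ.le)
    _ = _ := by ring

/-- The unstable projection is continuous on the lift, in charts. -/
theorem IsPartiallyHyperbolic.continuousOn_chartProj (hE : S.IsPartiallyHyperbolic Q Eu Ecs)
    (hS : S.IsComplete) (hQ : IsCompact Q) {c : M} {W : Set M} {C : ℝ}
    (hW : IsChartNhd (d := d) c W C) :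
    ContinuousOn (chartProj Eu Ecs c) {p | p ∈ S.lift Q ∧ p.2 ∈ W} := by
  obtain ⟨Λ, hΛ, hb⟩ := hE.exists_norm_chartProj_le hS hQ hW
  refine continuousOn_of_mapClusterPt (Λ := Λ) (fun p hp => hb p hp.1 hp.2) ?_
  intro p₀ hp₀ w y hy
  -- A cluster point `y` of the projections of `w` lies in `E⁺`, and `w - y` lies in `E⁰⁻`, because
  -- both bundles are closed. Uniqueness of the decomposition over `p₀` identifies `y`.
  obtain ⟨𝒰, hle, hlim⟩ := mapClusterPt_iff_ultrafilter.1 hy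
  have hsrc := hW.subset_source hp₀.2
  have h𝒰 : Tendsto id (𝒰 : Filter (Control S.U × M)) (𝓝 p₀) := hle.trans nhdsWithin_le_nhds
  have hmem : ∀ᶠ p in (𝒰 : Filter (Control S.U × M)), p ∈ S.lift Q ∧ p.2 ∈ W :=
    hle self_mem_nhdsWithin
  have h1 := (continuousAt_prod_chartInv (S := S) y hsrc).tendsto.comp (h𝒰.prodMk_nhds hlim)
  have h2 := (continuousAt_prod_chartInv (S := S) (w - y) hsrc).tendsto.comp
    (h𝒰.prodMk_nhds (hlim.const_sub w))
  obtain ⟨hcu, hcs⟩ := hE.isClosed_bundles hS hQ.isClosed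
  have h3 : chartInv c p₀.2 y ∈ Eu p₀ := by
    refine (hcu.mem_of_tendsto h1 ?_).2
    filter_upwards [hmem] with p hp
    refine ⟨hp.1, ?_⟩
    change chartInv c p.2 (chartProj Eu Ecs c p w) ∈ Eu p
    rw [chartProj_apply, chartInv_chartMap (hW.subset_source hp.2)]
    exact projAlong_mem _ _ _
  have h4 : chartInv c p₀.2 (w - y) ∈ Ecs p₀ := by
    refine (hcs.mem_of_tendsto h2 ?_).2
    filter_upwards [hmem] with p hp
    refine ⟨hp.1, ?_⟩
    change chartInv c p.2 (w - chartProj Eu Ecs c p w) ∈ Ecs p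
    rw [map_sub, chartProj_apply, chartInv_chartMap (hW.subset_source hp.2)]
    exact sub_projAlong_mem (hE.isCompl p hp.1) _
  have h5 := projAlong_add (hE.isCompl p₀ hp₀.1) h3 h4
  rw [← map_add, add_sub_cancel] at h5
  rw [chartProj_apply, h5, chartMap_chartInv hsrc]

theorem inner_Dφ_Dφ (hS : S.IsComplete) (t s : ℝ) (p : Control S.U × M) (v w : TangentSpace (𝓡 d) p.2) :
    inner ℝ (S.Dφ t (S.Φ s p) (S.Dφ s p v)) (S.Dφ t (S.Φ s p) (S.Dφ s p w)) =
      inner ℝ (S.Dφ (t + s) p v) (S.Dφ (t + s) p w) := by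
  rw [real_inner_eq_norm_add_mul_self_sub_norm_mul_self_sub_norm_mul_self_div_two,
    real_inner_eq_norm_add_mul_self_sub_norm_mul_self_sub_norm_mul_self_div_two,
    ← map_add, ← map_add, ← map_add, norm_Dφ_Dφ hS, norm_Dφ_Dφ hS, norm_Dφ_Dφ hS]

theorem unstableDet_sq_mul_det_gram (t : ℝ) (p : Control S.U × M) {n : ℕ}
    (hn : Module.finrank ℝ (Eu p) = n) (a : Fin n → TangentSpace (𝓡 d) p.2) (ha : ∀ i, a i ∈ Eu p) :
    S.unstableDet Eu t p ^ 2 * (Matrix.of fun i j => inner ℝ (a i) (a j)).det =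
      (Matrix.of fun i j => inner ℝ (S.Dφ t p (a i)) (S.Dφ t p (a j))).det :=
  normDet_sq_mul_det_gram hn ((S.Dφ t p).toLinearMap.domRestrict (Eu p)) (fun i => ⟨a i, ha i⟩)

theorem unstableDet_nonneg (t : ℝ) (p : Control S.U × M) : 0 ≤ S.unstableDet Eu t p :=
  LinearMap.normDet_nonneg _

theorem unstableDet_pos (hS : S.IsComplete) (t : ℝ) (p : Control S.U × M) :
    0 < S.unstableDet Eu t p := by
  refine lt_of_le_of_ne (unstableDet_nonneg t p) (Ne.symm ?_)
  refine ((LinearMap.normDet_ne_zero_tfae _).out 0 4).2 fun v w hvw => ?_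
  have h1 : S.Dφ t p (v : TangentSpace (𝓡 d) p.2) = S.Dφ t p (w : TangentSpace (𝓡 d) p.2) := hvw
  have h2 := norm_Dφ_Dφ_of_add_eq_zero hS (neg_add_cancel t) p ((v : TangentSpace (𝓡 d) p.2) - w)
  rw [map_sub, h1, sub_self, map_zero, norm_zero] at h2
  exact Subtype.ext (sub_eq_zero.1 (norm_eq_zero.1 h2.symm))

theorem exists_orthonormal_Eu (p : Control S.U × M) : ∃ b : Fin (Module.finrank ℝ (Eu p)) →
    TangentSpace (𝓡 d) p.2, (∀ i, b i ∈ Eu p) ∧ (Matrix.of fun i j => inner ℝ (b i) (b j)).det = 1 := by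
  let b := stdOrthonormalBasis ℝ (Eu p)
  refine ⟨fun i => b i, fun i => (b i).2, ?_⟩
  have h : (Matrix.of fun i j => inner ℝ (b i : TangentSpace (𝓡 d) p.2) (b j)) = 1 := by
    ext i j
    rw [Matrix.one_apply]
    exact orthonormal_iff_ite.1 b.orthonormal i j
  rw [h, Matrix.det_one]

/-- Both steps are computed with the Gram determinants of one orthonormal frame of `E⁺` and its
images. Constancy of the dimension makes the image family long enough to be used as a frame at `Φ_s
p`. -/
theorem IsPartiallyHyperbolic.unstableDet_add (hE : S.IsPartiallyHyperbolic Q Eu Ecs)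
    (hS : S.IsComplete) (t s : ℝ) {p : Control S.U × M} (hp : p ∈ S.lift Q) :
    S.unstableDet Eu (t + s) p = S.unstableDet Eu s p * S.unstableDet Eu t (S.Φ s p) := by
  obtain ⟨b, hb, hb1⟩ := exists_orthonormal_Eu (Eu := Eu) p
  obtain ⟨k, l, hkl⟩ := hE.finrank_const
  have hn : Module.finrank ℝ (Eu (S.Φ s p)) = Module.finrank ℝ (Eu p) := by
    rw [(hkl p hp).1, (hkl _ (Φ_mem_lift hS hp s)).1]
  have h1 := unstableDet_sq_mul_det_gram (t + s) p rfl b hb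
  have h2 := unstableDet_sq_mul_det_gram s p rfl b hb
  have h3 := unstableDet_sq_mul_det_gram t (S.Φ s p) hn (fun i => S.Dφ s p (b i))
    fun i => hE.Dφ_mem_Eu hp s (hb i)
  simp only [inner_Dφ_Dφ hS] at h3
  rw [hb1, mul_one] at h1 h2
  rw [← h1, ← h2, ← mul_pow] at h3
  have h4 := (pow_left_inj₀ (mul_nonneg (unstableDet_nonneg _ _) (unstableDet_nonneg _ _))
    (unstableDet_nonneg _ _) two_ne_zero).1 h3
  rw [← h4, mul_comm]

theorem IsPartiallyHyperbolic.unstableDet_zero (hS : S.IsComplete) (p : Control S.U × M) :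
    S.unstableDet Eu 0 p = 1 := by
  obtain ⟨b, hb, hb1⟩ := exists_orthonormal_Eu (Eu := Eu) p
  have h2 := unstableDet_sq_mul_det_gram 0 p rfl b hb
  have h3 : ∀ v w : TangentSpace (𝓡 d) p.2, inner ℝ (S.Dφ 0 p v) (S.Dφ 0 p w) = inner ℝ v w := by
    intro v w
    rw [real_inner_eq_norm_add_mul_self_sub_norm_mul_self_sub_norm_mul_self_div_two,
      real_inner_eq_norm_add_mul_self_sub_norm_mul_self_sub_norm_mul_self_div_two,
      ← map_add, norm_Dφ_zero hS, norm_Dφ_zero hS, norm_Dφ_zero hS]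
  simp only [h3] at h2
  rw [hb1, mul_one] at h2
  exact (pow_eq_one_iff_of_nonneg (unstableDet_nonneg _ _) two_ne_zero).1 h2

/-- The unstable determinant is continuous on the lift. -/
theorem IsPartiallyHyperbolic.continuousOn_unstableDet (hE : S.IsPartiallyHyperbolic Q Eu Ecs)
    (hS : S.IsComplete) (hQ : IsCompact Q) (t : ℝ) :
    ContinuousOn (S.unstableDet Eu t) (S.lift Q) := by
  intro p₀ hp₀
  obtain ⟨W, C, hW⟩ := exists_isChartNhd (d := d) p₀.2
  obtain ⟨k, l, hkl⟩ := hE.finrank_const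
  have hsrc := hW.subset_source hW.mem
  obtain ⟨b, hb, hb1⟩ := exists_orthonormal_Eu (Eu := Eu) p₀
  have hWp : ∀ᶠ p in 𝓝[S.lift Q] p₀, p.2 ∈ W :=
    mem_nhdsWithin_of_mem_nhds (continuousAt_snd.preimage_mem_nhds (hW.isOpen.mem_nhds hW.mem))
  have hP : ContinuousWithinAt (chartProj Eu Ecs p₀.2) (S.lift Q) p₀ := by
    refine (hE.continuousOn_chartProj hS hQ hW p₀ ⟨hp₀, hW.mem⟩).mono_of_mem_nhdsWithin ?_
    filter_upwards [self_mem_nhdsWithin, hWp] with p h1 h2 using ⟨h1, h2⟩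
  -- The continuous unstable projection moves an orthonormal frame at `p₀` to a continuous frame of
  -- `E⁺` at nearby points of the lift. It is no longer orthonormal, which the quotient of Gram
  -- determinants corrects.
  let a : ∀ (p : Control S.U × M), Fin (Module.finrank ℝ (Eu p₀)) → TangentSpace (𝓡 d) p.2 :=
    fun p i => chartInv p₀.2 p.2 (chartProj Eu Ecs p₀.2 p (chartMap p₀.2 p₀.2 (b i)))
  have ha : ∀ᶠ p in 𝓝[S.lift Q] p₀, ∀ i, a p i ∈ Eu p := by
    filter_upwards [hWp] with p h1 i
    simp only [a]
    rw [chartProj_apply, chartInv_chartMap (hW.subset_source h1)]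
    exact projAlong_mem _ _ _
  have ha0 : ∀ i, a p₀ i = b i := fun i => by
    simp only [a]
    rw [chartProj_apply, chartInv_chartMap hsrc, chartInv_chartMap hsrc]
    simpa using projAlong_add (hE.isCompl p₀ hp₀) (hb i) (Ecs p₀).zero_mem
  have hac : ∀ i, ContinuousWithinAt (fun p : Control S.U × M =>
      (p.1, (⟨p.2, a p i⟩ : TangentBundle (𝓡 d) M))) (S.lift Q) p₀ := fun i =>
    ContinuousAt.comp_continuousWithinAt (f := fun p : Control S.U × M =>
      (p, chartProj Eu Ecs p₀.2 p (chartMap p₀.2 p₀.2 (b i))))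
      (continuousAt_prod_chartInv (S := S) _ hsrc)
      (continuousWithinAt_id.prodMk (hP.clm_apply continuousWithinAt_const))
  have hG : ContinuousWithinAt (fun p => (Matrix.of fun i j => inner ℝ (a p i) (a p j)).det)
      (S.lift Q) p₀ := by
    refine (continuous_id.matrix_det).continuousAt.comp_continuousWithinAt
      (continuousWithinAt_pi.2 fun i => continuousWithinAt_pi.2 fun j => ?_)
    exact ContinuousWithinAt.inner_bundle (F := EuclideanSpace ℝ (Fin d))
      (continuousAt_snd.comp_continuousWithinAt (hac i))
      (continuousAt_snd.comp_continuousWithinAt (hac j))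
  have hH : ContinuousWithinAt (fun p => (Matrix.of fun i j => inner ℝ (S.Dφ t p (a p i))
      (S.Dφ t p (a p j))).det) (S.lift Q) p₀ := by
    refine (continuous_id.matrix_det).continuousAt.comp_continuousWithinAt
      (continuousWithinAt_pi.2 fun i => continuousWithinAt_pi.2 fun j => ?_)
    have h1 := fun i => (continuous_snd.comp (continuous_TΦ hS t)).continuousAt.comp_continuousWithinAt
      (hac i)
    exact ContinuousWithinAt.inner_bundle (F := EuclideanSpace ℝ (Fin d)) (h1 i) (h1 j)
  have hG0 : (Matrix.of fun i j => inner ℝ (a p₀ i) (a p₀ j)).det ≠ 0 := by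
    simp only [ha0, hb1]
    exact one_ne_zero
  have heq : ∀ p ∈ S.lift Q, (∀ i, a p i ∈ Eu p) →
      (Matrix.of fun i j => inner ℝ (a p i) (a p j)).det ≠ 0 → S.unstableDet Eu t p =
      √((Matrix.of fun i j => inner ℝ (S.Dφ t p (a p i)) (S.Dφ t p (a p j))).det /
        (Matrix.of fun i j => inner ℝ (a p i) (a p j)).det) := by
    intro p hp hpa hp0
    have hn : Module.finrank ℝ (Eu p) = Module.finrank ℝ (Eu p₀) := by
      rw [(hkl p hp).1, (hkl _ hp₀).1]
    rw [← unstableDet_sq_mul_det_gram t p hn (a p) hpa, mul_div_cancel_right₀ _ hp0,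
      Real.sqrt_sq (unstableDet_nonneg _ _)]
  refine ((hH.div hG hG0).sqrt).congr_of_eventuallyEq ?_ (heq p₀ hp₀ (fun i => ?_) hG0)
  · filter_upwards [self_mem_nhdsWithin, ha, hG.eventually_ne hG0] with p h1 h2 h3
    exact heq p h1 h2 h3
  · rw [ha0]
    exact hb i

end System
end ControlAffine
-- Extending the unstable determinant to a cocycle
namespace ControlAffine

/-- Uniform continuity in the second variable on a compact subset of a product. -/
theorem exists_forall_dist_lt {A Z Y : Type*} [TopologicalSpace A] [PseudoMetricSpace Z]
    [PseudoMetricSpace Y] {X : Set (A × Z)} (hX : IsCompact X) {h : A × Z → Y}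
    (hh : ContinuousOn h X) {η : ℝ} (hη : 0 < η) :
    ∃ ρ > 0, ∀ a y y', (a, y) ∈ X → (a, y') ∈ X → dist y y' < ρ → dist (h (a, y)) (h (a, y')) < η := by
  have key : ∃ ρ > 0, ∀ p ∈ X, ∀ y', (p.1, y') ∈ X → dist p.2 y' < ρ →
      dist (h p) (h (p.1, y')) < η := by
    refine hX.induction_on (p := fun X' => ∃ ρ > 0, ∀ p ∈ X', ∀ y', (p.1, y') ∈ X → dist p.2 y' < ρ →
      dist (h p) (h (p.1, y')) < η) ⟨1, one_pos, by simp⟩ ?_ ?_ ?_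
    · rintro s s' hss ⟨K, hK, h⟩
      exact ⟨K, hK, fun p hp => h p (hss hp)⟩
    · rintro s s' ⟨K, hK, h⟩ ⟨K', hK', h'⟩
      refine ⟨min K K', by positivity, ?_⟩
      rintro p (hp | hp) y' hy' hd
      · exact h p hp y' hy' (hd.trans_le (min_le_left _ _))
      · exact h' p hp y' hy' (hd.trans_le (min_le_right _ _))
    · intro p₀ hp₀
      have h1 := (Metric.continuousWithinAt_iff'.1 (hh p₀ hp₀)) (η / 2) (by positivity)
      obtain ⟨O, hO, hOX⟩ := mem_nhdsWithin_iff_exists_mem_nhds_inter.1 h1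
      obtain ⟨V, hV, B, hB, hVB⟩ := mem_nhds_prod_iff.1 hO
      obtain ⟨r, hr, hrB⟩ := Metric.mem_nhds_iff.1 hB
      refine ⟨V ×ˢ Metric.ball p₀.2 (r / 2) ∩ X, ?_, r / 2, by positivity, ?_⟩
      · exact inter_mem (mem_nhdsWithin_of_mem_nhds
          (prod_mem_nhds hV (Metric.ball_mem_nhds _ (by positivity)))) self_mem_nhdsWithin
      · rintro p ⟨⟨hp1, hp2⟩, hpX⟩ y' hy' hd
        rw [Metric.mem_ball] at hp2
        have h2 : dist (h p) (h p₀) < η / 2 := hOX ⟨hVB ⟨hp1, hrB (by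
          rw [Metric.mem_ball]; linarith)⟩, hpX⟩
        have h3 : dist (h (p.1, y')) (h p₀) < η / 2 := hOX ⟨hVB ⟨hp1, hrB (by
          rw [Metric.mem_ball]; linarith [dist_triangle_left y' p₀.2 p.2])⟩, hy'⟩
        linarith [dist_triangle_right (h p) (h (p.1, y')) (h p₀)]
  obtain ⟨ρ, hρ, H⟩ := key
  exact ⟨ρ, hρ, fun a y y' hy hy' hd => H (a, y) hy y' hy' hd⟩

/-- A continuous function on a closed subset of a compact set extends continuously. -/
theorem exists_continuousOn_extension {Y : Type*} [TopologicalSpace Y] [R1Space Y] {X L : Set Y}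
    (hX : IsCompact X) (hL : IsClosed L) (hLX : L ⊆ X) {f : Y → ℝ} (hf : ContinuousOn f L) :
    ∃ g : Y → ℝ, ContinuousOn g X ∧ ∀ p ∈ L, g p = f p := by
  have := isCompact_iff_compactSpace.1 hX
  let L' : Set X := {x | (x : Y) ∈ L}
  have hL' : IsClosed L' := hL.preimage continuous_subtype_val
  have hf' : Continuous (fun x : L' => f (x : X)) :=
    hf.comp_continuous (continuous_subtype_val.comp continuous_subtype_val) fun x => x.2
  obtain ⟨G, hG⟩ := ContinuousMap.exists_restrict_eq hL' ⟨_, hf'⟩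
  classical
  refine ⟨fun y => if h : y ∈ X then G ⟨y, h⟩ else 0, ?_, fun p hp => ?_⟩
  · rw [continuousOn_iff_continuous_domRestrict]
    refine G.continuous.congr fun x => ?_
    simp
  · have h1 := DFunLike.congr_fun hG (⟨⟨p, hLX hp⟩, hp⟩ : L')
    simp only [dif_pos (hLX hp)]
    exact h1

/-- The topology is induced from a Hausdorff product, hence R1; this makes compact subspaces normal,
as Tietze's theorem requires. -/
instance {m : ℕ} (U : Set (EuclideanSpace ℝ (Fin m))) : R1Space (Control U) := R1Space.induced _

variable {d m : ℕ} {M : Type*} [MetricSpace M] [ChartedSpace (EuclideanSpace ℝ (Fin d)) M]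
  [IsManifold (𝓡 d) ∞ M]
    [RiemannianBundle (fun x : M => TangentSpace (𝓡 d) x)]
    [IsContMDiffRiemannianBundle (𝓡 d) ∞ (EuclideanSpace ℝ (Fin d))
      (fun x : M => TangentSpace (𝓡 d) x)] [IsRiemannianManifold (𝓡 d) M]

namespace System

variable {S : System d m M} {Q : Set M}
  {Eu Ecs : ∀ p : Control S.U × M, Submodule ℝ (TangentSpace (𝓡 d) p.2)}

/-- The product of a function along the first `n` points of the time-one orbit. -/
def cocycle (S : System d m M) (j : Control S.U × M → ℝ) (n : ℕ) (p : Control S.U × M) : ℝ :=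
  ∏ i ∈ Finset.range n, j (S.Φ i p)

theorem cocycle_add (hS : S.IsComplete) (j : Control S.U × M → ℝ) (n k : ℕ) (p : Control S.U × M) :
    S.cocycle j (n + k) p = S.cocycle j n p * S.cocycle j k (S.Φ n p) := by
  rw [cocycle, Finset.prod_range_add, cocycle, cocycle]
  congr 1
  refine Finset.prod_congr rfl fun i _ => ?_
  rw [← Φ_add hS, Nat.cast_add, add_comm]

/-- Tietze's theorem is applied to the logarithm, so that the extension stays positive. -/
theorem IsPartiallyHyperbolic.exists_extension (hE : S.IsPartiallyHyperbolic Q Eu Ecs)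
    (hS : S.IsComplete) (hQ : IsCompact Q) {X : Set M} (hX : IsCompact X) (hQX : Q ⊆ X) :
    ∃ j : Control S.U × M → ℝ, ContinuousOn j (univ ×ˢ X) ∧ (∀ p, 0 < j p) ∧
      ∀ p ∈ S.lift Q, j p = S.unstableDet Eu 1 p := by
  obtain ⟨g, hg, hgL⟩ := exists_continuousOn_extension (isCompact_univ_prod S hX)
    (isClosed_lift hS hQ.isClosed) (fun p hp => ⟨mem_univ _, hQX (snd_mem_of_mem_lift hS hp)⟩)
    ((hE.continuousOn_unstableDet hS hQ 1).log fun p _ => (unstableDet_pos hS 1 p).ne')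
  refine ⟨fun p => Real.exp (g p), hg.rexp, fun p => Real.exp_pos _, fun p hp => ?_⟩
  beta_reduce
  rw [hgL p hp, Real.exp_log (unstableDet_pos hS 1 p)]

theorem IsPartiallyHyperbolic.cocycle_eq_unstableDet (hE : S.IsPartiallyHyperbolic Q Eu Ecs)
    (hS : S.IsComplete) {j : Control S.U × M → ℝ}
    (hj : ∀ p ∈ S.lift Q, j p = S.unstableDet Eu 1 p) (n : ℕ) {p : Control S.U × M}
    (hp : p ∈ S.lift Q) : S.cocycle j n p = S.unstableDet Eu n p := by
  induction n with
  | zero => simp [cocycle, unstableDet_zero hS]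
  | succ n ih =>
    rw [cocycle, Finset.prod_range_succ, hj _ (Φ_mem_lift hS hp _), Nat.cast_succ, add_comm,
      hE.unstableDet_add hS _ _ hp, ← ih, cocycle]

/-- Being a product along the orbit, the cocycle is multiplicative and positive everywhere. Only its
continuity needs the orbit segment to stay over `X`, where `j` is continuous. -/
theorem IsPartiallyHyperbolic.isExtension_cocycle (hE : S.IsPartiallyHyperbolic Q Eu Ecs)
    (hS : S.IsComplete) {X : Set M} (hQX : Q ⊆ interior X)
    {j : Control S.U × M → ℝ} (hjc : ContinuousOn j (univ ×ˢ X)) (hj0 : ∀ p, 0 < j p)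
    (hj : ∀ p ∈ S.lift Q, j p = S.unstableDet Eu 1 p) :
    S.IsExtension Q Eu {p | p.2 ∈ interior X} (S.cocycle j) where
  nhds n := by
    have h : IsOpen {p : Control S.U × M | ∀ i < n, S.Φ i p ∈ {p | p.2 ∈ interior X}} := by
      have : {p : Control S.U × M | ∀ i < n, S.Φ i p ∈ {p | p.2 ∈ interior X}} =
          ⋂ i ∈ Finset.range n, (fun p => (S.Φ i p).2) ⁻¹' interior X := by
        ext p
        simp only [mem_iInter, Finset.mem_range]
        rfl
      rw [this]
      exact isOpen_biInter_finset fun i _ =>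
        isOpen_interior.preimage (continuous_snd.comp (continuous_Φ hS i))
    exact h.mem_nhdsSet.2 fun p hp i _ => hQX (snd_mem_of_mem_lift hS (Φ_mem_lift hS hp i))
  continuousOn n := by
    refine continuousOn_finsetProd _ fun i hi => ?_
    exact hjc.comp (continuous_Φ hS i).continuousOn fun p hp =>
      ⟨mem_univ _, interior_subset (hp i (Finset.mem_range.1 hi))⟩
  pos n p _ := Finset.prod_pos fun i _ => hj0 _
  eq n p hp := hE.cocycle_eq_unstableDet hS hj n hp
  mul n k p _ := cocycle_add hS j n k p

end System
end ControlAffine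
-- Volumes of orbit balls for sequences of dominated maps
namespace ControlAffine

section Distortion

variable {A : Type*} [NormedAddCommGroup A] [NormedSpace ℝ A] [FiniteDimensional ℝ A]
  [MeasurableSpace A] [BorelSpace A] (μ : Measure A) [μ.IsAddHaarMeasure]

/-- Maps close to the identity change volumes by a factor of at most two. -/
def HasDistortionBound (η : ℝ≥0) : Prop :=
  ∀ (s : Set A) (f : A → A), ApproximatesLinearOn f (ContinuousLinearMap.id ℝ A) s η →
    μ (f '' s) ≤ 2 * μ s ∧ μ s ≤ 2 * μ (f '' s)

/-- The determinant of the identity lies strictly between `1 / 2` and `2`, and maps approximating it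
well enough distort volume by factors in this range. -/
theorem exists_hasDistortionBound : ∃ η₀ : ℝ≥0, 0 < η₀ ∧ ∀ η ≤ η₀, HasDistortionBound μ η := by
  have hd : (ContinuousLinearMap.id ℝ A).det = 1 := LinearMap.det_id
  have h1 := addHaar_image_le_mul_of_det_lt μ (ContinuousLinearMap.id ℝ A) (m := 2)
    (by rw [hd]; simp)
  have h2 := mul_le_addHaar_image_of_lt_det μ (ContinuousLinearMap.id ℝ A) (m := 1 / 2)
    (by rw [hd]; simp)
  obtain ⟨η₀, ⟨h1, h2⟩, hη₀⟩ := ((h1.and h2).and self_mem_nhdsWithin).exists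
  refine ⟨η₀, hη₀, fun η hη s f hf => ⟨h1 s f (hf.mono_num hη), ?_⟩⟩
  have h3 := h2 s f (hf.mono_num hη)
  calc μ s = 2 * (((1 / 2 : ℝ≥0) : ℝ≥0∞) * μ s) := by
        rw [← mul_assoc]
        simp [ENNReal.mul_inv_cancel]
    _ ≤ _ := by gcongr

variable {μ}

/-- Composing with the inverse of `P` turns an approximation of `P` with error `η'` into one of the
identity with error at most `η' / a`. The allowed error therefore depends on `P` only through its
expansion constant. -/
theorem HasDistortionBound.measure_image {a : ℝ} (ha : 0 < a) {η η' : ℝ≥0} (h : HasDistortionBound μ η)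
    (hη : (η' : ℝ) ≤ η * a) {P : A →L[ℝ] A} (hP : ∀ v, a * ‖v‖ ≤ ‖P v‖) {s : Set A} {f : A → A}
    (hf : ApproximatesLinearOn f P s η') :
    μ (f '' s) ≤ 2 * (ENNReal.ofReal |P.det| * μ s) ∧
      ENNReal.ofReal |P.det| * μ s ≤ 2 * μ (f '' s) := by
  have hinj : Function.Injective P.toLinearMap := by
    refine (injective_iff_map_eq_zero _).2 fun v hv => ?_
    have h1 := hP v
    rw [show P v = 0 from hv, norm_zero] at h1
    exact norm_le_zero_iff.1 (nonpos_of_mul_nonpos_right h1 ha)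
  let e := LinearEquiv.ofInjectiveEndo P.toLinearMap hinj
  have he : ∀ v, P (e.symm v) = v := fun v => e.apply_symm_apply v
  have hg : ApproximatesLinearOn (fun x => e.symm (f x)) (ContinuousLinearMap.id ℝ A) s η := by
    intro x hx y hy
    have h1 := hf x hx y hy
    have h2 := hP (e.symm (f x) - e.symm (f y) - (x - y))
    rw [map_sub, map_sub, he, he] at h2
    refine le_of_mul_le_mul_left ?_ ha
    calc _ ≤ _ := h2
      _ ≤ _ := h1
      _ ≤ η * a * ‖x - y‖ := by gcongr
      _ = _ := by ring
  have himg : μ (f '' s) = ENNReal.ofReal |P.det| * μ ((fun x => e.symm (f x)) '' s) := by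
    have := Measure.addHaar_image_continuousLinearMap μ P ((fun x => e.symm (f x)) '' s)
    rw [image_image] at this
    simp only [he] at this
    exact this
  obtain ⟨h1, h2⟩ := h s _ hg
  rw [himg]
  constructor
  · calc _ ≤ ENNReal.ofReal |P.det| * (2 * μ s) := by gcongr
      _ = _ := by ring
  · calc _ ≤ ENNReal.ofReal |P.det| * (2 * μ ((fun x => e.symm (f x)) '' s)) := by gcongr
      _ = _ := by ring

end Distortion

section Sequences

variable {A B : Type*} [NormedAddCommGroup A] [NormedSpace ℝ A] [NormedAddCommGroup B] [NormedSpace ℝ B]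

/-- The set of points whose orbit under `F 0, …, F (n - 1)` stays `δ`-close to the origin. -/
def seqBall (δ : ℝ) : ℕ → (ℕ → A × B → A × B) → Set (A × B)
  | 0, _ => Metric.closedBall 0 δ
  | n + 1, F => Metric.closedBall 0 δ ∩ F 0 ⁻¹' seqBall δ n (fun j => F (j + 1))

/-- `F` fixes the origin and is close to the block diagonal map of an expansion `P` and a map `C`
of small norm. -/
structure IsDominatedStep (F : A × B → A × B) (P : A →L[ℝ] A) (C : B →L[ℝ] B) (a b : ℝ) (η : ℝ≥0)
    (δ : ℝ) : Prop where
  zero : F 0 = 0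
  approx : ApproximatesLinearOn F (P.prodMap C) (Metric.closedBall 0 δ) η
  expand : ∀ v, a * ‖v‖ ≤ ‖P v‖
  bound : ∀ v, ‖C v‖ ≤ b * ‖v‖

variable {F : A × B → A × B} {P : A →L[ℝ] A} {C : B →L[ℝ] B} {a b δ : ℝ} {η : ℝ≥0}

namespace IsDominatedStep

theorem fst_sub_le (h : IsDominatedStep F P C a b η δ) {w w' : A × B} (hw : w ∈ Metric.closedBall 0 δ)
    (hw' : w' ∈ Metric.closedBall 0 δ) :
    ‖(F w).1 - (F w').1 - P (w.1 - w'.1)‖ ≤ η * ‖w - w'‖ :=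
  (norm_fst_le _).trans (h.approx w hw w' hw')

theorem le_norm_fst (h : IsDominatedStep F P C a b η δ) {w w' : A × B}
    (hw : w ∈ Metric.closedBall 0 δ) (hw' : w' ∈ Metric.closedBall 0 δ) :
    a * ‖w.1 - w'.1‖ - η * ‖w - w'‖ ≤ ‖(F w).1 - (F w').1‖ := by
  have h1 := h.fst_sub_le hw hw'
  have h2 := h.expand (w.1 - w'.1)
  have h3 := norm_sub_norm_le (P (w.1 - w'.1)) ((F w).1 - (F w').1)
  rw [norm_sub_rev (P (w.1 - w'.1))] at h3
  linarith

theorem norm_snd_le (h : IsDominatedStep F P C a b η δ) {w w' : A × B}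
    (hw : w ∈ Metric.closedBall 0 δ) (hw' : w' ∈ Metric.closedBall 0 δ) :
    ‖(F w).2 - (F w').2‖ ≤ b * ‖w.2 - w'.2‖ + η * ‖w - w'‖ := by
  have h1 : ‖(F w).2 - (F w').2 - C (w.2 - w'.2)‖ ≤ η * ‖w - w'‖ :=
    (_root_.norm_snd_le _).trans (h.approx w hw w' hw')
  have h2 := h.bound (w.2 - w'.2)
  have h3 := norm_sub_norm_le ((F w).2 - (F w').2) (C (w.2 - w'.2))
  linarith

/-- For a difference in the horizontal cone, the first component grows at least by `a - η` and the
second becomes at most `b + η` times the first, so `b + 2 * η ≤ a` keeps the image in the cone. -/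
theorem cone (h : IsDominatedStep F P C a b η δ) (hab : b + 2 * η ≤ a) (hb : 1 ≤ b) {w w' : A × B}
    (hw : w ∈ Metric.closedBall 0 δ) (hw' : w' ∈ Metric.closedBall 0 δ)
    (hc : ‖w.2 - w'.2‖ ≤ ‖w.1 - w'.1‖) : ‖(F w).2 - (F w').2‖ ≤ ‖(F w).1 - (F w').1‖ ∧
      ‖w.1 - w'.1‖ ≤ ‖(F w).1 - (F w').1‖ := by
  have h1 := h.le_norm_fst hw hw'
  have h2 := h.norm_snd_le hw hw'
  have h3 : ‖w - w'‖ = ‖w.1 - w'.1‖ := by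
    rw [Prod.norm_def]
    exact max_eq_left hc
  rw [h3] at h1 h2
  have h4 : b * ‖w.2 - w'.2‖ ≤ b * ‖w.1 - w'.1‖ := by gcongr
  have h5 := mul_le_mul_of_nonneg_right hab (norm_nonneg (w.1 - w'.1))
  have h6 := mul_le_mul_of_nonneg_right hb (norm_nonneg (w.1 - w'.1))
  have h7 := mul_nonneg η.coe_nonneg (norm_nonneg (w.1 - w'.1))
  constructor <;> linarith

end IsDominatedStep

theorem isClosed_seqBall {F : ℕ → A × B → A × B} {n : ℕ}
    (hF : ∀ j < n, ContinuousOn (F j) (Metric.closedBall 0 δ)) : IsClosed (seqBall δ n F) := by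
  induction n generalizing F with
  | zero => exact Metric.isClosed_closedBall
  | succ n ih =>
    exact (hF 0 (by omega)).preimage_isClosed_of_isClosed Metric.isClosed_closedBall
      (ih fun j hj => hF (j + 1) (by omega))

theorem seqBall_subset {F : ℕ → A × B → A × B} {n : ℕ} :
    seqBall δ n F ⊆ Metric.closedBall 0 δ := by
  cases n with
  | zero => exact subset_rfl
  | succ n => exact inter_subset_left

end Sequences

section Volume

variable {A B : Type*} [NormedAddCommGroup A] [NormedSpace ℝ A] [FiniteDimensional ℝ A]
  [MeasurableSpace A] [BorelSpace A] {μ : Measure A} [μ.IsAddHaarMeasure]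
  [NormedAddCommGroup B] [NormedSpace ℝ B]
  {P : ℕ → A →L[ℝ] A} {C : ℕ → B →L[ℝ] B} {a b δ : ℝ} {η η₀ : ℝ≥0}

/-- A set whose differences lie in the horizontal cone is a graph over its projection, and `cone`
keeps it so under each map. The induced map between projections approximates `P 0`, hence multiplies
volume by its determinant up to a factor 2. After all steps the projection still lies in the
`δ`-ball. -/
theorem prod_det_mul_measure_le (hη₀ : HasDistortionBound μ η₀) (hη : (η : ℝ) ≤ η₀ * a)
    (hab : b + 2 * η ≤ a) (hb : 1 ≤ b) {n : ℕ} {F : ℕ → A × B → A × B}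
    (hF : ∀ j < n, IsDominatedStep (F j) (P j) (C j) a b η δ) {G : Set (A × B)}
    (hG : G ⊆ seqBall δ n F) (hc : ∀ w ∈ G, ∀ w' ∈ G, ‖w.2 - w'.2‖ ≤ ‖w.1 - w'.1‖) :
    (∏ j ∈ Finset.range n, ENNReal.ofReal |(P j).det|) * μ (Prod.fst '' G) ≤
      2 ^ n * μ (Metric.closedBall 0 δ) := by
  have ha : 0 < a := by linarith [η.coe_nonneg]
  induction n generalizing F G P C with
  | zero =>
    simp only [Finset.range_zero, Finset.prod_empty, one_mul, pow_zero]
    refine measure_mono ?_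
    rintro _ ⟨w, hw, rfl⟩
    exact mem_closedBall_zero_iff.2 ((norm_fst_le w).trans (mem_closedBall_zero_iff.1 (hG hw)))
  | succ n ih =>
    have h0 := hF 0 (by omega)
    have hGb : G ⊆ Metric.closedBall 0 δ := hG.trans seqBall_subset
    have h1 := ih (P := fun j => P (j + 1)) (C := fun j => C (j + 1)) (F := fun j => F (j + 1))
      (G := F 0 '' G) (fun j hj => hF (j + 1) (by omega))
      (by rintro _ ⟨w, hw, rfl⟩; exact (hG hw).2)
      (by
        rintro _ ⟨w, hw, rfl⟩ _ ⟨w', hw', rfl⟩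
        exact (h0.cone hab hb (hGb hw) (hGb hw') (hc w hw w' hw')).1)
    have hs : ∀ x ∈ Prod.fst '' G, ∃ w ∈ G, w.1 = x := fun x hx => hx
    choose! s hsG hs using hs
    have h2 : ApproximatesLinearOn (fun x => (F 0 (s x)).1) (P 0) (Prod.fst '' G) η := by
      intro x hx y hy
      have h3 := h0.fst_sub_le (hGb (hsG x hx)) (hGb (hsG y hy))
      have h4 : ‖s x - s y‖ = ‖x - y‖ := by
        have h5 := hc _ (hsG x hx) _ (hsG y hy)
        rw [hs x hx, hs y hy] at h5
        rw [Prod.norm_def, Prod.fst_sub, Prod.snd_sub, hs x hx, hs y hy]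
        exact max_eq_left h5
      rwa [h4, hs x hx, hs y hy] at h3
    have h5 := (hη₀.measure_image ha hη h0.expand h2).2
    have h6 : μ ((fun x => (F 0 (s x)).1) '' (Prod.fst '' G)) ≤ μ (Prod.fst '' (F 0 '' G)) := by
      refine measure_mono ?_
      rintro _ ⟨x, hx, rfl⟩
      exact ⟨_, ⟨_, hsG x hx, rfl⟩, rfl⟩
    rw [Finset.prod_range_succ', mul_assoc]
    calc _ ≤ (∏ j ∈ Finset.range n, ENNReal.ofReal |(P (j + 1)).det|) *
          (2 * μ (Prod.fst '' (F 0 '' G))) := by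
          refine mul_le_mul_right (h5.trans ?_) _
          gcongr
      _ = 2 * ((∏ j ∈ Finset.range n, ENNReal.ofReal |(P (j + 1)).det|) *
          μ (Prod.fst '' (F 0 '' G))) := by ring
      _ ≤ 2 * (2 ^ n * μ (Metric.closedBall 0 δ)) := by gcongr
      _ = _ := by ring

/-- A graph transform. The image of the graph of `γ` covers the `δ`-ball again, since `(a - 2 * η) *
δ ≥ δ`, so it contains the graph of a new 1-Lipschitz function there. The height bound `max ‖v‖ σ`
reproduces itself with `(b + η) * σ`: where `γ` is below `‖v‖`, domination makes the new height
smaller than the new horizontal distance; elsewhere it grows by at most `b + η`. The condition on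
`(b + η) ^ n * σ` keeps every graph in the `δ`-ball. -/
theorem le_prod_det_mul_measure (hη₀ : HasDistortionBound μ η₀) (hη : (η : ℝ) ≤ η₀ * a)
    (hab : b + 2 * η ≤ a) (hb : 1 ≤ b) {n : ℕ} {F : ℕ → A × B → A × B}
    (hF : ∀ j < n, IsDominatedStep (F j) (P j) (C j) a b η δ) {σ : ℝ} (hσ0 : 0 ≤ σ)
    (hσ : (b + η) ^ n * σ ≤ δ) {γ : A → B}
    (hγ : ∀ v ∈ Metric.closedBall (0 : A) δ, ∀ v' ∈ Metric.closedBall (0 : A) δ,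
      ‖γ v - γ v'‖ ≤ ‖v - v'‖)
    (hγσ : ∀ v ∈ Metric.closedBall (0 : A) δ, ‖γ v‖ ≤ max ‖v‖ σ) :
    μ (Metric.closedBall 0 δ) ≤ 2 ^ n * (∏ j ∈ Finset.range n, ENNReal.ofReal |(P j).det|) *
      μ {v | v ∈ Metric.closedBall 0 δ ∧ (v, γ v) ∈ seqBall δ n F} := by
  have hη0 := η.coe_nonneg
  have ha : 0 < a := by linarith
  have hball : ∀ (n : ℕ) (σ : ℝ), 0 ≤ σ → (b + η) ^ n * σ ≤ δ → ∀ γ : A → B,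
      (∀ v ∈ Metric.closedBall (0 : A) δ, ‖γ v‖ ≤ max ‖v‖ σ) →
      σ ≤ δ ∧ ∀ v ∈ Metric.closedBall (0 : A) δ, (v, γ v) ∈ Metric.closedBall (0 : A × B) δ := by
    intro n σ hσ0 hσ γ hγσ
    have h1 : σ ≤ δ := (le_mul_of_one_le_left hσ0 (one_le_pow₀ (by linarith))).trans hσ
    refine ⟨h1, fun v hv => ?_⟩
    have hv' := mem_closedBall_zero_iff.1 hv
    rw [mem_closedBall_zero_iff, Prod.norm_def]
    exact max_le hv' ((hγσ v hv).trans (max_le hv' h1))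
  induction n generalizing F P C σ γ with
  | zero =>
    simp only [Finset.range_zero, Finset.prod_empty, one_mul, pow_zero]
    exact measure_mono fun v hv => ⟨hv, (hball 0 σ hσ0 hσ γ hγσ).2 v hv⟩
  | succ n ih =>
    have h0 := hF 0 (by omega)
    obtain ⟨hσδ, hmem⟩ := hball _ σ hσ0 hσ γ hγσ
    have hδ : 0 ≤ δ := hσ0.trans hσδ
    have hcone : ∀ v ∈ Metric.closedBall (0 : A) δ, ∀ v' ∈ Metric.closedBall (0 : A) δ,
        ‖(F 0 (v, γ v)).2 - (F 0 (v', γ v')).2‖ ≤ ‖(F 0 (v, γ v)).1 - (F 0 (v', γ v')).1‖ ∧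
        ‖v - v'‖ ≤ ‖(F 0 (v, γ v)).1 - (F 0 (v', γ v')).1‖ := fun v hv v' hv' =>
      h0.cone hab hb (hmem v hv) (hmem v' hv') (hγ v hv v' hv')
    have h2 : ApproximatesLinearOn (fun v => (F 0 (v, γ v)).1) (P 0) (Metric.closedBall 0 δ) η := by
      intro x hx y hy
      have h3 := h0.fst_sub_le (hmem x hx) (hmem y hy)
      have h4 : ‖(x, γ x) - (y, γ y)‖ = ‖x - y‖ := by
        rw [Prod.norm_def]
        exact max_eq_left (hγ x hx y hy)
      rwa [h4] at h3
    have hzero : ((0 : A), (0 : B)) ∈ Metric.closedBall (0 : A × B) δ := by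
      rw [mem_closedBall_zero_iff]; simpa using hδ
    have hsurj : SurjOn (fun v => (F 0 (v, γ v)).1) (Metric.closedBall 0 δ)
        (Metric.closedBall 0 δ) := by
      have hinj : Function.Injective (P 0).toLinearMap := by
        refine (injective_iff_map_eq_zero _).2 fun v hv => ?_
        have h1 := h0.expand v
        rw [show P 0 v = 0 from hv, norm_zero] at h1
        exact norm_le_zero_iff.1 (nonpos_of_mul_nonpos_right h1 ha)
      let e := LinearEquiv.ofInjectiveEndo (P 0).toLinearMap hinj
      have he : ∀ v, P 0 (e.symm v) = v := fun v => e.apply_symm_apply v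
      let R : (P 0).NonlinearRightInverse := ⟨e.symm, Real.toNNReal a⁻¹, fun y => by
        have h1 := h0.expand (e.symm y)
        rw [he] at h1
        rw [Real.coe_toNNReal _ (by positivity), ← div_eq_inv_mul, le_div_iff₀ ha, mul_comm]
        exact h1, he⟩
      have h3 := h2.surjOn_closedBall_of_nonlinearRightInverse R hδ subset_rfl
      refine h3.mono subset_rfl ?_
      have h4 : ((R.nnnorm : ℝ)⁻¹ : ℝ) = a := by
        change ((Real.toNNReal a⁻¹ : ℝ≥0) : ℝ)⁻¹ = a
        rw [Real.coe_toNNReal _ (by positivity), inv_inv]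
      rw [h4]
      refine Metric.closedBall_subset_closedBall' ?_
      have h5 : dist (0 : A) (F 0 (0, γ 0)).1 ≤ η * σ := by
        have h6 := h0.fst_sub_le (hmem 0 (Metric.mem_closedBall_self hδ)) hzero
        rw [show F 0 ((0 : A), (0 : B)) = 0 from h0.zero] at h6
        simp only [Prod.fst_zero, sub_zero, map_zero] at h6
        rw [dist_zero_left]
        refine h6.trans ?_
        gcongr
        have h7 := hγσ 0 (Metric.mem_closedBall_self hδ)
        rw [norm_zero, max_eq_right hσ0] at h7
        rw [Prod.norm_def]
        exact max_le (by simpa using hσ0) (by simpa using h7)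
      have h6 : (η : ℝ) * σ ≤ η * δ := by gcongr
      nlinarith
    have hr : ∀ y ∈ Metric.closedBall (0 : A) δ, ∃ v ∈ Metric.closedBall (0 : A) δ,
        (F 0 (v, γ v)).1 = y := fun y hy => hsurj hy
    choose! r hrb hr using hr
    have h3 := ih (P := fun j => P (j + 1)) (C := fun j => C (j + 1)) (F := fun j => F (j + 1))
      (fun j hj => hF (j + 1) (by omega)) (σ := (b + η) * σ) (γ := fun y => (F 0 (r y, γ (r y))).2)
      (by positivity) (by rw [← mul_assoc, ← pow_succ]; exact hσ)
      (fun y hy y' hy' => by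
        have h4 := (hcone _ (hrb y hy) _ (hrb y' hy')).1
        rwa [hr y hy, hr y' hy'] at h4)
      (fun y hy => by
        have h4 := h0.norm_snd_le (hmem _ (hrb y hy)) hzero
        have h5 := h0.le_norm_fst (hmem _ (hrb y hy)) hzero
        rw [show F 0 ((0 : A), (0 : B)) = 0 from h0.zero] at h4 h5
        simp only [Prod.snd_zero, Prod.fst_zero, sub_zero, hr y hy] at h4 h5
        rw [← Prod.zero_eq_mk, sub_zero, Prod.norm_def] at h4 h5
        simp only at h4 h5
        rcases le_or_gt ‖γ (r y)‖ ‖r y‖ with h6 | h6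
        · rw [max_eq_left h6] at h4 h5
          refine le_max_of_le_left ?_
          have h7 : b * ‖γ (r y)‖ ≤ b * ‖r y‖ := by gcongr
          have h8 := mul_le_mul_of_nonneg_right hab (norm_nonneg (r y))
          linarith
        · rw [max_eq_right h6.le] at h4 h5
          refine le_max_of_le_right ?_
          have h7 : ‖γ (r y)‖ ≤ σ := (le_max_iff.1 (hγσ _ (hrb y hy))).resolve_left h6.not_ge
          have h8 := mul_le_mul_of_nonneg_left h7 (by positivity : 0 ≤ b + η)
          linarith)
    have h4 : {y | y ∈ Metric.closedBall (0 : A) δ ∧ (y, (F 0 (r y, γ (r y))).2) ∈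
        seqBall δ n (fun j => F (j + 1))} ⊆ (fun v => (F 0 (v, γ v)).1) ''
        {v | v ∈ Metric.closedBall 0 δ ∧ (v, γ v) ∈ seqBall δ (n + 1) F} := by
      rintro y ⟨hy, hy'⟩
      refine ⟨r y, ⟨hrb y hy, hmem _ (hrb y hy), ?_⟩, hr y hy⟩
      have h5 : F 0 (r y, γ (r y)) = (y, (F 0 (r y, γ (r y))).2) := Prod.ext (hr y hy) rfl
      rw [mem_preimage, h5]
      exact hy'
    have h5 := (hη₀.measure_image ha hη h0.expand (h2.mono_set
      (s := {v | v ∈ Metric.closedBall 0 δ ∧ (v, γ v) ∈ seqBall δ (n + 1) F}) fun v hv => hv.1)).1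
    refine h3.trans ?_
    rw [Finset.prod_range_succ', pow_succ]
    calc _ ≤ 2 ^ n * (∏ j ∈ Finset.range n, ENNReal.ofReal |(P (j + 1)).det|) *
          (2 * (ENNReal.ofReal |(P 0).det| *
            μ {v | v ∈ Metric.closedBall 0 δ ∧ (v, γ v) ∈ seqBall δ (n + 1) F})) :=
          mul_le_mul_right ((measure_mono h4).trans h5) _
      _ = _ := by ring

variable [FiniteDimensional ℝ B] [MeasurableSpace B] [BorelSpace B] {ν : Measure B}
  [ν.IsAddHaarMeasure]

/-- Upper bound for the volume of the set of points whose orbits stay close to the origin. -/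
theorem prod_det_mul_measure_seqBall_le (hη₀ : HasDistortionBound μ η₀) (hη : (η : ℝ) ≤ η₀ * a)
    (hab : b + 2 * η ≤ a) (hb : 1 ≤ b) {n : ℕ} {F : ℕ → A × B → A × B}
    (hF : ∀ j < n, IsDominatedStep (F j) (P j) (C j) a b η δ) :
    (∏ j ∈ Finset.range n, ENNReal.ofReal |(P j).det|) * (μ.prod ν) (seqBall δ n F) ≤
      2 ^ n * μ (Metric.closedBall 0 δ) * ν (Metric.closedBall 0 δ) := by
  have hcl : IsClosed (seqBall δ n F) := isClosed_seqBall fun j hj => (hF j hj).approx.continuousOn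
  -- Fubini over the second coordinate: points of one slice differ horizontally, so the bound for
  -- cone sets applies, and slices at heights above `δ` are empty.
  rw [Measure.prod_apply_symm hcl.measurableSet, ← lintegral_const_mul' _ _
    (ENNReal.prod_lt_top fun _ _ => ENNReal.ofReal_lt_top).ne]
  calc _ ≤ ∫⁻ z, (Metric.closedBall (0 : B) δ).indicator
        (fun _ => 2 ^ n * μ (Metric.closedBall 0 δ)) z ∂ν := by
        refine lintegral_mono fun z => ?_
        by_cases hz : z ∈ Metric.closedBall (0 : B) δ
        · rw [indicator_of_mem hz]
          have h1 := prod_det_mul_measure_le (μ := μ) hη₀ hη hab hb hF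
            (G := seqBall δ n F ∩ {w | w.2 = z}) inter_subset_left (by
              rintro w ⟨-, hw⟩ w' ⟨-, hw'⟩
              have hw : w.2 = z := hw
              have hw' : w'.2 = z := hw'
              rw [hw, hw', sub_self, norm_zero]
              exact norm_nonneg _)
          refine le_trans ?_ h1
          gcongr
          intro v hv
          exact ⟨(v, z), ⟨hv, rfl⟩, rfl⟩
        · rw [indicator_of_notMem hz]
          have h1 : (fun v : A => (v, z)) ⁻¹' seqBall δ n F = ∅ := by
            refine eq_empty_of_forall_notMem fun v hv => hz ?_
            have h2 := mem_closedBall_zero_iff.1 (seqBall_subset hv)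
            exact mem_closedBall_zero_iff.2 ((_root_.norm_snd_le ((v, z) : A × B)).trans h2)
          rw [h1]
          simp
    _ = _ := by
        rw [lintegral_indicator measurableSet_closedBall, setLIntegral_const]

/-- Lower bound for the volume of the set of points whose orbits stay close to the origin. -/
theorem le_prod_det_mul_measure_seqBall (hη₀ : HasDistortionBound μ η₀) (hη : (η : ℝ) ≤ η₀ * a)
    (hab : b + 2 * η ≤ a) (hb : 1 ≤ b) {n : ℕ} {F : ℕ → A × B → A × B}
    (hF : ∀ j < n, IsDominatedStep (F j) (P j) (C j) a b η δ) {σ : ℝ} (hσ0 : 0 ≤ σ)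
    (hσ : (b + η) ^ n * σ ≤ δ) :
    μ (Metric.closedBall 0 δ) * ν (Metric.closedBall 0 σ) ≤
      2 ^ n * (∏ j ∈ Finset.range n, ENNReal.ofReal |(P j).det|) * (μ.prod ν) (seqBall δ n F) := by
  have hcl : IsClosed (seqBall δ n F) := isClosed_seqBall fun j hj => (hF j hj).approx.continuousOn
  -- Fubini again: only slices of height at most `σ` are used, as graphs of constant functions.
  rw [Measure.prod_apply_symm hcl.measurableSet, ← lintegral_const_mul' _ _
    (ENNReal.mul_lt_top (by simp) (ENNReal.prod_lt_top fun _ _ => ENNReal.ofReal_lt_top)).ne]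
  calc _ = ∫⁻ z, (Metric.closedBall (0 : B) σ).indicator
        (fun _ => μ (Metric.closedBall 0 δ)) z ∂ν := by
        rw [lintegral_indicator measurableSet_closedBall, setLIntegral_const]
    _ ≤ _ := by
        refine lintegral_mono fun z => ?_
        by_cases hz : z ∈ Metric.closedBall (0 : B) σ
        · rw [indicator_of_mem hz]
          refine (le_prod_det_mul_measure hη₀ hη hab hb hF hσ0 hσ (γ := fun _ => z)
            (fun v _ v' _ => by rw [sub_self, norm_zero]; exact norm_nonneg _)
            (fun v _ => le_max_of_le_right (mem_closedBall_zero_iff.1 hz))).trans ?_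
          gcongr
          exact fun v hv => hv.2
        · rw [indicator_of_notMem hz]
          exact zero_le

end Volume
end ControlAffine
-- Hausdorff measure and adapted linear coordinates
namespace ControlAffine

section HausdorffMeasure

theorem _root_.LipschitzOnWith.euclideanHausdorffMeasure_image_le {X Y : Type*} [EMetricSpace X]
    [MeasurableSpace X] [BorelSpace X] [EMetricSpace Y] [MeasurableSpace Y] [BorelSpace Y]
    {K : ℝ≥0} {f : X → Y} {s : Set X} (h : LipschitzOnWith K f s) (d : ℕ) :
    (μHE[d] : Measure Y) (f '' s) ≤ (K : ℝ≥0∞) ^ d * (μHE[d] : Measure X) s := by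
  simp_rw [Measure.euclideanHausdorffMeasure_def, Measure.smul_apply, Measure.nnreal_smul_coe_apply]
  rw [mul_left_comm, ← ENNReal.rpow_natCast]
  gcongr
  exact h.hausdorffMeasure_image_le d.cast_nonneg

/-- Uniqueness of Haar measure. It is used for a product with the maximum norm, where Hausdorff
measure and product volume need only be proportional. -/
theorem exists_eq_smul_euclideanHausdorffMeasure {E : Type*} [NormedAddCommGroup E]
    [NormedSpace ℝ E] [FiniteDimensional ℝ E] [MeasurableSpace E] [BorelSpace E] {d : ℕ}
    (hd : Module.finrank ℝ E = d) (μ : Measure E) [μ.IsAddHaarMeasure] :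
    ∃ c : ℝ≥0, 0 < c ∧ μ = (c : ℝ≥0∞) • (μHE[d] : Measure E) := by
  subst hd
  exact ⟨_, Measure.addHaarScalarFactor_pos_of_isAddHaarMeasure μ _,
    Measure.isAddLeftInvariant_eq_smul μ _⟩

variable {U V W : Type*} [NormedAddCommGroup U] [InnerProductSpace ℝ U] [FiniteDimensional ℝ U]
  [NormedAddCommGroup V] [InnerProductSpace ℝ V] [NormedAddCommGroup W] [InnerProductSpace ℝ W]

/-- On the range of `g` the map sending `g v` to `f v` is `K`-Lipschitz, and a determinant is the
factor by which the Hausdorff measure of the image of the unit ball changes. If `f` is not injective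
its determinant vanishes. -/
theorem normDet_le_of_norm_le {K : ℝ} (hK : 0 ≤ K) {f : U →ₗ[ℝ] V} {g : U →ₗ[ℝ] W}
    (h : ∀ v, ‖f v‖ ≤ K * ‖g v‖) : f.normDet ≤ K ^ Module.finrank ℝ U * g.normDet := by
  by_cases hf : f.normDet = 0
  · rw [hf]
    exact mul_nonneg (pow_nonneg hK _) g.normDet_nonneg
  have hg : Function.Injective g := by
    refine (injective_iff_map_eq_zero _).2 fun v hv => ?_
    have h1 := h v
    rw [hv, norm_zero, mul_zero] at h1
    have h2 : Function.Injective f := (f.normDet_ne_zero_tfae.out 0 4).1 hf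
    exact (injective_iff_map_eq_zero _).1 h2 v (norm_le_zero_iff.1 h1)
  borelize U
  borelize V
  borelize W
  let s : Set U := Metric.closedBall 0 1
  have hlip : LipschitzOnWith K.toNNReal (fun w => f (Function.invFun g w)) (g '' s) := by
    refine LipschitzOnWith.of_dist_le_mul ?_
    rintro _ ⟨x, -, rfl⟩ _ ⟨y, -, rfl⟩
    rw [Function.leftInverse_invFun hg, Function.leftInverse_invFun hg, dist_eq_norm, dist_eq_norm,
      ← map_sub, ← map_sub, Real.coe_toNNReal _ hK]
    exact h _
  have himg : (fun w => f (Function.invFun g w)) '' (g '' s) = f '' s := by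
    rw [image_image]
    exact image_congr fun x _ => by rw [Function.leftInverse_invFun hg]
  have h1 := hlip.euclideanHausdorffMeasure_image_le (Module.finrank ℝ U)
  rw [himg, f.euclideanHausdorffMeasure_image, g.euclideanHausdorffMeasure_image, ← mul_assoc] at h1
  have h2 : (μHE[Module.finrank ℝ U] : Measure U) s ≠ 0 :=
    (Metric.measure_closedBall_pos _ _ one_pos).ne'
  have h3 : (μHE[Module.finrank ℝ U] : Measure U) s ≠ (⊤ : ℝ≥0∞) :=
    (isCompact_closedBall _ _).measure_lt_top.ne
  rw [ENNReal.mul_le_mul_iff_left h2 h3] at h1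
  rw [← ENNReal.ofReal_le_ofReal_iff (mul_nonneg (pow_nonneg hK _) g.normDet_nonneg),
    ENNReal.ofReal_mul (pow_nonneg hK _), ENNReal.ofReal_pow hK]
  exact h1

end HausdorffMeasure

section AdaptedCoordinates

variable {E : Type*} [NormedAddCommGroup E] [InnerProductSpace ℝ E] [FiniteDimensional ℝ E] {k l : ℕ}

/-- Coordinates adapted to the splitting of a space given by a projection. -/
theorem exists_adaptedCoordinates (R : E →L[ℝ] E) (hR : ∀ w, R (R w) = R w)
    (hk : Module.finrank ℝ R.range = k) (hl : Module.finrank ℝ R.ker = l) :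
    ∃ T : E ≃L[ℝ] EuclideanSpace ℝ (Fin k) × EuclideanSpace ℝ (Fin l),
      ∀ w, ‖(T w).1‖ = ‖R w‖ ∧ ‖(T w).2‖ = ‖w - R w‖ := by
  let i₁ : R.range ≃ₗᵢ[ℝ] EuclideanSpace ℝ (Fin k) := (stdOrthonormalBasis ℝ _).reindex (finCongr hk) |>.repr
  let i₂ : R.ker ≃ₗᵢ[ℝ] EuclideanSpace ℝ (Fin l) := (stdOrthonormalBasis ℝ _).reindex (finCongr hl) |>.repr
  let p₁ : E →ₗ[ℝ] R.range := R.toLinearMap.rangeRestrict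
  let p₂ : E →ₗ[ℝ] R.ker := (LinearMap.id - R.toLinearMap).codRestrict _ fun w => by
    simp [hR]
  let f : E →ₗ[ℝ] EuclideanSpace ℝ (Fin k) × EuclideanSpace ℝ (Fin l) :=
    (i₁.toLinearEquiv.toLinearMap ∘ₗ p₁).prod (i₂.toLinearEquiv.toLinearMap ∘ₗ p₂)
  have hf₁ : ∀ w, ‖(f w).1‖ = ‖R w‖ := fun w => i₁.norm_map (p₁ w)
  have hf₂ : ∀ w, ‖(f w).2‖ = ‖w - R w‖ := fun w => i₂.norm_map (p₂ w)
  have hinj : Function.Injective f := by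
    refine (injective_iff_map_eq_zero _).2 fun w hw => ?_
    have h1 := hf₁ w
    have h2 := hf₂ w
    rw [hw] at h1 h2
    simp only [Prod.fst_zero, Prod.snd_zero, norm_zero] at h1 h2
    have h3 := norm_eq_zero.1 h1.symm
    rw [h3, sub_zero] at h2
    exact norm_eq_zero.1 h2.symm
  have hfr : Module.finrank ℝ E =
      Module.finrank ℝ (EuclideanSpace ℝ (Fin k) × EuclideanSpace ℝ (Fin l)) := by
    have := R.toLinearMap.finrank_range_add_finrank_ker
    rw [Module.finrank_prod, finrank_euclideanSpace_fin, finrank_euclideanSpace_fin]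
    exact this.symm.trans (by rw [← hk, ← hl])
  exact ⟨(LinearEquiv.ofInjectiveOfFinrankEq f hinj hfr).toContinuousLinearEquiv,
    fun w => ⟨hf₁ w, hf₂ w⟩⟩

end AdaptedCoordinates

end ControlAffine
-- Finite chart covers and coordinate representations
namespace ControlAffine

theorem exists_pos_forall_mem_finset {ι : Type*} (t : Finset ι) {P : ι → ℝ → Prop}
    (hP : ∀ i ∈ t, ∃ r > 0, P i r) (anti : ∀ i r r', 0 < r' → r' ≤ r → P i r → P i r') :
    ∃ r > 0, ∀ i ∈ t, P i r := by
  have h : ∀ᶠ r in 𝓝[>] (0 : ℝ), ∀ i ∈ t, P i r := by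
    refine (Filter.eventually_all_finset t).2 fun i hi => ?_
    obtain ⟨r, hr, h⟩ := hP i hi
    filter_upwards [Ioc_mem_nhdsGT hr] with r' hr'
    exact anti i r r' hr'.1 hr'.2 h
  obtain ⟨r, h, hr⟩ := (h.and self_mem_nhdsWithin).exists
  exact ⟨r, hr, h⟩

variable {d m : ℕ} {M : Type*} [MetricSpace M] [ChartedSpace (EuclideanSpace ℝ (Fin d)) M]
  [IsManifold (𝓡 d) ∞ M]
    [RiemannianBundle (fun x : M => TangentSpace (𝓡 d) x)]
    [IsContMDiffRiemannianBundle (𝓡 d) ∞ (EuclideanSpace ℝ (Fin d))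
      (fun x : M => TangentSpace (𝓡 d) x)] [IsRiemannianManifold (𝓡 d) M]

theorem IsChartNhd.mono {c : M} {W : Set M} {C C' : ℝ} (h : IsChartNhd (d := d) c W C) (hC : C ≤ C') :
    IsChartNhd (d := d) c W C' where
  isOpen := h.isOpen
  mem := h.mem
  subset_source := h.subset_source
  pos := h.pos.trans_le hC
  chartMap_le z hz v := (h.chartMap_le z hz v).trans (by gcongr)
  chartInv_le z hz v := (h.chartInv_le z hz v).trans (by gcongr)
  dist_chart_le y hy z hz := (h.dist_chart_le y hy z hz).trans (by gcongr)
  dist_le y hy z hz := (h.dist_le y hy z hz).trans (by gcongr)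

/-- Finitely many charts, centered at the points of `t`, whose compact parts `Z c` contain all
`ρ`-balls around points of `Q`. -/
structure IsChartCover (Q : Set M) (t : Finset M) (W Z : M → Set M) (C ρ : ℝ) : Prop where
  isChartNhd : ∀ c ∈ t, IsChartNhd (d := d) c (W c) C
  isCompact : ∀ c ∈ t, IsCompact (Z c)
  subset : ∀ c ∈ t, Z c ⊆ W c
  pos : 0 < ρ
  one_le : 1 ≤ C
  cover : ∀ y ∈ Q, ∃ c ∈ t, Metric.ball y ρ ⊆ Z c

variable (d) in
theorem exists_isChartCover {Q : Set M} (hQ : IsCompact Q) :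
    ∃ t W Z C ρ, IsChartCover (d := d) Q t W Z C ρ := by
  have : LocallyCompactSpace M := ChartedSpace.locallyCompactSpace (EuclideanSpace ℝ (Fin d)) M
  choose W C hW using exists_isChartNhd (d := d) (M := M)
  choose Z hZ hZW hZc using fun c => local_compact_nhds ((hW c).isOpen.mem_nhds (hW c).mem)
  obtain ⟨t, -, ht⟩ := hQ.elim_nhds_subcover (fun c => interior (Z c))
    fun c _ => interior_mem_nhds.2 (hZ c)
  obtain ⟨ρ, hρ, h⟩ := lebesgue_number_lemma_of_metric (c := fun c : t => interior (Z c)) hQ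
    (fun _ => isOpen_interior) (by rwa [iUnion_subtype])
  -- The sum dominates every single chart constant, the summand 1 gives `1 ≤ C`, and `ρ` is a
  -- Lebesgue number of the cover.
  refine ⟨t, W, Z, 1 + ∑ c ∈ t, C c, ρ, fun c hc => (hW c).mono ?_, fun c _ => hZc c, fun c _ => hZW c,
    hρ, ?_, fun y hy => ?_⟩
  · have := Finset.single_le_sum (fun i _ => (hW i).pos.le) hc
    linarith
  · have := Finset.sum_nonneg fun i (_ : i ∈ t) => (hW i).pos.le
    linarith
  · obtain ⟨⟨c, hc⟩, hc'⟩ := h y hy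
    exact ⟨c, hc, hc'.trans interior_subset⟩

/-- Points whose chart coordinates are close are close. -/
theorem IsChartNhd.exists_forall_symm {c : M} {W Z : Set M} {C : ℝ} (h : IsChartNhd (d := d) c W C)
    (hZ : IsCompact Z) (hZW : Z ⊆ W) {ρ : ℝ} (hρ : 0 < ρ) :
    ∃ r > 0, ∀ x ∈ Z, ∀ w, dist w (extChartAt (𝓡 d) c x) ≤ r → w ∈ (extChartAt (𝓡 d) c).target ∧
      (extChartAt (𝓡 d) c).symm w ∈ W ∧ dist ((extChartAt (𝓡 d) c).symm w) x < ρ := by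
  let ψ := extChartAt (𝓡 d) c
  have hsrc : Z ⊆ ψ.source := hZW.trans h.subset_source
  obtain ⟨ρ₁, hρ₁, hZρ⟩ := hZ.exists_thickening_subset_open h.isOpen hZW
  have hA : IsCompact (ψ '' Z) := hZ.image_of_continuousOn ((continuousOn_extChartAt c).mono hsrc)
  have hAt : ψ '' Z ⊆ ψ.target := by
    rintro _ ⟨x, hx, rfl⟩
    exact ψ.map_source (hsrc hx)
  obtain ⟨r₁, hr₁, hAr⟩ := hA.exists_cthickening_subset_open (isOpen_extChartAt_target c) hAt
  have hu := hA.uniformContinuousAt_of_continuousAt ψ.symm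
    (fun a ha => continuousAt_extChartAt_symm'' (hAt ha)) (Metric.dist_mem_uniformity (lt_min hρ hρ₁))
  obtain ⟨r₂, hr₂, hAu⟩ := Metric.mem_uniformity_dist.1 hu
  refine ⟨min r₁ (r₂ / 2), by positivity, fun x hx w hw => ?_⟩
  have hxA : ψ x ∈ ψ '' Z := mem_image_of_mem _ hx
  have h1 : dist (ψ.symm (ψ x)) (ψ.symm w) < min ρ ρ₁ := by
    refine hAu (a := ψ x) (b := w) ?_ hxA
    rw [dist_comm]
    exact (hw.trans (min_le_right _ _)).trans_lt (by linarith)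
  rw [ψ.left_inv (hsrc hx), dist_comm] at h1
  exact ⟨hAr (Metric.mem_cthickening_of_dist_le _ _ _ _ hxA (hw.trans (min_le_left _ _))),
    hZρ (Metric.mem_thickening_iff.2 ⟨x, hx, h1.trans_le (min_le_right _ _)⟩),
    h1.trans_le (min_le_left _ _)⟩

namespace System

variable {S : System d m M} {Q : Set M}
  {Eu Ecs : ∀ p : Control S.U × M, Submodule ℝ (TangentSpace (𝓡 d) p.2)}

/-- The derivative of the solution map, read in the charts at `c` and `c'`. -/
def chartDφ (S : System d m M) (c c' : M) (t : ℝ) (p : Control S.U × M) :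
    EuclideanSpace ℝ (Fin d) →L[ℝ] EuclideanSpace ℝ (Fin d) :=
  (chartMap c' (S.Φ t p).2) ∘L (S.Dφ t p) ∘L (chartInv c p.2)

theorem chartDφ_apply (c c' : M) (t : ℝ) (p : Control S.U × M) (w : EuclideanSpace ℝ (Fin d)) :
    S.chartDφ c c' t p w = chartMap c' (S.Φ t p).2 (S.Dφ t p (chartInv c p.2 w)) := rfl

theorem continuousOn_chartDφ (hS : S.IsComplete) (c c' : M) (t : ℝ) :
    ContinuousOn (S.chartDφ c c' t) {p | p.2 ∈ (extChartAt (𝓡 d) c).source ∧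
      (S.Φ t p).2 ∈ (extChartAt (𝓡 d) c').source} := by
  refine continuousOn_clm_apply.2 fun w p hp => ContinuousAt.continuousWithinAt ?_
  have hp1 : p.2 ∈ (extChartAt (𝓡 d) c).source := hp.1
  have hp2 : (S.Φ t p).2 ∈ (extChartAt (𝓡 d) c').source := hp.2
  let f : Control S.U × M → Control S.U × TangentBundle (𝓡 d) M :=
    fun p => (p.1, ⟨p.2, chartInv c p.2 w⟩)
  have hf : ContinuousAt f p :=
    ContinuousAt.comp (f := fun p : Control S.U × M => (p, w)) (continuousAt_prod_chartInv w hp1)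
      (continuousAt_id.prodMk continuousAt_const)
  have hg : ContinuousAt (fun p => (S.TΦ t (f p)).2) p :=
    continuousAt_snd.comp ((continuous_TΦ hS t).continuousAt.comp hf)
  exact ContinuousAt.comp (f := fun p => (S.TΦ t (f p)).2) (continuousAt_chartMap (c := c') hp2) hg

theorem hasFDerivAt_chart_φ (hS : S.IsComplete) {c c' : M} {t : ℝ} {u : Control S.U}
    {w : EuclideanSpace ℝ (Fin d)} (hw : w ∈ (extChartAt (𝓡 d) c).target)
    (hw' : S.φ t ((extChartAt (𝓡 d) c).symm w) u ∈ (extChartAt (𝓡 d) c').source) :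
    HasFDerivAt (fun w => extChartAt (𝓡 d) c' (S.φ t ((extChartAt (𝓡 d) c).symm w) u))
      (S.chartDφ c c' t (u, (extChartAt (𝓡 d) c).symm w)) w := by
  have h1 := hasMFDerivAt_extChartAt_symm hw
  have h2 := hasMFDerivAt_φ hS t (u, (extChartAt (𝓡 d) c).symm w)
  have h3 := hasMFDerivAt_extChartAt hw'
  exact (HasMFDerivAt.comp w h3 (HasMFDerivAt.comp w h2 h1)).hasFDerivAt

theorem chartProj_idem {c : M} {p : Control S.U × M} (hp : IsCompl (Eu p) (Ecs p))
    (hc : p.2 ∈ (extChartAt (𝓡 d) c).source) (w : EuclideanSpace ℝ (Fin d)) :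
    chartProj Eu Ecs c p (chartProj Eu Ecs c p w) = chartProj Eu Ecs c p w := by
  rw [chartProj_apply, chartProj_apply, chartInv_chartMap hc]
  congr 1
  simpa using projAlong_add hp (projAlong_mem (Eu p) (Ecs p) (chartInv c p.2 w)) (Ecs p).zero_mem

/-- The tangent space at `z`, read in a chart. -/
def chartEquiv {c z : M} (hz : z ∈ (extChartAt (𝓡 d) c).source) :
    TangentSpace (𝓡 d) z ≃ₗ[ℝ] EuclideanSpace ℝ (Fin d) :=
  { (chartMap c z).toLinearMap with
    invFun := chartInv c z
    left_inv := chartInv_chartMap hz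
    right_inv := chartMap_chartInv hz }

theorem finrank_range_chartProj {c : M} {p : Control S.U × M} (hp : IsCompl (Eu p) (Ecs p))
    (hc : p.2 ∈ (extChartAt (𝓡 d) c).source) :
    Module.finrank ℝ (chartProj Eu Ecs c p).range = Module.finrank ℝ (Eu p) := by
  have h : (chartProj Eu Ecs c p).range =
      (Eu p).map (chartEquiv hc : TangentSpace (𝓡 d) p.2 →ₗ[ℝ] EuclideanSpace ℝ (Fin d)) := by
    ext w
    constructor
    · rintro ⟨v, rfl⟩
      exact ⟨_, projAlong_mem (Eu p) (Ecs p) (chartInv c p.2 v), rfl⟩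
    · rintro ⟨v, hv, rfl⟩
      refine ⟨chartMap c p.2 v, ?_⟩
      have h := projAlong_add hp hv (Ecs p).zero_mem
      rw [add_zero] at h
      change chartMap c p.2 (projAlong (Eu p) (Ecs p) (chartInv c p.2 (chartMap c p.2 v))) =
        chartMap c p.2 v
      rw [chartInv_chartMap hc, h]
  rw [h, LinearEquiv.finrank_map_eq]

theorem finrank_ker_chartProj {c : M} {p : Control S.U × M} (hp : IsCompl (Eu p) (Ecs p))
    (hc : p.2 ∈ (extChartAt (𝓡 d) c).source) :
    Module.finrank ℝ (chartProj Eu Ecs c p).ker = Module.finrank ℝ (Ecs p) := by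
  have h1 := (chartProj Eu Ecs c p).toLinearMap.finrank_range_add_finrank_ker
  have h2 := Submodule.finrank_add_eq_of_isCompl hp
  have h3 := finrank_range_chartProj hp hc
  have h4 := (chartEquiv hc).finrank_eq
  have h5 : Module.finrank ℝ (chartProj Eu Ecs c p).range + Module.finrank ℝ (chartProj Eu Ecs c p).ker =
    Module.finrank ℝ (EuclideanSpace ℝ (Fin d)) := h1
  omega

end System
end ControlAffine
-- Block form in adapted coordinates
namespace ControlAffine

section Adapted

variable {E A B : Type*} [NormedAddCommGroup E] [NormedSpace ℝ E] [NormedAddCommGroup A]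
  [NormedSpace ℝ A] [NormedAddCommGroup B] [NormedSpace ℝ B]

/-- The coordinates `T` are isometric on the range and on the kernel of the projection `R`. -/
structure IsAdapted (R : E →L[ℝ] E) (T : E ≃L[ℝ] A × B) : Prop where
  fst : ∀ w, ‖(T w).1‖ = ‖R w‖
  snd : ∀ w, ‖(T w).2‖ = ‖w - R w‖

namespace IsAdapted

variable {R R₁ R' : E →L[ℝ] E} {T T' : E ≃L[ℝ] A × B} {D : E →L[ℝ] E} {κ : ℝ}

theorem norm_symm_le (h : IsAdapted R T) (v : A × B) : ‖T.symm v‖ ≤ 2 * ‖v‖ := by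
  have h1 := h.fst (T.symm v)
  have h2 := h.snd (T.symm v)
  rw [T.apply_symm_apply] at h1 h2
  have h3 := norm_add_le (R (T.symm v)) (T.symm v - R (T.symm v))
  rw [add_sub_cancel, ← h1, ← h2] at h3
  linarith [_root_.norm_fst_le v, _root_.norm_snd_le v]

theorem norm_le (h : IsAdapted R T) {Λ : ℝ} (hR : ∀ w, ‖R w‖ ≤ Λ * ‖w‖) (w : E) :
    ‖T w‖ ≤ (Λ + 1) * ‖w‖ := by
  have h0 := hR w
  have h1 := norm_nonneg w
  refine max_le ?_ ?_
  · rw [h.fst]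
    linarith
  · rw [h.snd]
    linarith [norm_sub_le w (R w)]

theorem apply_symm_inl (h : IsAdapted R T) (a : A) : R (T.symm (a, 0)) = T.symm (a, 0) := by
  have h2 := h.snd (T.symm (a, 0))
  rw [T.apply_symm_apply, norm_zero] at h2
  exact (sub_eq_zero.1 (norm_eq_zero.1 h2.symm)).symm

theorem apply_symm_inr (h : IsAdapted R T) (b : B) : R (T.symm (0, b)) = 0 := by
  have h2 := h.fst (T.symm (0, b))
  rw [T.apply_symm_apply, norm_zero] at h2
  exact norm_eq_zero.1 h2.symm

theorem norm_symm_inl (h : IsAdapted R T) (a : A) : ‖T.symm (a, 0)‖ = ‖a‖ := by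
  have h2 := h.fst (T.symm (a, 0))
  rw [h.apply_symm_inl, T.apply_symm_apply] at h2
  exact h2.symm

theorem norm_symm_inr (h : IsAdapted R T) (b : B) : ‖T.symm (0, b)‖ = ‖b‖ := by
  have h2 := h.snd (T.symm (0, b))
  rw [h.apply_symm_inr, T.apply_symm_apply, sub_zero] at h2
  exact h2.symm

/-- In the application `R₁` is the projection at the true image of the base point, and `R'` the one
to which the target coordinates are adapted. -/
theorem norm_sub_apply_le (hR : ‖R₁ - R'‖ ≤ κ) {w : E} (hw : R₁ w = w) : ‖w - R' w‖ ≤ κ * ‖w‖ := by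
  have h1 := (R₁ - R').le_of_opNorm_le hR w
  rwa [sub_apply, hw] at h1

theorem norm_apply_le (hR : ‖R₁ - R'‖ ≤ κ) {w : E} (hw : R₁ w = 0) : ‖R' w‖ ≤ κ * ‖w‖ := by
  have h1 := (R₁ - R').le_of_opNorm_le hR w
  rwa [sub_apply, hw, zero_sub, norm_neg] at h1

/-- The upper diagonal block of a linear map in adapted coordinates. -/
def blockFst (D : E →L[ℝ] E) (T T' : E ≃L[ℝ] A × B) : A →L[ℝ] A :=
  .fst ℝ A B ∘L (T' : E →L[ℝ] A × B) ∘L D ∘L (T.symm : A × B →L[ℝ] E) ∘L .inl ℝ A B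

/-- The lower diagonal block of a linear map in adapted coordinates. -/
def blockSnd (D : E →L[ℝ] E) (T T' : E ≃L[ℝ] A × B) : B →L[ℝ] B :=
  .snd ℝ A B ∘L (T' : E →L[ℝ] A × B) ∘L D ∘L (T.symm : A × B →L[ℝ] E) ∘L .inr ℝ A B

theorem blockFst_apply (a : A) : blockFst D T T' a = (T' (D (T.symm (a, 0)))).1 := rfl

theorem blockSnd_apply (b : B) : blockSnd D T T' b = (T' (D (T.symm (0, b)))).2 := rfl

variable (h : IsAdapted R T) (h' : IsAdapted R' T') (hD : ∀ w, R₁ (D w) = D (R w))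
  (hR : ‖R₁ - R'‖ ≤ κ)
include h h' hD hR

/-- By `hD` the map carries the range of `R` into vectors fixed by `R₁`, and `R'` differs from `R₁`
by at most `κ`; so projecting with `R'` changes these vectors by a relative error `κ`. -/
theorem norm_blockFst_le (a : A) :
    ‖blockFst D T T' a‖ ≤ (1 + κ) * ‖D (T.symm (a, 0))‖ ∧
      (1 - κ) * ‖D (T.symm (a, 0))‖ ≤ ‖blockFst D T T' a‖ := by
  have h1 := norm_sub_apply_le hR (w := D (T.symm (a, 0))) (by rw [hD, h.apply_symm_inl])
  rw [blockFst_apply, h'.fst]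
  constructor
  · have h2 := norm_sub_le (D (T.symm (a, 0))) (D (T.symm (a, 0)) - R' (D (T.symm (a, 0))))
    rw [sub_sub_cancel] at h2
    linarith
  · have h2 := norm_add_le (D (T.symm (a, 0)) - R' (D (T.symm (a, 0)))) (R' (D (T.symm (a, 0))))
    rw [sub_add_cancel] at h2
    linarith

theorem norm_blockSnd_le (b : B) :
    ‖blockSnd D T T' b‖ ≤ (1 + κ) * ‖D (T.symm (0, b))‖ := by
  have h1 := norm_apply_le hR (w := D (T.symm (0, b))) (by rw [hD, h.apply_symm_inr, map_zero])
  rw [blockSnd_apply, h'.snd]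
  linarith [norm_sub_le (D (T.symm (0, b))) (R' (D (T.symm (0, b))))]

/-- The difference consists of the off-diagonal blocks, which would vanish for `R₁ = R'` and are
therefore of size `κ * K`. -/
theorem norm_sub_prodMap_le (hκ : 0 ≤ κ) {K : ℝ} (hK0 : 0 ≤ K) (hK : ∀ w, ‖D w‖ ≤ K * ‖w‖) (v : A × B) :
    ‖T' (D (T.symm v)) - (blockFst D T T').prodMap (blockSnd D T T') v‖ ≤ κ * K * ‖v‖ := by
  obtain ⟨a, b⟩ := v
  have h1 := norm_sub_apply_le hR (w := D (T.symm (a, 0))) (by rw [hD, h.apply_symm_inl])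
  have h2 := norm_apply_le hR (w := D (T.symm (0, b))) (by rw [hD, h.apply_symm_inr, map_zero])
  have h3 : T' (D (T.symm (a, b))) = T' (D (T.symm (a, 0))) + T' (D (T.symm (0, b))) := by
    rw [← map_add, ← map_add, ← map_add]
    simp
  have h4 : T' (D (T.symm (a, b))) - (blockFst D T T').prodMap (blockSnd D T T') (a, b) =
      ((T' (D (T.symm (0, b)))).1, (T' (D (T.symm (a, 0)))).2) := by
    rw [h3]
    ext <;> simp [blockFst_apply, blockSnd_apply]
  rw [h4]
  have hk1 := hK (T.symm (a, 0))
  have hk2 := hK (T.symm (0, b))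
  rw [h.norm_symm_inl] at hk1
  rw [h.norm_symm_inr] at hk2
  have hKab : κ * K * ‖a‖ ≤ κ * K * ‖(a, b)‖ ∧ κ * K * ‖b‖ ≤ κ * K * ‖(a, b)‖ := by
    have hab : ‖a‖ ≤ ‖(a, b)‖ := _root_.norm_fst_le (a, b)
    have hab' : ‖b‖ ≤ ‖(a, b)‖ := _root_.norm_snd_le (a, b)
    exact ⟨by gcongr, by gcongr⟩
  refine max_le ?_ ?_
  · rw [h'.fst]
    calc _ ≤ κ * (K * ‖b‖) := h2.trans (by gcongr)
      _ ≤ _ := by linarith [hKab.2]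
  · rw [h'.snd]
    calc _ ≤ κ * (K * ‖a‖) := h1.trans (by gcongr)
      _ ≤ _ := by linarith [hKab.1]

/-- Two errors add up: the oscillation of the derivative of `G`, at most `κ` and multiplied by the
norms `2` and `τ` of the coordinate changes, and the off-diagonal blocks, at most `κ * K`. The
factors `1 / 2` and `2` in the rates absorb `1 - κ` and `1 + κ`. -/
theorem isDominatedStep {G : E → E} {G' : E → E →L[ℝ] E} {w₀ : E} {α β δ r τ K : ℝ} {η : ℝ≥0}
    (hκ : 0 ≤ κ) (hκ1 : κ ≤ 1 / 2) (hK0 : 0 ≤ K) (hK : ∀ w, ‖D w‖ ≤ K * ‖w‖) (hτ : 0 ≤ τ) (hT' : ∀ w, ‖T' w‖ ≤ τ * ‖w‖)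
    (hδ : 2 * δ ≤ r)
    (hG : ∀ w ∈ Metric.closedBall w₀ r, HasFDerivAt G (G' w) w ∧ ‖G' w - D‖ ≤ κ)
    (hα : ∀ w, R w = w → α * ‖w‖ ≤ ‖D w‖) (hβ : ∀ w, R w = 0 → ‖D w‖ ≤ β * ‖w‖)
    (hη : κ * (K + 2 * τ) ≤ η) :
    IsDominatedStep (fun v => T' (G (w₀ + T.symm v) - G w₀)) (blockFst D T T') (blockSnd D T T')
      (α / 2) (2 * β) η δ := by
  refine ⟨by simp, fun v hv v' hv' => ?_, fun a => ?_, fun b => ?_⟩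
  · have hb : ∀ v ∈ Metric.closedBall (0 : A × B) δ, w₀ + T.symm v ∈ Metric.closedBall w₀ r := by
      intro v hv
      rw [mem_closedBall_zero_iff] at hv
      rw [mem_closedBall_iff_norm, add_sub_cancel_left]
      linarith [h.norm_symm_le v]
    have h1 := (convex_closedBall w₀ r).norm_image_sub_le_of_norm_hasFDerivWithin_le'
      (fun w hw => (hG w hw).1.hasFDerivWithinAt) (fun w hw => (hG w hw).2) (hb v' hv') (hb v hv)
    rw [add_sub_add_left_eq_sub, ← map_sub] at h1
    have h2 := hT' (G (w₀ + T.symm v) - G (w₀ + T.symm v') - D (T.symm (v - v')))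
    have h3 := norm_sub_prodMap_le h h' hD hR hκ hK0 hK (v - v')
    have h4 := h.norm_symm_le (v - v')
    have h5 : T' (G (w₀ + T.symm v) - G w₀) - T' (G (w₀ + T.symm v') - G w₀) -
        (blockFst D T T').prodMap (blockSnd D T T') (v - v') =
        T' (G (w₀ + T.symm v) - G (w₀ + T.symm v') - D (T.symm (v - v'))) +
        (T' (D (T.symm (v - v'))) - (blockFst D T T').prodMap (blockSnd D T T') (v - v')) := by
      rw [← map_sub T', sub_sub_sub_cancel_right, map_sub T' (G _ - G _) (D _), sub_add_sub_cancel]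
    change ‖T' (G (w₀ + T.symm v) - G w₀) - T' (G (w₀ + T.symm v') - G w₀) - _‖ ≤ _
    rw [h5]
    calc _ ≤ τ * (κ * (2 * ‖v - v'‖)) + κ * K * ‖v - v'‖ := by
          refine (norm_add_le _ _).trans (add_le_add (h2.trans ?_) h3)
          exact mul_le_mul_of_nonneg_left (h1.trans (by gcongr)) hτ
      _ = κ * (K + 2 * τ) * ‖v - v'‖ := by ring
      _ ≤ η * ‖v - v'‖ := by gcongr
  · have h1 := (norm_blockFst_le h h' hD hR a).2
    have h2 := hα _ (h.apply_symm_inl a)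
    rw [h.norm_symm_inl] at h2
    nlinarith [norm_nonneg (D (T.symm (a, 0)))]
  · have h1 := norm_blockSnd_le h h' hD hR b
    have h2 := hβ _ (h.apply_symm_inr b)
    rw [h.norm_symm_inr] at h2
    nlinarith [norm_nonneg (D (T.symm (0, b)))]

end IsAdapted
end Adapted

end ControlAffine
-- Uniform continuity near the fibers
namespace ControlAffine

variable {d m : ℕ} {M : Type*} [MetricSpace M] [ChartedSpace (EuclideanSpace ℝ (Fin d)) M]
  [IsManifold (𝓡 d) ∞ M]
    [RiemannianBundle (fun x : M => TangentSpace (𝓡 d) x)]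
    [IsContMDiffRiemannianBundle (𝓡 d) ∞ (EuclideanSpace ℝ (Fin d))
      (fun x : M => TangentSpace (𝓡 d) x)] [IsRiemannianManifold (𝓡 d) M]

namespace System

variable {S : System d m M} {Q : Set M}
  {Eu Ecs : ∀ p : Control S.U × M, Submodule ℝ (TangentSpace (𝓡 d) p.2)}
  {t : Finset M} {W Z : M → Set M} {C ρ : ℝ} {k l : ℕ}

/-- Uniformity over all controls comes from compactness of the control space through
`exists_forall_dist_lt`; the analogous statements for the derivative and the projection have the
same source. -/
theorem exists_dist_φ_lt (hS : S.IsComplete) (τ : ℝ) {X : Set M} (hX : IsCompact X) {η : ℝ}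
    (hη : 0 < η) : ∃ ε > 0, ∀ (u : Control S.U), ∀ y ∈ X, ∀ z ∈ X, dist y z < ε →
      dist (S.φ τ y u) (S.φ τ z u) < η := by
  obtain ⟨ε, hε, h⟩ := exists_forall_dist_lt (isCompact_univ_prod S hX)
    (continuous_φ hS τ).continuousOn hη
  exact ⟨ε, hε, fun u y hy z hz => h u y z ⟨mem_univ _, hy⟩ ⟨mem_univ _, hz⟩⟩

theorem exists_dist_chartDφ_lt (hS : S.IsComplete) (hcov : IsChartCover (d := d) Q t W Z C ρ)
    (τ : ℝ) {κ : ℝ} (hκ : 0 < κ) :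
    ∃ ε > 0, ∀ q ∈ t ×ˢ t, ∀ u : Control S.U, ∀ y ∈ Z q.1, ∀ z ∈ Z q.1, S.φ τ y u ∈ Z q.2 →
      S.φ τ z u ∈ Z q.2 → dist y z < ε →
      ‖S.chartDφ q.1 q.2 τ (u, y) - S.chartDφ q.1 q.2 τ (u, z)‖ < κ := by
  refine exists_pos_forall_mem_finset (t ×ˢ t) (fun q hq => ?_)
    fun q r r' hr' hrr h u y hy z hz h1 h2 h3 => h u y hy z hz h1 h2 (h3.trans_le hrr)
  obtain ⟨h1, h2⟩ := Finset.mem_product.1 hq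
  have hX : IsCompact ((univ : Set (Control S.U)) ×ˢ Z q.1 ∩ (fun p => (S.Φ τ p).2) ⁻¹' Z q.2) :=
    (isCompact_univ_prod S (hcov.isCompact _ h1)).inter_right
      ((hcov.isCompact _ h2).isClosed.preimage (continuous_φ hS τ))
  obtain ⟨ε, hε, h⟩ := exists_forall_dist_lt hX ((continuousOn_chartDφ hS q.1 q.2 τ).mono
    fun p hp => ⟨(hcov.isChartNhd _ h1).subset_source (hcov.subset _ h1 hp.1.2),
      (hcov.isChartNhd _ h2).subset_source (hcov.subset _ h2 hp.2)⟩) hκ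
  refine ⟨ε, hε, fun u y hy z hz h1 h2 h3 => ?_⟩
  rw [← dist_eq_norm]
  exact h u y z ⟨⟨mem_univ _, hy⟩, h1⟩ ⟨⟨mem_univ _, hz⟩, h2⟩ h3

theorem IsPartiallyHyperbolic.exists_dist_chartProj_lt (hE : S.IsPartiallyHyperbolic Q Eu Ecs)
    (hS : S.IsComplete) (hQ : IsCompact Q) (hcov : IsChartCover (d := d) Q t W Z C ρ)
    {κ : ℝ} (hκ : 0 < κ) :
    ∃ ε > 0, ∀ c ∈ t, ∀ u : Control S.U, ∀ y ∈ Z c, ∀ z ∈ Z c, (u, y) ∈ S.lift Q → (u, z) ∈ S.lift Q →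
      dist y z < ε → ‖chartProj Eu Ecs c (u, y) - chartProj Eu Ecs c (u, z)‖ < κ := by
  refine exists_pos_forall_mem_finset t (fun c hc => ?_)
    fun q r r' hr' hrr h u y hy z hz h1 h2 h3 => h u y hy z hz h1 h2 (h3.trans_le hrr)
  have hX : IsCompact (S.lift Q ∩ Prod.snd ⁻¹' Z c) :=
    (isCompact_lift hS hQ).inter_right ((hcov.isCompact _ hc).isClosed.preimage continuous_snd)
  obtain ⟨ε, hε, h⟩ := exists_forall_dist_lt hX ((hE.continuousOn_chartProj hS hQ
    (hcov.isChartNhd _ hc)).mono fun p hp => ⟨hp.1, hcov.subset _ hc hp.2⟩) hκ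
  refine ⟨ε, hε, fun u y hy z hz h1 h2 h3 => ?_⟩
  rw [← dist_eq_norm]
  exact h u y z ⟨h1, hy⟩ ⟨h2, hz⟩ h3

theorem IsPartiallyHyperbolic.exists_norm_chartProj_le' (hE : S.IsPartiallyHyperbolic Q Eu Ecs)
    (hS : S.IsComplete) (hQ : IsCompact Q) (hcov : IsChartCover (d := d) Q t W Z C ρ) :
    ∃ Λ > 0, ∀ c ∈ t, ∀ p ∈ S.lift Q, p.2 ∈ W c → ∀ w, ‖chartProj Eu Ecs c p w‖ ≤ Λ * ‖w‖ := by
  -- Writing the bound as `r⁻¹` makes it persist for smaller `r`, so that finitely many charts can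
  -- share one constant.
  obtain ⟨r, hr, h⟩ := exists_pos_forall_mem_finset t (P := fun c r => ∀ p ∈ S.lift Q, p.2 ∈ W c →
    ∀ w, ‖chartProj Eu Ecs c p w‖ ≤ r⁻¹ * ‖w‖) (fun c hc => by
      obtain ⟨Λ, hΛ, h⟩ := hE.exists_norm_chartProj_le hS hQ (hcov.isChartNhd c hc)
      exact ⟨Λ⁻¹, inv_pos.2 hΛ, by simpa using h⟩) fun c r r' hr' hrr h p hp hc w =>
        (h p hp hc w).trans (by gcongr)
  exact ⟨r⁻¹, inv_pos.2 hr, h⟩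

theorem exists_forall_symm (hcov : IsChartCover (d := d) Q t W Z C ρ) {ε : ℝ} (hε : 0 < ε) :
    ∃ r > 0, ∀ c ∈ t, ∀ x ∈ Z c, ∀ w, dist w (extChartAt (𝓡 d) c x) ≤ r →
      w ∈ (extChartAt (𝓡 d) c).target ∧ (extChartAt (𝓡 d) c).symm w ∈ W c ∧
        dist ((extChartAt (𝓡 d) c).symm w) x < ε :=
  exists_pos_forall_mem_finset t (fun c hc =>
    (hcov.isChartNhd c hc).exists_forall_symm (hcov.isCompact c hc) (hcov.subset c hc) hε)
    fun _ _ _ _ hrr h x hx w hw => h x hx w (hw.trans hrr)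

/-- A chart whose compact part contains the `ρ`-ball around `p`, and coordinates of the model space
adapted to the splitting at `p`. -/
structure IsAdaptedAt (Eu Ecs : ∀ p : Control S.U × M, Submodule ℝ (TangentSpace (𝓡 d) p.2))
    (t : Finset M) (Z : M → Set M) (ρ : ℝ) (p : Control S.U × M) (c : M)
    (T : EuclideanSpace ℝ (Fin d) ≃L[ℝ] EuclideanSpace ℝ (Fin k) × EuclideanSpace ℝ (Fin l)) :
    Prop where
  mem : c ∈ t
  ball_subset : Metric.ball p.2 ρ ⊆ Z c
  isAdapted : IsAdapted (chartProj Eu Ecs c p) T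

theorem IsPartiallyHyperbolic.exists_isAdaptedAt (hE : S.IsPartiallyHyperbolic Q Eu Ecs)
    (hS : S.IsComplete) (hcov : IsChartCover (d := d) Q t W Z C ρ) {p : Control S.U × M}
    (hp : p ∈ S.lift Q) (hk : Module.finrank ℝ (Eu p) = k) (hl : Module.finrank ℝ (Ecs p) = l) :
    ∃ c T, IsAdaptedAt (k := k) (l := l) Eu Ecs t Z ρ p c T := by
  obtain ⟨c, hc, hcZ⟩ := hcov.cover p.2 (snd_mem_of_mem_lift hS hp)
  have hs : p.2 ∈ (extChartAt (𝓡 d) c).source := (hcov.isChartNhd c hc).subset_source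
    (hcov.subset c hc (hcZ (Metric.mem_ball_self hcov.pos)))
  obtain ⟨T, hT⟩ := exists_adaptedCoordinates (chartProj Eu Ecs c p)
    (chartProj_idem (hE.isCompl p hp) hs)
    ((finrank_range_chartProj (hE.isCompl p hp) hs).trans hk)
    ((finrank_ker_chartProj (hE.isCompl p hp) hs).trans hl)
  exact ⟨c, T, hc, hcZ, ⟨fun w => (hT w).1, fun w => (hT w).2⟩⟩

theorem IsPartiallyHyperbolic.projAlong_Dφ (hE : S.IsPartiallyHyperbolic Q Eu Ecs)
    {p : Control S.U × M} (hp : p ∈ S.lift Q) (hS : S.IsComplete) (τ : ℝ) (v : TangentSpace (𝓡 d) p.2) :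
    projAlong (Eu (S.Φ τ p)) (Ecs (S.Φ τ p)) (S.Dφ τ p v) =
      S.Dφ τ p (projAlong (Eu p) (Ecs p) v) := by
  have h1 := hE.Dφ_mem_Eu hp τ (projAlong_mem (Eu p) (Ecs p) v)
  have h2 := hE.Dφ_mem_Ecs hp τ (sub_projAlong_mem (hE.isCompl p hp) v)
  rw [← projAlong_add (hE.isCompl _ (Φ_mem_lift hS hp τ)) h1 h2, ← map_add, add_sub_cancel]

theorem IsPartiallyHyperbolic.chartProj_chartDφ (hE : S.IsPartiallyHyperbolic Q Eu Ecs)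
    {p : Control S.U × M} (hp : p ∈ S.lift Q) (hS : S.IsComplete) (τ : ℝ) {c c' : M}
    (hc : p.2 ∈ (extChartAt (𝓡 d) c).source) (hc' : (S.Φ τ p).2 ∈ (extChartAt (𝓡 d) c').source)
    (w : EuclideanSpace ℝ (Fin d)) :
    chartProj Eu Ecs c' (S.Φ τ p) (S.chartDφ c c' τ p w) =
      S.chartDφ c c' τ p (chartProj Eu Ecs c p w) := by
  rw [chartProj_apply, chartDφ_apply, chartDφ_apply, chartProj_apply, chartInv_chartMap hc,
    chartInv_chartMap hc', hE.projAlong_Dφ hp hS]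

theorem chartInv_mem_Eu {p : Control S.U × M} {c : M} (hc : p.2 ∈ (extChartAt (𝓡 d) c).source)
    {w : EuclideanSpace ℝ (Fin d)} (hw : chartProj Eu Ecs c p w = w) : chartInv c p.2 w ∈ Eu p := by
  rw [← hw, chartProj_apply, chartInv_chartMap hc]
  exact projAlong_mem _ _ _

theorem chartInv_mem_Ecs {p : Control S.U × M} (hp : IsCompl (Eu p) (Ecs p)) {c : M}
    (hc : p.2 ∈ (extChartAt (𝓡 d) c).source)
    {w : EuclideanSpace ℝ (Fin d)} (hw : chartProj Eu Ecs c p w = 0) : chartInv c p.2 w ∈ Ecs p := by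
  have h1 := congrArg (chartInv c p.2) hw
  rw [chartProj_apply, chartInv_chartMap hc, map_zero] at h1
  have h2 := sub_projAlong_mem hp (chartInv c p.2 w)
  rwa [h1, sub_zero] at h2

theorem norm_Dφ_le_chartDφ {p : Control S.U × M} {τ : ℝ} {c c' : M}
    (hW : IsChartNhd (d := d) c (W c) C) (hW' : IsChartNhd (d := d) c' (W c') C) (hc : p.2 ∈ W c)
    (hc' : (S.Φ τ p).2 ∈ W c') (v : TangentSpace (𝓡 d) p.2) :
    ‖S.Dφ τ p v‖ ≤ C * ‖S.chartDφ c c' τ p (chartMap c p.2 v)‖ ∧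
      ‖S.chartDφ c c' τ p (chartMap c p.2 v)‖ ≤ C * ‖S.Dφ τ p v‖ := by
  rw [chartDφ_apply, chartInv_chartMap (hW.subset_source hc)]
  refine ⟨?_, hW'.chartMap_le _ hc' _⟩
  have h := hW'.chartInv_le _ hc' (chartMap c' (S.Φ τ p).2 (S.Dφ τ p v))
  rwa [chartInv_chartMap (hW'.subset_source hc')] at h

end System
end ControlAffine
-- Time maps near the fibers are dominated
namespace ControlAffine

variable {d m : ℕ} {M : Type*} [MetricSpace M] [ChartedSpace (EuclideanSpace ℝ (Fin d)) M]
  [IsManifold (𝓡 d) ∞ M]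
    [RiemannianBundle (fun x : M => TangentSpace (𝓡 d) x)]
    [IsContMDiffRiemannianBundle (𝓡 d) ∞ (EuclideanSpace ℝ (Fin d))
      (fun x : M => TangentSpace (𝓡 d) x)] [IsRiemannianManifold (𝓡 d) M]

namespace System

variable {S : System d m M} {Q : Set M}
  {Eu Ecs : ∀ p : Control S.U × M, Submodule ℝ (TangentSpace (𝓡 d) p.2)}
  {t : Finset M} {W Z : M → Set M} {C ρ : ℝ} {k l : ℕ}

/-- The determinant of the unstable block in adapted coordinates is comparable to the unstable
determinant. -/
theorem det_blockFst_bounds {p : Control S.U × M} {τ : ℝ} {c c' : M} {κ : ℝ}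
    (hp : IsCompl (Eu p) (Ecs p)) (hk : Module.finrank ℝ (Eu p) = k) (hC : 1 ≤ C)
    (hW : IsChartNhd (d := d) c (W c) C) (hW' : IsChartNhd (d := d) c' (W c') C) (hc : p.2 ∈ W c)
    (hc' : (S.Φ τ p).2 ∈ W c')
    {T T' : EuclideanSpace ℝ (Fin d) ≃L[ℝ] EuclideanSpace ℝ (Fin k) × EuclideanSpace ℝ (Fin l)}
    {R₁ R' : EuclideanSpace ℝ (Fin d) →L[ℝ] EuclideanSpace ℝ (Fin d)}
    (h : IsAdapted (chartProj Eu Ecs c p) T) (h' : IsAdapted R' T')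
    (hD : ∀ w, R₁ (S.chartDφ c c' τ p w) = S.chartDφ c c' τ p (chartProj Eu Ecs c p w))
    (hR : ‖R₁ - R'‖ ≤ κ) (hκ : κ ≤ 1 / 2) :
    |(IsAdapted.blockFst (S.chartDφ c c' τ p) T T').det| ≤ (2 * C ^ 2) ^ k * S.unstableDet Eu τ p ∧
      S.unstableDet Eu τ p ≤ (2 * C ^ 2) ^ k * |(IsAdapted.blockFst (S.chartDφ c c' τ p) T T').det| := by
  set P := IsAdapted.blockFst (S.chartDφ c c' τ p) T T' with hP
  -- The block `P` is compared with the derivative on `E⁺` through the identification `γ`. Composed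
  -- with `γ`, `P` has the same norms as the derivative up to `2 * C`, and `γ` is isometric up to
  -- `C`; hence the factor `(2 * C) ^ k * C ^ k`.
  let γ : Eu p →ₗ[ℝ] EuclideanSpace ℝ (Fin k) :=
    (LinearMap.fst ℝ _ _ ∘ₗ T.toLinearEquiv.toLinearMap ∘ₗ (chartMap c p.2).toLinearMap).domRestrict (Eu p)
  have hγ : ∀ v : Eu p, T.symm (γ v, 0) = chartMap c p.2 (v : TangentSpace (𝓡 d) p.2) := by
    intro v
    have h1 : chartProj Eu Ecs c p (chartMap c p.2 (v : TangentSpace (𝓡 d) p.2)) =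
        chartMap c p.2 (v : TangentSpace (𝓡 d) p.2) := by
      rw [chartProj_apply, chartInv_chartMap (hW.subset_source hc)]
      have h2 := projAlong_add hp v.2 (Ecs p).zero_mem
      rw [add_zero] at h2
      rw [h2]
    have h2 := h.snd (chartMap c p.2 (v : TangentSpace (𝓡 d) p.2))
    rw [h1, sub_self, norm_zero] at h2
    rw [ContinuousLinearEquiv.symm_apply_eq]
    exact Prod.ext rfl (norm_eq_zero.1 h2).symm
  have hγn : ∀ v : Eu p, ‖γ v‖ = ‖chartMap c p.2 (v : TangentSpace (𝓡 d) p.2)‖ := fun v => by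
    rw [← hγ, h.norm_symm_inl]
  have hγ1 : ∀ v : Eu p, ‖γ v‖ ≤ C * ‖(LinearMap.id : Eu p →ₗ[ℝ] Eu p) v‖ := fun v => by
    rw [hγn]
    exact hW.chartMap_le _ hc _
  have hγ2 : ∀ v : Eu p, ‖(LinearMap.id : Eu p →ₗ[ℝ] Eu p) v‖ ≤ C * ‖γ v‖ := fun v => by
    have h1 := hW.chartInv_le _ hc (chartMap c p.2 (v : TangentSpace (𝓡 d) p.2))
    rw [chartInv_chartMap (hW.subset_source hc), ← hγn] at h1
    exact h1
  let f : Eu p →ₗ[ℝ] TangentSpace (𝓡 d) (S.Φ τ p).2 := (S.Dφ τ p).toLinearMap.domRestrict (Eu p)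
  have hPγ : ∀ v : Eu p, ‖(P.toLinearMap ∘ₗ γ) v‖ ≤ 2 * C * ‖f v‖ ∧ ‖f v‖ ≤ 2 * C * ‖(P.toLinearMap ∘ₗ γ) v‖ := by
    intro v
    have h1 := IsAdapted.norm_blockFst_le h h' hD hR (γ v)
    rw [hγ, ← hP] at h1
    have h2 := norm_Dφ_le_chartDφ (S := S) hW hW' hc hc' (v : TangentSpace (𝓡 d) p.2)
    have h3 := norm_nonneg (S.chartDφ c c' τ p (chartMap c p.2 (v : TangentSpace (𝓡 d) p.2)))
    have h5 : ‖S.chartDφ c c' τ p (chartMap c p.2 (v : TangentSpace (𝓡 d) p.2))‖ ≤ 2 * ‖P (γ v)‖ := by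
      nlinarith [h1.2]
    have h6 : ‖P (γ v)‖ ≤ 2 * ‖S.chartDφ c c' τ p (chartMap c p.2 (v : TangentSpace (𝓡 d) p.2))‖ := by
      nlinarith [h1.1]
    constructor
    · calc ‖P (γ v)‖ ≤ 2 * (C * ‖S.Dφ τ p (v : TangentSpace (𝓡 d) p.2)‖) := h6.trans (by linarith [h2.2])
        _ = _ := by rw [← mul_assoc]; rfl
    · calc ‖S.Dφ τ p (v : TangentSpace (𝓡 d) p.2)‖ ≤ C * (2 * ‖P (γ v)‖) := h2.1.trans (by gcongr)
        _ = _ := by rw [← mul_assoc, mul_comm C]; rfl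
  have hC0 : 0 ≤ C := by linarith
  have e1 := normDet_le_of_norm_le (by positivity) fun v => (hPγ v).1
  have e2 := normDet_le_of_norm_le (by positivity) fun v => (hPγ v).2
  have e3 := normDet_le_of_norm_le hC0 hγ1
  have e4 := normDet_le_of_norm_le hC0 hγ2
  rw [LinearMap.normDet_comp_of_finrank_eq _ _ (by rw [hk, finrank_euclideanSpace_fin]),
    LinearMap.normDet_eq_abs_det, hk] at e1 e2
  rw [LinearMap.normDet_id, hk] at e3 e4
  have e5 : f.normDet = S.unstableDet Eu τ p := rfl
  rw [e5] at e1 e2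
  have hdet : P.toLinearMap.det = P.det := rfl
  rw [hdet] at e1 e2
  have hJ := unstableDet_nonneg (Eu := Eu) τ p
  have hPd := abs_nonneg P.det
  have hmul : (2 * C ^ 2) ^ k = (2 * C) ^ k * C ^ k := by rw [← mul_pow]; ring
  rw [hmul]
  constructor
  · calc |P.det| = |P.det| * 1 := (mul_one _).symm
      _ ≤ |P.det| * (C ^ k * γ.normDet) := by gcongr
      _ = (|P.det| * γ.normDet) * C ^ k := by ring
      _ ≤ ((2 * C) ^ k * S.unstableDet Eu τ p) * C ^ k := by gcongr
      _ = _ := by ring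
  · calc S.unstableDet Eu τ p ≤ (2 * C) ^ k * (|P.det| * γ.normDet) := e2
      _ ≤ (2 * C) ^ k * (|P.det| * (C ^ k * 1)) := by gcongr
      _ = _ := by ring

/-- The time-`τ` map in adapted coordinates centered at `x` and at its image. -/
def stepMap (S : System d m M) (τ : ℝ) (u : Control S.U) (c c' : M)
    (T T' : EuclideanSpace ℝ (Fin d) ≃L[ℝ] EuclideanSpace ℝ (Fin k) × EuclideanSpace ℝ (Fin l)) (x : M)
    (v : EuclideanSpace ℝ (Fin k) × EuclideanSpace ℝ (Fin l)) :
    EuclideanSpace ℝ (Fin k) × EuclideanSpace ℝ (Fin l) :=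
  T' (extChartAt (𝓡 d) c' (S.φ τ ((extChartAt (𝓡 d) c).symm (extChartAt (𝓡 d) c x + T.symm v)) u) -
    extChartAt (𝓡 d) c' (S.φ τ x u))

/-- The points `y` and `y'` of the fibers shadow `x` and its image. The image of `y` and `y'` lie in
one fiber and are both close to the image of `x`, so the unstable projections at these two points
are close, although the points may differ. The factors `C ^ 2` in the rates come from the chart
changes at both ends. -/
theorem IsPartiallyHyperbolic.exists_isDominatedStep (hE : S.IsPartiallyHyperbolic Q Eu Ecs)
    (hS : S.IsComplete) (hQ : IsCompact Q) (hcov : IsChartCover (d := d) Q t W Z C ρ)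
    (hk : ∀ p ∈ S.lift Q, Module.finrank ℝ (Eu p) = k) (τ : ℝ) {α β : ℝ} (hα0 : 0 ≤ α) (hβ0 : 0 ≤ β)
    (hαβ : ∀ p ∈ S.lift Q, (∀ v ∈ Eu p, α * ‖v‖ ≤ ‖S.Dφ τ p v‖) ∧
      ∀ v ∈ Ecs p, ‖S.Dφ τ p v‖ ≤ β * ‖v‖) {η : ℝ≥0} (hη : 0 < η) :
    ∃ ε > 0, ∃ δ > 0, ∀ (u : Control S.U) (x y y' c c' : M) (T T'), (u, y) ∈ S.lift Q →
      (shift τ u, y') ∈ S.lift Q → IsAdaptedAt (k := k) (l := l) Eu Ecs t Z ρ (u, y) c T →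
      IsAdaptedAt Eu Ecs t Z ρ (shift τ u, y') c' T' → dist x y < ε → dist (S.φ τ x u) y' < ε →
      ∃ P D, IsDominatedStep (S.stepMap τ u c c' T T' x) P D (α / C ^ 2 / 2) (2 * (C ^ 2 * β)) η δ ∧
        |P.det| ≤ (2 * C ^ 2) ^ k * S.unstableDet Eu τ (u, y) ∧
        S.unstableDet Eu τ (u, y) ≤ (2 * C ^ 2) ^ k * |P.det| := by
  obtain ⟨Λ, hΛ, hproj⟩ := hE.exists_norm_chartProj_le' hS hQ hcov
  obtain ⟨K, hK, hKD⟩ := exists_norm_Dφ_le hS τ (isCompact_lift hS hQ)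
  have hC1 := hcov.one_le
  have hC0 : 0 < C := by linarith
  have hρ := hcov.pos
  -- The error term of `IsAdapted.isDominatedStep`, with `C * K * C` bounding the derivative in
  -- charts and `Λ + 1` the norm of the target coordinates.
  obtain ⟨κ, hκ, hκ1, hκη⟩ : ∃ κ : ℝ, 0 < κ ∧ κ ≤ 1 / 2 ∧ κ * (C * K * C + 2 * (Λ + 1)) ≤ η := by
    have hη' : (0 : ℝ) < η := hη
    refine ⟨min (1 / 2) (η / (C * K * C + 2 * (Λ + 1))), by positivity, min_le_left _ _, ?_⟩
    rw [← le_div_iff₀ (by positivity)]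
    exact min_le_right _ _
  obtain ⟨ε₁, hε₁, h₁⟩ := hE.exists_dist_chartProj_lt hS hQ hcov hκ
  obtain ⟨ε₂, hε₂, h₂⟩ := exists_dist_chartDφ_lt hS hcov τ hκ
  have hX : IsCompact (⋃ c ∈ t, Z c) := t.isCompact_biUnion hcov.isCompact
  have hZX : ∀ c ∈ t, ∀ z ∈ Z c, z ∈ ⋃ c ∈ t, Z c := fun c hc z hz => mem_iUnion₂.2 ⟨c, hc, hz⟩
  obtain ⟨ε₃, hε₃, h₃⟩ := exists_dist_φ_lt hS τ hX (η := min ρ ε₁ / 2) (by positivity)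
  obtain ⟨ε, hε, hερ, hε1, hε2, hε3⟩ : ∃ ε > 0, 2 * ε ≤ ρ ∧ 2 * ε ≤ ε₁ ∧ 2 * ε ≤ ε₂ ∧ 2 * ε ≤ ε₃ := by
    refine ⟨min (min ρ ε₁) (min ε₂ ε₃) / 2, by positivity, ?_⟩
    rw [mul_div_cancel₀ _ two_ne_zero]
    exact ⟨(min_le_left _ _).trans (min_le_left _ _), (min_le_left _ _).trans (min_le_right _ _),
      (min_le_right _ _).trans (min_le_left _ _), (min_le_right _ _).trans (min_le_right _ _)⟩
  obtain ⟨r, hr, hsymm⟩ := exists_forall_symm hcov hε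
  -- The inverse of adapted coordinates has norm at most 2, so radius `r / 2` there stays within
  -- radius `r` in the chart.
  refine ⟨ε, hε, r / 2, by positivity, fun u x y y' c c' T T' hy hy' hT hT' hxy hxy' => ?_⟩
  have hNc := hcov.isChartNhd c hT.mem
  have hNc' := hcov.isChartNhd c' hT'.mem
  have hρ1 := min_le_left ρ ε₁
  have hρ2 := min_le_right ρ ε₁
  have hyZ : y ∈ Z c := hT.ball_subset (Metric.mem_ball_self hcov.pos)
  have hy'Z : y' ∈ Z c' := hT'.ball_subset (Metric.mem_ball_self hcov.pos)
  have hxZ : x ∈ Z c := hT.ball_subset (Metric.mem_ball.2 (hxy.trans_le (by linarith)))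
  have hnear : ∀ z, dist z x < ε → z ∈ Z c ∧ S.φ τ z u ∈ Z c' := fun z hz => by
    have hz1 : z ∈ Z c := hT.ball_subset (Metric.mem_ball.2
      ((dist_triangle z x y).trans_lt (by linarith)))
    have h4 := h₃ u z (hZX c hT.mem z hz1) x (hZX c hT.mem x hxZ) (hz.trans_le (by linarith))
    exact ⟨hz1, hT'.ball_subset (Metric.mem_ball.2 ((dist_triangle _ (S.φ τ x u) y').trans_lt
      (by linarith)))⟩
  have hφy := h₃ u y (hZX c hT.mem y hyZ) x (hZX c hT.mem x hxZ)
    (by rw [dist_comm]; linarith)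
  have hφyy' := dist_triangle (S.φ τ y u) (S.φ τ x u) y'
  have hφyZ : S.φ τ y u ∈ Z c' := hT'.ball_subset (Metric.mem_ball.2 (hφyy'.trans_lt (by linarith)))
  have hR := (h₁ c' hT'.mem (shift τ u) _ hφyZ y' hy'Z (Φ_mem_lift hS hy τ) hy'
    (hφyy'.trans_lt (by linarith))).le
  have hyW : (u, y).2 ∈ W c := hcov.subset c hT.mem hyZ
  have hφyW : (S.Φ τ (u, y)).2 ∈ W c' := hcov.subset c' hT'.mem hφyZ
  have hD := hE.chartProj_chartDφ hy hS τ (hNc.subset_source hyW) (hNc'.subset_source hφyW)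
  have hDn : ∀ w, ‖S.chartDφ c c' τ (u, y) w‖ ≤ C * ‖S.Dφ τ (u, y) (chartInv c y w)‖ ∧
      ‖S.Dφ τ (u, y) (chartInv c y w)‖ ≤ C * ‖S.chartDφ c c' τ (u, y) w‖ := fun w => by
    have h4 := norm_Dφ_le_chartDφ (S := S) hNc hNc' hyW hφyW (chartInv c y w)
    rw [chartMap_chartInv (hNc.subset_source hyW)] at h4
    exact ⟨h4.2, h4.1⟩
  refine ⟨_, IsAdapted.blockSnd (S.chartDφ c c' τ (u, y)) T T', ?_, det_blockFst_bounds (hE.isCompl _ hy) (hk _ hy) hC1 hNc hNc' hyW hφyW hT.isAdapted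
    hT'.isAdapted hD hR hκ1⟩
  have hψx := (extChartAt (𝓡 d) c).left_inv (hNc.subset_source (hcov.subset c hT.mem hxZ))
  have hmain := IsAdapted.isDominatedStep hT.isAdapted hT'.isAdapted hD hR
    (G := fun w => extChartAt (𝓡 d) c' (S.φ τ ((extChartAt (𝓡 d) c).symm w) u))
    (G' := fun w => S.chartDφ c c' τ (u, (extChartAt (𝓡 d) c).symm w))
    (w₀ := extChartAt (𝓡 d) c x) (α := α / C ^ 2) (β := C ^ 2 * β) (δ := r / 2) (r := r) (τ := Λ + 1)
    (K := C * K * C) (η := η) hκ.le hκ1 (by positivity) (fun w => ?_) (by positivity)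
    (hT'.isAdapted.norm_le (hproj c' hT'.mem _ hy' (hcov.subset c' hT'.mem hy'Z)))
    (by linarith) (fun w hw => ?_) (fun w hw => ?_) (fun w hw => ?_) hκη
  · simp only [hψx] at hmain
    exact hmain
  · calc _ ≤ C * ‖S.Dφ τ (u, y) (chartInv c y w)‖ := (hDn w).1
      _ ≤ C * (K * (C * ‖w‖)) := by
        gcongr
        exact (hKD (u, y) hy _).trans (by gcongr; exact hNc.chartInv_le _ hyW _)
      _ = _ := by ring
  · obtain ⟨h4, h5, h6⟩ := hsymm c hT.mem x hxZ w hw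
    obtain ⟨h7, h8⟩ := hnear _ h6
    refine ⟨hasFDerivAt_chart_φ hS h4 (hNc'.subset_source (hcov.subset c' hT'.mem h8)), ?_⟩
    exact (h₂ (c, c') (Finset.mem_product.2 ⟨hT.mem, hT'.mem⟩) u _ h7 y hyZ h8 hφyZ
      ((dist_triangle _ x y).trans_lt (by linarith))).le
  · have h4 := (hαβ _ hy).1 _ (chartInv_mem_Eu (hNc.subset_source hyW) hw)
    have h5 := hNc.chartMap_le _ hyW (chartInv c y w)
    rw [chartMap_chartInv (hNc.subset_source hyW)] at h5
    rw [div_mul_eq_mul_div, div_le_iff₀ (by positivity)]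
    calc α * ‖w‖ ≤ α * (C * ‖(chartInv c y w : TangentSpace (𝓡 d) y)‖) := by gcongr
      _ = C * (α * ‖(chartInv c y w : TangentSpace (𝓡 d) y)‖) := by ring
      _ ≤ C * (C * ‖S.chartDφ c c' τ (u, y) w‖) :=
        mul_le_mul_of_nonneg_left (h4.trans (hDn w).2) hC0.le
      _ = _ := by ring
  · have h4 := (hαβ _ hy).2 _ (chartInv_mem_Ecs (hE.isCompl _ hy) (hNc.subset_source hyW) hw)
    calc _ ≤ C * ‖S.Dφ τ (u, y) (chartInv c y w)‖ := (hDn w).1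
      _ ≤ C * (β * (C * ‖w‖)) := by
        gcongr
        exact h4.trans (by gcongr; exact hNc.chartInv_le _ hyW _)
      _ = _ := by ring

end System
end ControlAffine
-- Bowen balls as orbit balls along a chain of coordinates
namespace ControlAffine

theorem euclideanHausdorffMeasure_le_of_dist_le {X Y : Type*} [MetricSpace X]
    [MeasurableSpace X] [BorelSpace X] [MetricSpace Y] [MeasurableSpace Y] [BorelSpace Y]
    {K : ℝ} (hK : 0 ≤ K) {f : X → Y} {s : Set X}
    (h : ∀ y ∈ s, ∀ z ∈ s, dist y z ≤ K * dist (f y) (f z)) (d : ℕ) :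
    (μHE[d] : Measure X) s ≤ ENNReal.ofReal K ^ d * (μHE[d] : Measure Y) (f '' s) := by
  rcases s.eq_empty_or_nonempty with rfl | ⟨x₀, hx₀⟩
  · simp
  have : Nonempty X := ⟨x₀⟩
  have hinj : InjOn f s := fun y hy z hz hyz => by
    have h1 := h y hy z hz
    rw [hyz, dist_self, mul_zero] at h1
    exact dist_le_zero.1 h1
  have hlip : LipschitzOnWith K.toNNReal (Function.invFunOn f s) (f '' s) := by
    refine LipschitzOnWith.of_dist_le_mul ?_
    rintro _ ⟨y, hy, rfl⟩ _ ⟨z, hz, rfl⟩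
    rw [hinj.leftInvOn_invFunOn hy, hinj.leftInvOn_invFunOn hz, Real.coe_toNNReal _ hK]
    exact h y hy z hz
  have h1 := hlip.euclideanHausdorffMeasure_image_le d
  rwa [hinj.leftInvOn_invFunOn.image_image] at h1

theorem euclideanHausdorffMeasure_image_le_of_dist_le {X Y : Type*} [MetricSpace X]
    [MeasurableSpace X] [BorelSpace X] [MetricSpace Y] [MeasurableSpace Y] [BorelSpace Y]
    {K : ℝ} (hK : 0 ≤ K) {f : X → Y} {s : Set X}
    (h : ∀ y ∈ s, ∀ z ∈ s, dist (f y) (f z) ≤ K * dist y z) (d : ℕ) :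
    (μHE[d] : Measure Y) (f '' s) ≤ ENNReal.ofReal K ^ d * (μHE[d] : Measure X) s := by
  refine (LipschitzOnWith.of_dist_le_mul (K := K.toNNReal) fun y hy z hz => ?_).euclideanHausdorffMeasure_image_le d
  rw [Real.coe_toNNReal _ hK]
  exact h y hy z hz

theorem mem_seqBall_iff {A B : Type*} [NormedAddCommGroup A] [NormedSpace ℝ A]
    [NormedAddCommGroup B] [NormedSpace ℝ B] {δ : ℝ} {n : ℕ} {F : ℕ → A × B → A × B} {v : A × B} :
    v ∈ seqBall δ n F ↔ ∃ w : ℕ → A × B, w 0 = v ∧ (∀ j < n, w (j + 1) = F j (w j)) ∧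
      ∀ j ≤ n, ‖w j‖ ≤ δ := by
  induction n generalizing F v with
  | zero =>
    rw [seqBall, mem_closedBall_zero_iff]
    refine ⟨fun h => ⟨fun _ => v, rfl, by simp, fun j _ => h⟩, ?_⟩
    rintro ⟨w, rfl, -, h⟩
    exact h 0 le_rfl
  | succ n ih =>
    rw [seqBall, mem_inter_iff, mem_preimage, ih, mem_closedBall_zero_iff]
    constructor
    · rintro ⟨hv, w, hw0, hw, hwδ⟩
      refine ⟨fun j => Nat.casesOn j v w, rfl, fun j hj => ?_, fun j hj => ?_⟩
      · cases j with
        | zero => exact hw0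
        | succ j => exact hw j (by omega)
      · cases j with
        | zero => exact hv
        | succ j => exact hwδ j (by omega)
    · rintro ⟨w, rfl, hw, hwδ⟩
      exact ⟨hwδ 0 (by omega), fun j => w (j + 1), hw 0 (by omega), fun j hj => hw (j + 1) (by omega),
        fun j hj => hwδ (j + 1) (by omega)⟩

variable {d m : ℕ} {M : Type*} [MetricSpace M] [ChartedSpace (EuclideanSpace ℝ (Fin d)) M]
  [IsManifold (𝓡 d) ∞ M]
    [RiemannianBundle (fun x : M => TangentSpace (𝓡 d) x)]
    [IsContMDiffRiemannianBundle (𝓡 d) ∞ (EuclideanSpace ℝ (Fin d))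
      (fun x : M => TangentSpace (𝓡 d) x)] [IsRiemannianManifold (𝓡 d) M]

/-- Coordinates centered at `x`: the chart at `c`, followed by a linear map. -/
def chartCoord {k l : ℕ} (c : M)
    (T : EuclideanSpace ℝ (Fin d) ≃L[ℝ] EuclideanSpace ℝ (Fin k) × EuclideanSpace ℝ (Fin l)) (x z : M) :
    EuclideanSpace ℝ (Fin k) × EuclideanSpace ℝ (Fin l) :=
  T (extChartAt (𝓡 d) c z - extChartAt (𝓡 d) c x)

namespace System

variable {S : System d m M} {Q : Set M}
  {Eu Ecs : ∀ p : Control S.U × M, Submodule ℝ (TangentSpace (𝓡 d) p.2)}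
  {t : Finset M} {W Z : M → Set M} {C ρ : ℝ} {k l : ℕ}

section Coord

variable {p : Control S.U × M} {c : M} {x : M}
  {T : EuclideanSpace ℝ (Fin d) ≃L[ℝ] EuclideanSpace ℝ (Fin k) × EuclideanSpace ℝ (Fin l)}

theorem chartCoord_sub (y z : M) : chartCoord c T x y - chartCoord c T x z =
    T (extChartAt (𝓡 d) c y - extChartAt (𝓡 d) c z) := by
  rw [chartCoord, chartCoord, ← map_sub, sub_sub_sub_cancel_right]

theorem chartCoord_self : chartCoord c T x x = 0 := by
  rw [chartCoord, sub_self, map_zero]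

theorem IsAdaptedAt.dist_chartCoord_le (h : IsAdaptedAt Eu Ecs t Z ρ p c T)
    (hcov : IsChartCover (d := d) Q t W Z C ρ) {Λ : ℝ} (hΛ : 0 ≤ Λ)
    (hR : ∀ w, ‖chartProj Eu Ecs c p w‖ ≤ Λ * ‖w‖) {y z : M} (hy : y ∈ Z c) (hz : z ∈ Z c) :
    dist (chartCoord c T x y) (chartCoord c T x z) ≤ (Λ + 1) * C * dist y z := by
  rw [dist_eq_norm, chartCoord_sub, mul_assoc]
  refine (h.isAdapted.norm_le hR _).trans ?_
  rw [← dist_eq_norm]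
  gcongr
  exact (hcov.isChartNhd c h.mem).dist_chart_le _ (hcov.subset c h.mem hy) _ (hcov.subset c h.mem hz)

theorem IsAdaptedAt.dist_le (h : IsAdaptedAt Eu Ecs t Z ρ p c T)
    (hcov : IsChartCover (d := d) Q t W Z C ρ) {y z : M} (hy : y ∈ Z c) (hz : z ∈ Z c) :
    dist y z ≤ 2 * C * dist (chartCoord c T x y) (chartCoord c T x z) := by
  have hC := (hcov.isChartNhd c h.mem).pos
  refine ((hcov.isChartNhd c h.mem).dist_le _ (hcov.subset c h.mem hy) _ (hcov.subset c h.mem hz)).trans ?_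
  have h1 := h.isAdapted.norm_symm_le (chartCoord c T x y - chartCoord c T x z)
  rw [chartCoord_sub, T.symm_apply_apply, ← chartCoord_sub (x := x), ← dist_eq_norm, ← dist_eq_norm] at h1
  calc _ ≤ C * (2 * dist (chartCoord c T x y) (chartCoord c T x z)) := by gcongr
    _ = _ := by ring

theorem stepMap_chartCoord {c' : M} {τ : ℝ} {u : Control S.U}
    {T' : EuclideanSpace ℝ (Fin d) ≃L[ℝ] EuclideanSpace ℝ (Fin k) × EuclideanSpace ℝ (Fin l)}
    {z : M} (hz : z ∈ (extChartAt (𝓡 d) c).source) :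
    S.stepMap τ u c c' T T' x (chartCoord c T x z) = chartCoord c' T' (S.φ τ x u) (S.φ τ z u) := by
  rw [stepMap, chartCoord, T.symm_apply_apply, add_sub_cancel, (extChartAt (𝓡 d) c).left_inv hz]
  rfl

end Coord

/-- Adapted coordinates at points `y j` of fibers which are `ε`-close to the points at the times
`0, N, …, q * N` of the orbit of `x`. -/
structure IsChain (S : System d m M) (Eu Ecs : ∀ p : Control S.U × M, Submodule ℝ (TangentSpace (𝓡 d) p.2))
    (Q : Set M) (t : Finset M) (Z : M → Set M) (ρ : ℝ) (N q : ℕ) (u : Control S.U) (x : M) (ε : ℝ)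
    (y c : ℕ → M)
    (T : ℕ → EuclideanSpace ℝ (Fin d) ≃L[ℝ] EuclideanSpace ℝ (Fin k) × EuclideanSpace ℝ (Fin l)) :
    Prop where
  mem_lift : ∀ j ≤ q, (shift ((j * N : ℕ) : ℝ) u, y j) ∈ S.lift Q
  adapted : ∀ j ≤ q, IsAdaptedAt Eu Ecs t Z ρ (shift ((j * N : ℕ) : ℝ) u, y j) (c j) (T j)
  dist_lt : ∀ j ≤ q, dist (S.φ ((j * N : ℕ) : ℝ) x u) (y j) < ε

/-- The sequence of coordinate representations of the time-`N` maps along the orbit of `x`. -/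
def chainStep (S : System d m M) (N : ℕ) (u : Control S.U) (x : M) (c : ℕ → M)
    (T : ℕ → EuclideanSpace ℝ (Fin d) ≃L[ℝ] EuclideanSpace ℝ (Fin k) × EuclideanSpace ℝ (Fin l)) (j : ℕ) :
    EuclideanSpace ℝ (Fin k) × EuclideanSpace ℝ (Fin l) →
      EuclideanSpace ℝ (Fin k) × EuclideanSpace ℝ (Fin l) :=
  S.stepMap N (shift ((j * N : ℕ) : ℝ) u) (c j) (c (j + 1)) (T j) (T (j + 1)) (S.φ ((j * N : ℕ) : ℝ) x u)

theorem φ_natCast_add (hS : S.IsComplete) (i j : ℕ) (u : Control S.U) (x : M) :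
    S.φ ((j + i : ℕ) : ℝ) x u = S.φ (i : ℝ) (S.φ (j : ℝ) x u) (shift (j : ℝ) u) := by
  rw [Nat.cast_add, add_comm, φ_add hS]

theorem φ_natCast_succ_mul (hS : S.IsComplete) (N j : ℕ) (u : Control S.U) (x : M) :
    S.φ (((j + 1) * N : ℕ) : ℝ) x u =
      S.φ (N : ℝ) (S.φ ((j * N : ℕ) : ℝ) x u) (shift ((j * N : ℕ) : ℝ) u) := by
  rw [add_mul, one_mul, φ_natCast_add hS]

theorem shift_natCast_succ_mul (N j : ℕ) (u : Control S.U) :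
    shift (((j + 1) * N : ℕ) : ℝ) u = shift (N : ℝ) (shift ((j * N : ℕ) : ℝ) u) := by
  rw [shift_shift, add_mul, one_mul, Nat.cast_add, add_comm]

namespace IsChain

variable {N q : ℕ} {u : Control S.U} {x : M} {ε : ℝ} {y c : ℕ → M}
  {T : ℕ → EuclideanSpace ℝ (Fin d) ≃L[ℝ] EuclideanSpace ℝ (Fin k) × EuclideanSpace ℝ (Fin l)}

theorem mem_of_dist_lt (h : S.IsChain Eu Ecs Q t Z ρ N q u x ε y c T) {j : ℕ} (hj : j ≤ q) {z : M} {r : ℝ}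
    (hz : dist z (S.φ ((j * N : ℕ) : ℝ) x u) ≤ r) (hr : r + ε ≤ ρ) : z ∈ Z (c j) :=
  (h.adapted j hj).ball_subset (Metric.mem_ball.2
    ((dist_triangle z (S.φ ((j * N : ℕ) : ℝ) x u) (y j)).trans_lt (by linarith [h.dist_lt j hj])))

/-- Since `q * N < n`, the Bowen ball controls the orbit at all times `j * N` with `j ≤ q`, and the
adapted coordinates enlarge distances by at most `(Λ + 1) * C`. -/
theorem chartCoord_mem_seqBall (h : S.IsChain Eu Ecs Q t Z ρ N q u x ε y c T) (hS : S.IsComplete)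
    (hcov : IsChartCover (d := d) Q t W Z C ρ) {Λ : ℝ} (hΛ : 0 ≤ Λ)
    (hR : ∀ c ∈ t, ∀ p ∈ S.lift Q, p.2 ∈ W c → ∀ w, ‖chartProj Eu Ecs c p w‖ ≤ Λ * ‖w‖)
    {δ : ℝ} (hδ0 : 0 ≤ δ) (hδ : δ + ε ≤ ρ) {n : ℕ} (hn : q * N < n) {z : M} (hz : z ∈ S.bowenBall n u δ x) :
    chartCoord (c 0) (T 0) x z ∈ seqBall ((Λ + 1) * C * δ) q (S.chainStep N u x c T) := by
  have hC : 0 ≤ C := zero_le_one.trans hcov.one_le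
  have hzj : ∀ j ≤ q, dist (S.φ ((j * N : ℕ) : ℝ) z u) (S.φ ((j * N : ℕ) : ℝ) x u) ≤ δ := fun j hj => by
    rw [dist_comm]
    exact hz (j * N) ((Nat.mul_le_mul_right N hj).trans_lt hn)
  have hW : ∀ j ≤ q, ∀ z ∈ Z (c j), z ∈ W (c j) := fun j hj => hcov.subset _ (h.adapted j hj).mem
  refine mem_seqBall_iff.2 ⟨fun j => chartCoord (c j) (T j) (S.φ ((j * N : ℕ) : ℝ) x u)
    (S.φ ((j * N : ℕ) : ℝ) z u), ?_, fun j hj => ?_, fun j hj => ?_⟩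
  · simp only [zero_mul, Nat.cast_zero, φ_zero hS]
  · beta_reduce
    rw [φ_natCast_succ_mul hS, φ_natCast_succ_mul hS, chainStep, stepMap_chartCoord]
    exact (hcov.isChartNhd _ (h.adapted j hj.le).mem).subset_source
      (hW j hj.le _ (h.mem_of_dist_lt hj.le (hzj j hj.le) hδ))
  · have hxZ := h.mem_of_dist_lt hj (z := S.φ ((j * N : ℕ) : ℝ) x u) (r := δ) (by rwa [dist_self]) hδ
    have hyZ := (h.adapted j hj).ball_subset (Metric.mem_ball_self hcov.pos)
    have h1 := (h.adapted j hj).dist_chartCoord_le hcov (x := S.φ ((j * N : ℕ) : ℝ) x u) hΛ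
      (hR _ (h.adapted j hj).mem _ (h.mem_lift j hj) (hW j hj _ hyZ))
      (h.mem_of_dist_lt hj (hzj j hj) hδ) hxZ
    rw [chartCoord_self, dist_zero_right] at h1
    exact h1.trans (by gcongr; exact hzj j hj)

/-- The converse inclusion. A coordinate orbit bounded by `δ'` is the coordinate image of a true
orbit, which at the times `j * N` is `2 * C * δ'`-close to that of `x`. Equicontinuity of the flow
over times up to `N` fills in the times between, including the incomplete last block up to `n ≤ (q +
1) * N`. -/
theorem exists_chartCoord_eq (h : S.IsChain Eu Ecs Q t Z ρ N q u x ε y c T) (hS : S.IsComplete)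
    (hcov : IsChartCover (d := d) Q t W Z C ρ) (hN : 0 < N) {r δ δ' ε' : ℝ}
    (hr : ∀ c ∈ t, ∀ x ∈ Z c, ∀ w, dist w (extChartAt (𝓡 d) c x) ≤ r →
      w ∈ (extChartAt (𝓡 d) c).target ∧ (extChartAt (𝓡 d) c).symm w ∈ W c ∧
        dist ((extChartAt (𝓡 d) c).symm w) x < ρ / 2)
    (hε' : ∀ i ≤ N, ∀ u : Control S.U, ∀ y ∈ ⋃ c ∈ t, Z c, ∀ z ∈ ⋃ c ∈ t, Z c, dist y z < ε' →
      dist (S.φ i y u) (S.φ i z u) < min (ρ / 2) δ)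
    (hε : ε ≤ ρ / 2) (hδ'r : 2 * δ' ≤ r) (hδ'ε : 2 * C * δ' < ε') {n : ℕ} (hn : n ≤ (q + 1) * N)
    {v : EuclideanSpace ℝ (Fin k) × EuclideanSpace ℝ (Fin l)}
    (hv : v ∈ seqBall δ' q (S.chainStep N u x c T)) :
    ∃ z ∈ S.bowenBall n u δ x, chartCoord (c 0) (T 0) x z = v := by
  have hC : 0 ≤ C := zero_le_one.trans hcov.one_le
  have hρ := hcov.pos
  obtain ⟨w, hw0, hw, hwδ⟩ := mem_seqBall_iff.1 hv
  let xj : ℕ → M := fun j => S.φ ((j * N : ℕ) : ℝ) x u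
  have hx0 : xj 0 = x := by simp only [xj, zero_mul, Nat.cast_zero, φ_zero hS]
  have hxZ : ∀ j ≤ q, xj j ∈ Z (c j) := fun j hj =>
    h.mem_of_dist_lt hj (r := 0) (by rw [dist_self]) (by linarith)
  have hsrc : ∀ j ≤ q, ∀ z ∈ Z (c j), z ∈ (extChartAt (𝓡 d) (c j)).source := fun j hj z hz =>
    (hcov.isChartNhd _ (h.adapted j hj).mem).subset_source (hcov.subset _ (h.adapted j hj).mem hz)
  have hX : ∀ j ≤ q, ∀ z ∈ Z (c j), z ∈ ⋃ c ∈ t, Z c := fun j hj z hz =>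
    mem_iUnion₂.2 ⟨c j, (h.adapted j hj).mem, hz⟩
  let z := (extChartAt (𝓡 d) (c 0)).symm (extChartAt (𝓡 d) (c 0) x + (T 0).symm v)
  let zj : ℕ → M := fun j => S.φ ((j * N : ℕ) : ℝ) z u
  have hz0 : zj 0 = z := by simp only [zj, zero_mul, Nat.cast_zero, φ_zero hS]
  have hdist : ∀ j ≤ q, zj j ∈ Z (c j) → chartCoord (c j) (T j) (xj j) (zj j) = w j →
      dist (zj j) (xj j) < ε' := fun j hj hz1 hz2 => by
    have h1 := (h.adapted j hj).dist_le hcov (x := xj j) hz1 (hxZ j hj)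
    rw [hz2, chartCoord_self, dist_zero_right] at h1
    exact (h1.trans (by gcongr; exact hwδ j hj)).trans_lt hδ'ε
  have key : ∀ j ≤ q, zj j ∈ Z (c j) ∧ chartCoord (c j) (T j) (xj j) (zj j) = w j := by
    intro j
    induction j with
    | zero =>
      intro hj
      rw [hz0, hx0]
      have hx := hxZ 0 hj
      rw [hx0] at hx
      obtain ⟨h1, h2, h3⟩ := hr (c 0) (h.adapted 0 hj).mem x hx
        (extChartAt (𝓡 d) (c 0) x + (T 0).symm v) (by
          rw [dist_eq_norm, add_sub_cancel_left]
          refine ((h.adapted 0 hj).isAdapted.norm_symm_le v).trans (le_trans ?_ hδ'r)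
          rw [← hw0]
          linarith [hwδ 0 hj])
      refine ⟨h.mem_of_dist_lt hj (r := ρ / 2) ?_ (by linarith), ?_⟩
      · change dist z (xj 0) ≤ _
        rw [hx0]
        exact h3.le
      · rw [chartCoord, (extChartAt (𝓡 d) (c 0)).right_inv h1, add_sub_cancel_left,
          (T 0).apply_symm_apply, hw0]
    | succ j ih =>
      intro hj
      obtain ⟨h1, h2⟩ := ih (by omega)
      have h3 := hε' N le_rfl (shift ((j * N : ℕ) : ℝ) u) _ (hX j (by omega) _ h1) _
        (hX j (by omega) _ (hxZ j (by omega))) (hdist j (by omega) h1 h2)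
      have hz1 : zj (j + 1) = S.φ N (zj j) (shift ((j * N : ℕ) : ℝ) u) := φ_natCast_succ_mul hS N j u z
      have hx1 : xj (j + 1) = S.φ N (xj j) (shift ((j * N : ℕ) : ℝ) u) := φ_natCast_succ_mul hS N j u x
      rw [← hz1, ← hx1] at h3
      refine ⟨h.mem_of_dist_lt hj (r := ρ / 2) (h3.le.trans (min_le_left _ _)) (by linarith), ?_⟩
      rw [hw j (by omega), ← h2, chainStep, stepMap_chartCoord (hsrc j (by omega) _ h1), hz1, hx1]
  refine ⟨z, fun i hi => ?_, ?_⟩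
  · have hiq : i / N ≤ q := Nat.lt_succ_iff.1 ((Nat.div_lt_iff_lt_mul hN).2 (hi.trans_le hn))
    obtain ⟨h1, h2⟩ := key _ hiq
    have h3 := hε' (i % N) (Nat.mod_lt _ hN).le (shift ((i / N * N : ℕ) : ℝ) u) _ (hX _ hiq _ h1) _
      (hX _ hiq _ (hxZ _ hiq)) (hdist _ hiq h1 h2)
    rw [← φ_natCast_add hS, ← φ_natCast_add hS, mul_comm, Nat.div_add_mod] at h3
    rw [dist_comm]
    exact h3.le.trans (min_le_right _ _)
  · have h1 := (key 0 (Nat.zero_le _)).2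
    rwa [hz0, hx0, hw0] at h1

end IsChain
end System
end ControlAffine
-- Comparison of cocycles and choice of the block length
namespace ControlAffine

theorem IsDominatedStep.mono {A B : Type*} [NormedAddCommGroup A] [NormedSpace ℝ A]
    [NormedAddCommGroup B] [NormedSpace ℝ B] {F : A × B → A × B} {P : A →L[ℝ] A} {C : B →L[ℝ] B}
    {a b δ δ' : ℝ} {η : ℝ≥0} (h : IsDominatedStep F P C a b η δ) (hδ : δ' ≤ δ) :
    IsDominatedStep F P C a b η δ' where
  zero := h.zero
  approx := h.approx.mono_set (Metric.closedBall_subset_closedBall hδ)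
  expand := h.expand
  bound := h.bound

variable {d m : ℕ} {M : Type*} [MetricSpace M] [ChartedSpace (EuclideanSpace ℝ (Fin d)) M]
  [IsManifold (𝓡 d) ∞ M]
    [RiemannianBundle (fun x : M => TangentSpace (𝓡 d) x)]
    [IsContMDiffRiemannianBundle (𝓡 d) ∞ (EuclideanSpace ℝ (Fin d))
      (fun x : M => TangentSpace (𝓡 d) x)] [IsRiemannianManifold (𝓡 d) M]

namespace System

variable {S : System d m M} {Q : Set M}
  {Eu Ecs : ∀ p : Control S.U × M, Submodule ℝ (TangentSpace (𝓡 d) p.2)}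
  {t : Finset M} {W Z : M → Set M} {C ρ : ℝ} {k l : ℕ}

theorem exists_mem_fiber_of_mem_nearFiber {n : ℕ} {u : Control S.U} {ε ε' : ℝ} (hε : 0 < ε')
    (hεε : ε < ε') {x : M} (hx : x ∈ S.nearFiber Q n u ε) {i : ℕ} (hi : i < n) :
    ∃ y, (shift (i : ℝ) u, y) ∈ S.lift Q ∧ dist (S.φ i x u) y < ε' := by
  have h1 : Metric.infEDist (S.φ i x u) (S.fiber Q (shift i u)) < ENNReal.ofReal ε' :=
    (hx i hi).trans_lt ((ENNReal.ofReal_lt_ofReal_iff hε).2 hεε)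
  obtain ⟨y, hy, hd⟩ := Metric.infEDist_lt_iff.1 h1
  rw [edist_dist, ENNReal.ofReal_lt_ofReal_iff hε] at hd
  exact ⟨y, hy, hd⟩

theorem IsPartiallyHyperbolic.exists_isChain (hE : S.IsPartiallyHyperbolic Q Eu Ecs)
    (hS : S.IsComplete) (hcov : IsChartCover (d := d) Q t W Z C ρ)
    (hkl : ∀ p ∈ S.lift Q, Module.finrank ℝ (Eu p) = k ∧ Module.finrank ℝ (Ecs p) = l)
    {n N q : ℕ} (hq : q * N < n) {ε ε' : ℝ} (hε : 0 < ε') (hεε : ε < ε') {u : Control S.U} {x : M}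
    (hx : x ∈ S.nearFiber Q n u ε) :
    ∃ y c T, IsChain (k := k) (l := l) S Eu Ecs Q t Z ρ N q u x ε' y c T := by
  have h1 : ∀ j ≤ q, ∃ (y c : M) (T : EuclideanSpace ℝ (Fin d) ≃L[ℝ]
      EuclideanSpace ℝ (Fin k) × EuclideanSpace ℝ (Fin l)),
      (shift ((j * N : ℕ) : ℝ) u, y) ∈ S.lift Q ∧
      IsAdaptedAt Eu Ecs t Z ρ (shift ((j * N : ℕ) : ℝ) u, y) c T ∧
      dist (S.φ ((j * N : ℕ) : ℝ) x u) y < ε' := by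
    intro j hj
    obtain ⟨y, hy, hd⟩ := exists_mem_fiber_of_mem_nearFiber hε hεε hx
      ((Nat.mul_le_mul_right N hj).trans_lt hq)
    obtain ⟨c, T, hT⟩ := hE.exists_isAdaptedAt hS hcov hy (hkl _ hy).1 (hkl _ hy).2
    exact ⟨y, c, T, hy, hT, hd⟩
  -- Filler values for indices beyond `q`, since the sequences are indexed by all natural numbers.
  obtain ⟨y₀, c₀, T₀, -⟩ := h1 0 (Nat.zero_le _)
  have h2 : ∀ j, ∃ (y c : M) (T : EuclideanSpace ℝ (Fin d) ≃L[ℝ]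
      EuclideanSpace ℝ (Fin k) × EuclideanSpace ℝ (Fin l)), j ≤ q →
      (shift ((j * N : ℕ) : ℝ) u, y) ∈ S.lift Q ∧
      IsAdaptedAt Eu Ecs t Z ρ (shift ((j * N : ℕ) : ℝ) u, y) c T ∧
      dist (S.φ ((j * N : ℕ) : ℝ) x u) y < ε' := by
    intro j
    by_cases hj : j ≤ q
    · obtain ⟨y, c, T, h⟩ := h1 j hj
      exact ⟨y, c, T, fun _ => h⟩
    · exact ⟨y₀, c₀, T₀, fun h => absurd h hj⟩
  choose y c T h using h2
  exact ⟨y, c, T, fun j hj => (h j hj).1, fun j hj => (h j hj).2.1, fun j hj => (h j hj).2.2⟩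

section Cocycle

variable {j : Control S.U × M → ℝ} {X : Set M}

theorem cocycle_pos (hj0 : ∀ p, 0 < j p) (n : ℕ) (p : Control S.U × M) : 0 < S.cocycle j n p :=
  Finset.prod_pos fun _ _ => hj0 _

theorem cocycle_mul (hS : S.IsComplete) (N q : ℕ) (p : Control S.U × M) :
    S.cocycle j (q * N) p = ∏ i ∈ Finset.range q, S.cocycle j N (S.Φ ((i * N : ℕ) : ℝ) p) := by
  induction q with
  | zero => simp [cocycle]
  | succ q ih => rw [add_mul, one_mul, cocycle_add hS, Finset.prod_range_succ, ih]

/-- The logarithm of the cocycle is uniformly continuous on the compact set of points whose first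
`N` iterates lie over `X`; a difference below one costs a factor `e`. -/
theorem exists_cocycle_le (hS : S.IsComplete) (hX : IsCompact X) (hjc : ContinuousOn j (univ ×ˢ X))
    (hj0 : ∀ p, 0 < j p) {N : ℕ} (hN : 0 < N) :
    ∃ ε > 0, ∀ (u : Control S.U) (x y : M), (∀ i < N, (S.Φ i (u, x)).2 ∈ X) →
      (∀ i < N, (S.Φ i (u, y)).2 ∈ X) → dist x y < ε →
      S.cocycle j N (u, x) ≤ Real.exp 1 * S.cocycle j N (u, y) := by
  let Y : Set (Control S.U × M) := ⋂ i ∈ Finset.range N, (fun p => (S.Φ i p).2) ⁻¹' X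
  have hmem : ∀ p, p ∈ Y ↔ ∀ i < N, (S.Φ i p).2 ∈ X := fun p => by
    simp only [Y, mem_iInter, Finset.mem_range, mem_preimage]
  have hYc : IsCompact Y := by
    refine (isCompact_univ_prod S hX).of_isClosed_subset (isClosed_biInter fun i _ =>
      hX.isClosed.preimage (continuous_snd.comp (continuous_Φ hS i))) fun p hp => ⟨mem_univ _, ?_⟩
    have h := (hmem p).1 hp 0 hN
    rwa [Nat.cast_zero, Φ_zero hS] at h
  have hcont : ContinuousOn (fun p => Real.log (S.cocycle j N p)) Y := by
    refine ContinuousOn.log ?_ fun p _ => (cocycle_pos hj0 N p).ne'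
    refine continuousOn_finsetProd _ fun i hi => ?_
    exact hjc.comp (continuous_Φ hS i).continuousOn fun p hp =>
      ⟨mem_univ _, (hmem p).1 hp i (Finset.mem_range.1 hi)⟩
  obtain ⟨ε, hε, h⟩ := exists_forall_dist_lt hYc hcont one_pos
  refine ⟨ε, hε, fun u x y hx hy hxy => ?_⟩
  have h1 := h u x y ((hmem _).2 hx) ((hmem _).2 hy) hxy
  rw [Real.dist_eq] at h1
  have h2 := (abs_lt.1 h1).2
  have h3 := cocycle_pos hj0 N (u, x)
  have h4 := cocycle_pos hj0 N (u, y)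
  rw [← Real.log_le_log_iff h3 (by positivity), Real.log_mul (Real.exp_pos _).ne' h4.ne', Real.log_exp]
  linarith

/-- Writing `n = q * N + r` with `r ≤ N`, each full block costs a factor `E`, and the remainder
consists of at most `N` factors between `κ⁻¹` and `κ`. -/
theorem cocycle_bounds (hS : S.IsComplete) (hj0 : ∀ p, 0 < j p) {κ E : ℝ} (hκ : 1 ≤ κ)
    (hE : 0 ≤ E) (hjκ : ∀ p : Control S.U × M, p.2 ∈ X → j p ≤ κ ∧ 1 ≤ κ * j p) {n N q : ℕ} (hqn : q * N ≤ n)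
    (hnN : n ≤ (q + 1) * N) {p : Control S.U × M} (hp : ∀ i < n, (S.Φ i p).2 ∈ X) {D : ℕ → ℝ}
    (hD0 : ∀ i < q, 0 ≤ D i)
    (hD : ∀ i < q, S.cocycle j N (S.Φ ((i * N : ℕ) : ℝ) p) ≤ E * D i ∧
      D i ≤ E * S.cocycle j N (S.Φ ((i * N : ℕ) : ℝ) p)) :
    S.cocycle j n p ≤ κ ^ N * E ^ q * ∏ i ∈ Finset.range q, D i ∧
      ∏ i ∈ Finset.range q, D i ≤ κ ^ N * E ^ q * S.cocycle j n p := by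
  obtain ⟨r, rfl⟩ := Nat.exists_eq_add_of_le hqn
  have hr : r ≤ N := by
    rw [add_mul, one_mul] at hnN
    omega
  have hrest : S.cocycle j r (S.Φ ((q * N : ℕ) : ℝ) p) ≤ κ ^ N ∧
      1 ≤ κ ^ N * S.cocycle j r (S.Φ ((q * N : ℕ) : ℝ) p) := by
    have hi : ∀ i < r, (S.Φ (i : ℝ) (S.Φ ((q * N : ℕ) : ℝ) p)).2 ∈ X := fun i hi => by
      rw [← Φ_add hS, add_comm, ← Nat.cast_add]
      exact hp _ (by omega)
    have h1 : κ ^ r ≤ κ ^ N := pow_le_pow_right₀ hκ hr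
    constructor
    · refine le_trans ?_ h1
      calc _ ≤ ∏ i ∈ Finset.range r, κ := Finset.prod_le_prod (fun _ _ => (hj0 _).le)
            fun i hir => (hjκ _ (hi i (Finset.mem_range.1 hir))).1
        _ = _ := by simp
    · have h0 := cocycle_pos hj0 r (S.Φ ((q * N : ℕ) : ℝ) p)
      refine le_trans ?_ (mul_le_mul_of_nonneg_right h1 h0.le)
      calc (1 : ℝ) = ∏ i ∈ Finset.range r, 1 := by simp
        _ ≤ ∏ i ∈ Finset.range r, (κ * j (S.Φ i (S.Φ ((q * N : ℕ) : ℝ) p))) :=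
          Finset.prod_le_prod (fun _ _ => zero_le_one)
            fun i hir => (hjκ _ (hi i (Finset.mem_range.1 hir))).2
        _ = _ := by rw [Finset.prod_mul_distrib]; simp [cocycle]
  have hpos := cocycle_pos hj0 (q * N) p
  have hposr := cocycle_pos hj0 r (S.Φ ((q * N : ℕ) : ℝ) p)
  have hD' : 0 ≤ ∏ i ∈ Finset.range q, D i := Finset.prod_nonneg fun i hi => hD0 i (Finset.mem_range.1 hi)
  have h1 : S.cocycle j (q * N) p ≤ E ^ q * ∏ i ∈ Finset.range q, D i := by
    rw [cocycle_mul hS]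
    calc _ ≤ ∏ i ∈ Finset.range q, (E * D i) := Finset.prod_le_prod
          (fun _ _ => (cocycle_pos hj0 _ _).le) fun i hi => (hD i (Finset.mem_range.1 hi)).1
      _ = _ := by rw [Finset.prod_mul_distrib]; simp
  have h2 : ∏ i ∈ Finset.range q, D i ≤ E ^ q * S.cocycle j (q * N) p := by
    rw [cocycle_mul hS]
    calc _ ≤ ∏ i ∈ Finset.range q, (E * S.cocycle j N (S.Φ ((i * N : ℕ) : ℝ) p)) := Finset.prod_le_prod
          (fun i hi => hD0 i (Finset.mem_range.1 hi)) fun i hi => (hD i (Finset.mem_range.1 hi)).2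
      _ = _ := by rw [Finset.prod_mul_distrib]; simp
  rw [cocycle_add hS]
  constructor
  · calc _ ≤ (E ^ q * ∏ i ∈ Finset.range q, D i) * κ ^ N := mul_le_mul h1 hrest.1 hposr.le (by positivity)
      _ = _ := by ring
  · calc _ ≤ E ^ q * S.cocycle j (q * N) p * 1 := by rwa [mul_one]
      _ ≤ E ^ q * S.cocycle j (q * N) p * (κ ^ N * S.cocycle j r (S.Φ ((q * N : ℕ) : ℝ) p)) :=
        mul_le_mul_of_nonneg_left hrest.2 (by positivity)
      _ = _ := by ring

theorem exists_bound_of_continuousOn (hX : IsCompact X) (hjc : ContinuousOn j (univ ×ˢ X))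
    (hj0 : ∀ p, 0 < j p) : ∃ κ ≥ 1, ∀ p : Control S.U × M, p.2 ∈ X → j p ≤ κ ∧ 1 ≤ κ * j p := by
  have hXc := isCompact_univ_prod S hX
  obtain ⟨κ₁, h₁⟩ := (hXc.image_of_continuousOn hjc).bddAbove
  obtain ⟨κ₂, h₂⟩ := (hXc.image_of_continuousOn (hjc.inv₀ fun p _ => (hj0 p).ne')).bddAbove
  refine ⟨max 1 (max κ₁ κ₂), le_max_left _ _, fun p hp => ?_⟩
  have e1 := h₁ (mem_image_of_mem j (show p ∈ univ ×ˢ X from ⟨mem_univ _, hp⟩))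
  have e2 : (j p)⁻¹ ≤ κ₂ := h₂ (mem_image_of_mem _ (show p ∈ univ ×ˢ X from ⟨mem_univ _, hp⟩))
  refine ⟨e1.trans ((le_max_left _ _).trans (le_max_right _ _)), ?_⟩
  rw [← inv_le_iff_one_le_mul₀ (hj0 p)]
  exact e2.trans ((le_max_right _ _).trans (le_max_right _ _))

end Cocycle

/-- The central rate `ε` is fixed first, with `l * ε ≤ ζ / 2` and `ε ≤ a / 2`. Then `N` is taken
large, with `α = e^{aN}` and `β = e^{εN}`: the ratio `α / β` is at least `e^{aN/2}` and beats the
constant `8 * C ^ 4`. In the last bound, one half of `e^{Nζ}` pays for `β ^ l` and the other half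
for the constants. -/
theorem IsPartiallyHyperbolic.exists_time (hE : S.IsPartiallyHyperbolic Q Eu Ecs) {ζ : ℝ} (hζ : 0 < ζ)
    (hC : 1 ≤ C) (C₁ : ℝ) (l : ℕ) :
    ∃ N : ℕ, 0 < N ∧ ∃ α β : ℝ, 0 ≤ α ∧ 0 ≤ β ∧ (∀ p ∈ S.lift Q,
      (∀ v ∈ Eu p, α * ‖v‖ ≤ ‖S.Dφ N p v‖) ∧ ∀ v ∈ Ecs p, ‖S.Dφ N p v‖ ≤ β * ‖v‖) ∧
      2 * (C ^ 2 * β) + 2 ≤ α / C ^ 2 / 2 ∧ 1 ≤ 2 * (C ^ 2 * β) ∧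
      C₁ * (2 * (C ^ 2 * β) + 1) ^ l ≤ Real.exp (N * ζ) := by
  obtain ⟨a, ha, H⟩ := hE.growth
  let ε := min (ζ / (2 * (l + 1))) (a / 2)
  have hε : 0 < ε := by positivity
  obtain ⟨T, -, HT⟩ := H ε hε
  have hlim : ∀ b : ℝ, 0 < b → Tendsto (fun N : ℕ => Real.exp (b * N)) atTop atTop := fun b hb =>
    Real.tendsto_exp_atTop.comp (tendsto_natCast_atTop_atTop.const_mul_atTop hb)
  obtain ⟨N, ⟨⟨hN0, hNT⟩, h1⟩, h2⟩ := (((eventually_gt_atTop 0).and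
    (tendsto_natCast_atTop_atTop.eventually_ge_atTop T)).and
    ((hlim (a / 2) (by positivity)).eventually_ge_atTop (8 * C ^ 4))).and
    ((hlim (ζ / 2) (by positivity)).eventually_ge_atTop (|C₁| * (3 * C ^ 2) ^ l)) |>.exists
  have hβ1 : 1 ≤ Real.exp (ε * N) := Real.one_le_exp (by positivity)
  have hC2 : 1 ≤ C ^ 2 := one_le_pow₀ hC
  have hCβ : 1 ≤ C ^ 2 * Real.exp (ε * N) := one_le_mul_of_one_le_of_one_le hC2 hβ1
  refine ⟨N, hN0, Real.exp (a * N), Real.exp (ε * N), (Real.exp_pos _).le, (Real.exp_pos _).le,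
    fun p hp => HT p hp N hNT, ?_, by linarith, ?_⟩
  · have h3 : Real.exp (a * N) = Real.exp (a / 2 * N) * Real.exp (a / 2 * N) := by
      rw [← Real.exp_add]
      ring_nf
    have h4 : Real.exp (ε * N) ≤ Real.exp (a / 2 * N) := by
      gcongr
      exact min_le_right _ _
    have h5 : 8 * C ^ 4 * Real.exp (ε * N) ≤ Real.exp (a * N) := by
      rw [h3]
      gcongr
    rw [div_div, le_div_iff₀ (by positivity)]
    calc _ ≤ (4 * (C ^ 2 * Real.exp (ε * N))) * (C ^ 2 * 2) := by gcongr; linarith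
      _ = 8 * C ^ 4 * Real.exp (ε * N) := by ring
      _ ≤ _ := h5
  · have h3 : l * ε ≤ ζ / 2 := by
      calc (l : ℝ) * ε ≤ l * (ζ / (2 * (l + 1))) := by gcongr; exact min_le_left _ _
        _ ≤ ζ / 2 := by
          rw [mul_div_assoc', div_le_div_iff₀ (by positivity) (by positivity)]
          nlinarith
    calc _ ≤ |C₁| * (3 * (C ^ 2 * Real.exp (ε * N))) ^ l := by
          gcongr
          · exact le_abs_self _
          · linarith
      _ = |C₁| * (3 * C ^ 2) ^ l * Real.exp (l * ε * N) := by
        rw [← mul_assoc, mul_pow _ (Real.exp _), ← Real.exp_nat_mul]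
        ring_nf
      _ ≤ Real.exp (ζ / 2 * N) * Real.exp (ζ / 2 * N) := by gcongr
      _ = _ := by
        rw [← Real.exp_add]
        ring_nf

end System
end ControlAffine
-- Volume bounds along a chain
namespace ControlAffine

theorem le_ofReal_of_prod_mul_le {V : ℝ≥0∞} {A P J κ E ζ : ℝ} {q n : ℕ} (hA : 0 ≤ A) (hκ : 0 ≤ κ)
    (hE : 0 ≤ E) (hJ : 0 < J) (h : ENNReal.ofReal P * V ≤ ENNReal.ofReal A * 2 ^ q)
    (hJP : J ≤ κ * E ^ q * P) (hq : (2 * E) ^ q ≤ Real.exp (n * ζ)) :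
    V ≤ ENNReal.ofReal (κ * A * Real.exp (n * ζ) * J⁻¹) := by
  have h2 : (2 : ℝ≥0∞) ^ q = ENNReal.ofReal (2 ^ q) := by
    rw [ENNReal.ofReal_pow zero_le_two, ENNReal.ofReal_ofNat]
  rw [← div_eq_mul_inv, ENNReal.ofReal_div_of_pos hJ, ENNReal.le_div_iff_mul_le
    (Or.inl (ENNReal.ofReal_pos.2 hJ).ne') (Or.inl ENNReal.ofReal_ne_top), mul_comm]
  calc ENNReal.ofReal J * V ≤ ENNReal.ofReal (κ * E ^ q * P) * V := by gcongr
    _ = ENNReal.ofReal (κ * E ^ q) * (ENNReal.ofReal P * V) := by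
      rw [ENNReal.ofReal_mul (by positivity), mul_assoc]
    _ ≤ ENNReal.ofReal (κ * E ^ q) * (ENNReal.ofReal A * 2 ^ q) := by gcongr
    _ = ENNReal.ofReal (κ * A * (2 * E) ^ q) := by
      rw [h2, ← ENNReal.ofReal_mul hA, ← ENNReal.ofReal_mul (by positivity), mul_pow]
      ring_nf
    _ ≤ _ := by gcongr

theorem ofReal_le_of_le_prod_mul {V : ℝ≥0∞} {A P J κ E ζ G : ℝ} {q n : ℕ} (hA : 0 < A) (hκ : 0 < κ)
    (hE : 0 < E) (hJ : 0 < J) (hG : 0 < G)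
    (h : ENNReal.ofReal (A * G⁻¹) ≤ 2 ^ q * ENNReal.ofReal P * V)
    (hPJ : P ≤ κ * E ^ q * J) (hq : (2 * E) ^ q * G ≤ Real.exp (n * ζ)) :
    ENNReal.ofReal ((κ / A)⁻¹ * Real.exp (-(n * ζ)) * J⁻¹) ≤ V := by
  have h2 : (2 : ℝ≥0∞) ^ q = ENNReal.ofReal (2 ^ q) := by
    rw [ENNReal.ofReal_pow zero_le_two, ENNReal.ofReal_ofNat]
  have h3 : ENNReal.ofReal (A * G⁻¹) ≤ ENNReal.ofReal (κ * (2 * E) ^ q * J) * V := by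
    refine h.trans ?_
    rw [h2, ← ENNReal.ofReal_mul (by positivity)]
    refine mul_le_mul' (ENNReal.ofReal_le_ofReal ?_) le_rfl
    rw [mul_pow]
    calc _ ≤ 2 ^ q * (κ * E ^ q * J) := by gcongr
      _ = _ := by ring
  have h4 : 0 < κ * (2 * E) ^ q * J := by positivity
  refine le_trans ?_ (ENNReal.div_le_of_le_mul' h3)
  rw [← ENNReal.ofReal_div_of_pos h4]
  refine ENNReal.ofReal_le_ofReal ?_
  rw [Real.exp_neg, inv_div, ← div_eq_mul_inv, ← div_eq_mul_inv, ← div_eq_mul_inv, div_div, div_div, div_div]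
  refine div_le_div_of_nonneg_left hA.le (by positivity) ?_
  calc G * (κ * (2 * E) ^ q * J) = κ * ((2 * E) ^ q * G) * J := by ring
    _ ≤ κ * Real.exp (n * ζ) * J := by gcongr
    _ = _ := by ring

variable {d m : ℕ} {M : Type*} [MetricSpace M] [ChartedSpace (EuclideanSpace ℝ (Fin d)) M]
  [IsManifold (𝓡 d) ∞ M]
    [RiemannianBundle (fun x : M => TangentSpace (𝓡 d) x)]
    [IsContMDiffRiemannianBundle (𝓡 d) ∞ (EuclideanSpace ℝ (Fin d))
      (fun x : M => TangentSpace (𝓡 d) x)] [IsRiemannianManifold (𝓡 d) M]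

namespace System

variable {S : System d m M} {Q : Set M}
  {Eu Ecs : ∀ p : Control S.U × M, Submodule ℝ (TangentSpace (𝓡 d) p.2)}
  {t : Finset M} {W Z : M → Set M} {C ρ : ℝ} {k l : ℕ}

namespace IsChain

variable [MeasurableSpace M] [BorelSpace M] {N q : ℕ} {u : Control S.U} {x : M} {ε : ℝ} {y c : ℕ → M}
  {T : ℕ → EuclideanSpace ℝ (Fin d) ≃L[ℝ] EuclideanSpace ℝ (Fin k) × EuclideanSpace ℝ (Fin l)}
  {P : ℕ → EuclideanSpace ℝ (Fin k) →L[ℝ] EuclideanSpace ℝ (Fin k)}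
  {D : ℕ → EuclideanSpace ℝ (Fin l) →L[ℝ] EuclideanSpace ℝ (Fin l)} {a b : ℝ} {η η₀ : ℝ≥0} {c₀ : ℝ≥0}

/-- The coordinates at time zero send the Bowen ball into an orbit ball and have a `2 * C`-Lipschitz
inverse there, so Hausdorff measure grows by at most `(2 * C) ^ d`; `c₀` converts it to product
volume. -/
theorem prod_det_mul_volume_bowenBall_le (h : S.IsChain Eu Ecs Q t Z ρ N q u x ε y c T)
    (hS : S.IsComplete) (hcov : IsChartCover (d := d) Q t W Z C ρ) {Λ : ℝ} (hΛ : 0 ≤ Λ)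
    (hR : ∀ c ∈ t, ∀ p ∈ S.lift Q, p.2 ∈ W c → ∀ w, ‖chartProj Eu Ecs c p w‖ ≤ Λ * ‖w‖)
    (hc₀ : 0 < c₀) (hvol : (volume : Measure (EuclideanSpace ℝ (Fin k))).prod
      (volume : Measure (EuclideanSpace ℝ (Fin l))) = (c₀ : ℝ≥0∞) • μHE[d])
    (hη₀ : HasDistortionBound (volume : Measure (EuclideanSpace ℝ (Fin k))) η₀)
    (hη : (η : ℝ) ≤ η₀ * a) (hab : b + 2 * η ≤ a) (hb : 1 ≤ b) {δ : ℝ}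
    (hF : ∀ j < q, IsDominatedStep (S.chainStep N u x c T j) (P j) (D j) a b η ((Λ + 1) * C * δ))
    (hδ0 : 0 ≤ δ) (hδ : δ + ε ≤ ρ) {n : ℕ} (hn : q * N < n) :
    (∏ j ∈ Finset.range q, ENNReal.ofReal |(P j).det|) * riemannianVolume d M (S.bowenBall n u δ x) ≤
      ENNReal.ofReal (2 * C) ^ d * (c₀ : ℝ≥0∞)⁻¹ *
        (volume (Metric.closedBall (0 : EuclideanSpace ℝ (Fin k)) ((Λ + 1) * C * δ)) *
        volume (Metric.closedBall (0 : EuclideanSpace ℝ (Fin l)) ((Λ + 1) * C * δ))) * 2 ^ q := by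
  have hC : 0 ≤ C := zero_le_one.trans hcov.one_le
  have hc₀' : (c₀ : ℝ≥0∞) ≠ 0 := by simpa using hc₀.ne'
  have hZ : ∀ z ∈ S.bowenBall n u δ x, z ∈ Z (c 0) := fun z hz => by
    refine h.mem_of_dist_lt (Nat.zero_le q) (r := δ) ?_ hδ
    have h1 := hz 0 (by omega)
    rw [dist_comm] at h1
    simpa only [zero_mul, Nat.cast_zero, φ_zero hS] using h1
  have h1 := euclideanHausdorffMeasure_le_of_dist_le (K := 2 * C) (by positivity)
    (f := chartCoord (c 0) (T 0) x) (s := S.bowenBall n u δ x)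
    (fun z hz z' hz' => (h.adapted 0 (Nat.zero_le q)).dist_le hcov (hZ z hz) (hZ z' hz')) d
  have h2 : chartCoord (c 0) (T 0) x '' S.bowenBall n u δ x ⊆
      seqBall ((Λ + 1) * C * δ) q (S.chainStep N u x c T) := by
    rintro _ ⟨z, hz, rfl⟩
    exact h.chartCoord_mem_seqBall hS hcov hΛ hR hδ0 hδ hn hz
  have h3 := prod_det_mul_measure_seqBall_le
    (ν := (volume : Measure (EuclideanSpace ℝ (Fin l)))) hη₀ hη hab hb hF
  rw [hvol, Measure.smul_apply, smul_eq_mul] at h3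
  set s := seqBall ((Λ + 1) * C * δ) q (S.chainStep N u x c T)
  set Pr := ∏ j ∈ Finset.range q, ENNReal.ofReal |(P j).det|
  change Pr * μHE[d] (S.bowenBall n u δ x) ≤ _
  calc _ ≤ Pr * (ENNReal.ofReal (2 * C) ^ d * μHE[d] s) := by
        gcongr
        exact h1.trans (by gcongr)
    _ = ENNReal.ofReal (2 * C) ^ d * (c₀ : ℝ≥0∞)⁻¹ * (Pr * (c₀ * μHE[d] s)) := by
      rw [mul_left_comm Pr (c₀ : ℝ≥0∞), ← mul_assoc _ (c₀ : ℝ≥0∞), mul_assoc _ _ (c₀ : ℝ≥0∞),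
        ENNReal.inv_mul_cancel hc₀' ENNReal.coe_ne_top, mul_one, mul_left_comm]
    _ ≤ _ := by
      rw [mul_assoc _ _ ((2 : ℝ≥0∞) ^ q)]
      exact mul_le_mul' le_rfl (h3.trans_eq (by ring))

theorem le_prod_det_mul_volume_bowenBall (h : S.IsChain Eu Ecs Q t Z ρ N q u x ε y c T)
    (hS : S.IsComplete) (hcov : IsChartCover (d := d) Q t W Z C ρ) {Λ : ℝ} (hΛ : 0 ≤ Λ)
    (hR : ∀ c ∈ t, ∀ p ∈ S.lift Q, p.2 ∈ W c → ∀ w, ‖chartProj Eu Ecs c p w‖ ≤ Λ * ‖w‖)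
    (hvol : (volume : Measure (EuclideanSpace ℝ (Fin k))).prod
      (volume : Measure (EuclideanSpace ℝ (Fin l))) = (c₀ : ℝ≥0∞) • μHE[d])
    (hη₀ : HasDistortionBound (volume : Measure (EuclideanSpace ℝ (Fin k))) η₀)
    (hη : (η : ℝ) ≤ η₀ * a) (hab : b + 2 * η ≤ a) (hb : 1 ≤ b) {r δ δ' ε' : ℝ}
    (hF : ∀ j < q, IsDominatedStep (S.chainStep N u x c T j) (P j) (D j) a b η δ')
    (hN : 0 < N)
    (hr : ∀ c ∈ t, ∀ x ∈ Z c, ∀ w, dist w (extChartAt (𝓡 d) c x) ≤ r →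
      w ∈ (extChartAt (𝓡 d) c).target ∧ (extChartAt (𝓡 d) c).symm w ∈ W c ∧
        dist ((extChartAt (𝓡 d) c).symm w) x < ρ / 2)
    (hε' : ∀ i ≤ N, ∀ u : Control S.U, ∀ y ∈ ⋃ c ∈ t, Z c, ∀ z ∈ ⋃ c ∈ t, Z c, dist y z < ε' →
      dist (S.φ i y u) (S.φ i z u) < min (ρ / 2) δ)
    (hε : ε ≤ ρ / 2) (hδ : δ ≤ ρ / 2) (hδ'0 : 0 ≤ δ') (hδ'r : 2 * δ' ≤ r) (hδ'ε : 2 * C * δ' < ε')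
    {n : ℕ} (hqn : q * N < n) (hn : n ≤ (q + 1) * N) :
    volume (Metric.closedBall (0 : EuclideanSpace ℝ (Fin k)) δ') * (ENNReal.ofReal (δ' ^ l) *
        volume (Metric.closedBall (0 : EuclideanSpace ℝ (Fin l)) 1)) *
        ENNReal.ofReal (((b + η) ^ l) ^ q)⁻¹ ≤
      2 ^ q * (∏ j ∈ Finset.range q, ENNReal.ofReal |(P j).det|) *
        (c₀ * ENNReal.ofReal ((Λ + 1) * C) ^ d * riemannianVolume d M (S.bowenBall n u δ x)) := by
  have hC : 0 ≤ C := zero_le_one.trans hcov.one_le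
  have hb0 : 0 < b + η := by linarith [η.coe_nonneg]
  have hZ : ∀ z ∈ S.bowenBall n u δ x, z ∈ Z (c 0) := fun z hz => by
    refine h.mem_of_dist_lt (Nat.zero_le q) (r := δ) ?_ (by linarith)
    have h1 := hz 0 (by omega)
    rw [dist_comm] at h1
    simpa only [zero_mul, Nat.cast_zero, φ_zero hS] using h1
  have hy := h.mem_lift 0 (Nat.zero_le q)
  have hyW := hcov.subset _ (h.adapted 0 (Nat.zero_le q)).mem
    ((h.adapted 0 (Nat.zero_le q)).ball_subset (Metric.mem_ball_self hcov.pos))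
  have h1 := euclideanHausdorffMeasure_image_le_of_dist_le (K := (Λ + 1) * C) (by positivity)
    (f := chartCoord (c 0) (T 0) x) (s := S.bowenBall n u δ x)
    (fun z hz z' hz' => (h.adapted 0 (Nat.zero_le q)).dist_chartCoord_le hcov hΛ
      (hR _ (h.adapted 0 (Nat.zero_le q)).mem _ hy hyW) (hZ z hz) (hZ z' hz')) d
  have h2 : seqBall δ' q (S.chainStep N u x c T) ⊆ chartCoord (c 0) (T 0) x '' S.bowenBall n u δ x :=
    fun v hv => h.exists_chartCoord_eq hS hcov hN hr hε' hε hδ'r hδ'ε hn hv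
  -- The largest initial height whose graphs stay in the `δ'`-ball for `q` steps. The volume of the
  -- `σ`-ball in `ℝˡ` contributes the factor `(b + η) ^ (-l q)`, which the upper bound does not
  -- have.
  have h3 := le_prod_det_mul_measure_seqBall (σ := δ' / (b + η) ^ q)
    (ν := (volume : Measure (EuclideanSpace ℝ (Fin l)))) hη₀ hη hab hb hF (by positivity)
    (by rw [mul_div_cancel₀ _ (by positivity)])
  rw [hvol, Measure.smul_apply, smul_eq_mul, Measure.addHaar_closedBall' volume (0 : EuclideanSpace ℝ (Fin l))
      (r := δ' / (b + η) ^ q) (by positivity),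
    finrank_euclideanSpace_fin, div_pow, div_eq_mul_inv, ENNReal.ofReal_mul (by positivity),
    ← pow_mul, mul_comm q l, pow_mul] at h3
  calc _ = _ := by ring
    _ ≤ _ := h3
    _ ≤ _ := by
      rw [mul_assoc (c₀ : ℝ≥0∞)]
      gcongr
      exact (measure_mono h2).trans h1

end IsChain

end System
end ControlAffine
-- Assembling the volume estimate
namespace ControlAffine

variable {d m : ℕ} {M : Type*} [MetricSpace M] [ChartedSpace (EuclideanSpace ℝ (Fin d)) M]
  [IsManifold (𝓡 d) ∞ M]
    [RiemannianBundle (fun x : M => TangentSpace (𝓡 d) x)]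
    [IsContMDiffRiemannianBundle (𝓡 d) ∞ (EuclideanSpace ℝ (Fin d))
      (fun x : M => TangentSpace (𝓡 d) x)] [IsRiemannianManifold (𝓡 d) M]

namespace System

variable {S : System d m M} {Q X : Set M}
  {Eu Ecs : ∀ p : Control S.U × M, Submodule ℝ (TangentSpace (𝓡 d) p.2)}
  {j : Control S.U × M → ℝ}
  {t : Finset M} {W Z : M → Set M} {C ρ : ℝ} {k l : ℕ}

theorem exists_nearFiber_mem_interior (hS : S.IsComplete) (hQ : IsCompact Q) (hQX : Q ⊆ interior X) :
    ∃ ε > 0, ∀ (u : Control S.U) (n : ℕ), ∀ x ∈ S.nearFiber Q n u ε, ∀ i < n,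
      (S.Φ i (u, x)).2 ∈ interior X := by
  obtain ⟨ε, hε, h⟩ := hQ.exists_thickening_subset_open isOpen_interior hQX
  refine ⟨ε / 2, by positivity, fun u n x hx i hi => ?_⟩
  obtain ⟨y, hy, hd⟩ := exists_mem_fiber_of_mem_nearFiber hε (by linarith) hx hi
  exact h (Metric.mem_thickening_iff.2 ⟨y, snd_mem_of_mem_lift hS hy, hd⟩)

theorem nearFiber_mono {n : ℕ} {u : Control S.U} {ε ε' : ℝ} (h : ε ≤ ε') :
    S.nearFiber Q n u ε ⊆ S.nearFiber Q n u ε' := fun _ hx i hi =>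
  (hx i hi).trans (ENNReal.ofReal_le_ofReal h)

/-- Along a chain of adapted coordinates the time-`N` maps are dominated, and the determinants of
their unstable blocks are comparable to the cocycle. -/
theorem IsPartiallyHyperbolic.exists_isDominatedStep_chainStep (hE : S.IsPartiallyHyperbolic Q Eu Ecs)
    (hS : S.IsComplete) (hQ : IsCompact Q) (hcov : IsChartCover (d := d) Q t W Z C ρ)
    (hk : ∀ p ∈ S.lift Q, Module.finrank ℝ (Eu p) = k) (hX : IsCompact X) (hQX : Q ⊆ X)
    (hjc : ContinuousOn j (univ ×ˢ X)) (hj0 : ∀ p, 0 < j p)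
    (hj : ∀ p ∈ S.lift Q, j p = S.unstableDet Eu 1 p) {N : ℕ} (hN : 0 < N)
    {α β : ℝ} (hα0 : 0 ≤ α) (hβ0 : 0 ≤ β)
    (hαβ : ∀ p ∈ S.lift Q, (∀ v ∈ Eu p, α * ‖v‖ ≤ ‖S.Dφ N p v‖) ∧
      ∀ v ∈ Ecs p, ‖S.Dφ N p v‖ ≤ β * ‖v‖) {η : ℝ≥0} (hη : 0 < η) :
    ∃ ε > 0, ∃ δ > 0, ∀ (q : ℕ) (u : Control S.U) (x : M) (ε' : ℝ) (y c : ℕ → M) (T), ε' ≤ ε →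
      IsChain (k := k) (l := l) S Eu Ecs Q t Z ρ N q u x ε' y c T →
      (∀ i < q * N, (S.Φ i (u, x)).2 ∈ X) →
      ∃ (P : ℕ → EuclideanSpace ℝ (Fin k) →L[ℝ] EuclideanSpace ℝ (Fin k))
        (D : ℕ → EuclideanSpace ℝ (Fin l) →L[ℝ] EuclideanSpace ℝ (Fin l)),
        ∀ i < q, IsDominatedStep (S.chainStep N u x c T i) (P i) (D i) (α / C ^ 2 / 2)
        (2 * (C ^ 2 * β)) η δ ∧
        S.cocycle j N (S.Φ ((i * N : ℕ) : ℝ) (u, x)) ≤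
          Real.exp 1 * (2 * C ^ 2) ^ k * |(P i).det| ∧
        |(P i).det| ≤
          Real.exp 1 * (2 * C ^ 2) ^ k * S.cocycle j N (S.Φ ((i * N : ℕ) : ℝ) (u, x)) := by
  obtain ⟨ε₁, hε₁, δ, hδ, h₁⟩ := hE.exists_isDominatedStep (l := l) hS hQ hcov hk N hα0 hβ0 hαβ hη
  obtain ⟨ε₂, hε₂, h₂⟩ := exists_cocycle_le hS hX hjc hj0 hN
  refine ⟨min ε₁ ε₂, by positivity, δ, hδ, fun q u x ε' y c T hε' h hx => ?_⟩
  have key : ∀ i, ∃ P D, i < q → IsDominatedStep (S.chainStep N u x c T i) P D (α / C ^ 2 / 2)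
        (2 * (C ^ 2 * β)) η δ ∧
        S.cocycle j N (S.Φ ((i * N : ℕ) : ℝ) (u, x)) ≤ Real.exp 1 * (2 * C ^ 2) ^ k * |P.det| ∧
        |P.det| ≤
          Real.exp 1 * (2 * C ^ 2) ^ k * S.cocycle j N (S.Φ ((i * N : ℕ) : ℝ) (u, x)) := by
    intro i
    by_cases hi : i < q
    swap
    · exact ⟨0, 0, fun h => absurd h hi⟩
    have hd₀ := (h.dist_lt i hi.le).trans_le hε'
    have hy := h.mem_lift i hi.le
    have hy' := h.mem_lift (i + 1) hi
    have hT' := h.adapted (i + 1) hi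
    have hd' := (h.dist_lt (i + 1) hi).trans_le hε'
    rw [shift_natCast_succ_mul] at hy' hT'
    rw [φ_natCast_succ_mul hS] at hd'
    obtain ⟨P, D, hPD, hP1, hP2⟩ := h₁ _ _ _ _ _ _ _ _ hy hy' (h.adapted i hi.le) hT'
      (hd₀.trans_le (min_le_left _ _)) (hd'.trans_le (min_le_left _ _))
    refine ⟨P, D, fun _ => ⟨hPD, ?_⟩⟩
    have hxX : ∀ i' < N, (S.Φ i' (shift ((i * N : ℕ) : ℝ) u, S.φ ((i * N : ℕ) : ℝ) x u)).2 ∈ X := by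
      intro i' hi'
      have h3 := hx (i * N + i') (by nlinarith)
      rwa [Nat.cast_add, add_comm, Φ_add hS] at h3
    have hyX : ∀ i' < N, (S.Φ i' (shift ((i * N : ℕ) : ℝ) u, y i)).2 ∈ X := fun i' _ =>
      hQX (snd_mem_of_mem_lift hS (Φ_mem_lift hS hy _))
    have hd₂ := hd₀.trans_le (min_le_right _ _)
    -- The cocycle at the orbit point is replaced by its value at the nearby fiber point, at the
    -- cost of a factor `e`; there it is the unstable determinant.
    have e1 := h₂ _ _ _ hxX hyX hd₂
    have e2 := h₂ _ _ _ hyX hxX (by rwa [dist_comm])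
    rw [hE.cocycle_eq_unstableDet hS hj N hy] at e1 e2
    have hC := hcov.one_le
    constructor
    · refine e1.trans ?_
      rw [mul_assoc]
      gcongr
    · refine hP1.trans ?_
      rw [mul_comm (Real.exp 1), mul_assoc]
      gcongr
      exact e2
  choose P D hPD using key
  exact ⟨P, D, hPD⟩

variable [MeasurableSpace M] [BorelSpace M]

/-- The order of choices matters: `N` depends on `ζ`, the tolerances for dominated steps on `N`, and
the radii `ε'` and `δ'` on `δ`. The latter enter only the constant `A`, so `ε₀` and `δ₀` do not
depend on `δ`. -/
theorem IsPartiallyHyperbolic.exists_volume_bounds (hE : S.IsPartiallyHyperbolic Q Eu Ecs)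
    (hS : S.IsComplete) (hQ : IsCompact Q) (hX : IsCompact X) (hQX : Q ⊆ interior X)
    (hjc : ContinuousOn j (univ ×ˢ X)) (hj0 : ∀ p, 0 < j p)
    (hj : ∀ p ∈ S.lift Q, j p = S.unstableDet Eu 1 p) {ζ : ℝ} (hζ : 0 < ζ) :
    ∃ ε₀ > 0, ∃ δ₀ > 0, ∀ δ ∈ Ioc 0 δ₀, ∃ A > 0, ∀ (u : Control S.U) (n : ℕ), 1 ≤ n →
      ∀ x ∈ S.nearFiber Q n u ε₀,
        ENNReal.ofReal (A⁻¹ * Real.exp (-(n * ζ)) * (S.cocycle j n (u, x))⁻¹) ≤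
          riemannianVolume d M (S.bowenBall n u δ x) ∧
        riemannianVolume d M (S.bowenBall n u δ x) ≤
          ENNReal.ofReal (A * Real.exp (n * ζ) * (S.cocycle j n (u, x))⁻¹) := by
  -- With an empty lift the dimensions are not determined, but then no point is near a fiber, as `n
  -- ≥ 1`.
  rcases (S.lift Q).eq_empty_or_nonempty with hempty | ⟨p₀, hp₀⟩
  · refine ⟨1, one_pos, 1, one_pos, fun δ _ => ⟨1, one_pos, fun u n hn x hx => ?_⟩⟩
    obtain ⟨y, hy, -⟩ := exists_mem_fiber_of_mem_nearFiber (ε' := 2) two_pos one_lt_two hx hn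
    rw [hempty] at hy
    exact hy.elim
  obtain ⟨k, l, hkl⟩ := hE.finrank_const
  have hdkl : Module.finrank ℝ (EuclideanSpace ℝ (Fin k) × EuclideanSpace ℝ (Fin l)) = d := by
    rw [Module.finrank_prod, finrank_euclideanSpace_fin, finrank_euclideanSpace_fin,
      ← (hkl p₀ hp₀).1, ← (hkl p₀ hp₀).2, Submodule.finrank_add_eq_of_isCompl (hE.isCompl p₀ hp₀)]
    exact finrank_euclideanSpace_fin
  obtain ⟨c₀, hc₀, hvol⟩ := exists_eq_smul_euclideanHausdorffMeasure hdkl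
    ((volume : Measure (EuclideanSpace ℝ (Fin k))).prod (volume : Measure (EuclideanSpace ℝ (Fin l))))
  obtain ⟨t, W, Z, C, ρ, hcov⟩ := exists_isChartCover d hQ
  obtain ⟨Λ, hΛ, hR⟩ := hE.exists_norm_chartProj_le' hS hQ hcov
  obtain ⟨κ, hκ, hjκ⟩ := exists_bound_of_continuousOn hX hjc hj0
  obtain ⟨η₀, hη₀, hdist⟩ := exists_hasDistortionBound (volume : Measure (EuclideanSpace ℝ (Fin k)))
  have hC1 := hcov.one_le
  have hρ := hcov.pos
  have hC0 : 0 < C := by linarith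
  -- The comparison error per block: `e` from moving to the fiber point, the rest from the
  -- coordinates. The volume distortion contributes the further factor 2 in the call of
  -- `exists_time`.
  set E := Real.exp 1 * (2 * C ^ 2) ^ k with hEdef
  have hE0 : 0 < E := by positivity
  obtain ⟨N, hN, α, β, hα0, hβ0, hαβ, hab, hb, hNζ⟩ := hE.exists_time hζ hC1 (2 * E) l
  set a := α / C ^ 2 / 2
  set b := 2 * (C ^ 2 * β)
  -- The bound by 1 reduces `b + 2 * η ≤ a` to the gap of size 2 provided by `exists_time`; the
  -- bound by `η₀` suffices for the distortion lemma since `a ≥ 1`.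
  have hη1 : ((min η₀ 1 : ℝ≥0) : ℝ) ≤ 1 := by exact_mod_cast min_le_right η₀ 1
  have hη0 : 0 < min η₀ 1 := lt_min hη₀ one_pos
  have hηa : ((min η₀ 1 : ℝ≥0) : ℝ) ≤ η₀ * a := by
    have h1 : ((min η₀ 1 : ℝ≥0) : ℝ) ≤ η₀ := by exact_mod_cast min_le_left η₀ 1
    refine h1.trans (le_mul_of_one_le_right η₀.coe_nonneg ?_)
    linarith
  set η := min η₀ 1
  have habη : b + 2 * η ≤ a := by linarith
  obtain ⟨ε₁, hε₁, δ₁, hδ₁, hstep⟩ := hE.exists_isDominatedStep_chainStep (l := l) hS hQ hcov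
    (fun p hp => (hkl p hp).1) hX (hQX.trans interior_subset) hjc hj0 hj hN hα0 hβ0 hαβ hη0
  obtain ⟨ε₂, hε₂, hint⟩ := exists_nearFiber_mem_interior hS hQ hQX
  obtain ⟨r, hr, hsymm⟩ := exists_forall_symm hcov (half_pos hρ)
  obtain ⟨ε, hε, hεε₁, hερ⟩ : ∃ ε > 0, ε ≤ ε₁ ∧ ε ≤ ρ / 2 :=
    ⟨min ε₁ (ρ / 2), by positivity, min_le_left _ _, min_le_right _ _⟩
  -- Halving `ε` gives the strict inequality needed to select fiber points from a bound on the
  -- distance to the fiber.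
  refine ⟨min ε₂ (ε / 2), by positivity, min (ρ / 2) (δ₁ / ((Λ + 1) * C)), by positivity,
    fun δ hδ => ?_⟩
  have hδ0 : 0 < δ := hδ.1
  have hδρ : δ ≤ ρ / 2 := hδ.2.trans (min_le_left _ _)
  have hδ₁' : (Λ + 1) * C * δ ≤ δ₁ := by
    have h1 := hδ.2.trans (min_le_right _ _)
    rw [le_div_iff₀ (by positivity)] at h1
    linarith
  obtain ⟨ε', hε', hequi⟩ := exists_pos_forall_mem_finset (Finset.range (N + 1))
    (P := fun i ε' => ∀ u : Control S.U, ∀ y ∈ ⋃ c ∈ t, Z c, ∀ z ∈ ⋃ c ∈ t, Z c, dist y z < ε' →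
      dist (S.φ i y u) (S.φ i z u) < min (ρ / 2) δ)
    (fun i _ => exists_dist_φ_lt hS i (t.isCompact_biUnion hcov.isCompact) (by positivity))
    fun i r r' _ hrr h u y hy z hz hyz => h u y hy z hz (hyz.trans_le hrr)
  obtain ⟨δ', hδ'0, hδ'₁, hδ'r, hδ'ε⟩ : ∃ δ' > 0, δ' ≤ δ₁ ∧ 2 * δ' ≤ r ∧ 2 * C * δ' < ε' := by
    refine ⟨min δ₁ (min (r / 2) (ε' / (4 * C))), by positivity, min_le_left _ _, ?_, ?_⟩
    · linarith [(min_le_right δ₁ (min (r / 2) (ε' / (4 * C)))).trans (min_le_left _ _)]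
    · have h1 := (min_le_right δ₁ (min (r / 2) (ε' / (4 * C)))).trans (min_le_right _ _)
      rw [le_div_iff₀ (by positivity)] at h1
      linarith
  have hballk : ∀ s : ℝ, volume (Metric.closedBall (0 : EuclideanSpace ℝ (Fin k)) s) ≠ (⊤ : ℝ≥0∞) :=
    fun s => (isCompact_closedBall _ _).measure_lt_top.ne
  have hballl : ∀ s : ℝ, volume (Metric.closedBall (0 : EuclideanSpace ℝ (Fin l)) s) ≠ (⊤ : ℝ≥0∞) :=
    fun s => (isCompact_closedBall _ _).measure_lt_top.ne
  have hc₀' : (c₀ : ℝ≥0∞) ≠ 0 := by simpa using hc₀.ne'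
  set a₁ : ℝ≥0∞ := ENNReal.ofReal (2 * C) ^ d * (c₀ : ℝ≥0∞)⁻¹ *
        (volume (Metric.closedBall (0 : EuclideanSpace ℝ (Fin k)) ((Λ + 1) * C * δ)) *
        volume (Metric.closedBall (0 : EuclideanSpace ℝ (Fin l)) ((Λ + 1) * C * δ))) with ha₁
  have ha₁t : a₁ ≠ ⊤ := ENNReal.mul_ne_top
    (ENNReal.mul_ne_top (ENNReal.pow_ne_top ENNReal.ofReal_ne_top) (ENNReal.inv_ne_top.2 hc₀'))
    (ENNReal.mul_ne_top (hballk _) (hballl _))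
  set b₁ : ℝ≥0∞ := volume (Metric.closedBall (0 : EuclideanSpace ℝ (Fin k)) δ') *
    (ENNReal.ofReal (δ' ^ l) * volume (Metric.closedBall (0 : EuclideanSpace ℝ (Fin l)) 1)) with hb₁
  have hb₁t : b₁ ≠ ⊤ := ENNReal.mul_ne_top (hballk _)
    (ENNReal.mul_ne_top ENNReal.ofReal_ne_top (hballl _))
  have hb₁0 : b₁ ≠ 0 := mul_ne_zero (Metric.measure_closedBall_pos _ _ hδ'0).ne'
    (mul_ne_zero (ENNReal.ofReal_pos.2 (by positivity)).ne' (Metric.measure_closedBall_pos _ _ one_pos).ne')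
  set c₁ : ℝ≥0∞ := c₀ * ENNReal.ofReal ((Λ + 1) * C) ^ d with hc₁
  have hc₁t : c₁ ≠ ⊤ := ENNReal.mul_ne_top ENNReal.coe_ne_top (ENNReal.pow_ne_top ENNReal.ofReal_ne_top)
  have hc₁0 : c₁ ≠ 0 := mul_ne_zero hc₀' (pow_ne_zero _ (ENNReal.ofReal_pos.2 (by positivity)).ne')
  have hbc : b₁ / c₁ ≠ ⊤ := ENNReal.div_ne_top hb₁t hc₁0
  have hA₂ : 0 < (b₁ / c₁).toReal := ENNReal.toReal_pos (ENNReal.div_pos hb₁0 hc₁t).ne' hbc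
  have hκN : 0 < κ ^ N := by positivity
  refine ⟨max (κ ^ N * a₁.toReal) (κ ^ N / (b₁ / c₁).toReal), by positivity, fun u n hn x hx => ?_⟩
  have hxX := fun i hi => interior_subset (hint u n x (nearFiber_mono (min_le_left _ _) hx) i hi)
  -- Dividing `n - 1` rather than `n` makes the time `q * N` one of those controlled by the Bowen
  -- ball.
  obtain ⟨q, hqn, hnq⟩ : ∃ q, q * N < n ∧ n ≤ (q + 1) * N := by
    refine ⟨(n - 1) / N, ?_, ?_⟩
    · have := Nat.div_mul_le_self (n - 1) N
      omega
    · have := Nat.lt_div_mul_add (a := n - 1) hN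
      rw [add_mul, one_mul]
      omega
  obtain ⟨y, c, T, hch⟩ := hE.exists_isChain hS hcov hkl hqn hε
    (show ε / 2 < ε by linarith) (nearFiber_mono (min_le_right _ _) hx)
  obtain ⟨P, D, hPD⟩ := hstep q u x ε y c T hεε₁ hch fun i hi => hxX i (hi.trans hqn)
  have hup := hch.prod_det_mul_volume_bowenBall_le hS hcov hΛ.le hR hc₀ hvol (hdist η₀ le_rfl) hηa habη hb
    (fun i hi => (hPD i hi).1.mono hδ₁') hδ0.le (by linarith) hqn
  have hlow := hch.le_prod_det_mul_volume_bowenBall hS hcov hΛ.le hR hvol (hdist η₀ le_rfl) hηa habη hb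
    (fun i hi => (hPD i hi).1.mono hδ'₁) hN hsymm
    (fun i hi => hequi i (Finset.mem_range.2 (Nat.lt_succ_of_le hi))) hερ hδρ hδ'0.le hδ'r hδ'ε hqn hnq
  obtain ⟨hJ1, hJ2⟩ := cocycle_bounds hS hj0 hκ hE0.le hjκ hqn.le hnq hxX
    (fun i _ => abs_nonneg (P i).det) fun i hi => (hPD i hi).2
  rw [← ENNReal.ofReal_prod_of_nonneg fun i _ => abs_nonneg _] at hup hlow
  have hJ0 := cocycle_pos hj0 n (u, x)
  have hg1 : 1 ≤ (b + η) ^ l := one_le_pow₀ (by linarith [η.coe_nonneg])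
  -- The loss per block is at most `2 * E * (b + 1) ^ l`, which `N` was chosen to bound by `e^{Nζ}`;
  -- the `q` blocks together cost at most `e^{nζ}`.
  have hqζ : (2 * E) ^ q * ((b + η) ^ l) ^ q ≤ Real.exp (n * ζ) := by
    rw [← mul_pow]
    calc _ ≤ (2 * E * (b + 1) ^ l) ^ q := by gcongr
      _ ≤ Real.exp (N * ζ) ^ q := by gcongr
      _ = Real.exp ((q * N : ℕ) * ζ) := by
        rw [← Real.exp_nat_mul, Nat.cast_mul, mul_assoc]
      _ ≤ _ := by gcongr
  have hqζ' : (2 * E) ^ q ≤ Real.exp (n * ζ) :=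
    (le_mul_of_one_le_right (by positivity) (one_le_pow₀ hg1)).trans hqζ
  rw [← ha₁, ← ENNReal.ofReal_toReal ha₁t] at hup
  constructor
  · have hlow' : ENNReal.ofReal ((b₁ / c₁).toReal * (((b + η) ^ l) ^ q)⁻¹) ≤
        2 ^ q * ENNReal.ofReal (∏ i ∈ Finset.range q, |(P i).det|) *
          riemannianVolume d M (S.bowenBall n u δ x) := by
      rw [ENNReal.ofReal_mul hA₂.le, ENNReal.ofReal_toReal hbc, div_eq_mul_inv, mul_right_comm,
        ← div_eq_mul_inv]
      refine ENNReal.div_le_of_le_mul' (hlow.trans_eq ?_)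
      rw [mul_left_comm]
    refine le_trans (ENNReal.ofReal_le_ofReal ?_) (ofReal_le_of_le_prod_mul hA₂ hκN hE0 hJ0
      (by positivity) hlow' hJ2 hqζ)
    gcongr
    exact le_max_right _ _
  · refine (le_ofReal_of_prod_mul_le ENNReal.toReal_nonneg hκN.le hE0.le hJ0 hup hJ1 hqζ').trans
      (ENNReal.ofReal_le_ofReal ?_)
    gcongr
    exact le_max_left _ _

end System
end ControlAffine

end

theorem mainTheorem5 {d m : ℕ} {M : Type*} [MetricSpace M] [ConnectedSpace M]
    [MeasurableSpace M] [BorelSpace M]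
    [ChartedSpace (EuclideanSpace ℝ (Fin d)) M] [IsManifold (𝓡 d) ∞ M]
    [RiemannianBundle (fun x : M => TangentSpace (𝓡 d) x)]
    [IsContMDiffRiemannianBundle (𝓡 d) ∞ (EuclideanSpace ℝ (Fin d))
      (fun x : M => TangentSpace (𝓡 d) x)]
    [IsRiemannianManifold (𝓡 d) M]
    (S : System d m M) (hS : S.IsComplete) (Q : Set M) (hQ : IsCompact Q)
    (Eu Ecs : ∀ p : Control S.U × M, Submodule ℝ (TangentSpace (𝓡 d) p.2))
    (hE : S.IsPartiallyHyperbolic Q Eu Ecs) :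
    ∃ (K : Set (Control S.U × M)) (J : ℕ → Control S.U × M → ℝ), S.IsExtension Q Eu K J ∧
      ∀ ζ : ℝ, 0 < ζ → ∃ ε₀ : ℝ, 0 < ε₀ ∧ ∃ δ₀ : ℝ, 0 < δ₀ ∧
        ∃ C : ℝ → ℝ, (∀ δ, 0 < C δ) ∧
          ∀ ε ∈ Ioc 0 ε₀, ∀ (u : Control S.U) (n : ℕ), 1 ≤ n → ∀ x ∈ S.nearFiber Q n u ε,
            (∀ i < n, S.Φ i (u, x) ∈ K) ∧
            ∀ δ ∈ Ioc 0 δ₀,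
              ENNReal.ofReal ((C δ)⁻¹ * Real.exp (-(n * ζ)) * (J n (u, x))⁻¹) ≤
                  riemannianVolume d M (S.bowenBall n u δ x) ∧
                riemannianVolume d M (S.bowenBall n u δ x) ≤
                  ENNReal.ofReal (C δ * Real.exp (n * ζ) * (J n (u, x))⁻¹) := by
  obtain ⟨X, hX, hQX⟩ : ∃ X : Set M, IsCompact X ∧ Q ⊆ interior X := by
    have : LocallyCompactSpace M := ChartedSpace.locallyCompactSpace (EuclideanSpace ℝ (Fin d)) M
    exact exists_compact_superset hQ
  obtain ⟨j, hjc, hj0, hj⟩ := hE.exists_extension hS hQ hX (hQX.trans interior_subset)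
  refine ⟨{p | p.2 ∈ interior X}, S.cocycle j, hE.isExtension_cocycle hS hQX hjc hj0 hj,
    fun ζ hζ => ?_⟩
  obtain ⟨ε₁, hε₁, hint⟩ := System.exists_nearFiber_mem_interior hS hQ hQX
  obtain ⟨ε₂, hε₂, δ₀, hδ₀, h⟩ := hE.exists_volume_bounds hS hQ hX hQX hjc hj0 hj hζ
  choose! A hA hbounds using h
  -- Outside `(0, δ₀]` the constant is irrelevant; the value 1 keeps it positive.
  refine ⟨min ε₁ ε₂, by positivity, δ₀, hδ₀, fun δ => if δ ∈ Ioc 0 δ₀ then A δ else 1, fun δ => ?_,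
    fun ε hε u n hn x hx => ⟨fun i hi => ?_, fun δ hδ => ?_⟩⟩
  · beta_reduce
    split_ifs with hδ
    · exact hA δ hδ
    · exact one_pos
  · exact hint u n x (System.nearFiber_mono (hε.2.trans (min_le_left _ _)) hx) i hi
  · beta_reduce
    rw [if_pos hδ]
    exact hbounds δ hδ u n hn x (System.nearFiber_mono (hε.2.trans (min_le_right _ _)) hx)
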